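/- \textbf{Setting.} Let $p$ be a prime, $L,K$ finite extensions of $\mathbb Q_p$ in $\overline{\mathbb Q}_p$ with $[L:\mathbb Q_p]=|\mathrm{Hom}_{\mathbb Q_p}(L,K)|$ (so $L\subseteq K$), and $L'/L$ a finite Galois extension with maximal unramified subfield $L_0'$ over $\mathbb Q_p$, $f'=[L_0':\mathbb Q_p]=|\mathrm{Hom}_{\mathbb Q_p}(L_0',K)|$. Let $\mathrm{MOD}_{L'/L}$ be the category of $(\varphi,N,\mathrm{Gal}(L'/L),D)$ with $D$ a free $L_0'\otimes_{\mathbb Q_p}K$-module of finite rank, $\varphi$ a bijective Frobenius, semilinear with respect to the Frobenius of $L'_0$ and $K$-linear, $N$ a linear endomorphism with $N\varphi=p\varphi N$, and a semilinear action of $\mathrm{Gal}(L'/L)$ commuting with $\varphi$ and $N$. Let $\mathrm{WD}$ be the usual functor from $\mathrm{MOD}_{L'/L}$ to the $K$-representations $(r,N,V)$ of the Weil--Deligne group of $L$ whose restriction to the Weil group of $L'$ is unramified: for a fixed embedding $\sigma_0:L_0'\to K$, $V=D_{\sigma_0}$, $r(w)=\overline w\circ\varphi^{-\alpha(w)}$,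 where $\overline w$ is the image of $w$ in $\mathrm{Gal}(L'/L)$ and $w$ acts on $\overline{\mathbb F}_p$ as $x\mapsto x^{p^{\alpha(w)}}$. Put $t_N(D)=\frac1{f'}\mathrm{val}_p(\det_{L_0'}\varphi^{f'}|_D)$, also for $L'_0$-subspaces of $D$ stable under $\varphi$. For a decreasing, exhaustive, separated filtration of $D_{L'}=L'\otimes_{L_0'}D\simeq\prod_{\sigma:L\to K}D_{L',\sigma}$ by $L'\otimes_{\mathbb Q_p} K$-submodules stable under $\mathrm{Gal}(L'/L)$, put $t_H(W)=\sum_i i\dim_{L'}\mathrm{gr}^i W$ for every $L'$-subspace $W$ of $D_{L'}$ with the induced filtration. The filtration is \emph{admissible} if $t_H(D_{L'})=t_N(D)$ and $t_H(D'_{L'})\le t_N(D')$ for every $L_0'$-subspace $D'\subseteq D$ stable under $\varphi$ and $N$ (in particular for every subobject $D'$ of $D$). \textbf{Data.} Let $d\ge 0$, let $(r,N,V)$ be of dimension $d+1$ with $r$ semisimple, and assume that $(r,N,V)=\bigoplus_{i=1}^s(r_i,N_i,V_i)$ with $(r_i,N_i,V_i)$ absolutely indecomposable of dimension $d_i$.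 Let $D_i$ be the object of $\mathrm{MOD}_{L'/L}$ with $\mathrm{WD}(D_i)\simeq(r_i,N_i,V_i)$, let $D_{i,0}=\ker N_i$, let $b_i$ be the least integer with $N_i^{b_i}=0$, and write $M(l)$ for $M$ with $\varphi$ replaced by $p^l\varphi$; so $D_i=D_{i,0}\oplus D_{i,0}(1)\oplus\cdots\oplus D_{i,0}(b_i-1)$. Say that $D_i,D_j$ are of the same type if $\mathrm{Hom}_{\varphi,\mathrm{Gal}(L'/L)}(D_i,D_j)\neq0$; the classes of the equivalence relation on $\{1,\dots,s\}$ generated by this relation are called blocks. The numbering is such that: blocks are intervals; if $k_1\ne k_2$ lie in a block and $D_{k_1,0}(l)\simeq D_{k_2,0}$ with $l>0$, then $k_1<k_2$; if $D_{k_1,0}\simeq D_{k_2,0}$ and $b_{k_1}<b_{k_2}$, then $k_1<k_2$; blocks with smaller slope $t_N(M)/\operatorname{rank} M$, $M=\bigoplus_{k\in\text{block}}D_k$, come first. \textbf{The object $D$.} Let $D=\bigoplus_k D_k$ with the direct sum of the $N_k$ and of the Galois actions. For $k_1<k_2$ in the same block write $D_{k_2,0}\simeq D_{k_1,0}(l)$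 with $l\ge0$. Call $(k_1,k_2)$ linked if $k_2$ is the smallest index $>k_1$ of the block with $l=0$, or the smallest index $>k_1$ of the block with $b_{k_1}=l+b_{k_2}$. For each linked pair fix a nonzero morphism $\alpha_{k_1k_2}:D_{k_1}\to D_{k_2}$ in $\mathrm{MOD}_{L'/L}$, and put $\varphi(e)=\varphi_{k_1}(e)+\sum_{k_2}\varphi_{k_2}(\alpha_{k_1k_2}(e))$ for $e\in D_{k_1}$, the sum being over the $k_2$ such that $(k_1,k_2)$ is linked. A \emph{good} subobject of $D$ is a subobject of the form $\bigoplus_k\big(D_{k,0}\oplus\cdots\oplus D_{k,0}(m_k-1)\big)$ with $0\le m_k\le b_k$; a good flag is a chain of good subobjects. \textbf{Theorem.} For every $\sigma:L\to K$ let $i_{1,\sigma}<\cdots<i_{d+1,\sigma}$ be integers such that \[[K:L]\sum_{j=1}^{d_1+\cdots+d_m}\sum_\sigma i_{j,\sigma}\le\sum_{i=1}^m t_N(D_i)\quad(1\le m\le s-1),\qquad [K:L]\sum_{j=1}^{d+1}\sum_\sigma i_{j,\sigma}=\sum_{i=1}^s t_N(D_i).\tag{iii}\] Let $\mathrm{Fil}$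 be a $\mathrm{Gal}(L'/L)$-stable filtration of $D_{L'}$ as above such that, for every $\sigma$, its jumps on $D_{L',\sigma}$ are $i_{1,\sigma},\dots,i_{d+1,\sigma}$, and which is transverse to all good flags: for every member $E$ of a good flag and every $\sigma$, the jumps of the filtration induced on $E_{L',\sigma}$ are $i_{1,\sigma},\dots,i_{\operatorname{rank}E,\sigma}$. Then $\mathrm{Fil}$ is admissible. Consequently (iii) implies (ii): there are an object $X$ of $\mathrm{MOD}_{L'/L}$ with $\mathrm{WD}(X)^{\mathrm{ss}}\simeq(r,N,V)$ ($F$-semisimplification) and an admissible $\mathrm{Gal}(L'/L)$-stable filtration of $X_{L'}$ such that $\mathrm{Fil}^iX_{L',\sigma}/\mathrm{Fil}^{i+1}X_{L',\sigma}\ne0$ if and only if $i\in\{i_{1,\sigma},\dots,i_{d+1,\sigma}\}$, for every $\sigma$. -/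

import Mathlib

open scoped TensorProduct

universe v

noncomputable section

namespace PhiN

/-! ## Local fields: maximal unramified subfield, Frobenius, valuation -/

section Fields

/-- `ζ` is a root of unity of order prime to `p`. -/
def IsPrimeToPRoot (p : ℕ) {E : Type*} [Field E] (ζ : E) : Prop :=
  ∃ n : ℕ, ¬ p ∣ n ∧ ζ ^ n = 1

/-- The maximal unramified subfield `E₀ = Frac W(k_E)` of a finite extension `E` of `ℚ_p`: it is
generated over `ℚ_p` by the roots of unity of order prime to `p` in `E`. -/
def maxUnram (p : ℕ) [Fact p.Prime] (E : Type*) [Field E] [Algebra ℚ_[p] E] :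
    IntermediateField ℚ_[p] E :=
  IntermediateField.adjoin ℚ_[p] {ζ : E | IsPrimeToPRoot p ζ}

theorem isGalois_maxUnram (p : ℕ) [Fact p.Prime] (E : Type*) [Field E] [Algebra ℚ_[p] E] :
    IsGalois ℚ_[p] (maxUnram p E) := by
  set S : Set ℕ := {n | ¬ p ∣ n ∧ ∃ ζ : E, IsPrimitiveRoot ζ n} with hS
  have hset : {ζ : E | IsPrimeToPRoot p ζ} = {b : E | ∃ n ∈ S, n ≠ 0 ∧ b ^ n = 1} := by
    ext ζ
    constructor
    · rintro ⟨n, hn, h⟩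
      have hn0 : n ≠ 0 := by rintro rfl; simp at hn
      obtain ⟨k, hk, hζ⟩ := IsPrimitiveRoot.exists_pos h hn0
      exact ⟨k, ⟨fun hpk => hn (hpk.trans (hζ.2 n h)), ζ, hζ⟩, hk.ne', hζ.1⟩
    · rintro ⟨n, ⟨hn, -⟩, -, h⟩
      exact ⟨n, hn, h⟩
  have : IsCyclotomicExtension S ℚ_[p] (maxUnram p E) := by
    rw [maxUnram, hset]
    exact IntermediateField.isCyclotomicExtension_adjoin_of_exists_isPrimitiveRoot S ℚ_[p] E
      (fun n hn _ => hn.2)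
  exact IsCyclotomicExtension.isGalois S ℚ_[p] (maxUnram p E)

instance (p : ℕ) [Fact p.Prime] (E : Type*) [Field E] [Algebra ℚ_[p] E] :
    IsGalois ℚ_[p] (maxUnram p E) := isGalois_maxUnram p E

theorem exists_frob_aux (p : ℕ) [Fact p.Prime] (F : Type*) [Field F] [Algebra ℚ_[p] F]
    [FiniteDimensional ℚ_[p] F] [IsGalois ℚ_[p] F] : ∃ φ : F ≃ₐ[ℚ_[p]] F,
    ∀ (ζ : F) (n : ℕ), ¬ p ∣ n → ζ ^ n = 1 → φ ζ = ζ ^ p := by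
  let : Algebra ℤ_[p] F := ((algebraMap ℚ_[p] F).comp (algebraMap ℤ_[p] ℚ_[p])).toAlgebra
  have : IsScalarTower ℤ_[p] ℚ_[p] F := IsScalarTower.of_algebraMap_eq fun _ => rfl
  have : FaithfulSMul ℤ_[p] F := (faithfulSMul_iff_algebraMap_injective _ _).2
    ((algebraMap ℚ_[p] F).injective.comp (IsFractionRing.injective ℤ_[p] ℚ_[p]))
  let O := integralClosure ℤ_[p] F
  have : Module.Finite ℤ_[p] O := IsIntegralClosure.finite ℤ_[p] ℚ_[p] F O
  have : IsFractionRing O F := integralClosure.isFractionRing_of_finite_extension ℚ_[p] F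
  let := IsIntegralClosure.MulSemiringAction ℤ_[p] ℚ_[p] F O
  have := Algebra.isInvariant_of_isGalois ℤ_[p] ℚ_[p] F O
  have hint : Algebra.IsIntegral ℤ_[p] O := inferInstance
  have : FaithfulSMul ℤ_[p] O := (faithfulSMul_iff_algebraMap_injective _ _).2 fun a b h =>
    FaithfulSMul.algebraMap_injective ℤ_[p] F (congrArg (algebraMap O F) h)
  let m := IsLocalRing.maximalIdeal ℤ_[p]
  obtain ⟨Q, hQm, hQ⟩ := Ideal.exists_maximal_ideal_liesOver_of_isIntegral (S := O) m
  have e : (ℤ_[p] ⧸ m) ≃+* ZMod p := PadicInt.residueField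
  have hfin : Finite (ℤ_[p] ⧸ m) := Finite.of_equiv _ e.symm.toEquiv
  have : Finite (O ⧸ Q) := by
    have : Module.Finite (ℤ_[p] ⧸ m) (O ⧸ Q) := inferInstance
    exact Module.finite_of_finite (ℤ_[p] ⧸ m)
  have : SMulCommClass (F ≃ₐ[ℚ_[p]] F) ℤ_[p] O :=
    ⟨fun g a x => map_smul (galRestrict ℤ_[p] ℚ_[p] F O g) a x⟩
  obtain ⟨σ, hσ⟩ := IsArithFrobAt.exists_of_isInvariant ℤ_[p] (F ≃ₐ[ℚ_[p]] F) Q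
  have hcard : Nat.card (ℤ_[p] ⧸ Q.under ℤ_[p]) = p := by
    rw [← hQ.over, Nat.card_congr e.toEquiv, Nat.card_zmod]
  refine ⟨σ, fun ζ n hn h => ?_⟩
  have hn0 : n ≠ 0 := by rintro rfl; simp at hn
  have hζ : IsIntegral ℤ_[p] ζ := by
    refine ⟨Polynomial.X ^ n - 1, Polynomial.monic_X_pow_sub_C 1 hn0, by simp [h]⟩
  have hnQ : ((n : ℕ) : O) ∉ Q := by
    intro hmem
    have h1 : (n : ℤ_[p]) ∈ m := by
      rw [hQ.over, Ideal.mem_comap]; simpa using hmem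
    have h2 : (n : ℤ_[p]) ∈ nonunits ℤ_[p] := h1
    rw [PadicInt.mem_nonunits, PadicInt.norm_natCast_lt_one_iff] at h2
    exact hn h2
  have := AlgHom.IsArithFrobAt.apply_of_pow_eq_one hσ (ζ := (⟨ζ, hζ⟩ : O)) (m := n)
    (Subtype.ext (by simpa using h)) hnQ
  rw [hcard] at this
  have h3 := congrArg (algebraMap O F) this
  have h4 : algebraMap O F (MulSemiringAction.toAlgHom ℤ_[p] O σ ⟨ζ, hζ⟩) = σ ζ := 
    algebraMap_galRestrict_apply ℤ_[p] σ (⟨ζ, hζ⟩ : O)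
  rw [h4] at h3
  simpa using h3

theorem exists_frob (p : ℕ) [Fact p.Prime] (E : Type*) [Field E] [Algebra ℚ_[p] E]
    [FiniteDimensional ℚ_[p] E] : ∃ φ : maxUnram p E ≃ₐ[ℚ_[p]] maxUnram p E,
    ∀ ζ : maxUnram p E, IsPrimeToPRoot p ζ → φ ζ = ζ ^ p := by
  obtain ⟨φ, h⟩ := exists_frob_aux p (maxUnram p E)
  exact ⟨φ, fun ζ ⟨n, hn, hζ⟩ => h ζ n hn hζ⟩

/-- The (absolute) Frobenius automorphism of `E₀`. It is the only automorphism of `E₀` that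
raises the roots of unity of order prime to `p` to the power `p`, since these generate `E₀`. -/
def frob (p : ℕ) [Fact p.Prime] (E : Type*) [Field E] [Algebra ℚ_[p] E]
    [FiniteDimensional ℚ_[p] E] : maxUnram p E ≃ₐ[ℚ_[p]] maxUnram p E :=
  (exists_frob p E).choose

theorem frob_apply (p : ℕ) [Fact p.Prime] (E : Type*) [Field E] [Algebra ℚ_[p] E]
    [FiniteDimensional ℚ_[p] E] (ζ : maxUnram p E) (h : IsPrimeToPRoot p ζ) :
    frob p E ζ = ζ ^ p :=
  (exists_frob p E).choose_spec ζ h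

/-- `f' = [E₀ : ℚ_p]`. -/
def resDeg (p : ℕ) [Fact p.Prime] (E : Type*) [Field E] [Algebra ℚ_[p] E] : ℕ :=
  Module.finrank ℚ_[p] (maxUnram p E)

theorem frob_pow_resDeg (p : ℕ) [Fact p.Prime] (E : Type*) [Field E] [Algebra ℚ_[p] E]
    [FiniteDimensional ℚ_[p] E] : frob p E ^ resDeg p E = 1 := by
  rw [resDeg, ← IsGalois.card_aut_eq_finrank]
  exact pow_card_eq_one'

/-- The `p`-adic valuation, normalized by `val_p(p) = 1`, of an element of a finite extension of
`ℚ_p`. -/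
def valP (p : ℕ) [Fact p.Prime] {E : Type*} [Field E] [Algebra ℚ_[p] E] (x : E) : ℚ :=
  ((Algebra.norm ℚ_[p] x).valuation : ℚ) / Module.finrank ℚ_[p] E

/-- Restriction to `L'₀` of an element of `Gal(L'/L)`. -/
def galUnram (p : ℕ) [Fact p.Prime] {L L' : Type*} [Field L] [Field L'] [Algebra ℚ_[p] L]
    [Algebra ℚ_[p] L'] [Algebra L L'] [IsScalarTower ℚ_[p] L L'] (g : L' ≃ₐ[L] L') :
    maxUnram p L' ≃ₐ[ℚ_[p]] maxUnram p L' :=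
  (g.restrictScalars ℚ_[p]).restrictNormal (maxUnram p L')

theorem galUnram_coe (p : ℕ) [Fact p.Prime] {L L' : Type*} [Field L] [Field L']
    [Algebra ℚ_[p] L] [Algebra ℚ_[p] L'] [Algebra L L'] [IsScalarTower ℚ_[p] L L']
    (g : L' ≃ₐ[L] L') (l : maxUnram p L') : ((galUnram p g l : maxUnram p L') : L') = g l :=
  AlgEquiv.restrictNormal_commutes (g.restrictScalars ℚ_[p]) (maxUnram p L') l

/-- Two automorphisms of `E₀` that agree on the roots of unity of order prime to `p` are equal. -/
theorem algEquiv_maxUnram_ext (p : ℕ) [Fact p.Prime] {E : Type*} [Field E] [Algebra ℚ_[p] E]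
    (φ ψ : maxUnram p E ≃ₐ[ℚ_[p]] maxUnram p E)
    (h : ∀ ζ : maxUnram p E, IsPrimeToPRoot p ζ → φ ζ = ψ ζ) : φ = ψ := by
  have key : ∀ (x : E) (hx : x ∈ maxUnram p E), φ ⟨x, hx⟩ = ψ ⟨x, hx⟩ := by
    intro x hx
    induction hx using IntermediateField.adjoin_induction with
    | mem x hx =>
      obtain ⟨n, hn, h1⟩ := hx
      exact h _ ⟨n, hn, Subtype.ext (by simpa using h1)⟩
    | algebraMap x => exact (φ.commutes x).trans (ψ.commutes x).symm
    | add x y hx hy h1 h2 =>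
      exact (map_add φ ⟨x, hx⟩ ⟨y, hy⟩).trans
        ((congrArg₂ (· + ·) h1 h2).trans (map_add ψ ⟨x, hx⟩ ⟨y, hy⟩).symm)
    | inv x hx h1 =>
      exact (map_inv₀ φ ⟨x, hx⟩).trans
        ((congrArg (·⁻¹) h1).trans (map_inv₀ ψ ⟨x, hx⟩).symm)
    | mul x y hx hy h1 h2 =>
      exact (map_mul φ ⟨x, hx⟩ ⟨y, hy⟩).trans
        ((congrArg₂ (· * ·) h1 h2).trans (map_mul ψ ⟨x, hx⟩ ⟨y, hy⟩).symm)
  exact AlgEquiv.ext fun x => key x.1 x.2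

end Fields

/-! ## The Weil group -/

section Weil

/-- `w` acts on the residue field `𝔽̄_p` of `Ω` (an algebraic closure of `ℚ_p`) as the `n`-th power
of the arithmetic Frobenius `x ↦ x ^ p`. The nonzero elements of `𝔽̄_p` are the reductions of the
roots of unity of order prime to `p`, on which the condition is tested; `n = a - b` is allowed to
be negative. -/
def ActsAsFrobPow (p : ℕ) {L Ω : Type*} [Field L] [Field Ω] [Algebra L Ω]
    (w : Ω ≃ₐ[L] Ω) (n : ℤ) : Prop :=
  ∃ a b : ℕ, n = a - b ∧ ∀ ζ : Ω, IsPrimeToPRoot p ζ → (w ζ) ^ p ^ b = ζ ^ p ^ a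

variable {p : ℕ} {L Ω : Type*} [Field L] [Field Ω] [Algebra L Ω]

theorem IsPrimeToPRoot.pow {ζ : Ω} (h : IsPrimeToPRoot p ζ) (k : ℕ) :
    IsPrimeToPRoot p (ζ ^ k) := by
  obtain ⟨n, hn, h⟩ := h
  exact ⟨n, hn, by rw [← pow_mul, mul_comm, pow_mul, h, one_pow]⟩

theorem IsPrimeToPRoot.map {ζ : Ω} (h : IsPrimeToPRoot p ζ) (w : Ω ≃ₐ[L] Ω) :
    IsPrimeToPRoot p (w ζ) := by
  obtain ⟨n, hn, h⟩ := h
  exact ⟨n, hn, by rw [← map_pow, h, map_one]⟩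

theorem ActsAsFrobPow.one : ActsAsFrobPow p (1 : Ω ≃ₐ[L] Ω) 0 :=
  ⟨0, 0, by simp, fun ζ _ => by simp⟩

theorem ActsAsFrobPow.mul {w w' : Ω ≃ₐ[L] Ω} {n n' : ℤ} (h : ActsAsFrobPow p w n)
    (h' : ActsAsFrobPow p w' n') : ActsAsFrobPow p (w * w') (n + n') := by
  obtain ⟨a, b, rfl, h⟩ := h
  obtain ⟨a', b', rfl, h'⟩ := h'
  refine ⟨a + a', b + b', by push_cast; ring, fun ζ hζ => ?_⟩
  rw [AlgEquiv.mul_apply, add_comm b b', pow_add, pow_mul, ← map_pow, h' ζ hζ, h _ (hζ.pow _),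
    ← pow_mul, ← pow_add, add_comm]

theorem ActsAsFrobPow.inv {w : Ω ≃ₐ[L] Ω} {n : ℤ} (h : ActsAsFrobPow p w n) :
    ActsAsFrobPow p w⁻¹ (-n) := by
  obtain ⟨a, b, rfl, h⟩ := h
  refine ⟨b, a, by ring, fun ζ hζ => ?_⟩
  have h1 := h _ (hζ.map w⁻¹)
  have h2 : w (w⁻¹ ζ) = ζ := by rw [← AlgEquiv.mul_apply, mul_inv_cancel, AlgEquiv.one_apply]
  rw [h2] at h1
  exact h1.symm

theorem ActsAsFrobPow.unique [Fact p.Prime] [IsAlgClosed Ω] [CharZero Ω] {w : Ω ≃ₐ[L] Ω}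
    {n n' : ℤ} (h : ActsAsFrobPow p w n) (h' : ActsAsFrobPow p w n') : n = n' := by
  have hp : p.Prime := Fact.out
  have key : ∀ x y : ℕ, x < y → ¬ ∀ ζ : Ω, IsPrimeToPRoot p ζ → ζ ^ p ^ x = ζ ^ p ^ y := by
    intro x y hxy H
    set m := p ^ (y - x) + 1 with hm
    have hpm : ¬ p ∣ m := by
      intro hd
      have h1 : p ∣ p ^ (y - x) := dvd_pow_self p (by omega)
      exact hp.one_lt.ne' (Nat.dvd_one.1 ((Nat.dvd_add_right h1).1 hd))
    have : NeZero (m : Ω) := ⟨Nat.cast_ne_zero.2 (Nat.succ_ne_zero _)⟩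
    obtain ⟨ζ, hζ⟩ := HasEnoughRootsOfUnity.exists_primitiveRoot Ω m
    have h2 := H ζ ⟨m, hpm, hζ.1⟩
    have hz : ζ ≠ 0 := hζ.ne_zero (by rw [hm]; omega)
    have h3 : ζ ^ (p ^ x * (p ^ (y - x) - 1)) = 1 := by
      have h4 : p ^ y = p ^ x * (p ^ (y - x) - 1) + p ^ x := by
        have h5 : 1 ≤ p ^ (y - x) := Nat.one_le_pow _ _ hp.pos
        have h6 : p ^ y = p ^ x * p ^ (y - x) := by rw [← pow_add]; congr 1; omega
        rw [h6, Nat.mul_sub, mul_one, Nat.sub_add_cancel (Nat.le_mul_of_pos_right _ h5)]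
      rw [h4, pow_add] at h2
      have h7 : ζ ^ p ^ x ≠ 0 := pow_ne_zero _ hz
      exact mul_right_cancel₀ h7 (by rw [one_mul]; exact h2.symm)
    have h8 := hζ.2 _ h3
    have hcop : Nat.Coprime m (p ^ x) :=
      Nat.Coprime.pow_right _ ((Nat.Prime.coprime_iff_not_dvd hp).2 hpm).symm
    have h9 := hcop.dvd_of_dvd_mul_left h8
    have h10 : 1 < p ^ (y - x) := Nat.one_lt_pow (by omega) hp.one_lt
    have h11 := Nat.le_of_dvd (by omega) h9
    omega
  obtain ⟨a, b, rfl, h⟩ := h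
  obtain ⟨a', b', rfl, h'⟩ := h'
  have h3 : ∀ ζ : Ω, IsPrimeToPRoot p ζ → ζ ^ p ^ (a + b') = ζ ^ p ^ (a' + b) := by
    intro ζ hζ
    rw [pow_add, pow_mul, ← h ζ hζ, pow_add, pow_mul, ← h' ζ hζ, ← pow_mul, ← pow_mul, mul_comm]
  rcases lt_trichotomy (a + b') (a' + b) with hl | he | hg
  · exact (key _ _ hl h3).elim
  · have : ((a + b' : ℕ) : ℤ) = ((a' + b : ℕ) : ℤ) := by rw [he]
    push_cast at this
    linarith
  · exact (key _ _ hg fun ζ hζ => (h3 ζ hζ).symm).elim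

/-- The Weil group `W(Ω/L)`: the automorphisms of `Ω` over `L` which act on the residue field as
an integral power of the arithmetic Frobenius. -/
def weilGroup (p : ℕ) (L Ω : Type*) [Field L] [Field Ω] [Algebra L Ω] :
    Subgroup (Ω ≃ₐ[L] Ω) where
  carrier := {w | ∃ n : ℤ, ActsAsFrobPow p w n}
  one_mem' := ⟨0, ActsAsFrobPow.one⟩
  mul_mem' := fun ⟨n, h⟩ ⟨n', h'⟩ => ⟨n + n', h.mul h'⟩
  inv_mem' := fun ⟨n, h⟩ => ⟨-n, h.inv⟩

/-- `α(w)`: the integer such that `w` acts on the residue field as `x ↦ x ^ (p ^ α(w))`. -/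
def weilDeg (w : weilGroup p L Ω) : ℤ := w.2.choose

theorem weilDeg_spec (w : weilGroup p L Ω) : ActsAsFrobPow p w.1 (weilDeg w) := w.2.choose_spec

theorem weilDeg_one [Fact p.Prime] [IsAlgClosed Ω] [CharZero Ω] :
    weilDeg (1 : weilGroup p L Ω) = 0 :=
  (weilDeg_spec 1).unique ActsAsFrobPow.one

theorem weilDeg_mul [Fact p.Prime] [IsAlgClosed Ω] [CharZero Ω] (w w' : weilGroup p L Ω) :
    weilDeg (w * w') = weilDeg w + weilDeg w' :=
  (weilDeg_spec (w * w')).unique ((weilDeg_spec w).mul (weilDeg_spec w'))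

end Weil

/-! ## Weil–Deligne representations -/

section WeilDeligne

variable (p : ℕ) [Fact p.Prime] (L L' K : Type*) [Field L] [Field L'] [Field K]
  [Algebra ℚ_[p] L] [Algebra ℚ_[p] L'] [Algebra L L'] [IsScalarTower ℚ_[p] L L']

/-- The Weil group `W(ℚ̄_p/L)`, the algebraic closure of `ℚ_p` being realized as that of `L'`. -/
abbrev WeilGp : Type _ := weilGroup p L (AlgebraicClosure L')

variable {p L L'} in
/-- The image in `Gal(L'/L)` of an element of the Weil group of `L`. -/
def weilToGal [IsGalois L L'] (w : WeilGp p L L') : L' ≃ₐ[L] L' :=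
  AlgEquiv.restrictNormalHom L' w.1

/-- An object `(r, N, V)` of `WD_{L'/L}`: a finite-dimensional representation over `K` of the
Weil–Deligne group of `L` which is unramified on the Weil group of `L'`, i.e. trivial on the
elements of the Weil group fixing `L'` and acting trivially on the residue field. -/
structure WDRep [IsGalois L L'] where
  V : Type v
  [addCommGroup : AddCommGroup V]
  [module : Module K V]
  [finite : Module.Finite K V]
  r : Representation K (WeilGp p L L') V
  unramified : ∀ w, weilToGal w = 1 → weilDeg w = 0 → r w = 1
  N : V →ₗ[K] V
  r_N : ∀ w x, r w (N x) = (p : K) ^ weilDeg w • N (r w x)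

attribute [instance] WDRep.addCommGroup WDRep.module WDRep.finite

namespace WDRep

variable {p L L' K} [IsGalois L L']

/-- Isomorphism of Weil–Deligne representations. -/
def Iso (X Y : WDRep.{v} p L L' K) : Prop :=
  ∃ e : X.V ≃ₗ[K] Y.V, (∀ w x, e (X.r w x) = Y.r w (e x)) ∧ ∀ x, e (X.N x) = Y.N (e x)

/-- `X` is isomorphic to the direct sum of the `Y i`. -/
def IsDirectSum {ι : Type*} (X : WDRep.{v} p L L' K) (Y : ι → WDRep.{v} p L L' K) : Prop :=
  ∃ e : X.V ≃ₗ[K] (∀ i, (Y i).V), (∀ w x i, e (X.r w x) i = (Y i).r w (e x i)) ∧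
    ∀ x i, e (X.N x) i = (Y i).N (e x i)

/-- The underlying representation `r` of the Weil group is semisimple. -/
def IsSemisimple (X : WDRep.{v} p L L' K) : Prop :=
  Representation.IsSemisimpleRepresentation X.r

/-- `X` is absolutely indecomposable: it is nonzero, and after extension of scalars to an algebraic
closure of `K` it is not the direct sum of two nonzero subrepresentations stable under `N`. -/
def IsAbsIndecomposable (X : WDRep.{v} p L L' K) : Prop :=
  Nontrivial X.V ∧ ∀ A B : Submodule (AlgebraicClosure K) (AlgebraicClosure K ⊗[K] X.V),
    (∀ w, ∀ x ∈ A, (X.r w).baseChange (AlgebraicClosure K) x ∈ A) →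
    (∀ x ∈ A, X.N.baseChange (AlgebraicClosure K) x ∈ A) →
    (∀ w, ∀ x ∈ B, (X.r w).baseChange (AlgebraicClosure K) x ∈ B) →
    (∀ x ∈ B, X.N.baseChange (AlgebraicClosure K) x ∈ B) →
    IsCompl A B → A = ⊥ ∨ B = ⊥

/-- `Y` is (isomorphic to) the Frobenius-semisimplification `X^{ss}` of `X`: the representation of
`Y` is semisimple, and `Y` is obtained from `X` by keeping `V` and `N` and replacing `r w` by
`r w * u ^ α(w)` for a unipotent automorphism `u` which commutes with `r` and `N`. (The `-f`-th
power of `u` is the unipotent part of the image under `r` of an arithmetic Frobenius, and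
`α(w) ∈ fℤ`; unipotent automorphisms have unique unipotent roots.) -/
def IsFrobSemisimplification (X Y : WDRep.{v} p L L' K) : Prop :=
  Y.IsSemisimple ∧ ∃ (e : X.V ≃ₗ[K] Y.V) (u : X.V ≃ₗ[K] X.V),
    IsNilpotent ((u : X.V →ₗ[K] X.V) - 1) ∧
    (∀ w x, u (X.r w x) = X.r w (u x)) ∧ (∀ x, u (X.N x) = X.N (u x)) ∧
    (∀ w x, e (X.r w ((u ^ weilDeg w) x)) = Y.r w (e x)) ∧ ∀ x, e (X.N x) = Y.N (e x)

end WDRep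

end WeilDeligne

/-! ## Filtered `(φ, N, Gal(L'/L))`-modules -/

section Modules

attribute [local instance] TensorProduct.Algebra.module

variable (p : ℕ) [Fact p.Prime] (L L' K : Type*) [Field L] [Field L'] [Field K]
  [Algebra ℚ_[p] L] [Algebra ℚ_[p] L'] [Algebra ℚ_[p] K] [Algebra L L']
  [IsScalarTower ℚ_[p] L L'] [FiniteDimensional ℚ_[p] L']

/-- An object `(φ, N, Gal(L'/L), D)` of `MOD_{L'/L}`. An `L'₀ ⊗ K`-module is given by its
(commuting) `L'₀`-module and `K`-module structures. -/
structure ModObj where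
  D : Type v
  [addCommGroup : AddCommGroup D]
  [moduleQ : Module ℚ_[p] D]
  [moduleL : Module (maxUnram p L') D]
  [moduleK : Module K D]
  [towerL : IsScalarTower ℚ_[p] (maxUnram p L') D]
  [towerK : IsScalarTower ℚ_[p] K D]
  [smulComm : SMulCommClass (maxUnram p L') K D]
  free : Module.Free (maxUnram p L' ⊗[ℚ_[p]] K) D
  finite : Module.Finite (maxUnram p L' ⊗[ℚ_[p]] K) D
  phi : D ≃ₗ[K] D
  phi_smul : ∀ (l : maxUnram p L') (x : D), phi (l • x) = frob p L' l • phi x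
  N : D →ₗ[K] D
  N_smul : ∀ (l : maxUnram p L') (x : D), N (l • x) = l • N x
  N_phi : ∀ x, N (phi x) = (p : K) • phi (N x)
  gal : Representation K (L' ≃ₐ[L] L') D
  gal_smul : ∀ (g : L' ≃ₐ[L] L') (l : maxUnram p L') (x : D),
    gal g (l • x) = galUnram p g l • gal g x
  gal_phi : ∀ g x, gal g (phi x) = phi (gal g x)
  gal_N : ∀ g x, gal g (N x) = N (gal g x)

attribute [instance] ModObj.addCommGroup ModObj.moduleQ ModObj.moduleL ModObj.moduleK
  ModObj.towerL ModObj.towerK ModObj.smulComm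

namespace ModObj

variable {p L L' K}

instance (X : ModObj.{v} p L L' K) : SMulCommClass K (maxUnram p L') X.D :=
  SMulCommClass.symm _ _ _

/-- Morphisms of `(φ, Gal(L'/L))`-modules (not necessarily compatible with `N`). -/
structure PhiGalHom (X Y : ModObj.{v} p L L' K) where
  f : X.D →ₗ[K] Y.D
  map_smul : ∀ (l : maxUnram p L') (x : X.D), f (l • x) = l • f x
  map_phi : ∀ x, f (X.phi x) = Y.phi (f x)
  map_gal : ∀ g x, f (X.gal g x) = Y.gal g (f x)

/-- Morphisms of `MOD_{L'/L}`. -/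
structure Hom (X Y : ModObj.{v} p L L' K) extends PhiGalHom X Y where
  map_N : ∀ x, f (X.N x) = Y.N (f x)

variable (X Y : ModObj.{v} p L L' K)

/-- `φ^{f'}`, as an `L'₀`-linear endomorphism. -/
def phiPow : X.D →ₗ[maxUnram p L'] X.D where
  toFun x := (X.phi ^ resDeg p L') x
  map_add' := map_add _
  map_smul' := by
    intro l x
    have h : ∀ n : ℕ, (X.phi ^ n) (l • x) = (frob p L' ^ n) l • (X.phi ^ n) x := by
      intro n
      induction n with
      | zero => simp
      | succ n ih =>
        rw [pow_succ', pow_succ', LinearEquiv.mul_apply, ih, X.phi_smul, LinearEquiv.mul_apply,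
          AlgEquiv.mul_apply]
    rw [h, frob_pow_resDeg]
    simp

theorem phiPow_mem (E : Submodule (maxUnram p L') X.D) (hE : ∀ x ∈ E, X.phi x ∈ E) :
    ∀ x ∈ E, X.phiPow x ∈ E := by
  have h : ∀ n : ℕ, ∀ x ∈ E, (X.phi ^ n) x ∈ E := by
    intro n
    induction n with
    | zero => simp
    | succ n ih =>
      intro x hx
      rw [pow_succ', LinearEquiv.mul_apply]
      exact hE _ (ih x hx)
  exact h _

/-- `t_N(E)` for an `L'₀`-subspace `E` of `D` stable under `φ`, namely
`val_L (det_{L'₀} (φ^{f'} | E)) / ([L : L₀] f')`; since `val_L = e val_p` with `e = [L : L₀]`, this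
is `val_p (det_{L'₀} (φ^{f'} | E)) / f'`. -/
def tNSub (E : Submodule (maxUnram p L') X.D) (hE : ∀ x ∈ E, X.phi x ∈ E) : ℚ :=
  valP p (LinearMap.det (X.phiPow.restrict (X.phiPow_mem E hE))) / resDeg p L'

/-- `t_N(D)`. -/
def tN : ℚ := valP p (LinearMap.det X.phiPow) / resDeg p L'

/-- The rank of `D` over `L'₀ ⊗ K`. -/
def rank : ℕ := Module.finrank (maxUnram p L' ⊗[ℚ_[p]] K) X.D

/-- An `L'₀ ⊗ K`-submodule of `D` stable under `φ`, `N` and `Gal(L'/L)`, that is, a subobject of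
`D` in `MOD_{L'/L}` (such a submodule is automatically free). -/
structure IsSubobject (E : Submodule (maxUnram p L') X.D) : Prop where
  smul_mem : ∀ (k : K), ∀ x ∈ E, k • x ∈ E
  phi_mem : ∀ x ∈ E, X.phi x ∈ E
  N_mem : ∀ x ∈ E, X.N x ∈ E
  gal_mem : ∀ g, ∀ x ∈ E, X.gal g x ∈ E

/-- The rank over `L'₀ ⊗ K` of a subobject `E`; recall that `L'₀ ⊗ K` has dimension `[K : ℚ_p]`
over `L'₀`. -/
def subRank (E : Submodule (maxUnram p L') X.D) : ℕ :=
  Module.finrank (maxUnram p L') E / Module.finrank ℚ_[p] K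

/-! ### The scalar extension `D_{L'}` and its filtrations -/

/-- `D_{L'} = L' ⊗_{L'₀} D`. -/
abbrev DL : Type _ := L' ⊗[maxUnram p L'] X.D

/-- The action of `K` on `D_{L'}`. -/
def actK (k : K) : X.DL →ₗ[L'] X.DL :=
  (DistribSMul.toLinearMap (maxUnram p L') X.D k).baseChange L'

/-- The semilinear action `l ⊗ x ↦ g l ⊗ g x` of `Gal(L'/L)` on `D_{L'}`. -/
def actGal (g : L' ≃ₐ[L] L') :
    X.DL →ₛₗ[((galUnram p g : maxUnram p L' ≃ₐ[ℚ_[p]] maxUnram p L') :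
      maxUnram p L' →+* maxUnram p L')] X.DL :=
  TensorProduct.map
    { toFun := g
      map_add' := map_add g
      map_smul' := fun l x => by
        rw [Algebra.smul_def, Algebra.smul_def, map_mul]
        exact congrArg (· * g x) (galUnram_coe p g l).symm }
    { toFun := X.gal g
      map_add' := map_add (X.gal g)
      map_smul' := fun l x => X.gal_smul g l x }

/-- The component `D_{L',σ} = D_{L'} ⊗_{L' ⊗ K} (L' ⊗_{L,σ} K)` of `D_{L'}`, for an embedding
`σ : L → K`, seen as the direct factor of `D_{L'}` on which `L ⊆ L'` and `σ(L) ⊆ K` act in the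
same way. -/
def sigmaPart (σ : L →ₐ[ℚ_[p]] K) : Submodule L' X.DL where
  carrier := {x | ∀ l : L, algebraMap L L' l • x = X.actK (σ l) x}
  add_mem' := fun hx hy l => by rw [smul_add, map_add, hx l, hy l]
  zero_mem' := fun l => by rw [smul_zero, map_zero]
  smul_mem' := fun c x hx l => by rw [smul_comm, hx l, map_smul]

/-- A decreasing, exhaustive and separated filtration of `D_{L'}` by `L' ⊗ K`-submodules stable
under `Gal(L'/L)`. -/
structure Filtration where
  Fil : ℤ → Submodule L' X.DL
  anti : Antitone Fil
  exhaustive : ∀ x, ∃ i, x ∈ Fil i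
  separated : ∀ x, (∀ i, x ∈ Fil i) → x = 0
  actK_mem : ∀ i k, ∀ x ∈ Fil i, X.actK k x ∈ Fil i
  actGal_mem : ∀ i g, ∀ x ∈ Fil i, X.actGal g x ∈ Fil i

namespace Filtration

variable {X} (F : Filtration X)

/-- `t_H(W) = ∑ i • dim_{L'} gr^i W` for an `L'`-subspace `W` of `D_{L'}` with the induced
filtration. -/
def tH (W : Submodule L' X.DL) : ℤ :=
  ∑ᶠ i : ℤ, i * ((Module.finrank L' ↥(F.Fil i ⊓ W) : ℤ) -
    (Module.finrank L' ↥(F.Fil (i + 1) ⊓ W) : ℤ))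

/-- The set of jumps of the filtration induced on an `L'`-subspace `W`. -/
def jumps (W : Submodule L' X.DL) : Set ℤ := {i | F.Fil i ⊓ W ≠ F.Fil (i + 1) ⊓ W}

/-- Admissibility: `t_H(D_{L'}) = t_N(D)`, and `t_H(D'_{L'}) ≤ t_N(D')` for every `L'₀`-subspace
`D'` of `D` stable under `φ` and `N`; in particular for every subobject `D'` of `D`. -/
def IsAdmissible : Prop :=
  (F.tH ⊤ : ℚ) = X.tN ∧
  ∀ (E : Submodule (maxUnram p L') X.D) (hφ : ∀ x ∈ E, X.phi x ∈ E), (∀ x ∈ E, X.N x ∈ E) →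
    (F.tH (E.baseChange L') : ℚ) ≤ X.tNSub E hφ

/-- For every `σ`, the jumps of the filtration on `D_{L',σ}` are the given integers. -/
def HasJumps {n : ℕ} (j : (L →ₐ[ℚ_[p]] K) → Fin n → ℤ) : Prop :=
  ∀ σ, F.jumps (X.sigmaPart σ) = Set.range (j σ)

/-- `F` is transverse to a flag `Δ` of `D` (a totally ordered set of submodules): for every `E` in
`Δ` and every `σ`, the jumps of `F` on `E_{L',σ}` are the first `rank E` ones among the given
jumps `j σ 0 < j σ 1 < ⋯` of `F` on `D_{L',σ}`. -/
def IsTransverse {n : ℕ} (j : (L →ₐ[ℚ_[p]] K) → Fin n → ℤ)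
    (Δ : Set (Submodule (maxUnram p L') X.D)) : Prop :=
  ∀ E ∈ Δ, ∀ σ, F.jumps (E.baseChange L' ⊓ X.sigmaPart σ) =
    j σ '' {a : Fin n | (a : ℕ) < X.subRank E}

end Filtration

/-! ### The functor `WD` -/

/-- `D_{σ₀} = D ⊗_{L'₀ ⊗ K} K` for an embedding `σ₀ : L'₀ → K`, seen as the direct factor of `D` on
which `L'₀` acts through `σ₀`. -/
def WDspace (σ₀ : maxUnram p L' →ₐ[ℚ_[p]] K) : Submodule K X.D where
  carrier := {x | ∀ l : maxUnram p L', l • x = σ₀ l • x}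
  add_mem' := fun hx hy l => by rw [smul_add, smul_add, hx l, hy l]
  zero_mem' := fun l => by rw [smul_zero, smul_zero]
  smul_mem' := fun c x hx l => by rw [smul_comm, hx l, smul_comm]


theorem phi_zpow_smul (n : ℤ) (l : maxUnram p L') (x : X.D) :
    (X.phi ^ n) (l • x) = (frob p L' ^ n) l • (X.phi ^ n) x := by
  induction n using Int.induction_on generalizing l x with
  | zero => simp
  | succ n ih =>
    rw [zpow_add_one, zpow_add_one, LinearEquiv.mul_apply, X.phi_smul, ih, AlgEquiv.mul_apply,
      LinearEquiv.mul_apply]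
  | pred n ih =>
    have h1 : X.phi⁻¹ (l • x) = (frob p L')⁻¹ l • X.phi⁻¹ x := by
      apply X.phi.injective
      rw [X.phi_smul]
      have h2 : ∀ y, X.phi (X.phi⁻¹ y) = y := fun y => X.phi.apply_symm_apply y
      have h3 : frob p L' ((frob p L')⁻¹ l) = l := (frob p L').apply_symm_apply l
      rw [h2, h2, h3]
    rw [zpow_sub_one, zpow_sub_one, LinearEquiv.mul_apply, h1, ih, AlgEquiv.mul_apply,
      LinearEquiv.mul_apply]

theorem gal_phi_zpow (n : ℤ) (g : L' ≃ₐ[L] L') (x : X.D) :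
    X.gal g ((X.phi ^ n) x) = (X.phi ^ n) (X.gal g x) := by
  have h2 : ∀ y, X.phi (X.phi⁻¹ y) = y := fun y => X.phi.apply_symm_apply y
  induction n using Int.induction_on generalizing x with
  | zero => simp
  | succ n ih => rw [zpow_add_one, LinearEquiv.mul_apply, ih, X.gal_phi, LinearEquiv.mul_apply]
  | pred n ih =>
    have h1 : X.gal g (X.phi⁻¹ x) = X.phi⁻¹ (X.gal g x) := by
      apply X.phi.injective
      rw [← X.gal_phi, h2, h2]
    rw [zpow_sub_one, LinearEquiv.mul_apply, ih, h1, LinearEquiv.mul_apply]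

theorem phi_zpow_N [CharZero K] (n : ℤ) (x : X.D) :
    (X.phi ^ (-n)) (X.N x) = (p : K) ^ n • X.N ((X.phi ^ (-n)) x) := by
  have hp : (p : K) ≠ 0 := Nat.cast_ne_zero.2 (Fact.out : p.Prime).ne_zero
  have h2 : ∀ y, X.phi (X.phi⁻¹ y) = y := fun y => X.phi.apply_symm_apply y
  induction n using Int.induction_on generalizing x with
  | zero => simp
  | succ n ih =>
    have h1 : X.phi⁻¹ (X.N x) = (p : K) • X.N (X.phi⁻¹ x) := by
      apply X.phi.injective
      rw [map_smul, h2, ← X.N_phi, h2]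
    rw [neg_add, ← sub_eq_add_neg, zpow_sub_one, LinearEquiv.mul_apply, h1, map_smul, ih,
      smul_smul, LinearEquiv.mul_apply, zpow_add_one₀ hp, mul_comm]
  | pred n ih =>
    have h1 : X.phi (X.N x) = (p : K)⁻¹ • X.N (X.phi x) := by
      rw [X.N_phi, smul_smul, inv_mul_cancel₀ hp, one_smul]
    have h3 : -(-(n : ℤ) - 1) = - -(n : ℤ) + 1 := by ring
    rw [h3, zpow_add_one, LinearEquiv.mul_apply, h1, map_smul, ih, smul_smul,
      LinearEquiv.mul_apply, zpow_sub_one₀ hp, mul_comm]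

theorem galUnram_weilToGal [IsGalois L L'] (w : WeilGp p L L') :
    galUnram p (weilToGal w) = frob p L' ^ weilDeg w := by
  obtain ⟨a, b, hab, h⟩ := weilDeg_spec w
  have hfrob : ∀ (n : ℕ) (ζ : maxUnram p L'), IsPrimeToPRoot p ζ →
      (frob p L' ^ n) ζ = ζ ^ p ^ n := by
    intro n
    induction n with
    | zero => intro ζ _; simp
    | succ n ih =>
      intro ζ hζ
      rw [pow_succ, AlgEquiv.mul_apply, frob_apply p L' ζ hζ, map_pow, ih ζ hζ, ← pow_mul,
        pow_succ]
  have key : frob p L' ^ b * galUnram p (weilToGal w) = frob p L' ^ a := by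
    refine algEquiv_maxUnram_ext p _ _ fun ζ hζ => ?_
    have hζ' : IsPrimeToPRoot p (galUnram p (weilToGal w) ζ) := hζ.map _
    rw [AlgEquiv.mul_apply, hfrob b _ hζ', hfrob a ζ hζ]
    have hΩ : IsPrimeToPRoot p (algebraMap L' (AlgebraicClosure L') (ζ : L')) := by
      obtain ⟨n, hn, h1⟩ := hζ
      refine ⟨n, hn, ?_⟩
      rw [← map_pow]
      have : (ζ : L') ^ n = 1 := by exact_mod_cast congrArg Subtype.val h1
      rw [this, map_one]
    have h1 := h _ hΩ
    have h2 : w.1 (algebraMap L' (AlgebraicClosure L') (ζ : L')) =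
        algebraMap L' (AlgebraicClosure L') (weilToGal w (ζ : L')) :=
      (AlgEquiv.restrictNormal_commutes w.1 L' (ζ : L')).symm
    rw [h2] at h1
    have h3 : (weilToGal w (ζ : L')) ^ p ^ b = (ζ : L') ^ p ^ a := by
      apply (algebraMap L' (AlgebraicClosure L')).injective
      rw [map_pow, map_pow]
      exact h1
    apply Subtype.ext
    push_cast
    rw [galUnram_coe]
    exact h3
  rw [hab, zpow_sub, zpow_natCast, zpow_natCast, ← key]
  have hc : Commute (frob p L' ^ b * galUnram p (weilToGal w)) (frob p L' ^ b)⁻¹ := by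
    rw [key]
    exact ((Commute.refl (frob p L')).pow_pow a b).inv_right
  rw [hc.eq, inv_mul_cancel_left]

/-- The endomorphism `w̄ ∘ φ^{-α(w)}` of `D`. -/
def weilAct [IsGalois L L'] (w : WeilGp p L L') : X.D →ₗ[K] X.D :=
  X.gal (weilToGal w) ∘ₗ (X.phi ^ (-weilDeg w)).toLinearMap

theorem weilAct_smul [IsGalois L L'] (w : WeilGp p L L') (l : maxUnram p L') (x : X.D) :
    X.weilAct w (l • x) = l • X.weilAct w x := by
  have h : X.weilAct w (l • x) = X.gal (weilToGal w) ((X.phi ^ (-weilDeg w)) (l • x)) := rfl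
  rw [h, phi_zpow_smul, X.gal_smul, galUnram_weilToGal, ← AlgEquiv.mul_apply, ← zpow_add,
    add_neg_cancel, zpow_zero, AlgEquiv.one_apply]
  rfl

theorem weilAct_mem [IsGalois L L'] (σ₀ : maxUnram p L' →ₐ[ℚ_[p]] K) (w : WeilGp p L L') :
    ∀ x ∈ X.WDspace σ₀, X.weilAct w x ∈ X.WDspace σ₀ := by
  intro x hx l
  rw [← weilAct_smul, hx l, map_smul]

theorem N_mem_WDspace (σ₀ : maxUnram p L' →ₐ[ℚ_[p]] K) :
    ∀ x ∈ X.WDspace σ₀, X.N x ∈ X.WDspace σ₀ := by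
  intro x hx l
  rw [← X.N_smul, hx l, map_smul]

theorem finite_K [FiniteDimensional ℚ_[p] K] : Module.Finite K X.D := by
  have := X.finite
  have : IsScalarTower ℚ_[p] (maxUnram p L' ⊗[ℚ_[p]] K) X.D := by
    refine ⟨fun a t x => ?_⟩
    have h1 : ∀ u v : maxUnram p L' ⊗[ℚ_[p]] K, (u + v) • x = u • x + v • x :=
      fun u v => add_smul u v x
    induction t using TensorProduct.induction_on with
    | zero =>
      have h0 : (0 : maxUnram p L' ⊗[ℚ_[p]] K) • x = 0 := by simpa using h1 0 0
      rw [smul_zero, h0, smul_zero]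
    | tmul l k =>
      rw [TensorProduct.smul_tmul', TensorProduct.Algebra.smul_def,
        TensorProduct.Algebra.smul_def, smul_assoc]
    | add s t hs ht => rw [smul_add, h1, h1, smul_add, hs, ht]
  have : Module.Finite ℚ_[p] X.D := Module.Finite.trans (maxUnram p L' ⊗[ℚ_[p]] K) X.D
  exact Module.Finite.of_restrictScalars_finite ℚ_[p] K X.D

variable (p) in
theorem charZero_of_algebra_padic (F : Type*) [Field F] [Algebra ℚ_[p] F] : CharZero F :=
  charZero_of_injective_algebraMap (algebraMap ℚ_[p] F).injective

/-- The functor `WD : MOD_{L'/L} → WD_{L'/L}`, depending on the choice of an embedding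
`σ₀ : L'₀ → K`: `V = D_{σ₀}` with `r w = w̄ ∘ φ^{-α(w)}` and the restriction of `N`. -/
def WD [IsGalois L L'] [FiniteDimensional ℚ_[p] K] (σ₀ : maxUnram p L' →ₐ[ℚ_[p]] K) :
    WDRep.{v} p L L' K :=
  have := X.finite_K
  have : CharZero (AlgebraicClosure L') :=
    charZero_of_algebra_padic p (AlgebraicClosure L')
  have := charZero_of_algebra_padic p K
  { V := X.WDspace σ₀
    finite := inferInstance
    r :=
      { toFun := fun w => (X.weilAct w).restrict (X.weilAct_mem σ₀ w)
        map_one' := by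
          ext x
          change X.gal (weilToGal 1) ((X.phi ^ (-weilDeg (1 : WeilGp p L L'))) (x : X.D)) = x
          have h1 : weilToGal (1 : WeilGp p L L') = 1 :=
            map_one (AlgEquiv.restrictNormalHom L')
          rw [h1, weilDeg_one]
          simp
        map_mul' := by
          intro w w'
          ext x
          change X.gal (weilToGal (w * w')) ((X.phi ^ (-weilDeg (w * w'))) (x : X.D)) =
            X.gal (weilToGal w) ((X.phi ^ (-weilDeg w)) (X.gal (weilToGal w')
              ((X.phi ^ (-weilDeg w')) (x : X.D))))
          have h1 : weilToGal (w * w') = weilToGal w * weilToGal w' :=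
            map_mul (AlgEquiv.restrictNormalHom L') w.1 w'.1
          rw [h1, weilDeg_mul, neg_add, zpow_add, LinearEquiv.mul_apply, ← X.gal_phi_zpow, map_mul]
          rfl }
    unramified := by
      intro w h1 h2
      ext x
      change X.gal (weilToGal w) ((X.phi ^ (-weilDeg w)) (x : X.D)) = x
      rw [h1, h2]
      simp
    N := X.N.restrict (X.N_mem_WDspace σ₀)
    r_N := by
      intro w x
      apply Subtype.ext
      change X.gal (weilToGal w) ((X.phi ^ (-weilDeg w)) (X.N (x : X.D))) =
        (p : K) ^ weilDeg w • X.N (X.gal (weilToGal w) ((X.phi ^ (-weilDeg w)) (x : X.D)))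
      rw [X.phi_zpow_N, map_smul, X.gal_N] }

/-! ### Types, the order on the indecomposable objects, the modified Frobenius -/

/-- `b`, the smallest integer with `N ^ b = 0`: for an indecomposable object
`D = D₀ ⊕ D₀(1) ⊕ ⋯ ⊕ D₀(b - 1)` with `D₀ = ker N`. -/
def nilLength : ℕ := nilpotencyClass X.N

/-- `X` and `Y` are of the same type: `Hom_{φ, Gal(L'/L)}(X, Y) ≠ 0`. -/
def SameType : Prop := ∃ f : PhiGalHom X Y, f.f ≠ 0

/-- `ker(N_X)(l) ≃ ker(N_Y)` as `(φ, Gal(L'/L))`-modules; `M(l)` is `M` with Frobenius `p ^ l φ`. -/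
def KerTwistIso (l : ℤ) : Prop :=
  ∃ e : LinearMap.ker X.N ≃ₗ[K] LinearMap.ker Y.N,
    (∀ (c : maxUnram p L') (x y : LinearMap.ker X.N), (y : X.D) = c • (x : X.D) →
      (e y : Y.D) = c • (e x : Y.D)) ∧
    (∀ x y : LinearMap.ker X.N, (y : X.D) = (p : K) ^ l • X.phi x →
      (e y : Y.D) = Y.phi (e x)) ∧
    (∀ (g : L' ≃ₐ[L] L') (x y : LinearMap.ker X.N), (y : X.D) = X.gal g x →
      (e y : Y.D) = Y.gal g (e x))

section Family

variable {s : ℕ} (D : Fin s → ModObj.{v} p L L' K)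

/-- `k₁` and `k₂` belong to the same block `H_i`: they are joined by a chain of objects of the same
type. -/
def SameBlock (k₁ k₂ : Fin s) : Prop :=
  Relation.EqvGen (fun i j => SameType (D i) (D j)) k₁ k₂

open Classical in
/-- The slope `t_N(M) / dim M` of the sum `M` of the `D j` with `j` in the block of `k`. -/
def blockSlope (k : Fin s) : ℚ :=
  (∑ j with SameBlock D k j, (D j).tN) / (∑ j with SameBlock D k j, ((D j).rank : ℚ))

/-- The conditions on the numbering of the indecomposable objects `D 0, D 1, …`. -/
structure IsOrdered : Prop where
  /-- the blocks are intervals -/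
  interval : ∀ k₁ k₂ k₃, k₁ ≤ k₂ → k₂ ≤ k₃ → SameBlock D k₁ k₃ → SameBlock D k₁ k₂
  /-- in a block, the objects are numbered by increasing twist -/
  twist : ∀ k₁ k₂, SameBlock D k₁ k₂ → k₁ ≠ k₂ → ∀ l : ℤ, 0 < l →
    KerTwistIso (D k₁) (D k₂) l → k₁ < k₂
  /-- objects with the same kernel of `N` are numbered by increasing length -/
  length : ∀ k₁ k₂, KerTwistIso (D k₁) (D k₂) 0 → (D k₁).nilLength < (D k₂).nilLength → k₁ < k₂
  /-- the blocks are numbered by increasing slope -/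
  slope : ∀ k₁ k₂, ¬ SameBlock D k₁ k₂ → blockSlope D k₁ < blockSlope D k₂ → k₁ < k₂

/-- With `D k₁ = D₀ ⊕ ⋯ ⊕ D₀(r₁)` and `D k₂ = D₀(l) ⊕ ⋯ ⊕ D₀(l + r₂)` in the same block:
`l = 0`. -/
def SameStart (k₁ k₂ : Fin s) : Prop :=
  SameBlock D k₁ k₂ ∧ KerTwistIso (D k₁) (D k₂) 0

/-- With `D k₁ = D₀ ⊕ ⋯ ⊕ D₀(r₁)` and `D k₂ = D₀(l) ⊕ ⋯ ⊕ D₀(l + r₂)` in the same block, `l ≥ 0`: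
`r₁ = l + r₂`. -/
def SameEnd (k₁ k₂ : Fin s) : Prop :=
  SameBlock D k₁ k₂ ∧ ∃ l : ℕ, KerTwistIso (D k₁) (D k₂) l ∧
    (D k₁).nilLength = l + (D k₂).nilLength

/-- The pairs `k₁ < k₂` along which the Frobenius is modified: `k₂` is the smallest index after
`k₁` with the same start, or the smallest index after `k₁` with the same end. -/
def Linked (k₁ k₂ : Fin s) : Prop :=
  k₁ < k₂ ∧ ((SameStart D k₁ k₂ ∧ ∀ k, k₁ < k → k < k₂ → ¬ SameStart D k₁ k) ∨
    (SameEnd D k₁ k₂ ∧ ∀ k, k₁ < k → k < k₂ → ¬ SameEnd D k₁ k))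

variable (α : ∀ k₁ k₂, Hom (D k₁) (D k₂))

open Classical in
/-- The sum of the morphisms `α k₁ k₂` over the linked pairs, as an endomorphism of `⊕ D k`. -/
def linkMap : (∀ k, (D k).D) →ₗ[K] (∀ k, (D k).D) :=
  LinearMap.pi fun k₂ => ∑ k₁, if Linked D k₁ k₂ then (α k₁ k₂).f ∘ₗ LinearMap.proj k₁ else 0

open Classical in
theorem linkMap_apply (x : ∀ k, (D k).D) (k₂ : Fin s) :
    linkMap D α x k₂ = ∑ k₁, if Linked D k₁ k₂ then (α k₁ k₂).f (x k₁) else 0 := by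
  simp only [linkMap, LinearMap.pi_apply, LinearMap.sum_apply]
  refine Finset.sum_congr rfl fun k₁ _ => ?_
  split_ifs <;> simp

theorem isNilpotent_linkMap : IsNilpotent (linkMap D α) := by
  have h : ∀ (n : ℕ) (x : ∀ k, (D k).D) (k : Fin s), (k : ℕ) < n →
      ((linkMap D α) ^ n) x k = 0 := by
    intro n
    induction n with
    | zero => intro x k hk; omega
    | succ n ih =>
      intro x k hk
      rw [pow_succ', Module.End.mul_apply, linkMap_apply]
      refine Finset.sum_eq_zero fun k₁ _ => ?_
      split_ifs with hl
      · have hlt : (k₁ : ℕ) < k := hl.1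
        rw [ih x k₁ (by omega), map_zero]
      · rfl
  exact ⟨s, LinearMap.ext fun x => funext fun k => h s x k k.2⟩

theorem pi_module_eq : (TensorProduct.Algebra.module :
    Module (maxUnram p L' ⊗[ℚ_[p]] K) (∀ k, (D k).D)) =
      Pi.module (Fin s) (fun k => (D k).D) (maxUnram p L' ⊗[ℚ_[p]] K) := by
  refine Module.ext' _ _ fun t x => ?_
  let M₁ : Module (maxUnram p L' ⊗[ℚ_[p]] K) (∀ k, (D k).D) := TensorProduct.Algebra.module
  let M₂ : Module (maxUnram p L' ⊗[ℚ_[p]] K) (∀ k, (D k).D) :=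
    Pi.module (Fin s) (fun k => (D k).D) (maxUnram p L' ⊗[ℚ_[p]] K)
  have a₁ : ∀ u v, M₁.smul (u + v) x = M₁.smul u x + M₁.smul v x := fun u v => M₁.add_smul u v x
  have a₂ : ∀ u v, M₂.smul (u + v) x = M₂.smul u x + M₂.smul v x := fun u v => M₂.add_smul u v x
  change M₁.smul t x = M₂.smul t x
  induction t using TensorProduct.induction_on with
  | zero =>
    have h1 : M₁.smul 0 x = 0 := by simpa using a₁ 0 0
    have h2 : M₂.smul 0 x = 0 := by simpa using a₂ 0 0
    rw [h1, h2]
  | tmul l k =>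
    have h1 : M₁.smul (l ⊗ₜ k) x = l • k • x := TensorProduct.Algebra.smul_def l k x
    rw [h1]
    funext i
    exact (TensorProduct.Algebra.smul_def l k (x i)).symm
  | add u v hu hv => rw [a₁, a₂, hu, hv]

/-- The object `⊕ D k` with the direct sum of the `N` and of the actions of `Gal(L'/L)`, and with
the modified Frobenius
`(φ x)_{k₂} = φ_{k₂} (x_{k₂}) + ∑ φ_{k₂} (α k₁ k₂ (x_{k₁}))`, the sum being over the `k₁` linked to
`k₂`. -/
def modified : ModObj.{v} p L L' K where
  D := ∀ k, (D k).D
  free := by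
    have := fun k => (D k).free
    rw [pi_module_eq D]
    infer_instance
  finite := by
    have := fun k => (D k).finite
    rw [pi_module_eq D]
    infer_instance
  phi := (LinearEquiv.ofBijective (1 + linkMap D α)
    ((Module.End.isUnit_iff _).1 (isNilpotent_linkMap D α).isUnit_one_add)).trans
      (LinearEquiv.piCongrRight fun k => (D k).phi)
  phi_smul := by
    intro l x
    funext k
    change (D k).phi (l • x k + linkMap D α (l • x) k) =
      frob p L' l • (D k).phi (x k + linkMap D α x k)
    rw [← (D k).phi_smul, smul_add, linkMap_apply, linkMap_apply, Finset.smul_sum]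
    congr 2
    refine Finset.sum_congr rfl fun k₁ _ => ?_
    split_ifs
    · exact (α k₁ k).map_smul l (x k₁)
    · rw [smul_zero]
  N := LinearMap.pi fun k => (D k).N ∘ₗ LinearMap.proj k
  N_smul := fun l x => funext fun k => (D k).N_smul l (x k)
  N_phi := by
    intro x
    funext k
    change (D k).N ((D k).phi (x k + linkMap D α x k)) = (p : K) • (D k).phi ((D k).N (x k) +
      linkMap D α (fun k => (D k).N (x k)) k)
    rw [(D k).N_phi, map_add, linkMap_apply, linkMap_apply, map_sum]
    congr 3
    refine Finset.sum_congr rfl fun k₁ _ => ?_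
    split_ifs
    · exact ((α k₁ k).map_N (x k₁)).symm
    · rw [map_zero]
  gal :=
    { toFun := fun g => LinearMap.pi fun k => (D k).gal g ∘ₗ LinearMap.proj k
      map_one' := by ext x k; simp
      map_mul' := by intro g h; ext x k; simp }
  gal_smul := fun g l x => funext fun k => (D k).gal_smul g l (x k)
  gal_phi := by
    intro g x
    funext k
    change (D k).gal g ((D k).phi (x k + linkMap D α x k)) = (D k).phi ((D k).gal g (x k) +
      linkMap D α (fun k => (D k).gal g (x k)) k)
    rw [(D k).gal_phi, map_add, linkMap_apply, linkMap_apply, map_sum]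
    congr 2
    refine Finset.sum_congr rfl fun k₁ _ => ?_
    split_ifs
    · exact ((α k₁ k).map_gal g (x k₁)).symm
    · rw [map_zero]
  gal_N := fun g x => funext fun k => (D k).gal_N g (x k)

/-- A good subobject of the modified object: a subobject of the form
`⊕ (D_{k,0} ⊕ D_{k,0}(1) ⊕ ⋯ ⊕ D_{k,0}(m k - 1))` with `0 ≤ m k ≤ b k`; the `k`-th summand is the
kernel of `N ^ m k` on `D k`. -/
def IsGood (E : Submodule (maxUnram p L') (modified D α).D) : Prop :=
  (modified D α).IsSubobject E ∧ ∃ m : Fin s → ℕ, (∀ k, m k ≤ (D k).nilLength) ∧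
    ∀ x : ∀ k, (D k).D, x ∈ E ↔ ∀ k, ((D k).N ^ m k) (x k) = 0

/-- A good flag: a totally ordered set of good subobjects. -/
def IsGoodFlag (Δ : Set (Submodule (maxUnram p L') (modified D α).D)) : Prop :=
  IsChain (· ≤ ·) Δ ∧ ∀ E ∈ Δ, IsGood D α E

end Family

end ModObj

end Modules

end PhiN

end

noncomputable section

namespace PhiN

section ResidueField

variable (p : ℕ) [Fact p.Prime] (Ω : Type*) [Field Ω] [Algebra ℚ_[p] Ω]
  [Algebra.IsAlgebraic ℚ_[p] Ω]

/-- The ring of integers for the spectral norm. -/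
def intRing : Subring Ω where
  carrier := {x | spectralNorm ℚ_[p] Ω x ≤ 1}
  mul_mem' {x y} hx hy := by
    have h := spectralAlgNorm_mul (K := ℚ_[p]) x y
    change spectralNorm ℚ_[p] Ω (x * y) = spectralNorm ℚ_[p] Ω x * spectralNorm ℚ_[p] Ω y at h
    change spectralNorm ℚ_[p] Ω (x * y) ≤ 1
    rw [h]
    exact mul_le_one₀ hx (spectralNorm_nonneg y) hy
  one_mem' := spectralNorm_one.le
  add_mem' {x y} hx hy := (isNonarchimedean_spectralNorm x y).trans (max_le hx hy)
  zero_mem' := by simp [spectralNorm_zero]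
  neg_mem' {x} hx := by
    change spectralNorm ℚ_[p] Ω (-x) ≤ 1
    rw [spectralNorm_neg (Algebra.IsAlgebraic.isAlgebraic x)]
    exact hx

variable {p Ω}

theorem mem_intRing {x : Ω} : x ∈ intRing p Ω ↔ spectralNorm ℚ_[p] Ω x ≤ 1 := Iff.rfl

theorem spectralNorm_mul' (x y : Ω) : spectralNorm ℚ_[p] Ω (x * y) =
    spectralNorm ℚ_[p] Ω x * spectralNorm ℚ_[p] Ω y := spectralAlgNorm_mul (K := ℚ_[p]) x y

theorem spectralNorm_pow' (x : Ω) (n : ℕ) : spectralNorm ℚ_[p] Ω (x ^ n) =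
    spectralNorm ℚ_[p] Ω x ^ n := by
  induction n with
  | zero => simp [spectralNorm_one]
  | succ n ih => rw [pow_succ, spectralNorm_mul', ih, pow_succ]

variable (p Ω) in
/-- The maximal ideal of the ring of integers. -/
def intMax : Ideal (intRing p Ω) where
  carrier := {x | spectralNorm ℚ_[p] Ω x < 1}
  add_mem' {x y} hx hy := (isNonarchimedean_spectralNorm (x : Ω) y).trans_lt (max_lt hx hy)
  zero_mem' := by simp [spectralNorm_zero]
  smul_mem' c x hx := by
    change spectralNorm ℚ_[p] Ω (c * x) < 1
    rw [spectralNorm_mul']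
    exact mul_lt_one_of_nonneg_of_lt_one_right c.2 (spectralNorm_nonneg _) hx

theorem mem_intMax {x : intRing p Ω} : x ∈ intMax p Ω ↔ spectralNorm ℚ_[p] Ω (x : Ω) < 1 := Iff.rfl

instance : (intMax p Ω).IsMaximal := by
  rw [Ideal.isMaximal_iff]
  refine ⟨fun h => ?_, fun J x hJ hx hxJ => ?_⟩
  · rw [mem_intMax] at h
    simp [spectralNorm_one] at h
  · rw [mem_intMax, not_lt] at hx
    have h1 : spectralNorm ℚ_[p] Ω (x : Ω) = 1 := le_antisymm x.2 hx
    have h0 : (x : Ω) ≠ 0 := by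
      intro h
      rw [h, spectralNorm_zero] at h1
      norm_num at h1
    have h2 : spectralNorm ℚ_[p] Ω (x : Ω)⁻¹ = 1 := by
      have := spectralNorm_mul' (p := p) (x : Ω) (x : Ω)⁻¹
      rw [mul_inv_cancel₀ h0, spectralNorm_one, h1, one_mul] at this
      exact this.symm
    have h3 := J.mul_mem_left ⟨(x : Ω)⁻¹, h2.le⟩ hxJ
    convert h3
    exact Subtype.ext (inv_mul_cancel₀ h0).symm

variable (p Ω) in
/-- The residue field. -/
abbrev resField : Type _ := intRing p Ω ⧸ intMax p Ω

instance : Field (resField p Ω) := Ideal.Quotient.field _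

theorem natCast_p_mem_intMax : ((p : ℕ) : intRing p Ω) ∈ intMax p Ω := by
  rw [mem_intMax]
  have h : (((p : ℕ) : intRing p Ω) : Ω) = algebraMap ℚ_[p] Ω p := by simp
  rw [h, spectralNorm_extends]
  exact Padic.norm_p_lt_one

instance : CharP (resField p Ω) p := by
  have h : ((p : ℕ) : resField p Ω) = 0 := by
    have := Ideal.Quotient.eq_zero_iff_mem.2 (natCast_p_mem_intMax (p := p) (Ω := Ω))
    simpa using this
  obtain ⟨q, hq⟩ := CharP.exists (resField p Ω)
  have h1 := (CharP.cast_eq_zero_iff (resField p Ω) q p).1 h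
  rcases (Nat.dvd_prime (Fact.out : p.Prime)).1 h1 with h2 | h2
  · subst h2
    exact (CharP.char_ne_one (resField p Ω) 1 rfl).elim
  · exact h2 ▸ hq

theorem IsPrimeToPRoot.mem_intRing {ζ : Ω} (h : IsPrimeToPRoot p ζ) : ζ ∈ intRing p Ω := by
  obtain ⟨n, hn, h⟩ := h
  have hn0 : n ≠ 0 := by rintro rfl; simp at hn
  rw [PhiN.mem_intRing]
  have h1 := spectralNorm_pow' (p := p) ζ n
  rw [h, spectralNorm_one] at h1
  exact ((pow_eq_one_iff_of_nonneg (spectralNorm_nonneg ζ) hn0).1 h1.symm).le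

theorem natCast_resField_ne_zero {n : ℕ} (hn : ¬ p ∣ n) : (n : resField p Ω) ≠ 0 := fun h =>
  hn ((CharP.cast_eq_zero_iff (resField p Ω) p n).1 h)

/-- Reductions of distinct roots of unity of order prime to `p` are distinct. -/
theorem eq_of_red_eq {ζ η : intRing p Ω} (hζ : IsPrimeToPRoot p (ζ : Ω))
    (hη : IsPrimeToPRoot p (η : Ω))
    (h : Ideal.Quotient.mk (intMax p Ω) ζ = Ideal.Quotient.mk (intMax p Ω) η) : ζ = η := by
  obtain ⟨n, hn, h1⟩ := hζ
  obtain ⟨m, hm, h2⟩ := hη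
  have hp : p.Prime := Fact.out
  by_contra hne
  have h3 : ζ ^ (n * m) = 1 := by
    apply Subtype.ext
    push_cast
    rw [pow_mul, h1, one_pow]
  have h4 : η ^ (n * m) = 1 := by
    apply Subtype.ext
    push_cast
    rw [mul_comm, pow_mul, h2, one_pow]
  have h5 := (Commute.all ζ η).mul_geom_sum₂ (n * m)
  rw [h3, h4, sub_self] at h5
  have h6 := (mul_eq_zero.1 h5).resolve_left (sub_ne_zero.2 hne)
  have h7 := congrArg (Ideal.Quotient.mk (intMax p Ω)) h6
  rw [map_sum, map_zero] at h7
  simp only [map_mul, map_pow, h] at h7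
  have h8 : ∀ i ∈ Finset.range (n * m), Ideal.Quotient.mk (intMax p Ω) η ^ i *
      Ideal.Quotient.mk (intMax p Ω) η ^ (n * m - 1 - i) =
      Ideal.Quotient.mk (intMax p Ω) η ^ (n * m - 1) := by
    intro i hi
    rw [← pow_add]
    congr 1
    have := Finset.mem_range.1 hi
    omega
  rw [Finset.sum_congr rfl h8, Finset.sum_const, Finset.card_range, nsmul_eq_mul] at h7
  have h9 : Ideal.Quotient.mk (intMax p Ω) η ^ (n * m) = 1 := by
    rw [← map_pow, h4, map_one]
  have hη0 : Ideal.Quotient.mk (intMax p Ω) η ≠ 0 := by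
    intro h0
    rw [h0, zero_pow (fun h => by
      rcases Nat.mul_eq_zero.1 h with h | h
      · exact hn (h ▸ dvd_zero p)
      · exact hm (h ▸ dvd_zero p))] at h9
    exact zero_ne_one h9
  have h10 : ¬ p ∣ n * m := fun h => (hp.dvd_mul.1 h).elim hn hm
  exact (mul_ne_zero (natCast_resField_ne_zero h10) (pow_ne_zero _ hη0)) h7

/-- An element of the residue field which is an `m`-th root of unity, with `m` prime to `p`, is the
reduction of a root of unity. -/
theorem exists_root_lift [IsAlgClosed Ω] {m : ℕ} (hm : ¬ p ∣ m) (x : resField p Ω)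
    (hx : x ^ m = 1) : ∃ ζ : intRing p Ω, IsPrimeToPRoot p (ζ : Ω) ∧
      Ideal.Quotient.mk (intMax p Ω) ζ = x := by
  have hm0 : 0 < m := Nat.pos_of_ne_zero (by rintro rfl; simp at hm)
  have : CharZero Ω := charZero_of_injective_algebraMap (algebraMap ℚ_[p] Ω).injective
  have : NeZero (m : Ω) := ⟨Nat.cast_ne_zero.2 hm0.ne'⟩
  obtain ⟨ζ, hζ⟩ := HasEnoughRootsOfUnity.exists_primitiveRoot Ω m
  have hP : IsPrimeToPRoot p ζ := ⟨m, hm, hζ.1⟩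
  let z : intRing p Ω := ⟨ζ, hP.mem_intRing⟩
  have hz : IsPrimitiveRoot z m := IsPrimitiveRoot.of_map_of_injective (f := (intRing p Ω).subtype)
    hζ Subtype.val_injective
  have h1 := Polynomial.X_pow_sub_one_eq_prod hm0 hz
  have h2 := congrArg (Polynomial.eval₂ (Ideal.Quotient.mk (intMax p Ω)) x) h1
  rw [Polynomial.eval₂_finsetProd] at h2
  simp only [Polynomial.eval₂_sub, Polynomial.eval₂_pow, Polynomial.eval₂_X, Polynomial.eval₂_one,
    Polynomial.eval₂_C, hx, sub_self] at h2
  obtain ⟨y, hy, h3⟩ := Finset.prod_eq_zero_iff.1 h2.symm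
  refine ⟨y, ⟨m, hm, ?_⟩, (sub_eq_zero.1 h3).symm⟩
  have := (Polynomial.mem_nthRootsFinset hm0 1).1 hy
  exact_mod_cast congrArg Subtype.val this

instance : Algebra (ZMod p) (resField p Ω) := ZMod.algebra _ p

variable (p Ω) in
/-- The structure map `ℤ_p → O_Ω`. -/
def padicIntToIntRing : ℤ_[p] →+* intRing p Ω :=
  ((algebraMap ℚ_[p] Ω).comp (algebraMap ℤ_[p] ℚ_[p])).codRestrict (intRing p Ω) fun c => by
    rw [PhiN.mem_intRing, RingHom.comp_apply, spectralNorm_extends]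
    exact c.2

theorem mk_padicIntToIntRing (c : ℤ_[p]) :
    Ideal.Quotient.mk (intMax p Ω) (padicIntToIntRing p Ω c) =
      algebraMap (ZMod p) (resField p Ω) (PadicInt.toZMod c) := by
  have h1 := PadicInt.toZMod_spec c
  rw [PadicInt.maximalIdeal_eq_span_p, Ideal.mem_span_singleton] at h1
  obtain ⟨y, hy⟩ := h1
  have h2 : c = p * y + ((PadicInt.toZMod c).val : ℕ) := by
    rw [← hy, ← ZMod.natCast_val]
    ring
  have hp : (p : resField p Ω) = 0 := CharP.cast_eq_zero _ p
  conv_lhs => rw [h2]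
  rw [map_add, map_add, map_mul, map_mul, map_natCast, map_natCast, map_natCast, map_natCast, hp,
    zero_mul, zero_add]
  rw [← map_natCast (algebraMap (ZMod p) (resField p Ω)), ZMod.natCast_val, ZMod.cast_id]

instance : Algebra.IsIntegral (ZMod p) (resField p Ω) := by
  refine ⟨fun x => ?_⟩
  obtain ⟨b, rfl⟩ := Ideal.Quotient.mk_surjective x
  have hb := b.2
  rw [PhiN.mem_intRing, spectralNorm] at hb
  have hmon := minpoly.monic (Algebra.IsAlgebraic.isAlgebraic (R := ℚ_[p]) (b : Ω)).isIntegral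
  rw [spectralValue_le_one_iff hmon] at hb
  have hl : minpoly ℚ_[p] (b : Ω) ∈ Polynomial.lifts (algebraMap ℤ_[p] ℚ_[p]) := by
    rw [Polynomial.lifts_iff_coeff_lifts]
    exact fun n => ⟨⟨_, hb n⟩, rfl⟩
  obtain ⟨P, hP, -, hPm⟩ := Polynomial.lifts_and_natDegree_eq_and_monic hl hmon
  refine ⟨P.map PadicInt.toZMod, hPm.map _, ?_⟩
  have h1 : (algebraMap (ZMod p) (resField p Ω)).comp PadicInt.toZMod =
      (Ideal.Quotient.mk (intMax p Ω)).comp (padicIntToIntRing p Ω) :=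
    RingHom.ext fun c => (mk_padicIntToIntRing c).symm
  rw [Polynomial.eval₂_map, h1, ← Polynomial.hom_eval₂]
  have h2 : Polynomial.eval₂ (padicIntToIntRing p Ω) b P = 0 := by
    apply Subtype.ext
    have h3 := Polynomial.hom_eval₂ P (padicIntToIntRing p Ω) (intRing p Ω).subtype b
    have h4 : (intRing p Ω).subtype.comp (padicIntToIntRing p Ω) =
      (algebraMap ℚ_[p] Ω).comp (algebraMap ℤ_[p] ℚ_[p]) := rfl
    rw [h4, ← Polynomial.eval₂_map, hP] at h3
    exact h3.trans (minpoly.aeval ℚ_[p] (b : Ω))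
  rw [h2, map_zero]

/-- A nonzero element of the residue field is a root of unity of order prime to `p`. -/
theorem exists_pow_eq_one (x : resField p Ω) (hx : x ≠ 0) : ∃ m, ¬ p ∣ m ∧ x ^ m = 1 := by
  have hint := Algebra.IsIntegral.isIntegral (R := ZMod p) x
  let E := IntermediateField.adjoin (ZMod p) {x}
  have : FiniteDimensional (ZMod p) E := IntermediateField.adjoin.finiteDimensional hint
  have : Finite E := Module.finite_of_finite (ZMod p)
  have := Fintype.ofFinite E
  let y : E := ⟨x, IntermediateField.mem_adjoin_simple_self _ x⟩
  have hy : y ≠ 0 := fun h => hx (congrArg Subtype.val h)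
  have hcard := FiniteField.pow_card_sub_one_eq_one y hy
  refine ⟨Fintype.card E - 1, ?_, by simpa using congrArg Subtype.val hcard⟩
  intro hd
  have h1 : p ∣ Fintype.card E := by
    have := Module.card_eq_pow_finrank (K := ZMod p) (V := E)
    rw [this, ZMod.card]
    exact dvd_pow_self p Module.finrank_pos.ne'
  have h2 : 1 ≤ Fintype.card E := Fintype.card_pos
  have h4 : p ∣ 1 := by
    have := Nat.dvd_sub h1 hd
    rwa [Nat.sub_sub_self h2] at this
  exact (Fact.out : p.Prime).one_lt.ne' (Nat.dvd_one.1 h4)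

/-- An automorphism acts on the ring of integers. -/
def intEquiv (w : Ω ≃ₐ[ℚ_[p]] Ω) : intRing p Ω ≃+* intRing p Ω where
  toFun x := ⟨w x, by rw [PhiN.mem_intRing, ← spectralNorm_eq_of_equiv]; exact x.2⟩
  invFun x := ⟨w.symm x, by rw [PhiN.mem_intRing, ← spectralNorm_eq_of_equiv]; exact x.2⟩
  left_inv x := by simp
  right_inv x := by simp
  map_mul' x y := by apply Subtype.ext; simp
  map_add' x y := by apply Subtype.ext; simp

/-- The induced automorphism of the residue field. -/
def redEquiv (w : Ω ≃ₐ[ℚ_[p]] Ω) : resField p Ω ≃+* resField p Ω :=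
  Ideal.quotientEquiv (intMax p Ω) (intMax p Ω) (intEquiv w) (by
    rw [Ideal.map_comap_of_equiv]
    ext x
    rw [Ideal.mem_comap, mem_intMax, mem_intMax]
    change _ ↔ spectralNorm ℚ_[p] Ω (w.symm x) < 1
    rw [← spectralNorm_eq_of_equiv])

theorem redEquiv_mk (w : Ω ≃ₐ[ℚ_[p]] Ω) (x : intRing p Ω) :
    redEquiv w (Ideal.Quotient.mk (intMax p Ω) x) = Ideal.Quotient.mk (intMax p Ω) (intEquiv w x) :=
  rfl

theorem intEquiv_coe (w : Ω ≃ₐ[ℚ_[p]] Ω) (x : intRing p Ω) : (intEquiv w x : Ω) = w x := rfl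

/-- An automorphism acts on a root of unity of order prime to `p` through a power of `p`. -/
theorem exists_apply_eq_pow (w : Ω ≃ₐ[ℚ_[p]] Ω) (ζ : Ω) (hζ : IsPrimeToPRoot p ζ) :
    ∃ i : ℕ, w ζ = ζ ^ p ^ i := by
  let z : intRing p Ω := ⟨ζ, hζ.mem_intRing⟩
  let x : resField p Ω := Ideal.Quotient.mk (intMax p Ω) z
  let E := IntermediateField.adjoin (ZMod p) {x}
  have : FiniteDimensional (ZMod p) E := IntermediateField.adjoin.finiteDimensional
    (Algebra.IsIntegral.isIntegral (R := ZMod p) x)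
  have : Finite E := Module.finite_of_finite (ZMod p)
  let τ : resField p Ω ≃ₐ[ZMod p] resField p Ω :=
    AlgEquiv.ofRingEquiv (f := redEquiv w) fun c => by
      exact RingHom.congr_fun (Subsingleton.elim
        ((redEquiv w : resField p Ω →+* resField p Ω).comp (algebraMap (ZMod p) _))
        (algebraMap (ZMod p) _)) c
  obtain ⟨i, hi⟩ := (FiniteField.bijective_frobeniusAlgEquivOfAlgebraic_pow (ZMod p) E).2
    (τ.restrictNormal E)
  refine ⟨i, ?_⟩
  have h1 := AlgEquiv.restrictNormal_commutes τ E ⟨x, IntermediateField.mem_adjoin_simple_self _ x⟩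
  rw [← hi] at h1
  simp only [AlgEquiv.coe_pow, FiniteField.coe_frobeniusAlgEquivOfAlgebraic_iterate, ZMod.card]
    at h1
  have h2 : redEquiv w x = x ^ p ^ (i : ℕ) := h1.symm
  have h3 : intEquiv w z = z ^ p ^ (i : ℕ) := by
    refine eq_of_red_eq (hζ.map w) ?_ (h2.trans (map_pow _ _ _).symm)
    push_cast
    exact hζ.pow _
  exact (congrArg Subtype.val h3).trans (by push_cast; rfl)

end ResidueField

/-- The Frobenius generates the automorphism group of the maximal unramified subfield. -/
theorem exists_frob_pow (p : ℕ) [Fact p.Prime] (E : Type*) [Field E] [Algebra ℚ_[p] E]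
    [FiniteDimensional ℚ_[p] E] (g : maxUnram p E ≃ₐ[ℚ_[p]] maxUnram p E) :
    ∃ i : ℕ, g = frob p E ^ i := by
  have hfrob : ∀ (n : ℕ) (ζ : maxUnram p E), IsPrimeToPRoot p ζ →
      (frob p E ^ n) ζ = ζ ^ p ^ n := by
    intro n
    induction n with
    | zero => intro ζ _; simp
    | succ n ih =>
      intro ζ hζ
      rw [pow_succ, AlgEquiv.mul_apply, frob_apply p E ζ hζ, map_pow, ih ζ hζ, ← pow_mul,
        pow_succ]
  have hsingle : ∀ ζ : maxUnram p E, IsPrimeToPRoot p ζ → ∃ i : ℕ, g ζ = ζ ^ p ^ i := by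
    intro ζ hζ
    let Ω := AlgebraicClosure (maxUnram p E)
    have : Algebra.IsAlgebraic ℚ_[p] Ω := Algebra.IsAlgebraic.trans ℚ_[p] (maxUnram p E) Ω
    have : Normal ℚ_[p] Ω := normal_iff.2 fun x => ⟨(Algebra.IsAlgebraic.isAlgebraic x).isIntegral,
      IsAlgClosed.splits _⟩
    obtain ⟨w, hw⟩ := AlgEquiv.restrictNormalHom_surjective (F := ℚ_[p]) (K₁ := maxUnram p E) Ω g
    have h1 := AlgEquiv.restrictNormal_commutes w (maxUnram p E) ζ
    have h2 : w.restrictNormal (maxUnram p E) = g := hw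
    rw [h2] at h1
    have hζ' : IsPrimeToPRoot p (algebraMap (maxUnram p E) Ω ζ) := by
      obtain ⟨n, hn, h⟩ := hζ
      exact ⟨n, hn, by rw [← map_pow, h, map_one]⟩
    obtain ⟨i, hi⟩ := exists_apply_eq_pow w _ hζ'
    refine ⟨i, (algebraMap (maxUnram p E) Ω).injective ?_⟩
    rw [h1, map_pow, ← hi]
  by_contra! hcon
  have hne : ∀ i : ℕ, ∃ ζ : maxUnram p E, IsPrimeToPRoot p ζ ∧ g ζ ≠ (frob p E ^ i) ζ := by
    intro i
    by_contra! h
    exact hcon i (algEquiv_maxUnram_ext p _ _ h)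
  choose ζ hζ hgζ using hne
  choose m hm hζm using hζ
  set n := orderOf (frob p E)
  have hn : 0 < n := orderOf_pos _
  set M := ∏ i ∈ Finset.range n, m i
  have hM : ¬ p ∣ M := fun h => by
    obtain ⟨i, -, hi⟩ := ((Fact.out : p.Prime).prime.dvd_finsetProd_iff _).1 h
    exact hm i hi
  have hM0 : M ≠ 0 := by intro h; rw [h] at hM; exact hM (dvd_zero p)
  have : NeZero M := ⟨hM0⟩
  obtain ⟨u, hu⟩ := IsCyclic.exists_generator (α := rootsOfUnity M (maxUnram p E))
  have hu1 : ((u : (maxUnram p E)ˣ) : maxUnram p E) ^ M = 1 := by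
    have := u.2
    rw [mem_rootsOfUnity] at this
    exact (Units.val_pow_eq_pow_val _ _).symm.trans (congrArg Units.val this)
  obtain ⟨j, hj⟩ := hsingle _ ⟨M, hM, hu1⟩
  have hall : ∀ z : maxUnram p E, z ^ M = 1 → g z = z ^ p ^ j := by
    intro z hz
    obtain ⟨k, hk⟩ := (mem_powers_iff_mem_zpowers.2 (hu (rootsOfUnity.mkOfPowEq z hz)))
    have hk' : z = ((u : (maxUnram p E)ˣ) : maxUnram p E) ^ k := by
      have := congrArg (fun t : rootsOfUnity M (maxUnram p E) =>
        ((t : (maxUnram p E)ˣ) : maxUnram p E)) hk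
      simpa using this.symm
    rw [hk', map_pow, hj, ← pow_mul, ← pow_mul, mul_comm]
  have hi : j % n < n := Nat.mod_lt _ hn
  apply hgζ (j % n)
  have hz : ζ (j % n) ^ M = 1 := by
    obtain ⟨c, hc⟩ := Finset.dvd_prod_of_mem m (Finset.mem_range.2 hi)
    change ζ (j % n) ^ (∏ i ∈ Finset.range n, m i) = 1
    rw [hc, pow_mul, hζm, one_pow]
  rw [hall _ hz, pow_mod_orderOf, hfrob j _ ⟨_, hm _, hζm _⟩]

end PhiN

namespace PhiN

section Lift

variable {p : ℕ} [Fact p.Prime] {F Ω : Type*} [Field F] [Field Ω] [Algebra ℚ_[p] F]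
  [Algebra ℚ_[p] Ω] [Algebra F Ω] [IsScalarTower ℚ_[p] F Ω] [Algebra.IsAlgebraic ℚ_[p] Ω]

instance : IsInvariantSubring (Ω ≃ₐ[F] Ω) (intRing p Ω) where
  smul_mem w x hx := by
    rw [mem_intRing] at hx ⊢
    change spectralNorm ℚ_[p] Ω ((w.restrictScalars ℚ_[p]) x) ≤ 1
    rwa [← spectralNorm_eq_of_equiv]

/-- An automorphism of the residue field of `Ω` which fixes the residue field of `F` lifts to an
automorphism of `Ω` over `F`. -/
theorem exists_lift_redEquiv [IsGalois F Ω] (τ : resField p Ω ≃+* resField p Ω)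
    (hτ : ∀ (x : F) (hx : algebraMap F Ω x ∈ intRing p Ω),
      τ (Ideal.Quotient.mk (intMax p Ω) ⟨_, hx⟩) = Ideal.Quotient.mk (intMax p Ω) ⟨_, hx⟩) :
    ∃ w : Ω ≃ₐ[F] Ω, redEquiv (w.restrictScalars ℚ_[p]) = τ := by
  let A : Subring F := (intRing p Ω).comap (algebraMap F Ω)
  let : Algebra A (intRing p Ω) := RingHom.toAlgebra
    { toFun := fun a => (⟨algebraMap F Ω a, a.2⟩ : intRing p Ω)
      map_one' := Subtype.ext (by simp)
      map_mul' := fun a b => Subtype.ext (by simp)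
      map_zero' := Subtype.ext (by simp)
      map_add' := fun a b => Subtype.ext (by simp) }
  have hA : ∀ a : A, ((algebraMap A (intRing p Ω) a : intRing p Ω) : Ω) = algebraMap F Ω a :=
    fun a => rfl
  have hs : ∀ (g : Ω ≃ₐ[F] Ω) (b : intRing p Ω), ((g • b : intRing p Ω) : Ω) = g b := fun g b => rfl
  have : SMulCommClass (Ω ≃ₐ[F] Ω) A (intRing p Ω) := ⟨fun g a b => by
    apply Subtype.ext
    rw [hs, Algebra.smul_def, Algebra.smul_def]
    push_cast
    rw [map_mul, hA, AlgEquiv.commutes, hs]⟩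
  let : TopologicalSpace (intRing p Ω) := ⊥
  have : DiscreteTopology (intRing p Ω) := ⟨rfl⟩
  have : ContinuousSMul (Ω ≃ₐ[F] Ω) (intRing p Ω) := by
    rw [continuousSMul_iff_stabilizer_isOpen]
    intro x
    have hfin : FiniteDimensional F (IntermediateField.adjoin F {(x : Ω)}) :=
      IntermediateField.adjoin.finiteDimensional (Algebra.IsIntegral.isIntegral _)
    refine Subgroup.isOpen_mono (H₁ := (IntermediateField.adjoin F {(x : Ω)}).fixingSubgroup)
      (H₂ := MulAction.stabilizer (Ω ≃ₐ[F] Ω) x) (fun g hg => ?_)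
      (IntermediateField.fixingSubgroup_isOpen _)
    rw [MulAction.mem_stabilizer_iff]
    exact Subtype.ext (((IntermediateField.mem_fixingSubgroup_iff _ _).1 hg) x
      (IntermediateField.mem_adjoin_simple_self F _))
  have : Algebra.IsInvariant A (intRing p Ω) (Ω ≃ₐ[F] Ω) := ⟨fun b hb => by
    obtain ⟨y, hy⟩ := (InfiniteGalois.mem_bot_iff_fixed (k := F) (b : Ω)).2 fun g =>
      congrArg Subtype.val (hb g)
    refine ⟨⟨y, ?_⟩, Subtype.ext hy⟩
    change algebraMap F Ω y ∈ intRing p Ω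
    change algebraMap F Ω y = b at hy
    rw [hy]
    exact b.2⟩
  let P : Ideal A := (intMax p Ω).under A
  have : (intMax p Ω).LiesOver P := ⟨rfl⟩
  let τ' : (intRing p Ω ⧸ intMax p Ω) ≃ₐ[A ⧸ P] (intRing p Ω ⧸ intMax p Ω) :=
    AlgEquiv.ofRingEquiv (f := τ) fun c => by
      obtain ⟨a, rfl⟩ := Ideal.Quotient.mk_surjective c
      exact hτ a a.2
  obtain ⟨w, hw⟩ := Ideal.Quotient.stabilizerHom_surjective_of_profinite (G := Ω ≃ₐ[F] Ω) P
    (intMax p Ω) τ'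
  refine ⟨w.1, RingEquiv.ext fun x => ?_⟩
  have h := DFunLike.congr_fun hw x
  obtain ⟨b, rfl⟩ := Ideal.Quotient.mk_surjective x
  exact h

end Lift

section WeilLift

variable {p : ℕ} [Fact p.Prime] {L L' : Type*} [Field L] [Field L'] [Algebra ℚ_[p] L]
  [Algebra ℚ_[p] L'] [FiniteDimensional ℚ_[p] L'] [Algebra L L'] [IsScalarTower ℚ_[p] L L']
  [IsGalois L L']

theorem frob_pow_apply (p : ℕ) [Fact p.Prime] (E : Type*) [Field E] [Algebra ℚ_[p] E]
    [FiniteDimensional ℚ_[p] E] (n : ℕ) (ζ : maxUnram p E) (hζ : IsPrimeToPRoot p ζ) :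
    (frob p E ^ n) ζ = ζ ^ p ^ n := by
  induction n generalizing ζ with
  | zero => simp
  | succ n ih =>
    rw [pow_succ, AlgEquiv.mul_apply, frob_apply p E ζ hζ, map_pow, ih ζ hζ, ← pow_mul, pow_succ]

/-- Every pair `(g, a)` such that `g` acts on `L'₀` as the `a`-th power of the Frobenius comes from
an element of the Weil group. -/
theorem exists_weil (g : L' ≃ₐ[L] L') (a : ℤ) (h : galUnram p g = frob p L' ^ a) :
    ∃ w : WeilGp p L L', weilToGal w = g ∧ weilDeg w = a := by
  let Ω := AlgebraicClosure L'
  have hp : p.Prime := Fact.out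
  have : Algebra.IsAlgebraic ℚ_[p] Ω := Algebra.IsAlgebraic.trans ℚ_[p] L' Ω
  have : CharZero Ω := ModObj.charZero_of_algebra_padic p Ω
  have : CharZero L' := ModObj.charZero_of_algebra_padic p L'
  have : IsScalarTower ℚ_[p] L Ω := IsScalarTower.of_algebraMap_eq fun x => by
    rw [IsScalarTower.algebraMap_apply ℚ_[p] L' Ω, IsScalarTower.algebraMap_apply L L' Ω,
      ← IsScalarTower.algebraMap_apply ℚ_[p] L L']
  have : FiniteDimensional L L' := Module.Finite.of_restrictScalars_finite ℚ_[p] L L'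
  have : Algebra.IsAlgebraic L Ω := Algebra.IsAlgebraic.trans L L' Ω
  have : Normal L Ω := normal_iff.2 fun x => ⟨(Algebra.IsAlgebraic.isAlgebraic x).isIntegral,
      IsAlgClosed.splits _⟩
  have : Normal L' Ω := normal_iff.2 fun x => ⟨(Algebra.IsAlgebraic.isAlgebraic x).isIntegral,
      IsAlgClosed.splits _⟩
  have : IsGalois L' Ω := {}
  obtain ⟨w₀, hw₀⟩ := AlgEquiv.restrictNormalHom_surjective (F := L) (K₁ := L') Ω g
  have hw₀' : ∀ x : L', w₀ (algebraMap L' Ω x) = algebraMap L' Ω (g x) := by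
    intro x
    have h1 := AlgEquiv.restrictNormal_commutes w₀ L' x
    have h2 : w₀.restrictNormal L' = g := hw₀
    rw [h2] at h1
    exact h1.symm
  obtain ⟨a₁, a₂, rfl⟩ : ∃ a₁ a₂ : ℕ, a = a₁ - a₂ := ⟨a.toNat, (-a).toNat, by omega⟩
  have hg : ∀ ζ : maxUnram p L', IsPrimeToPRoot p ζ →
      (galUnram p g ζ) ^ p ^ a₂ = ζ ^ p ^ a₁ := by
    intro ζ hζ
    have hζ' : IsPrimeToPRoot p (galUnram p g ζ) := hζ.map _
    rw [← frob_pow_apply p L' a₂ _ hζ', ← frob_pow_apply p L' a₁ _ hζ, h, ← AlgEquiv.mul_apply,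
      ← zpow_natCast, ← zpow_natCast, ← zpow_add]
    congr 2
    ring
  have hsurj : Function.Surjective (frobenius (resField p Ω) p) := by
    intro x
    obtain ⟨b, rfl⟩ := Ideal.Quotient.mk_surjective x
    obtain ⟨y, hy⟩ := IsAlgClosed.exists_pow_nat_eq (b : Ω) hp.pos
    have hyB : y ∈ intRing p Ω := by
      have h1 := b.2
      rw [mem_intRing] at h1 ⊢
      rw [← hy, spectralNorm_pow'] at h1
      exact (pow_le_one_iff_of_nonneg (spectralNorm_nonneg y) hp.ne_zero).1 h1
    refine ⟨Ideal.Quotient.mk _ ⟨y, hyB⟩, ?_⟩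
    rw [frobenius_def, ← map_pow]
    congr 1
    exact Subtype.ext (by push_cast; exact hy)
  have : PerfectRing (resField p Ω) p := PerfectRing.ofSurjective _ p hsurj
  let Fr (n : ℕ) : resField p Ω ≃+* resField p Ω := iterateFrobeniusEquiv (resField p Ω) p n
  have hFr : ∀ (n : ℕ) x, Fr n x = x ^ p ^ n := fun n x => iterateFrobeniusEquiv_apply _ _ _ _
  let r₀ := redEquiv (w₀.restrictScalars ℚ_[p])
  let τ : resField p Ω ≃+* resField p Ω := ((Fr a₁).trans (Fr a₂).symm).trans r₀.symm
  have hτ : ∀ (x : L') (hx : algebraMap L' Ω x ∈ intRing p Ω),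
      τ (Ideal.Quotient.mk (intMax p Ω) ⟨_, hx⟩) = Ideal.Quotient.mk (intMax p Ω) ⟨_, hx⟩ := by
    intro x hx
    set xb := Ideal.Quotient.mk (intMax p Ω) ⟨_, hx⟩ with hxb
    by_cases hx0 : xb = 0
    · rw [hx0, map_zero]
    obtain ⟨m, hm, hxm⟩ := exists_pow_eq_one xb hx0
    obtain ⟨ζ, hζ, hζx⟩ := exists_root_lift hm xb hxm
    obtain ⟨z, hz⟩ := (InfiniteGalois.mem_bot_iff_fixed (k := L') (ζ : Ω)).2 fun u => by
      refine congrArg Subtype.val (eq_of_red_eq (p := p)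
        (ζ := intEquiv (u.restrictScalars ℚ_[p]) ζ) (η := ζ) (hζ.map u) hζ ?_)
      rw [← redEquiv_mk, hζx, hxb, redEquiv_mk]
      congr 1
      exact Subtype.ext (u.commutes x)
    change algebraMap L' Ω z = ζ at hz
    have hzP : IsPrimeToPRoot p z := by
      obtain ⟨n, hn, h1⟩ := hζ
      refine ⟨n, hn, (algebraMap L' Ω).injective ?_⟩
      rw [map_pow, hz, h1, map_one]
    let z' : maxUnram p L' := ⟨z, IntermediateField.subset_adjoin _ _ hzP⟩
    have h2 := hg z' (by obtain ⟨n, hn, h1⟩ := hzP; exact ⟨n, hn, Subtype.ext (by simpa using h1)⟩)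
    have h3 : (g z) ^ p ^ a₂ = z ^ p ^ a₁ := by
      have := congrArg Subtype.val h2
      push_cast at this
      rwa [galUnram_coe] at this
    have h4 : Fr a₂ (r₀ xb) = Fr a₁ xb := by
      rw [hFr, hFr, ← hζx]
      change (redEquiv _ _) ^ _ = _
      have h5 : intEquiv (w₀.restrictScalars ℚ_[p]) ζ ^ p ^ a₂ = ζ ^ p ^ a₁ := by
        apply Subtype.ext
        push_cast
        rw [intEquiv_coe, ← hz]
        change w₀ _ ^ _ = _
        rw [hw₀', ← map_pow, h3, map_pow]
      exact (map_pow (Ideal.Quotient.mk (intMax p Ω)) _ _).symm.trans ((congrArg (Ideal.Quotient.mk (intMax p Ω)) h5).trans (map_pow _ _ _))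
    change r₀.symm ((Fr a₂).symm (Fr a₁ xb)) = xb
    rw [← h4, RingEquiv.symm_apply_apply, RingEquiv.symm_apply_apply]
  obtain ⟨w₁, hw₁⟩ := exists_lift_redEquiv τ hτ
  let w : Ω ≃ₐ[L] Ω := w₀ * w₁.restrictScalars L
  have hw : ActsAsFrobPow p w (a₁ - a₂) := by
    refine ⟨a₁, a₂, rfl, fun ζ hζ => ?_⟩
    let b : intRing p Ω := ⟨ζ, hζ.mem_intRing⟩
    let c := intEquiv (w.restrictScalars ℚ_[p]) b
    have h1 : redEquiv (w.restrictScalars ℚ_[p]) (Ideal.Quotient.mk _ b) =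
        r₀ (redEquiv (w₁.restrictScalars ℚ_[p]) (Ideal.Quotient.mk _ b)) := rfl
    rw [hw₁] at h1
    have h2 : r₀ (τ (Ideal.Quotient.mk _ b)) = (Fr a₂).symm (Fr a₁ (Ideal.Quotient.mk _ b)) :=
      r₀.apply_symm_apply _
    rw [h2, redEquiv_mk, RingEquiv.eq_symm_apply, hFr, hFr] at h1
    have h3 := eq_of_red_eq (p := p) (ζ := c ^ p ^ a₂) (η := b ^ p ^ a₁) ?_ ?_
      ((map_pow _ _ _).trans (h1.trans (map_pow _ _ _).symm))
    · have := congrArg Subtype.val h3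
      push_cast at this
      exact this
    · push_cast
      exact IsPrimeToPRoot.pow (hζ.map w) _
    · push_cast
      exact hζ.pow _
  refine ⟨⟨w, _, hw⟩, ?_, (weilDeg_spec (⟨w, _, hw⟩ : WeilGp p L L')).unique hw⟩
  refine AlgEquiv.ext fun x => (algebraMap L' Ω).injective ?_
  have h1 := AlgEquiv.restrictNormal_commutes w L' x
  refine h1.trans ?_
  rw [← hw₀']
  change w₀ (w₁ (algebraMap L' Ω x)) = _
  rw [w₁.commutes]

end WeilLift

end PhiN

namespace PhiN

/-- A finite-dimensional `K`-space with a bijective endomorphism `phi` and a family of operators. -/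
structure PG (K : Type*) [Field K] (Ω : Type*) where
  V : Type v
  [addCommGroup : AddCommGroup V]
  [module : Module K V]
  [finite : FiniteDimensional K V]
  op : Ω → V →ₗ[K] V
  phi : V ≃ₗ[K] V

attribute [instance] PG.addCommGroup PG.module PG.finite

namespace PG

variable {K : Type*} [Field K] {Ω : Type*}

/-- Subspaces stable under `phi` and the operators. -/
structure Stable (X : PG.{v} K Ω) (E : Submodule K X.V) : Prop where
  op_mem : ∀ ω, ∀ x ∈ E, X.op ω x ∈ E
  phi_mem : ∀ x ∈ E, X.phi x ∈ E

/-- `f` is a morphism from `X`, with Frobenius multiplied by `c`, to `Y`. -/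
structure IsHom (c : K) (X Y : PG.{v} K Ω) (f : X.V →ₗ[K] Y.V) : Prop where
  map_op : ∀ ω x, f (X.op ω x) = Y.op ω (f x)
  map_phi : ∀ x, f (c • X.phi x) = Y.phi (f x)

/-- `X` is simple. -/
structure Simple (X : PG.{v} K Ω) : Prop where
  nontrivial : Nontrivial X.V
  eq_bot_or : ∀ E, X.Stable E → E = ⊥ ∨ E = ⊤

/-- `X` is semisimple. -/
def Semisimple (X : PG.{v} K Ω) : Prop := ∀ E, X.Stable E → ∃ E', X.Stable E' ∧ IsCompl E E'

/-- There is a nonzero morphism from `X`, with Frobenius multiplied by `c`, to `Y`. -/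
def Tw (c : K) (X Y : PG.{v} K Ω) : Prop := ∃ f : X.V →ₗ[K] Y.V, IsHom c X Y f ∧ f ≠ 0

variable {X Y Z : PG.{v} K Ω} {c c' : K}

theorem Stable.inf {E F : Submodule K X.V} (hE : X.Stable E) (hF : X.Stable F) :
    X.Stable (E ⊓ F) :=
  ⟨fun ω x hx => ⟨hE.op_mem ω x hx.1, hF.op_mem ω x hx.2⟩,
    fun x hx => ⟨hE.phi_mem x hx.1, hF.phi_mem x hx.2⟩⟩

theorem Stable.sup {E F : Submodule K X.V} (hE : X.Stable E) (hF : X.Stable F) :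
    X.Stable (E ⊔ F) := by
  constructor
  · intro ω x hx
    obtain ⟨y, hy, z, hz, rfl⟩ := Submodule.mem_sup.1 hx
    rw [map_add]
    exact Submodule.add_mem_sup (hE.op_mem ω y hy) (hF.op_mem ω z hz)
  · intro x hx
    obtain ⟨y, hy, z, hz, rfl⟩ := Submodule.mem_sup.1 hx
    rw [map_add]
    exact Submodule.add_mem_sup (hE.phi_mem y hy) (hF.phi_mem z hz)

theorem Stable.bot : X.Stable ⊥ := by
  constructor <;> simp

theorem Stable.top : X.Stable ⊤ := ⟨fun _ _ _ => trivial, fun _ _ => trivial⟩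

theorem Stable.phi_symm_mem {E : Submodule K X.V} (hE : X.Stable E) {x : X.V} (hx : X.phi x ∈ E) :
    x ∈ E := by
  have h1 : E.map (X.phi : X.V →ₗ[K] X.V) ≤ E := by
    rintro _ ⟨y, hy, rfl⟩
    exact hE.phi_mem y hy
  have h2 : E.map (X.phi : X.V →ₗ[K] X.V) = E :=
    Submodule.eq_of_le_of_finrank_eq h1 (LinearEquiv.finrank_map_eq X.phi E)
  rw [← h2] at hx
  obtain ⟨y, hy, h⟩ := hx
  rwa [← X.phi.injective h]

/-- The restriction of the structure to a stable subspace. -/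
abbrev sub (X : PG.{v} K Ω) (E : Submodule K X.V) (hE : X.Stable E) : PG.{v} K Ω where
  V := E
  op ω := (X.op ω).restrict (hE.op_mem ω)
  phi := LinearEquiv.ofBijective ((X.phi : X.V →ₗ[K] X.V).restrict hE.phi_mem)
    ⟨fun x y h => Subtype.ext (X.phi.injective (congrArg Subtype.val h)), fun y =>
      ⟨⟨X.phi.symm y, hE.phi_symm_mem (by simp)⟩, Subtype.ext (X.phi.apply_symm_apply _)⟩⟩

theorem IsHom.comp {f : X.V →ₗ[K] Y.V} {g : Y.V →ₗ[K] Z.V} (hf : IsHom c X Y f)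
    (hg : IsHom c' Y Z g) : IsHom (c * c') X Z (g ∘ₗ f) := by
  constructor
  · intro ω x
    simp [hf.map_op, hg.map_op]
  · intro x
    rw [LinearMap.comp_apply, LinearMap.comp_apply, mul_smul, smul_comm, map_smul, ← hg.map_phi,
      ← hf.map_phi]

theorem IsHom.ker_stable {f : X.V →ₗ[K] Y.V} (hf : IsHom c X Y f) (hc : c ≠ 0) :
    X.Stable (LinearMap.ker f) := by
  constructor
  · intro ω x hx
    rw [LinearMap.mem_ker] at hx ⊢
    rw [hf.map_op, hx, map_zero]
  · intro x hx
    rw [LinearMap.mem_ker] at hx ⊢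
    have h := hf.map_phi x
    rw [hx, map_zero, map_smul, smul_eq_zero] at h
    exact h.resolve_left hc

theorem IsHom.range_stable {f : X.V →ₗ[K] Y.V} (hf : IsHom c X Y f) :
    Y.Stable (LinearMap.range f) := by
  constructor
  · rintro ω _ ⟨x, rfl⟩
    exact ⟨_, hf.map_op ω x⟩
  · rintro _ ⟨x, rfl⟩
    exact ⟨_, hf.map_phi x⟩

theorem IsHom.bijective {f : X.V →ₗ[K] Y.V} (hf : IsHom c X Y f) (hc : c ≠ 0) (hX : X.Simple)
    (hY : Y.Simple) (h0 : f ≠ 0) : Function.Bijective f := by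
  constructor
  · rw [← LinearMap.ker_eq_bot]
    refine (hX.eq_bot_or _ (hf.ker_stable hc)).resolve_right fun h => h0 ?_
    exact LinearMap.ker_eq_top.1 h
  · rw [← LinearMap.range_eq_top]
    refine (hY.eq_bot_or _ hf.range_stable).resolve_left fun h => h0 ?_
    exact LinearMap.range_eq_bot.1 h

theorem IsHom.symm {f : X.V ≃ₗ[K] Y.V} (hf : IsHom c X Y f.toLinearMap) (hc : c ≠ 0) :
    IsHom c⁻¹ Y X f.symm.toLinearMap := by
  constructor
  · intro ω y
    apply f.injective
    have := hf.map_op ω (f.symm y)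
    simp only [LinearEquiv.coe_coe] at this
    simp [this]
  · intro y
    apply f.injective
    have := hf.map_phi (f.symm y)
    simp only [LinearEquiv.coe_coe, LinearEquiv.apply_symm_apply, map_smul] at this
    simp [← this, smul_smul, hc]

theorem Tw.symm (h : Tw c X Y) (hc : c ≠ 0) (hX : X.Simple) (hY : Y.Simple) : Tw c⁻¹ Y X := by
  obtain ⟨f, hf, h0⟩ := h
  let e := LinearEquiv.ofBijective f (hf.bijective hc hX hY h0)
  have he : IsHom c X Y e.toLinearMap := hf
  refine ⟨e.symm.toLinearMap, he.symm hc, fun h => ?_⟩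
  have := hY.nontrivial
  obtain ⟨y, hy⟩ := exists_ne (0 : Y.V)
  exact hy (e.symm.injective (by simpa using LinearMap.congr_fun h y))

theorem Tw.trans (h : Tw c X Y) (h' : Tw c' Y Z) (hc : c ≠ 0) (hX : X.Simple)
    (hY : Y.Simple) : Tw (c * c') X Z := by
  obtain ⟨f, hf, h0⟩ := h
  obtain ⟨g, hg, h0'⟩ := h'
  refine ⟨g ∘ₗ f, hf.comp hg, fun h => h0' ?_⟩
  refine LinearMap.ext fun y => ?_
  obtain ⟨x, rfl⟩ := (hf.bijective hc hX hY h0).2 y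
  exact LinearMap.congr_fun h x

theorem Tw.refl (hX : X.Simple) : Tw 1 X X := by
  refine ⟨LinearMap.id, ⟨fun _ _ => rfl, fun x => by simp⟩, fun h => ?_⟩
  have := hX.nontrivial
  obtain ⟨y, hy⟩ := exists_ne (0 : X.V)
  exact hy (LinearMap.congr_fun h y)

theorem Tw.pow_finrank_eq_one (h : Tw c X X) (hc : c ≠ 0) (hX : X.Simple) :
    c ^ Module.finrank K X.V = 1 := by
  obtain ⟨f, hf, h0⟩ := h
  let e := LinearEquiv.ofBijective f (hf.bijective hc hX hX h0)
  have h1 : c • X.phi.toLinearMap = e.symm.toLinearMap ∘ₗ X.phi.toLinearMap ∘ₗ e.toLinearMap := by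
    refine LinearMap.ext fun x => e.injective ?_
    have h4 : e (c • X.phi x) = X.phi (e x) := hf.map_phi x
    simpa using h4
  have h2 := congrArg LinearMap.det h1
  have h3 : LinearMap.det (e.symm.toLinearMap ∘ₗ X.phi.toLinearMap ∘ₗ e.toLinearMap) =
      LinearMap.det X.phi.toLinearMap := LinearMap.det_conj X.phi.toLinearMap e.symm
  rw [h3, LinearMap.det_smul] at h2
  exact mul_right_cancel₀ (LinearEquiv.isUnit_det' X.phi).ne_zero (h2.trans (one_mul _).symm)

theorem sub_stable_map {E : Submodule K X.V} (hE : X.Stable E) {F : Submodule K E}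
    (hF : (X.sub E hE).Stable F) : X.Stable (F.map E.subtype) := by
  constructor
  · rintro ω _ ⟨x, hx, rfl⟩
    exact ⟨_, hF.op_mem ω x hx, rfl⟩
  · rintro _ ⟨x, hx, rfl⟩
    exact ⟨_, hF.phi_mem x hx, rfl⟩

theorem sub_simple {E : Submodule K X.V} (hE : X.Stable E) (h0 : E ≠ ⊥)
    (h : ∀ F ≤ E, X.Stable F → F = ⊥ ∨ F = E) : (X.sub E hE).Simple := by
  refine ⟨(Submodule.nontrivial_iff_ne_bot).2 h0, fun F hF => ?_⟩
  rcases h _ (Submodule.map_subtype_le E F) (sub_stable_map hE hF) with h1 | h1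
  · left
    exact Submodule.map_injective_of_injective (f := E.subtype) E.injective_subtype
      (h1.trans (Submodule.map_bot _).symm)
  · right
    refine Submodule.map_injective_of_injective (f := E.subtype) E.injective_subtype (h1.trans ?_)
    exact ((Submodule.map_top _).trans (Submodule.range_subtype E)).symm

/-- A nonzero stable subspace contains a minimal one on which a given equivariant-up-to-scalars map
does not vanish. -/
theorem Semisimple.exists_minimal (hX : X.Semisimple) {P : Submodule K X.V} (hP : X.Stable P)
    {S : Submodule K X.V} (hS : X.Stable S) (hPS : ¬ P ≤ S) :
    ∃ E ≤ P, X.Stable E ∧ E ⊓ S = ⊥ ∧ E ≠ ⊥ ∧ ∀ F ≤ E, X.Stable F → F = ⊥ ∨ F = E := by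
  have hex : ∃ n, ∃ E ≤ P, X.Stable E ∧ ¬ E ≤ S ∧ Module.finrank K E = n := ⟨_, P, le_rfl, hP, hPS, rfl⟩
  classical
  obtain ⟨E, hEP, hE, hES, hn⟩ := Nat.find_spec hex
  have hmin : ∀ F ≤ E, X.Stable F → ¬ F ≤ S → F = E := by
    intro F hF hFs hFS
    refine Submodule.eq_of_le_of_finrank_le hF ?_
    rw [hn]
    exact Nat.find_min' hex ⟨F, hF.trans hEP, hFs, hFS, rfl⟩
  have hall : ∀ F ≤ E, X.Stable F → F = ⊥ ∨ F = E := by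
    intro F hF hFs
    obtain ⟨G, hG, hc⟩ := hX F hFs
    have hsup : F ⊔ G ⊓ E = E := by
      rw [← sup_inf_assoc_of_le G hF, hc.sup_eq_top, top_inf_eq]
    by_cases h1 : F ≤ S
    · left
      have h2 : ¬ G ⊓ E ≤ S := fun h => hES (hsup ▸ sup_le h1 h)
      have h3 := hmin _ inf_le_right (hG.inf hE) h2
      have h4 : F ≤ G := hF.trans (h3 ▸ inf_le_left)
      exact le_bot_iff.1 (hc.inf_eq_bot ▸ le_inf le_rfl h4)
    · exact Or.inr (hmin F hF hFs h1)
  refine ⟨E, hEP, hE, ?_, fun h => hES (h ▸ bot_le), hall⟩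
  refine (hall _ inf_le_left (hE.inf hS)).resolve_right fun h => hES ?_
  rw [← h]
  exact inf_le_right

end PG
end PhiN

namespace PhiN
namespace PG

variable {K : Type*} [Field K] {Ω : Type*} {X Y Z : PG.{v} K Ω} {c c' : K}

theorem Stable.exists_proj {A B : Submodule K X.V} (hA : X.Stable A) (hB : X.Stable B)
    (h : IsCompl A B) : ∃ π : X.V →ₗ[K] X.V, IsHom 1 X X π ∧ (∀ x, π x ∈ A) ∧
      (∀ x ∈ A, π x = x) ∧ ∀ x ∈ B, π x = 0 := by
  have hl : ∀ x ∈ A, A.projection B h x = x := fun x hx =>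
    Submodule.projection_apply_of_mem_left h hx
  have hr : ∀ x ∈ B, A.projection B h x = 0 := fun x hx =>
    (Submodule.projection_apply_eq_zero_iff h).2 hx
  refine ⟨A.projection B h, ⟨fun ω x => ?_, fun x => ?_⟩,
    fun x => Submodule.projection_apply_mem h x, hl, hr⟩
  · have hx : x ∈ A ⊔ B := h.sup_eq_top ▸ trivial
    obtain ⟨a, ha, b, hb, rfl⟩ := Submodule.mem_sup.1 hx
    simp only [map_add, hl a ha, hr b hb, hl _ (hA.op_mem ω a ha), hr _ (hB.op_mem ω b hb),
      map_zero]
  · have hx : x ∈ A ⊔ B := h.sup_eq_top ▸ trivial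
    obtain ⟨a, ha, b, hb, rfl⟩ := Submodule.mem_sup.1 hx
    simp only [one_smul, map_add, hl a ha, hr b hb, hl _ (hA.phi_mem a ha),
      hr _ (hB.phi_mem b hb), map_zero]

/-- `X`, with the operator `N`, is a string `X₀ ⊕ X₀(1) ⊕ ⋯ ⊕ X₀(b - 1)` with `X₀ = ker N` simple
and `θ` an equivariant retraction onto `X₀`. -/
structure IsString (c : K) (X : PG.{v} K Ω) (N θ : X.V →ₗ[K] X.V) (b : ℕ) : Prop where
  N_op : ∀ ω x, N (X.op ω x) = X.op ω (N x)
  N_phi : ∀ x, N (X.phi x) = c • X.phi (N x)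
  hom : IsHom 1 X X θ
  N_θ : ∀ x, N (θ x) = 0
  θ_eq : ∀ x, N x = 0 → θ x = x
  simple : ∀ F ≤ LinearMap.ker N, X.Stable F → F = ⊥ ∨ F = LinearMap.ker N
  ker_ne : LinearMap.ker N ≠ ⊥
  pos : 0 < b
  pow_eq : N ^ b = 0
  inj : ∀ x, (∀ i < b, θ ((N ^ i) x) = 0) → x = 0
  surj : ∀ y : ℕ → X.V, (∀ i, N (y i) = 0) → ∃ x, ∀ i < b, θ ((N ^ i) x) = y i

section

variable {N : X.V →ₗ[K] X.V}

theorem pow_N_op (h1 : ∀ ω x, N (X.op ω x) = X.op ω (N x)) (n : ℕ) (ω : Ω) (x : X.V) :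
    (N ^ n) (X.op ω x) = X.op ω ((N ^ n) x) := by
  induction n with
  | zero => rfl
  | succ n ih => rw [pow_succ', Module.End.mul_apply, ih, h1]; rfl

theorem pow_N_phi (h2 : ∀ x, N (X.phi x) = c • X.phi (N x)) (n : ℕ) (x : X.V) :
    (N ^ n) (X.phi x) = c ^ n • X.phi ((N ^ n) x) := by
  induction n with
  | zero => simp
  | succ n ih =>
    rw [pow_succ', Module.End.mul_apply, ih, map_smul, h2, smul_smul, pow_succ]; rfl

theorem isHom_pow_N (h1 : ∀ ω x, N (X.op ω x) = X.op ω (N x))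
    (h2 : ∀ x, N (X.phi x) = c • X.phi (N x)) (hc : c ≠ 0) (n : ℕ) :
    IsHom (c ^ n)⁻¹ X X (N ^ n) :=
  ⟨pow_N_op h1 n, fun x => by
    rw [map_smul, pow_N_phi h2, smul_smul, inv_mul_cancel₀ (pow_ne_zero _ hc), one_smul]⟩

theorem exists_isString (hX : X.Semisimple) (hc : c ≠ 0)
    (h1 : ∀ ω x, N (X.op ω x) = X.op ω (N x)) (h2 : ∀ x, N (X.phi x) = c • X.phi (N x))
    {b : ℕ} (hb : N ^ (b + 1) = 0) (hb' : N ^ b ≠ 0)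
    (hind : ∀ A B, X.Stable A → X.Stable B → (∀ x ∈ A, N x ∈ A) → (∀ x ∈ B, N x ∈ B) →
      IsCompl A B → A = ⊥ ∨ B = ⊥) :
    ∃ θ : X.V →ₗ[K] X.V, IsString c X N θ (b + 1) := by
  have hpow : ∀ n, IsHom (c ^ n)⁻¹ X X (N ^ n) := isHom_pow_N h1 h2 hc
  have hpow0 : ∀ n, b < n → ∀ x, (N ^ n) x = 0 := by
    intro n hn x
    obtain ⟨m, rfl⟩ := Nat.exists_eq_add_of_le' (Nat.succ_le_of_lt hn)
    rw [pow_add, hb]; simp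
  have hadd : ∀ m n x, (N ^ m) ((N ^ n) x) = (N ^ (m + n)) x := by
    intro m n x; rw [pow_add, Module.End.mul_apply]
  obtain ⟨X₀, -, hX₀, hdis, hX₀0, hmin⟩ := hX.exists_minimal (P := ⊤) Stable.top
    ((hpow b).ker_stable (inv_ne_zero (pow_ne_zero _ hc)))
    (fun h => hb' (LinearMap.ker_eq_top.1 (top_le_iff.1 h)))
  have hinj : ∀ x ∈ X₀, (N ^ b) x = 0 → x = 0 := fun x hx h =>
    (Submodule.mem_bot K).1 (hdis ▸ ⟨hx, h⟩)
  have hZ : X.Stable (X₀.map (N ^ b)) := by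
    constructor
    · rintro ω _ ⟨x, hx, rfl⟩
      exact ⟨_, hX₀.op_mem ω x hx, pow_N_op h1 b ω x⟩
    · rintro _ ⟨x, hx, rfl⟩
      refine ⟨(c ^ b)⁻¹ • X.phi x, Submodule.smul_mem _ _ (hX₀.phi_mem x hx), (hpow b).map_phi x⟩
  obtain ⟨Z', hZ', hZZ⟩ := hX _ hZ
  obtain ⟨π, hπ, hπm, hπi, -⟩ := hZ.exists_proj hZ' hZZ
  let S : (Fin (b + 1) → X₀) →ₗ[K] X.V := LinearMap.lsum K (fun _ => X₀) K fun i =>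
    (N ^ (i : ℕ)) ∘ₗ X₀.subtype
  have hS : ∀ y, S y = ∑ i : Fin (b + 1), (N ^ (i : ℕ)) (y i : X.V) := by
    intro y; simp [S]
  let T' : Submodule K X.V := ⨅ i : ℕ, LinearMap.ker (π ∘ₗ (N ^ i))
  have hT' : ∀ x, x ∈ T' ↔ ∀ i, π ((N ^ i) x) = 0 := by
    intro x; simp [T']
  have hTs : X.Stable (LinearMap.range S) := by
    constructor
    · rintro ω _ ⟨y, rfl⟩
      refine ⟨fun i => ⟨X.op ω (y i), hX₀.op_mem ω _ (y i).2⟩, ?_⟩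
      rw [hS, hS, map_sum]
      exact Finset.sum_congr rfl fun i _ => pow_N_op h1 i ω _
    · rintro _ ⟨y, rfl⟩
      refine ⟨fun i => ⟨(c ^ (i : ℕ))⁻¹ • X.phi (y i),
        Submodule.smul_mem _ _ (hX₀.phi_mem _ (y i).2)⟩, ?_⟩
      rw [hS, hS, map_sum]
      exact Finset.sum_congr rfl fun i _ => (hpow i).map_phi _
  have hT's : X.Stable T' := by
    constructor
    · intro ω x hx
      rw [hT'] at hx ⊢
      intro i
      rw [pow_N_op h1, hπ.map_op, hx, map_zero]
    · intro x hx
      rw [hT'] at hx ⊢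
      intro i
      have := hπ.map_phi ((N ^ i) x)
      rw [one_smul] at this
      rw [pow_N_phi h2, map_smul, this, hx, map_zero, smul_zero]
  have hTN : ∀ x ∈ LinearMap.range S, N x ∈ LinearMap.range S := by
    rintro _ ⟨y, rfl⟩
    rw [hS, map_sum]
    refine Submodule.sum_mem _ fun i _ => ?_
    have h3 : N ((N ^ (i : ℕ)) (y i : X.V)) = (N ^ ((i : ℕ) + 1)) (y i : X.V) := by
      rw [pow_succ', Module.End.mul_apply]
    rw [h3]
    by_cases hi : (i : ℕ) + 1 < b + 1
    · refine ⟨Pi.single ⟨(i : ℕ) + 1, hi⟩ (y i), ?_⟩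
      rw [hS, Finset.sum_eq_single ⟨(i : ℕ) + 1, hi⟩]
      · simp
      · intro j _ hj; simp [Pi.single_eq_of_ne hj]
      · simp
    · rw [hpow0 _ (by omega)]
      exact zero_mem _
  have hT'N : ∀ x ∈ T', N x ∈ T' := by
    intro x hx
    rw [hT'] at hx ⊢
    intro i
    exact (congrArg π (by rw [pow_succ]; rfl)).trans (hx (i + 1))
  have hdisj : Disjoint (LinearMap.range S) T' := by
    rw [Submodule.disjoint_def]
    rintro _ ⟨y, rfl⟩ hy
    rw [hT'] at hy
    have hy0 : ∀ n, ∀ i : Fin (b + 1), (i : ℕ) < n → y i = 0 := by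
      intro n
      induction n with
      | zero => intro i hi; omega
      | succ n ih =>
        intro i hi
        have h3 := hy (b - i)
        rw [hS, map_sum, Finset.sum_eq_single i] at h3
        · rw [hadd, Nat.sub_add_cancel (Nat.lt_succ_iff.1 i.2), hπi _ ⟨_, (y i).2, rfl⟩] at h3
          exact Subtype.ext (hinj _ (y i).2 h3)
        · intro j _ hj
          rcases lt_or_gt_of_ne (Fin.val_ne_of_ne hj) with hlt | hlt
          · rw [ih j (by omega)]; simp
          · rw [hadd, hpow0 _ (by have := i.2; omega)]
        · simp
    have : y = 0 := funext fun i => hy0 (b + 1) i i.2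
    rw [this, map_zero]
  have hcod : ∀ n x, (∀ i, n ≤ i → π ((N ^ i) x) = 0) → x ∈ LinearMap.range S ⊔ T' := by
    intro n
    induction n with
    | zero =>
      intro x hx
      exact Submodule.mem_sup_right ((hT' x).2 fun i => hx i (Nat.zero_le i))
    | succ n ih =>
      intro x hx
      by_cases hn : b < n
      · refine ih x fun i hi => ?_
        rw [hpow0 i (by omega), map_zero]
      obtain ⟨z, hz, hzx⟩ := hπm ((N ^ n) x)
      have ht : (N ^ (b - n)) z ∈ LinearMap.range S := by
        refine ⟨Pi.single ⟨b - n, by omega⟩ ⟨z, hz⟩, ?_⟩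
        rw [hS, Finset.sum_eq_single ⟨b - n, by omega⟩]
        · simp
        · intro j _ hj; simp [Pi.single_eq_of_ne hj]
        · simp
      have h3 := ih (x - (N ^ (b - n)) z) (by
        intro i hi
        rw [map_sub, hadd, map_sub]
        rcases hi.eq_or_lt with rfl | hlt
        · rw [Nat.add_sub_cancel' (by omega), ← hzx, hπi _ ⟨z, hz, rfl⟩, sub_self]
        · rw [hx i hlt, hpow0 _ (by omega), map_zero, sub_zero])
      have := Submodule.add_mem _ h3 (Submodule.mem_sup_left ht)
      simpa using this
  have hcompl : IsCompl (LinearMap.range S) T' := by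
    refine ⟨hdisj, codisjoint_iff.2 (top_le_iff.1 fun x _ => hcod (b + 1) x fun i hi => ?_)⟩
    rw [hpow0 i (by omega), map_zero]
  have hT'0 : T' = ⊥ := by
    refine (hind _ _ hTs hT's hTN hT'N hcompl).resolve_left fun h => hX₀0 ?_
    rw [LinearMap.range_eq_bot] at h
    rw [eq_bot_iff]
    intro x hx
    have h3 : S (Pi.single 0 ⟨x, hx⟩) = x := by
      rw [hS, Finset.sum_eq_single 0]
      · simp
      · intro j _ hj; simp [Pi.single_eq_of_ne hj]
      · simp
    rw [h] at h3
    exact (Submodule.mem_bot K).2 h3.symm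
  have hker : LinearMap.ker N = X₀.map (N ^ b) := by
    apply le_antisymm
    · intro x hx
      rw [LinearMap.mem_ker] at hx
      have hz : N (π x) = 0 := by
        obtain ⟨z, hz, h⟩ := hπm x
        rw [← h, ← Module.End.mul_apply, ← pow_succ', hpow0 _ (by omega)]
      have h4 : x - π x ∈ T' := by
        rw [hT']
        intro i
        cases i with
        | zero =>
          rw [pow_zero, Module.End.one_apply, map_sub, hπi _ (hπm x), sub_self]
        | succ i =>
          rw [pow_succ, Module.End.mul_apply, map_sub, hx, hz, sub_zero, map_zero, map_zero]
      rw [hT'0, Submodule.mem_bot, sub_eq_zero] at h4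
      rw [h4]
      exact hπm x
    · rintro _ ⟨x, hx, rfl⟩
      rw [LinearMap.mem_ker, ← Module.End.mul_apply, ← pow_succ', hpow0 _ (by omega)]
  refine ⟨π, h1, h2, hπ, fun x => ?_, fun x hx => ?_, fun F hF hFs => ?_, ?_, Nat.succ_pos b, hb,
    fun x hx => ?_, fun y hy => ?_⟩
  · rw [← LinearMap.mem_ker, hker]
    exact hπm x
  · refine hπi x ?_
    rwa [← hker]
  · rw [hker] at hF ⊢
    have h3 : X.Stable (F.comap (N ^ b) ⊓ X₀) := by
      refine Stable.inf ⟨fun ω x hx => ?_, fun x hx => ?_⟩ hX₀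
      · rw [Submodule.mem_comap, pow_N_op h1]
        exact hFs.op_mem ω _ hx
      · rw [Submodule.mem_comap, pow_N_phi h2]
        exact Submodule.smul_mem _ _ (hFs.phi_mem _ hx)
    have h4 : F = (F.comap (N ^ b) ⊓ X₀).map (N ^ b) := by
      apply le_antisymm
      · intro y hy
        obtain ⟨x, hx, rfl⟩ := hF hy
        exact ⟨x, ⟨hy, hx⟩, rfl⟩
      · rintro _ ⟨x, hx, rfl⟩
        exact hx.1
    rcases hmin _ inf_le_right h3 with h5 | h5
    · left
      rw [h4, h5, Submodule.map_bot]
    · right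
      rw [h4, h5]
  · rw [hker]
    intro h
    obtain ⟨x, hx, hx0⟩ := Submodule.exists_mem_ne_zero_of_ne_bot hX₀0
    refine hx0 (hinj x hx ((Submodule.mem_bot K).1 ?_))
    rw [← h]
    exact ⟨x, hx, rfl⟩
  · have : x ∈ T' := by
      rw [hT']
      intro i
      by_cases hi : i < b + 1
      · exact hx i hi
      · rw [hpow0 i (by omega), map_zero]
    rwa [hT'0, Submodule.mem_bot] at this
  · have h3 : ∀ n ≤ b + 1, ∃ x, ∀ i < b + 1, b + 1 - n ≤ i → π ((N ^ i) x) = y i := by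
      intro n
      induction n with
      | zero => exact fun _ => ⟨0, fun i hi hi' => by omega⟩
      | succ n ih =>
        intro hn
        obtain ⟨x, hx⟩ := ih (by omega)
        have h4 : y (b - n) - π ((N ^ (b - n)) x) ∈ LinearMap.ker N := by
          rw [LinearMap.mem_ker, map_sub, hy, zero_sub, neg_eq_zero, ← LinearMap.mem_ker, hker]
          exact hπm _
        rw [hker] at h4
        obtain ⟨z, hz, hz'⟩ := h4
        refine ⟨x + (N ^ n) z, fun i hi hi' => ?_⟩
        rw [map_add, hadd, map_add]
        by_cases hin : i = b - n
        · subst hin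
          rw [Nat.sub_add_cancel (by omega), hz', map_sub, hπi _ (hπm _),
            hπi (y (b - n)) (hker ▸ hy _)]
          abel
        · rw [hx i hi (by omega), hpow0 (i + n) (by omega), map_zero, add_zero]
    obtain ⟨x, hx⟩ := h3 (b + 1) le_rfl
    exact ⟨x, fun i hi => hx i hi (by omega)⟩

end

end PG
end PhiN

namespace PhiN
namespace PG

variable {K : Type*} [Field K] {Ω : Type*} {X Y Z : PG.{v} K Ω} {c c' : K}

theorem pow_pow_apply (N : X.V →ₗ[K] X.V) (i j : ℕ) (x : X.V) :
    (N ^ i) ((N ^ j) x) = (N ^ (i + j)) x := by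
  rw [pow_add, Module.End.mul_apply]

theorem pow_apply_apply (N : X.V →ₗ[K] X.V) (i : ℕ) (x : X.V) :
    (N ^ i) (N x) = (N ^ (i + 1)) x := by
  rw [pow_succ, Module.End.mul_apply]

namespace IsString

variable {N θ : X.V →ₗ[K] X.V} {b : ℕ} (h : IsString c X N θ b)
include h

theorem ker_stable : X.Stable (LinearMap.ker N) := by
  constructor
  · intro ω x hx
    rw [LinearMap.mem_ker] at hx ⊢
    rw [h.N_op, hx, map_zero]
  · intro x hx
    rw [LinearMap.mem_ker] at hx ⊢
    rw [h.N_phi, hx, map_zero, smul_zero]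

end IsString

/-- The simple object `ker N` of a string. -/
abbrev IsString.kerPG {N θ : X.V →ₗ[K] X.V} {b : ℕ} (h : IsString c X N θ b) : PG.{v} K Ω :=
  X.sub (LinearMap.ker N) h.ker_stable

namespace IsString

variable {N θ : X.V →ₗ[K] X.V} {b : ℕ} (h : IsString c X N θ b)

theorem kerPG_simple : h.kerPG.Simple := sub_simple h.ker_stable h.ker_ne h.simple

include h in
theorem θ_phi (x : X.V) : θ (X.phi x) = X.phi (θ x) := by
  simpa using h.hom.map_phi x

include h in
theorem pow_zero_of_le {n : ℕ} (hn : b ≤ n) (x : X.V) : (N ^ n) x = 0 := by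
  obtain ⟨m, rfl⟩ := Nat.exists_eq_add_of_le' hn
  rw [pow_add, h.pow_eq]; simp

/-- The coordinates `x ↦ θ (N ^ i x)` of a string. -/
def coord : X.V ≃ₗ[K] (Fin b → LinearMap.ker N) :=
  LinearEquiv.ofBijective
    (LinearMap.pi fun i : Fin b => (θ ∘ₗ (N ^ (i : ℕ))).codRestrict (LinearMap.ker N) fun x => h.N_θ _)
    ⟨(injective_iff_map_eq_zero _).2 fun x hx => h.inj x fun i hi =>
      congrArg Subtype.val (congrFun hx ⟨i, hi⟩), fun y => by
      obtain ⟨x, hx⟩ := h.surj (fun i => if hi : i < b then y ⟨i, hi⟩ else 0) (by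
        intro i
        split_ifs
        · exact (y _).2
        · exact map_zero N)
      refine ⟨x, funext fun i => Subtype.ext ?_⟩
      have := hx i i.2
      rw [dif_pos i.2] at this
      exact this⟩

theorem coord_apply (x : X.V) (i : Fin b) : (h.coord x i : X.V) = θ ((N ^ (i : ℕ)) x) := rfl

/-- The inclusion of the `i`-th coordinate `X₀(i)` of a string. -/
def sec (i : ℕ) : LinearMap.ker N →ₗ[K] X.V :=
  if hi : i < b then h.coord.symm.toLinearMap ∘ₗ LinearMap.single K (fun _ : Fin b => LinearMap.ker N) ⟨i, hi⟩ else 0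

theorem θ_sec (i j : ℕ) (hi : i < b) (y : LinearMap.ker N) :
    θ ((N ^ j) (h.sec i y)) = if i = j then (y : X.V) else 0 := by
  by_cases hj : j < b
  · rw [sec, dif_pos hi]
    have := h.coord_apply (h.coord.symm (Pi.single ⟨i, hi⟩ y)) ⟨j, hj⟩
    rw [LinearEquiv.apply_symm_apply] at this
    refine this.symm.trans ?_
    split_ifs with hij
    · subst hij; simp
    · rw [Pi.single_eq_of_ne (by simpa [eq_comm] using hij)]; rfl
  · rw [h.pow_zero_of_le (by omega), map_zero, if_neg (by omega)]

include h in
theorem ext_θ {x y : X.V} (hxy : ∀ i < b, θ ((N ^ i) x) = θ ((N ^ i) y)) : x = y := by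
  rw [← sub_eq_zero]
  refine h.inj _ fun i hi => ?_
  rw [map_sub, map_sub, hxy i hi, sub_self]

theorem N_sec_zero (y : LinearMap.ker N) : N (h.sec 0 y) = 0 := by
  refine h.ext_θ fun i _ => ?_
  rw [pow_apply_apply, h.θ_sec 0 _ h.pos, if_neg (by omega)]
  simp

theorem N_sec_succ {i : ℕ} (hi : i + 1 < b) (y : LinearMap.ker N) :
    N (h.sec (i + 1) y) = h.sec i y := by
  refine h.ext_θ fun j _ => ?_
  rw [pow_apply_apply, h.θ_sec _ _ hi, h.θ_sec _ _ (by omega)]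
  simp

theorem sec_zero (y : LinearMap.ker N) : h.sec 0 y = y := by
  have h1 := h.θ_sec 0 0 h.pos y
  rw [pow_zero, Module.End.one_apply, if_pos rfl, h.θ_eq _ (h.N_sec_zero y)] at h1
  exact h1

theorem isHom_sec (i : ℕ) : IsHom (c ^ i) h.kerPG X (h.sec i) := by
  by_cases hi : i < b
  · constructor
    · intro ω y
      refine h.ext_θ fun j _ => ?_
      rw [pow_N_op h.N_op, h.hom.map_op, h.θ_sec i j hi, h.θ_sec i j hi]
      split_ifs
      · rfl
      · rw [map_zero]
    · intro y
      refine h.ext_θ fun j _ => ?_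
      rw [pow_N_phi h.N_phi]
      simp only [map_smul]
      rw [h.θ_phi, h.θ_sec i j hi, h.θ_sec i j hi]
      split_ifs with hij
      · subst hij; rfl
      · simp
  · have : h.sec i = 0 := dif_neg hi
    rw [this]
    exact ⟨fun ω x => by simp, fun x => by simp⟩

theorem sum_sec (x : X.V) : x = ∑ i : Fin b, h.sec i (h.coord x i) := by
  refine h.ext_θ fun j hj => ?_
  rw [map_sum, map_sum, Finset.sum_eq_single (⟨j, hj⟩ : Fin b)]
  · rw [h.θ_sec j j hj, if_pos rfl, h.coord_apply]
  · intro i _ hi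
    rw [h.θ_sec i j i.2, if_neg fun hij => hi (Fin.ext hij)]
  · simp

/-- The projection on the `i`-th coordinate. -/
def proj (i : ℕ) : X.V →ₗ[K] LinearMap.ker N :=
  (θ ∘ₗ (N ^ i)).codRestrict (LinearMap.ker N) fun _ => h.N_θ _

theorem proj_coe (i : ℕ) (x : X.V) : (h.proj i x : X.V) = θ ((N ^ i) x) := rfl

theorem isHom_proj (hc : c ≠ 0) (i : ℕ) : IsHom (c ^ i)⁻¹ X h.kerPG (h.proj i) := by
  constructor
  · intro ω x
    apply Subtype.ext
    rw [proj_coe, pow_N_op h.N_op, h.hom.map_op]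
    rfl
  · intro x
    apply Subtype.ext
    rw [proj_coe, map_smul, map_smul, pow_N_phi h.N_phi, map_smul, smul_smul,
      inv_mul_cancel₀ (pow_ne_zero _ hc), one_smul, h.θ_phi]
    rfl

include h in
theorem mem_ker_pow {m : ℕ} {x : X.V} :
    (N ^ m) x = 0 ↔ ∀ i, m ≤ i → i < b → θ ((N ^ i) x) = 0 := by
  constructor
  · intro hx i hi _
    obtain ⟨j, rfl⟩ := Nat.exists_eq_add_of_le' hi
    rw [pow_add, Module.End.mul_apply, hx, map_zero, map_zero]
  · intro hx
    refine h.inj _ fun i _ => ?_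
    rw [pow_pow_apply]
    by_cases hb : i + m < b
    · exact hx _ (by omega) hb
    · rw [h.pow_zero_of_le (by omega), map_zero]

include h in
theorem exists_pow_eq {m j : ℕ} {x : X.V} (hx : (N ^ m) x = 0) (hmj : m + j ≤ b) :
    ∃ y, (N ^ j) y = x ∧ (N ^ (m + j)) y = 0 := by
  obtain ⟨y, hy⟩ := h.surj (fun i => if j ≤ i then θ ((N ^ (i - j)) x) else 0) (by
    intro i
    split_ifs
    · exact h.N_θ _
    · exact map_zero N)
  have hyx : (N ^ j) y = x := by
    refine h.ext_θ fun i _ => ?_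
    rw [pow_pow_apply]
    by_cases hi : i + j < b
    · rw [hy _ hi, if_pos (by omega), Nat.add_sub_cancel]
    · rw [h.pow_zero_of_le (by omega), map_zero]
      obtain ⟨t, rfl⟩ := Nat.exists_eq_add_of_le' (show m ≤ i by omega)
      rw [pow_add, Module.End.mul_apply, hx, map_zero, map_zero]
  refine ⟨y, hyx, ?_⟩
  rw [pow_add, Module.End.mul_apply, hyx, hx]

end IsString

theorem Tw.zpow_unique {c : K} (hc : ∀ n : ℤ, c ^ n = 1 → n = 0) (hc0 : c ≠ 0) (hX : X.Simple)
    (hY : Y.Simple) {m n : ℤ} (h1 : Tw (c ^ m) X Y) (h2 : Tw (c ^ n) X Y) : m = n := by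
  have h3 := (h1.trans (h2.symm (zpow_ne_zero n hc0) hX hY) (zpow_ne_zero m hc0) hX hY)
  have h4 := h3.pow_finrank_eq_one (mul_ne_zero (zpow_ne_zero _ hc0)
    (inv_ne_zero (zpow_ne_zero _ hc0))) hX
  rw [← div_eq_mul_inv, ← zpow_sub₀ hc0, ← zpow_natCast, ← zpow_mul] at h4
  have := hX.nontrivial
  rcases mul_eq_zero.1 (hc _ h4) with h5 | h5
  · omega
  · exact absurd (Nat.cast_eq_zero.1 h5) Module.finrank_pos.ne'

/-- A nonzero morphism of strings is a shift. -/
theorem IsString.hom_eq_shift {N θ : X.V →ₗ[K] X.V} {b : ℕ} (h : IsString c X N θ b)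
    {N' θ' : Y.V →ₗ[K] Y.V} {b' : ℕ} (h' : IsString c Y N' θ' b')
    (hc : ∀ n : ℤ, c ^ n = 1 → n = 0) (hc0 : c ≠ 0) {α : X.V →ₗ[K] Y.V} (hα : IsHom 1 X Y α)
    (hαN : ∀ x, α (N x) = N' (α x)) (h0 : α ≠ 0) {l : ℤ} (hl : Tw (c ^ l) h.kerPG h'.kerPG) :
    ∃ n : ℕ, l = n ∧ b ≤ n + b' ∧ ∃ f : h.kerPG.V →ₗ[K] h'.kerPG.V,
      IsHom (c ^ n) h.kerPG h'.kerPG f ∧ f ≠ 0 ∧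
      ∀ i x, h'.proj i (α x) = f (h.proj (i + n) x) := by
  let g : ℕ → ℕ → (LinearMap.ker N →ₗ[K] LinearMap.ker N') := fun i j =>
    h'.proj j ∘ₗ α ∘ₗ h.sec i
  have hg : ∀ i j : ℕ, IsHom (c ^ ((i : ℤ) - j)) h.kerPG h'.kerPG (g i j) := by
    intro i j
    have := ((h.isHom_sec i).comp hα).comp (h'.isHom_proj hc0 j)
    rw [mul_one, ← div_eq_mul_inv, ← zpow_natCast, ← zpow_natCast, ← zpow_sub₀ hc0] at this
    exact this
  have hg0 : ∀ i j, g i j ≠ 0 → (i : ℤ) - j = l := fun i j hij =>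
    Tw.zpow_unique hc hc0 h.kerPG_simple h'.kerPG_simple ⟨_, hg i j, hij⟩ hl
  have hpow : ∀ j x, α ((N ^ j) x) = (N' ^ j) (α x) := by
    intro j
    induction j with
    | zero => intro x; rfl
    | succ j ih =>
      intro x
      rw [pow_succ, pow_succ, Module.End.mul_apply, Module.End.mul_apply, ih, hαN]
  have hproj : ∀ j y, h'.proj (j + 1) y = h'.proj j (N' y) := by
    intro j y
    apply Subtype.ext
    rw [proj_coe, proj_coe, pow_succ, Module.End.mul_apply]
  have hgs : ∀ i j, i + 1 < b → g (i + 1) (j + 1) = g i j := by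
    intro i j hi
    refine LinearMap.ext fun y => ?_
    change h'.proj (j + 1) (α (h.sec (i + 1) y)) = h'.proj j (α (h.sec i y))
    rw [hproj, ← hαN, h.N_sec_succ hi]
  have hgz : ∀ j, g 0 (j + 1) = 0 := by
    intro j
    refine LinearMap.ext fun y => ?_
    change h'.proj (j + 1) (α (h.sec 0 y)) = 0
    rw [hproj, ← hαN, h.N_sec_zero, map_zero, map_zero]
  have hgb : ∀ i j, b' ≤ j → g i j = 0 := by
    intro i j hj
    refine LinearMap.ext fun y => Subtype.ext ?_
    change θ' ((N' ^ j) (α (h.sec i y))) = 0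
    rw [h'.pow_zero_of_le hj, map_zero]
  have hgb' : ∀ i j, b ≤ i → g i j = 0 := by
    intro i j hj
    refine LinearMap.ext fun y => ?_
    have : h.sec i = 0 := dif_neg (by omega)
    change h'.proj j (α (h.sec i y)) = 0
    rw [this, LinearMap.zero_apply, map_zero, map_zero]
  have hsum : ∀ j x, h'.proj j (α x) = ∑ i : Fin b, g i j (h.proj i x) := by
    intro j x
    conv_lhs => rw [h.sum_sec x, map_sum, map_sum]
    rfl
  obtain ⟨i₀, j₀, hij⟩ : ∃ i j, g i j ≠ 0 := by
    by_contra! hall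
    refine h0 (LinearMap.ext fun x => h'.ext_θ fun j _ => ?_)
    have := congrArg Subtype.val (hsum j x)
    simp only [hall] at this
    simpa [proj_coe] using this
  have hdesc : ∀ t i j, g (i + t) (j + t) ≠ 0 → g (i + t) (j + t) = g i j := by
    intro t
    induction t with
    | zero => intro i j _; rfl
    | succ t ih =>
      intro i j hne
      have hlt : i + t + 1 < b := by
        by_contra hle
        exact hne (hgb' _ _ (by omega))
      have h1 := hgs (i + t) (j + t) hlt
      rw [← add_assoc, ← add_assoc] at hne ⊢
      rw [h1]
      exact ih i j (h1 ▸ hne)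
  have hle : j₀ ≤ i₀ := by
    by_contra hlt
    obtain ⟨t, rfl⟩ := Nat.exists_eq_add_of_lt (not_le.1 hlt)
    have h1 := hdesc i₀ 0 (t + 1)
    have e : t + 1 + i₀ = i₀ + t + 1 := by omega
    rw [zero_add, e, hgz] at h1
    exact hij (h1 hij)
  obtain ⟨n, rfl⟩ := Nat.exists_eq_add_of_le' hle
  have hn0 : g n 0 ≠ 0 := by
    have h1 := hdesc j₀ n 0 (by simpa using hij)
    rw [← h1]; simpa using hij
  have hln : l = n := by
    have := hg0 _ _ hn0
    simpa using this.symm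
  have hasc : ∀ t, n + t < b → g (n + t) t = g n 0 := by
    intro t
    induction t with
    | zero => intro _; rfl
    | succ t ih =>
      intro ht
      rw [← ih (by omega)]
      exact hgs (n + t) t ht
  have hnb : n < b := by
    by_contra hle
    exact hn0 (hgb' _ _ (by omega))
  refine ⟨n, hln, ?_, g n 0, ?_, hn0, fun j x => ?_⟩
  · by_contra hlt
    have h1 := hasc (b - 1 - n) (by omega)
    have h2 : b' ≤ b - 1 - n := by omega
    rw [hgb _ _ h2] at h1
    exact hn0 h1.symm
  · have := hg n 0
    simpa using this
  · rw [hsum]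
    by_cases hj : j + n < b
    · rw [Finset.sum_eq_single (⟨j + n, hj⟩ : Fin b)]
      · have := hasc j (by omega)
        rw [add_comm n j] at this
        exact LinearMap.congr_fun this _
      · intro i _ hi
        have : g i j = 0 := by
          by_contra hne
          have h1 := hg0 _ _ hne
          rw [hln] at h1
          exact hi (Fin.ext (show (i : ℕ) = j + n by omega))
        rw [this, LinearMap.zero_apply]
      · simp
    · have hz : h.proj (j + n) x = 0 := by
        apply Subtype.ext
        rw [proj_coe, h.pow_zero_of_le (by omega), map_zero]
        rfl
      rw [hz, map_zero]
      refine Finset.sum_eq_zero fun i _ => ?_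
      have : g i j = 0 := by
        by_contra hne
        have h1 := hg0 _ _ hne
        rw [hln] at h1
        have := i.2
        omega
      rw [this, LinearMap.zero_apply]

end PG
end PhiN

namespace PhiN
namespace PG

variable {K : Type*} [Field K] {Ω : Type*}

/-- No automorphism satisfies `t φ = φ (t + ν)` relative to an isomorphism `ν`. -/
theorem IsHom.not_coboundary [CharZero K] {X Y : PG.{v} K Ω} {ν : X.V →ₗ[K] Y.V}
    (hν : IsHom 1 X Y ν) (hX : X.Simple) (hY : Y.Simple) (h0 : ν ≠ 0) {t : X.V →ₗ[K] Y.V}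
    (ht : ∀ x, t (X.phi x) = Y.phi (t x + ν x)) : False := by
  let e := LinearEquiv.ofBijective ν (hν.bijective one_ne_zero hX hY h0)
  have he : ∀ x, e x = ν x := fun x => rfl
  let u : X.V →ₗ[K] X.V := e.symm.toLinearMap ∘ₗ t
  have hu : ∀ x, u (X.phi x) = X.phi (u x + x) := by
    intro x
    apply e.injective
    have h1 : e (X.phi (u x + x)) = Y.phi (e (u x + x)) := by
      rw [he, he, ← hν.map_phi, one_smul]
    rw [h1, map_add]
    simp only [u, LinearMap.comp_apply, LinearEquiv.coe_coe, LinearEquiv.apply_symm_apply]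
    rw [ht, he]
  have h2 : X.phi.symm.toLinearMap ∘ₗ u ∘ₗ X.phi.toLinearMap = u + LinearMap.id := by
    refine LinearMap.ext fun x => ?_
    simp [hu]
  have h3 := congrArg (LinearMap.trace K X.V) h2
  rw [map_add, LinearMap.trace_id] at h3
  have h4 : LinearMap.trace K X.V (X.phi.symm.toLinearMap ∘ₗ u ∘ₗ X.phi.toLinearMap) =
      LinearMap.trace K X.V u := LinearMap.trace_conj' u X.phi.symm
  rw [h4] at h3
  have := hX.nontrivial
  have h5 : (Module.finrank K X.V : K) ≠ 0 := Nat.cast_ne_zero.2 Module.finrank_pos.ne'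
  exact h5 (by simpa using h3)

section

variable {s : ℕ} {Y : Fin s → PG.{v} K Ω} {ν : ∀ k k', (Y k).V →ₗ[K] (Y k').V}

/-- A subspace of `⊕ Y k`, with the `Y k` simple, which is stable under the operators and the
Frobenius modified along all the minimal isomorphisms, is a sum of some of the `Y k`. -/
theorem exists_coordinate [CharZero K] (hY : ∀ k, (Y k).Simple)
    (hν : ∀ k k', IsHom 1 (Y k) (Y k') (ν k k')) (hlt : ∀ k k', ν k k' ≠ 0 → k < k')
    (hne : ∀ k k', k < k' → Tw 1 (Y k) (Y k') →
      (∀ k'', k < k'' → k'' < k' → ¬ Tw 1 (Y k) (Y k'')) → ν k k' ≠ 0)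
    (E : Submodule K (∀ k, (Y k).V))
    (hop : ∀ ω, ∀ x ∈ E, (fun k => (Y k).op ω (x k)) ∈ E)
    (hphi : ∀ x ∈ E, (fun k => (Y k).phi (x k + ∑ k₁, ν k₁ k (x k₁))) ∈ E) :
    ∃ A : Set (Fin s), ∀ x, x ∈ E ↔ ∀ k, k ∉ A → x k = 0 := by
  classical
  have hν0 : ∀ k k', ¬ k < k' → ν k k' = 0 := fun k k' h => by
    by_contra h0; exact h (hlt k k' h0)
  have main : ∀ m n : ℕ, n + m = s → ∃ A : Set (Fin s), (∀ k ∈ A, n ≤ (k : ℕ)) ∧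
      ∀ x, (x ∈ E ∧ ∀ k : Fin s, (k : ℕ) < n → x k = 0) ↔ ∀ k, k ∉ A → x k = 0 := by
    intro m
    induction m with
    | zero =>
      intro n hn
      refine ⟨∅, by simp, fun x => ⟨fun h k _ => h.2 k (by omega), fun h => ?_⟩⟩
      have : x = 0 := funext fun k => h k (by simp)
      rw [this]
      exact ⟨zero_mem _, fun _ _ => rfl⟩
    | succ m ih =>
      intro n hn
      obtain ⟨A', hA'n, hA'⟩ := ih (n + 1) (by omega)
      let a : Fin s := ⟨n, by omega⟩
      -- closure of `A'`
      have hclos : ∀ k ∈ A', ∀ k', k' ∉ A' → ν k k' = 0 := by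
        intro k hk k' hk'
        refine LinearMap.ext fun y => ?_
        have h1 : ∀ j, j ∉ A' → (Pi.single k y : ∀ k, (Y k).V) j = 0 := fun j hj => by
          have hjk : j ≠ k := fun h => hj (by rwa [h])
          rw [Pi.single_eq_of_ne hjk]
        have h2 := hphi _ ((hA' _).2 h1).1
        have h3 := ((hA' _).1 ⟨h2, fun j hj => by
          rw [h1 j fun h => absurd (hA'n j h) (by omega), zero_add]
          rw [Finset.sum_eq_zero, map_zero]
          intro i _
          by_cases hi : i = k
          · subst hi
            rw [hν0 i j fun h => absurd (hA'n i hk) (by have : (i : ℕ) < j := h; omega)]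
            rfl
          · rw [Pi.single_eq_of_ne hi, map_zero]⟩) k' hk'
        rw [h1 k' hk', zero_add, Finset.sum_eq_single k] at h3
        · rw [Pi.single_eq_same] at h3
          exact (Y k').phi.injective (by rw [h3]; simp)
        · intro i _ hi
          rw [Pi.single_eq_of_ne hi, map_zero]
        · simp
      have hup : ∀ t : ℕ, ∀ k k' : Fin s, (k' : ℕ) = k + t → k ∈ A' → Tw 1 (Y k) (Y k') →
          k' ∈ A' := by
        intro t
        induction t using Nat.strong_induction_on with
        | _ t iht =>
          intro k k' hkk hk hT
          by_cases ht : t = 0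
          · have : k' = k := Fin.ext (by omega)
            rwa [this]
          have hex : ∃ j : ℕ, ∃ i : Fin s, (i : ℕ) = j ∧ k < i ∧ Tw 1 (Y k) (Y i) :=
            ⟨_, k', rfl, show (k : ℕ) < k' by omega, hT⟩
          obtain ⟨i, hij, hki, hTi⟩ := Nat.find_spec hex
          have hi : ν k i ≠ 0 := hne k i hki hTi fun k'' h1 h2 h3 =>
            Nat.find_min hex (show (k'' : ℕ) < _ by rw [← hij]; exact h2) ⟨k'', rfl, h1, h3⟩
          have hiA : i ∈ A' := by
            by_contra h
            exact hi (hclos k hk i h)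
          have hik : (i : ℕ) ≤ k' := by
            rw [hij]
            exact Nat.find_min' hex ⟨k', rfl, show (k : ℕ) < k' by omega, hT⟩
          have hki' : (k : ℕ) < i := hki
          refine iht (k' - i) (by omega) i k' (by omega) hiA ?_
          have h4 := (hTi.symm one_ne_zero (hY k) (hY i)).trans hT (inv_ne_zero one_ne_zero)
            (hY i) (hY k)
          simpa using h4
      let En : Submodule K (∀ k, (Y k).V) :=
        E ⊓ ⨅ k : {k : Fin s // (k : ℕ) < n}, LinearMap.ker (LinearMap.proj k.1)
      have hEn : ∀ x, x ∈ En ↔ x ∈ E ∧ ∀ k : Fin s, (k : ℕ) < n → x k = 0 := by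
        intro x; simp [En]
      have hphin : ∀ x ∈ En, (fun k => (Y k).phi (x k + ∑ k₁, ν k₁ k (x k₁))) ∈ En := by
        intro x hx
        rw [hEn] at hx ⊢
        refine ⟨hphi x hx.1, fun k hk => ?_⟩
        rw [hx.2 k hk, zero_add, Finset.sum_eq_zero, map_zero]
        intro i _
        by_cases hi : i < k
        · rw [hx.2 i (lt_trans (show (i : ℕ) < k from hi) hk), map_zero]
        · rw [hν0 i k hi]; rfl
      have hopn : ∀ ω, ∀ x ∈ En, (fun k => (Y k).op ω (x k)) ∈ En := by
        intro ω x hx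
        rw [hEn] at hx ⊢
        exact ⟨hop ω x hx.1, fun k hk => by rw [hx.2 k hk, map_zero]⟩
      have hphia : ∀ x ∈ En, (Y a).phi (x a + ∑ k₁, ν k₁ a (x k₁)) = (Y a).phi (x a) := by
        intro x hx
        rw [hEn] at hx
        rw [Finset.sum_eq_zero, add_zero]
        intro i _
        by_cases hi : i < a
        · rw [hx.2 i hi, map_zero]
        · rw [hν0 i a hi]; rfl
      have hA'E : ∀ x ∈ En, x a = 0 → ∀ k, k ∉ A' → x k = 0 := by
        intro x hx hxa
        rw [hEn] at hx
        refine (hA' x).1 ⟨hx.1, fun k hk => ?_⟩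
        by_cases hkn : (k : ℕ) < n
        · exact hx.2 k hkn
        · have : k = a := Fin.ext (show (k : ℕ) = n by omega)
          rw [this, hxa]
      have hst : (Y a).Stable (En.map (LinearMap.proj a)) := by
        constructor
        · rintro ω _ ⟨x, hx, rfl⟩
          exact ⟨_, hopn ω x hx, rfl⟩
        · rintro _ ⟨x, hx, rfl⟩
          exact ⟨_, hphin x hx, hphia x hx⟩
      rcases (hY a).eq_bot_or _ hst with h0 | h1
      · refine ⟨A', fun k hk => (Nat.le_succ n).trans (hA'n k hk), fun x => ⟨fun hx => ?_, fun hx => ?_⟩⟩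
        · refine hA'E x ((hEn x).2 hx) ?_
          rw [← Submodule.mem_bot K, ← h0]
          exact ⟨x, (hEn x).2 hx, rfl⟩
        · have := (hA' x).2 hx
          exact ⟨this.1, fun k hk => this.2 k (by omega)⟩
      let P : En →ₗ[K] (Y a).V := LinearMap.proj a ∘ₗ En.subtype
      have hP : LinearMap.range P = ⊤ := by
        rw [LinearMap.range_comp, Submodule.range_subtype, h1]
      obtain ⟨S, hS⟩ := P.exists_rightInverse_of_surjective hP
      have hSa : ∀ y, (S y : ∀ k, (Y k).V) a = y := fun y => LinearMap.congr_fun hS y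
      let t : ∀ k, (Y a).V →ₗ[K] (Y k).V := fun k => LinearMap.proj k ∘ₗ En.subtype ∘ₗ S
      have htx : ∀ x ∈ En, ∀ k, k ∉ A' → x k = t k (x a) := by
        intro x hx k hk
        have := hA'E (x - S (x a)) (En.sub_mem hx (S (x a)).2) (by
          rw [Pi.sub_apply, hSa, sub_self]) k hk
        exact sub_eq_zero.1 this
      have hta : ∀ k : Fin s, (k : ℕ) < n → t k = 0 := by
        intro k hk
        exact LinearMap.ext fun y => ((hEn _).1 (S y).2).2 k hk
      have htop : ∀ k, k ∉ A' → ∀ ω y, t k ((Y a).op ω y) = (Y k).op ω (t k y) := by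
        intro k hk ω y
        have := htx _ (hopn ω _ (S y).2) k hk
        rw [hSa] at this
        exact this.symm
      have htphi : ∀ k, k ∉ A' → ∀ y, t k ((Y a).phi y) =
          (Y k).phi (t k y + ∑ k₁, ν k₁ k ((S y).1 k₁)) := by
        intro k hk y
        have := htx _ (hphin _ (S y).2) k hk
        rw [hphia _ (S y).2, hSa] at this
        exact this.symm
      have ht0 : ∀ j : ℕ, ∀ k : Fin s, (k : ℕ) = j → k ∉ A' → k ≠ a → t k = 0 := by
        intro j
        induction j using Nat.strong_induction_on with
        | _ j ihj =>
          intro k hkj hk hka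
          by_cases hkn : (k : ℕ) < n
          · exact hta k hkn
          have hak : a < k := lt_of_le_of_ne (show n ≤ (k : ℕ) by omega) (Ne.symm hka)
          have hsum : ∀ k', k' ∉ A' → k' ≤ k → ∀ y, ∑ k₁, ν k₁ k' ((S y).1 k₁) = ν a k' y := by
            intro k' hk' hkk y
            rw [Finset.sum_eq_single a]
            · rw [hSa]
            · intro i _ hia
              by_cases hik : i < k'
              · by_cases hiA : i ∈ A'
                · rw [hclos i hiA k' hk']; rfl
                · have h5 : t i = 0 := ihj i (by
                    rw [← hkj]; exact lt_of_lt_of_le (show (i : ℕ) < k' from hik) hkk) i rfl hiA hia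
                  have h6 : (S y : ∀ k, (Y k).V) i = t i y := rfl
                  rw [h6, h5, LinearMap.zero_apply, map_zero]
              · rw [hν0 i k' hik]; rfl
            · simp
          have hcb : ∀ k', k' ∉ A' → k' ≤ k → ν a k' = 0 := by
            intro k' hk' hkk
            by_contra hne0
            refine (hν a k').not_coboundary (hY a) (hY k') hne0 (t := t k') fun y => ?_
            rw [htphi k' hk', hsum k' hk' hkk]
          have hhom : IsHom 1 (Y a) (Y k) (t k) := by
            refine ⟨fun ω y => htop k hk ω y, fun y => ?_⟩
            rw [one_smul, htphi k hk, hsum k hk le_rfl, hcb k hk le_rfl, LinearMap.zero_apply,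
              add_zero]
          by_contra htk
          have hT : Tw 1 (Y a) (Y k) := ⟨t k, hhom, htk⟩
          have hex : ∃ j : ℕ, ∃ i : Fin s, (i : ℕ) = j ∧ a < i ∧ Tw 1 (Y a) (Y i) :=
            ⟨_, k, rfl, hak, hT⟩
          obtain ⟨i, hij, hai, hTi⟩ := Nat.find_spec hex
          have hi : ν a i ≠ 0 := hne a i hai hTi fun k'' h1 h2 h3 =>
            Nat.find_min hex (show (k'' : ℕ) < _ by rw [← hij]; exact h2) ⟨k'', rfl, h1, h3⟩
          have hik : (i : ℕ) ≤ k := by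
            rw [hij]
            exact Nat.find_min' hex ⟨k, rfl, hak, hT⟩
          by_cases hiA : i ∈ A'
          · refine hk (hup (k - i) i k (by omega) hiA ?_)
            have h4 := (hTi.symm one_ne_zero (hY a) (hY i)).trans hT (inv_ne_zero one_ne_zero)
              (hY i) (hY a)
            simpa using h4
          · exact hi (hcb i hiA hik)
      refine ⟨insert a A', ?_, fun x => ⟨fun hx k hk => ?_, fun hx => ?_⟩⟩
      · rintro k (rfl | hk)
        · exact le_rfl
        · exact (Nat.le_succ n).trans (hA'n k hk)
      · rw [Set.mem_insert_iff, not_or] at hk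
        rw [htx x ((hEn x).2 hx) k hk.2, ht0 k k rfl hk.2 hk.1]
        rfl
      · have h5 : x - S (x a) ∈ En := by
          rw [hEn]
          have := (hA' (x - S (x a))).2 fun k hk => by
            by_cases hka : k = a
            · subst hka; rw [Pi.sub_apply, hSa, sub_self]
            · have h6 : (S (x a) : ∀ k, (Y k).V) k = t k (x a) := rfl
              rw [Pi.sub_apply, h6, ht0 k k rfl hk hka, hx k (by simp [hka, hk])]
              simp
          exact ⟨this.1, fun k hk => this.2 k (by omega)⟩
        have := En.add_mem h5 (S (x a)).2
        rw [sub_add_cancel, hEn] at this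
        exact this
  obtain ⟨A, -, hA⟩ := main s 0 (zero_add s)
  exact ⟨A, fun x => by rw [← hA x]; simp⟩

end

end PG
end PhiN

namespace PhiN
namespace PG

variable {K : Type*} [Field K] {Ω : Type*} {X Y Z : PG.{v} K Ω} {c c' : K}

/-- A subspace of `X ⊕ Y` stable under the operators and `φ`. -/
structure StableProd (X Y : PG.{v} K Ω) (E : Submodule K (X.V × Y.V)) : Prop where
  op_mem : ∀ ω, ∀ p ∈ E, (X.op ω p.1, Y.op ω p.2) ∈ E
  phi_mem : ∀ p ∈ E, (X.phi p.1, Y.phi p.2) ∈ E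

/-- Every stable subspace of `X ⊕ Y` is the sum of its intersections with `X` and `Y`. -/
def Split (X Y : PG.{v} K Ω) : Prop :=
  ∀ E : Submodule K (X.V × Y.V), StableProd X Y E → ∀ p ∈ E, (p.1, (0 : Y.V)) ∈ E

theorem Split.snd_mem (h : Split X Y) {E : Submodule K (X.V × Y.V)} (hE : StableProd X Y E)
    {p : X.V × Y.V} (hp : p ∈ E) : ((0 : X.V), p.2) ∈ E := by
  have h1 := E.sub_mem hp (h E hE p hp)
  have h2 : p - (p.1, (0 : Y.V)) = (0, p.2) := Prod.ext (sub_self _) (sub_zero _)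
  rwa [h2] at h1

theorem Split.symm (h : Split X Y) : Split Y X := by
  intro E hE p hp
  let e := LinearEquiv.prodComm K X.V Y.V
  have h1 : StableProd X Y (E.comap e.toLinearMap) :=
    ⟨fun ω q hq => hE.op_mem ω _ hq, fun q hq => hE.phi_mem _ hq⟩
  have h2 := h.snd_mem h1 (p := (p.2, p.1)) hp
  exact h2

theorem Split.of_exact {X₁ X₂ : PG.{v} K Ω} {i : X₁.V →ₗ[K] X.V} {f : X.V →ₗ[K] X₂.V}
    (hi : IsHom 1 X₁ X i) (hf : IsHom 1 X X₂ f) (hex : LinearMap.ker f ≤ LinearMap.range i)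
    (h₁ : Split X₁ Y) (h₂ : Split X₂ Y) : Split X Y := by
  intro E hE p hp
  let E₂ := E.map (f.prodMap (LinearMap.id : Y.V →ₗ[K] Y.V))
  let E₁ := E.comap (i.prodMap (LinearMap.id : Y.V →ₗ[K] Y.V))
  have hE₂ : StableProd X₂ Y E₂ := by
    constructor
    · rintro ω _ ⟨q, hq, rfl⟩
      exact ⟨_, hE.op_mem ω q hq, by simp [hf.map_op]⟩
    · rintro _ ⟨q, hq, rfl⟩
      have := hf.map_phi
      simp only [one_smul] at this
      exact ⟨_, hE.phi_mem q hq, by simp [this]⟩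
  have hE₁ : StableProd X₁ Y E₁ := by
    constructor
    · intro ω q hq
      have := hE.op_mem ω _ hq
      simpa [E₁, hi.map_op] using this
    · intro q hq
      have := hE.phi_mem _ hq
      have h3 := hi.map_phi
      simp only [one_smul] at h3
      simpa [E₁, h3] using this
  obtain ⟨q, hq, hqp⟩ := h₂.snd_mem hE₂ (p := (f p.1, p.2)) ⟨p, hp, rfl⟩
  have hq1 : f q.1 = 0 := by simpa using congrArg Prod.fst hqp
  have hq2 : q.2 = p.2 := by simpa using congrArg Prod.snd hqp
  obtain ⟨x, hx⟩ := hex hq1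
  have h3 : (x, p.2) ∈ E₁ := by
    change (i x, p.2) ∈ E
    rw [hx, ← hq2]
    exact hq
  have h4 := h₁.snd_mem hE₁ h3
  have h5 : ((0 : X.V), p.2) ∈ E := by
    have : (i 0, p.2) ∈ E := h4
    rwa [map_zero] at this
  have h6 := E.sub_mem hp h5
  have h7 : p - ((0 : X.V), p.2) = (p.1, 0) := Prod.ext (sub_zero _) (sub_self _)
  rwa [h7] at h6

theorem Split.of_semisimple (hX : X.Semisimple) (hY : Y.Semisimple)
    (h : ∀ f : X.V →ₗ[K] Y.V, IsHom 1 X Y f → f = 0) : Split X Y := by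
  intro E hE p hp
  let I : Submodule K X.V := E.comap (LinearMap.inl K X.V Y.V)
  let J : Submodule K Y.V := E.comap (LinearMap.inr K X.V Y.V)
  have hI : X.Stable I := by
    constructor
    · intro ω x hx
      have := hE.op_mem ω _ hx
      simpa [I] using this
    · intro x hx
      have := hE.phi_mem _ hx
      simpa [I] using this
  have hJ : Y.Stable J := by
    constructor
    · intro ω x hx
      have := hE.op_mem ω _ hx
      simpa [J] using this
    · intro x hx
      have := hE.phi_mem _ hx
      simpa [J] using this
  obtain ⟨C, hC, hIC⟩ := hX I hI
  obtain ⟨C', hC', hJC⟩ := hY J hJ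
  let G : Submodule K (X.V × Y.V) := E ⊓ C.prod C'
  have hG1 : ∀ q ∈ G, q.1 = 0 → q.2 = 0 := by
    intro q hq h0
    have : q.2 ∈ J ⊓ C' := ⟨show (0, q.2) ∈ E by rw [← h0]; exact hq.1, hq.2.2⟩
    rwa [hJC.inf_eq_bot] at this
  let P : G →ₗ[K] X.V := LinearMap.fst K X.V Y.V ∘ₗ G.subtype
  have hP : Function.Injective P := by
    refine (injective_iff_map_eq_zero _).2 fun q hq => Subtype.ext (Prod.ext hq (hG1 q q.2 hq))
  have hPs : X.Stable (LinearMap.range P) := by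
    constructor
    · rintro ω _ ⟨q, rfl⟩
      exact ⟨⟨_, hE.op_mem ω _ q.2.1, hC.op_mem ω _ q.2.2.1, hC'.op_mem ω _ q.2.2.2⟩, rfl⟩
    · rintro _ ⟨q, rfl⟩
      exact ⟨⟨_, hE.phi_mem _ q.2.1, hC.phi_mem _ q.2.2.1, hC'.phi_mem _ q.2.2.2⟩, rfl⟩
  obtain ⟨Q, hQ, hPQ⟩ := hX _ hPs
  obtain ⟨π, hπ, hπm, hπi, -⟩ := hPs.exists_proj hQ hPQ
  let e := LinearEquiv.ofInjective P hP
  let g : X.V →ₗ[K] Y.V := LinearMap.snd K X.V Y.V ∘ₗ G.subtype ∘ₗ e.symm.toLinearMap ∘ₗ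
    π.codRestrict _ hπm
  have hg : ∀ (x : X.V) (q : G), P q = π x → g x = q.1.2 := by
    intro x q hq
    have : e.symm (π.codRestrict _ hπm x) = q := by
      apply e.injective
      rw [LinearEquiv.apply_symm_apply]
      exact Subtype.ext hq.symm
    simp [g, this]
  have hgh : IsHom 1 X Y g := by
    constructor
    · intro ω x
      obtain ⟨q, hq⟩ := hπm x
      have h1 := hg (X.op ω x)
        ⟨_, hE.op_mem ω _ q.2.1, hC.op_mem ω _ q.2.2.1, hC'.op_mem ω _ q.2.2.2⟩ (by
          rw [hπ.map_op, ← hq]; rfl)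
      rw [h1, hg x q hq]
    · intro x
      obtain ⟨q, hq⟩ := hπm x
      have h1 := hg ((1 : K) • X.phi x)
        ⟨_, hE.phi_mem _ q.2.1, hC.phi_mem _ q.2.2.1, hC'.phi_mem _ q.2.2.2⟩ (by
          rw [hπ.map_phi, ← hq]; rfl)
      rw [h1, hg x q hq]
  have hg0 := h g hgh
  have hG0 : ∀ q ∈ G, q.1 = 0 := by
    intro q hq
    have h1 := hg q.1 ⟨q, hq⟩ (hπi _ ⟨⟨q, hq⟩, rfl⟩).symm
    rw [hg0, LinearMap.zero_apply] at h1
    have : q.1 ∈ I ⊓ C := ⟨show (q.1, 0) ∈ E by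
      have h2 : (q.1, (0 : Y.V)) = q := Prod.ext rfl h1
      rw [h2]; exact hq.1, hq.2.1⟩
    rwa [hIC.inf_eq_bot] at this
  have h1 : p.1 ∈ I ⊔ C := hIC.sup_eq_top ▸ trivial
  have h2 : p.2 ∈ J ⊔ C' := hJC.sup_eq_top ▸ trivial
  obtain ⟨i, hi, a, ha, hia⟩ := Submodule.mem_sup.1 h1
  obtain ⟨j, hj, a', ha', hja⟩ := Submodule.mem_sup.1 h2
  have h3 : (a, a') ∈ G := by
    refine ⟨?_, ha, ha'⟩
    have h4 := E.sub_mem (E.sub_mem hp hi) hj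
    have h5 : p - LinearMap.inl K X.V Y.V i - LinearMap.inr K X.V Y.V j = (a, a') := by
      apply Prod.ext <;> simp [← hia, ← hja]
    rwa [h5] at h4
  have h4 : a = 0 := hG0 _ h3
  rw [h4, add_zero] at hia
  rw [← hia]
  exact hi

/-- `X` with the Frobenius multiplied by `c`. -/
abbrev twist (X : PG.{v} K Ω) {c : K} (hc : c ≠ 0) : PG.{v} K Ω where
  V := X.V
  op := X.op
  phi := X.phi.trans (LinearEquiv.smulOfNeZero K X.V c hc)

theorem twist_phi (hc : c ≠ 0) (x : X.V) : (X.twist hc).phi x = c • X.phi x := rfl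

theorem twist_stable_iff (hc : c ≠ 0) {E : Submodule K X.V} :
    (X.twist hc).Stable E ↔ X.Stable E := by
  refine ⟨fun h => ⟨h.op_mem, fun x hx => ?_⟩, fun h => ⟨h.op_mem, fun x hx => ?_⟩⟩
  · exact (Submodule.smul_mem_iff E hc).1 (h.phi_mem x hx)
  · exact E.smul_mem c (h.phi_mem x hx)

theorem Simple.twist (hX : X.Simple) (hc : c ≠ 0) : (X.twist hc).Simple :=
  ⟨hX.nontrivial, fun E hE => hX.eq_bot_or E ((twist_stable_iff hc).1 hE)⟩

theorem isHom_twist_iff {a : K} (hc : c ≠ 0) (hc' : c' ≠ 0) {f : X.V →ₗ[K] Y.V} :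
    IsHom a (X.twist hc) (Y.twist hc') f ↔ IsHom (a * c / c') X Y f := by
  refine ⟨fun h => ⟨h.map_op, fun x => ?_⟩, fun h => ⟨h.map_op, fun x => ?_⟩⟩
  · have := h.map_phi x
    rw [twist_phi, twist_phi, smul_smul] at this
    rw [div_eq_inv_mul, mul_smul, map_smul, this, smul_smul, inv_mul_cancel₀ hc', one_smul]
  · change f (a • c • X.phi x) = c' • Y.phi (f x)
    rw [← h.map_phi, smul_smul, ← map_smul f c', smul_smul, mul_div_cancel₀ _ hc']

theorem tw_twist_iff {a : K} (hc : c ≠ 0) (hc' : c' ≠ 0) :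
    Tw a (X.twist hc) (Y.twist hc') ↔ Tw (a * c / c') X Y :=
  ⟨fun ⟨f, hf, h0⟩ => ⟨f, (isHom_twist_iff hc hc').1 hf, h0⟩,
    fun ⟨f, hf, h0⟩ => ⟨f, (isHom_twist_iff hc hc').2 hf, h0⟩⟩

end PG
end PhiN

namespace PhiN
namespace PG

/-- A finite family of strings, with a morphism along each linked pair. -/
structure Fam (K : Type*) [Field K] (Ω : Type*) (c : K) (s : ℕ) where
  Z : Fin s → PG.{v} K Ω
  N : ∀ k, (Z k).V →ₗ[K] (Z k).V
  θ : ∀ k, (Z k).V →ₗ[K] (Z k).V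
  b : Fin s → ℕ
  str : ∀ k, IsString c (Z k) (N k) (θ k) (b k)
  ss : ∀ k, (Z k).Semisimple
  α : ∀ k k', (Z k).V →ₗ[K] (Z k').V
  hom : ∀ k k', IsHom 1 (Z k) (Z k') (α k k')
  comm : ∀ k k' x, α k k' (N k x) = N k' (α k k' x)
  lt : ∀ k k', α k k' ≠ 0 → k < k'
  order : ∀ k k' (l : ℤ), k ≠ k' → 0 < l → l < b k →
    Tw (c ^ l) (str k).kerPG (str k').kerPG → k < k'
  start : ∀ k k', k < k' → Tw 1 (str k).kerPG (str k').kerPG →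
    (∀ k'', k < k'' → k'' < k' → ¬ Tw 1 (str k).kerPG (str k'').kerPG) → α k k' ≠ 0
  ending : ∀ k k', k < k' → (∃ l : ℕ, Tw (c ^ l) (str k).kerPG (str k').kerPG ∧ b k = l + b k') →
    (∀ k'', k < k'' → k'' < k' →
      ¬ ∃ l : ℕ, Tw (c ^ l) (str k).kerPG (str k'').kerPG ∧ b k = l + b k'') → α k k' ≠ 0
  c_ne : c ≠ 0
  c_zpow : ∀ n : ℤ, c ^ n = 1 → n = 0

namespace Fam

variable {K : Type*} [Field K] {Ω : Type*} {c : K} {s : ℕ} (F : Fam.{v} K Ω c s)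

/-- Two strings are in the same block. -/
def rel : Fin s → Fin s → Prop :=
  Relation.EqvGen fun i j => ∃ f, IsHom 1 (F.Z i) (F.Z j) f ∧ f ≠ 0

theorem rel_of_ne (k k' : Fin s) (h : F.α k k' ≠ 0) : F.rel k k' :=
  .rel _ _ ⟨_, F.hom k k', h⟩

theorem disj (k k' : Fin s) (h : ¬ F.rel k k') (f : (F.Z k).V →ₗ[K] (F.Z k').V)
    (hf : IsHom 1 (F.Z k) (F.Z k') f) : f = 0 := by
  by_contra h0
  exact h (.rel _ _ ⟨f, hf, h0⟩)

theorem exists_overlap {i j : Fin s} {f : (F.Z i).V →ₗ[K] (F.Z j).V}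
    (hf : IsHom 1 (F.Z i) (F.Z j) f) (h0 : f ≠ 0) : ∃ a b : ℕ, a < F.b i ∧ b < F.b j ∧
      Tw (c ^ ((a : ℤ) - b)) (F.str i).kerPG (F.str j).kerPG := by
  by_contra! hall
  refine h0 (LinearMap.ext fun x => (F.str j).ext_θ fun b hb => ?_)
  have h1 : (F.str j).proj b (f x) = 0 := by
    rw [(F.str i).sum_sec x, map_sum, map_sum]
    refine Finset.sum_eq_zero fun a _ => ?_
    by_contra hne
    refine hall a b a.2 hb ⟨(F.str j).proj b ∘ₗ f ∘ₗ (F.str i).sec a, ?_, fun h2 => hne ?_⟩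
    · have := (((F.str i).isHom_sec a).comp hf).comp ((F.str j).isHom_proj F.c_ne b)
      rw [mul_one, ← div_eq_mul_inv, ← zpow_natCast, ← zpow_natCast, ← zpow_sub₀ F.c_ne] at this
      exact this
    · exact LinearMap.congr_fun h2 _
  have h2 := congrArg Subtype.val h1
  rw [IsString.proj_coe] at h2
  rw [h2]
  simp

theorem tw_trans {i j k : Fin s} {l m : ℤ} (h : Tw (c ^ l) (F.str i).kerPG (F.str j).kerPG)
    (h' : Tw (c ^ m) (F.str j).kerPG (F.str k).kerPG) :
    Tw (c ^ (l + m)) (F.str i).kerPG (F.str k).kerPG := by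
  rw [zpow_add₀ F.c_ne]
  exact h.trans h' (zpow_ne_zero _ F.c_ne) (F.str i).kerPG_simple (F.str j).kerPG_simple

theorem tw_symm {i j : Fin s} {l : ℤ} (h : Tw (c ^ l) (F.str i).kerPG (F.str j).kerPG) :
    Tw (c ^ (-l)) (F.str j).kerPG (F.str i).kerPG := by
  rw [zpow_neg]
  exact h.symm (zpow_ne_zero _ F.c_ne) (F.str i).kerPG_simple (F.str j).kerPG_simple

theorem tw_unique {i j : Fin s} {l m : ℤ} (h : Tw (c ^ l) (F.str i).kerPG (F.str j).kerPG)
    (h' : Tw (c ^ m) (F.str i).kerPG (F.str j).kerPG) : l = m :=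
  Tw.zpow_unique F.c_zpow F.c_ne (F.str i).kerPG_simple (F.str j).kerPG_simple h h'

theorem exists_tw (k k' : Fin s) (h : F.rel k k') :
    ∃ l : ℤ, Tw (c ^ l) (F.str k).kerPG (F.str k').kerPG := by
  induction h with
  | rel i j h =>
    obtain ⟨f, hf, h0⟩ := h
    obtain ⟨a, b, -, -, h⟩ := F.exists_overlap hf h0
    exact ⟨_, h⟩
  | refl i => exact ⟨0, by simpa using Tw.refl (F.str i).kerPG_simple⟩
  | symm i j _ ih =>
    obtain ⟨l, hl⟩ := ih
    exact ⟨_, F.tw_symm hl⟩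
  | trans i j k _ _ ih ih' =>
    obtain ⟨l, hl⟩ := ih
    obtain ⟨m, hm⟩ := ih'
    exact ⟨_, F.tw_trans hl hm⟩

/-- The sum of the strings. -/
abbrev V : Type v := ∀ k, (F.Z k).V

/-- The monodromy operator on the sum. -/
def NN : F.V →ₗ[K] F.V := LinearMap.pi fun k => F.N k ∘ₗ LinearMap.proj k

theorem NN_apply (x : F.V) (k : Fin s) : F.NN x k = F.N k (x k) := rfl

/-- The modified Frobenius on the sum. -/
def Phi : F.V →ₗ[K] F.V :=
  LinearMap.pi fun k => (F.Z k).phi.toLinearMap ∘ₗ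
    (LinearMap.proj k + ∑ k₁, F.α k₁ k ∘ₗ LinearMap.proj k₁)

theorem Phi_apply (x : F.V) (k : Fin s) :
    F.Phi x k = (F.Z k).phi (x k + ∑ k₁, F.α k₁ k (x k₁)) := by
  simp [Phi]

theorem α_eq_zero {k k' : Fin s} (h : ¬ k < k') : F.α k k' = 0 := by
  by_contra h0
  exact h (F.lt _ _ h0)

theorem Phi_injective : Function.Injective F.Phi := by
  refine (injective_iff_map_eq_zero _).2 fun x hx => ?_
  have h : ∀ n : ℕ, ∀ k : Fin s, (k : ℕ) = n → x k = 0 := by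
    intro n
    induction n using Nat.strong_induction_on with
    | _ n ih =>
      intro k hk
      have h1 := congrFun hx k
      rw [Phi_apply, Finset.sum_eq_zero, add_zero] at h1
      · exact (F.Z k).phi.injective (by rw [h1]; simp)
      · intro i _
        by_cases hi : i < k
        · rw [ih i (by rw [← hk]; exact hi) i rfl, map_zero]
        · rw [F.α_eq_zero hi]; rfl
  exact funext fun k => h k k rfl

/-- The sum of the strings, with the modified Frobenius. -/
abbrev T : PG.{v} K Ω where
  V := F.V
  op ω := LinearMap.pi fun k => (F.Z k).op ω ∘ₗ LinearMap.proj k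
  phi := LinearEquiv.ofBijective F.Phi
    ⟨F.Phi_injective, LinearMap.surjective_of_injective F.Phi_injective⟩

theorem T_op_apply (ω : Ω) (x : F.V) (k : Fin s) : F.T.op ω x k = (F.Z k).op ω (x k) := rfl

theorem T_phi_apply (x : F.V) (k : Fin s) :
    F.T.phi x k = (F.Z k).phi (x k + ∑ k₁, F.α k₁ k (x k₁)) := F.Phi_apply x k

theorem NN_phi (x : F.V) : F.NN (F.T.phi x) = c • F.T.phi (F.NN x) := by
  funext k
  rw [NN_apply, T_phi_apply, (F.str k).N_phi, Pi.smul_apply, T_phi_apply, map_add, map_sum]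
  simp only [F.comm, NN_apply]

theorem NN_op (ω : Ω) (x : F.V) : F.NN (F.T.op ω x) = F.T.op ω (F.NN x) := by
  funext k
  rw [NN_apply, T_op_apply, (F.str k).N_op, T_op_apply, NN_apply]

theorem NN_pow_apply (n : ℕ) (x : F.V) (k : Fin s) : (F.NN ^ n) x k = (F.N k ^ n) (x k) := by
  induction n generalizing x with
  | zero => rfl
  | succ n ih => rw [pow_succ, Module.End.mul_apply, ih, NN_apply, pow_apply_apply]

/-- The vectors supported on `P`. -/
def supp (P : Fin s → Prop) : Submodule K F.V where
  carrier := {x | ∀ k, ¬ P k → x k = 0}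
  add_mem' := fun hx hy k hk => by rw [Pi.add_apply, hx k hk, hy k hk, add_zero]
  zero_mem' := fun _ _ => rfl
  smul_mem' := fun a x hx k hk => by rw [Pi.smul_apply, hx k hk, smul_zero]

theorem supp_stable {P : Fin s → Prop} (hP : ∀ k k', F.α k k' ≠ 0 → P k → P k') :
    F.T.Stable (F.supp P) := by
  constructor
  · intro ω x hx k hk
    rw [T_op_apply, hx k hk, map_zero]
  · intro x hx k hk
    rw [T_phi_apply, hx k hk, zero_add, Finset.sum_eq_zero, map_zero]
    intro i _
    by_cases hi : P i
    · have : F.α i k = 0 := by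
        by_contra h0
        exact hk (hP i k h0 hi)
      rw [this]; rfl
    · rw [hx i hi, map_zero]

theorem split_supp {Y : PG.{v} K Ω} {P : Fin s → Prop} (hP : ∀ k k', F.α k k' ≠ 0 → P k → P k')
    (h : ∀ k, P k → Split (F.Z k) Y) :
    Split (F.T.sub (F.supp P) (F.supp_stable hP)) Y := by
  have main : ∀ m n : ℕ, n + m = s → ∀ (S : Submodule K F.V) (hS : F.T.Stable S),
      S = F.supp (fun k => P k ∧ n ≤ (k : ℕ)) → Split (F.T.sub S hS) Y := by
    intro m
    induction m with
    | zero =>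
      intro n hn S hS hSn E hE p hp
      have h1 : p.1 = 0 := by
        have h2 : (p.1 : F.V) ∈ F.supp (fun k => P k ∧ n ≤ (k : ℕ)) := hSn ▸ p.1.2
        exact Subtype.ext (funext fun k => h2 k fun h3 => by have := k.2; omega)
      rw [h1]
      exact E.zero_mem
    | succ m ih =>
      intro n hn S hS hSn
      have hst : F.T.Stable (F.supp (fun k => P k ∧ n + 1 ≤ (k : ℕ))) := by
        refine F.supp_stable fun k k' h0 hk => ⟨hP k k' h0 hk.1, ?_⟩
        have : (k : ℕ) < k' := F.lt k k' h0
        omega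
      have hsplit := ih (n + 1) (by omega) _ hst rfl
      let a : Fin s := ⟨n, by omega⟩
      have hle : F.supp (fun k => P k ∧ n + 1 ≤ (k : ℕ)) ≤ S := by
        rw [hSn]
        exact fun x hx k hk => hx k fun h1 => hk ⟨h1.1, by omega⟩
      by_cases ha : P a
      · refine Split.of_exact (X₁ := F.T.sub _ hst) (X₂ := F.Z a)
          (i := Submodule.inclusion hle) (f := LinearMap.proj a ∘ₗ S.subtype)
          ⟨fun _ _ => rfl, fun x => ?_⟩ ⟨fun _ _ => rfl, fun x => ?_⟩ ?_ hsplit (h a ha)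
        · rw [one_smul]; rfl
        · rw [one_smul]
          change F.T.phi (x : F.V) a = (F.Z a).phi ((x : F.V) a)
          rw [T_phi_apply, Finset.sum_eq_zero, add_zero]
          intro i _
          have hx : (x : F.V) ∈ F.supp (fun k => P k ∧ n ≤ (k : ℕ)) := hSn ▸ x.2
          by_cases hi : i < a
          · have hi' : (i : ℕ) < n := hi
            rw [hx i fun h1 => by omega, map_zero]
          · rw [F.α_eq_zero hi]; rfl
        · intro x hx
          have hx' : (x : F.V) ∈ F.supp (fun k => P k ∧ n ≤ (k : ℕ)) := hSn ▸ x.2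
          refine ⟨⟨x, fun k hk => ?_⟩, rfl⟩
          by_cases hka : k = a
          · rw [hka]; exact hx
          · refine hx' k fun h1 => hk ⟨h1.1, ?_⟩
            have : (k : ℕ) ≠ n := fun h2 => hka (Fin.ext h2)
            omega
      · refine ih (n + 1) (by omega) S hS (le_antisymm ?_ hle)
        rw [hSn]
        intro x hx k hk
        by_cases hka : k = a
        · exact hx k fun h1 => ha (hka ▸ h1.1)
        · refine hx k fun h1 => hk ⟨h1.1, ?_⟩
          have : (k : ℕ) ≠ n := fun h2 => hka (Fin.ext h2)
          omega
  exact main s 0 (zero_add s) _ _ (by simp)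

open Classical in
/-- Stable subspaces decompose along the blocks. -/
theorem block_mem {P : Fin s → Prop} (hP : ∀ k k', F.rel k k' → (P k ↔ P k'))
    {E : Submodule K F.V} (hE : F.T.Stable E) {x : F.V} (hx : x ∈ E) :
    (fun k => if P k then x k else 0) ∈ E := by
  have hP1 : ∀ k k', F.α k k' ≠ 0 → P k → P k' := fun k k' h0 => (hP k k' (F.rel_of_ne k k' h0)).1
  have hP2 : ∀ k k', F.α k k' ≠ 0 → ¬ P k → ¬ P k' := fun k k' h0 =>
    mt (hP k k' (F.rel_of_ne k k' h0)).2
  have h1 : Split (F.T.sub _ (F.supp_stable hP1)) (F.T.sub _ (F.supp_stable hP2)) := by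
    refine F.split_supp hP1 fun k hk => Split.symm (F.split_supp hP2 fun k' hk' => ?_)
    refine Split.of_semisimple (F.ss k') (F.ss k) fun f hf => F.disj k' k (fun hr => ?_) f hf
    exact hk' ((hP k' k hr).2 hk)
  let A := F.supp P
  let B := F.supp fun k => ¬ P k
  let S : (A × B) →ₗ[K] F.V := A.subtype.coprod B.subtype
  have h2 := h1 (E.comap S) ⟨fun ω p hp => ?_, fun p hp => ?_⟩
    (⟨fun k => if P k then x k else 0, fun k hk => if_neg hk⟩,
      ⟨fun k => if P k then 0 else x k, fun k hk => if_pos (not_not.1 hk)⟩) ?_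
  · have h3 : S (⟨fun k => if P k then x k else 0, fun k hk => if_neg hk⟩, 0) ∈ E := h2
    simpa [S] using h3
  · have := hE.op_mem ω _ hp
    rw [Submodule.mem_comap]
    simp only [S, LinearMap.coprod_apply, map_add] at this ⊢
    exact this
  · have := hE.phi_mem _ hp
    rw [Submodule.mem_comap]
    simp only [S, LinearMap.coprod_apply, map_add] at this ⊢
    exact this
  · rw [Submodule.mem_comap]
    convert hx using 1
    funext k
    simp only [S, LinearMap.coprod_apply, Submodule.subtype_apply, Pi.add_apply]
    split_ifs <;> simp

/-- Along a linked pair the morphism is a shift. -/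
theorem α_shift (k k' : Fin s) (h0 : F.α k k' ≠ 0) : ∃ n : ℕ, F.b k ≤ n + F.b k' ∧
    ∃ f : (F.str k).kerPG.V →ₗ[K] (F.str k').kerPG.V,
      IsHom (c ^ n) (F.str k).kerPG (F.str k').kerPG f ∧ f ≠ 0 ∧
      ∀ i x, (F.str k').proj i (F.α k k' x) = f ((F.str k).proj (i + n) x) := by
  obtain ⟨l, hl⟩ := F.exists_tw k k' (F.rel_of_ne k k' h0)
  obtain ⟨n, -, hb, f, hf⟩ := (F.str k).hom_eq_shift (F.str k') F.c_zpow F.c_ne (F.hom k k')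
    (F.comm k k') h0 hl
  exact ⟨n, hb, f, hf⟩

/-- The subspace `⊕ ker (N_k ^ m_k)`. -/
def shape (m : Fin s → ℕ) : Submodule K F.V where
  carrier := {x | ∀ k, (F.N k ^ m k) (x k) = 0}
  add_mem' := fun hx hy k => by rw [Pi.add_apply, map_add, hx k, hy k, add_zero]
  zero_mem' := fun k => by rw [Pi.zero_apply, map_zero]
  smul_mem' := fun a x hx k => by rw [Pi.smul_apply, map_smul, hx k, smul_zero]

theorem mem_shape {m : Fin s → ℕ} {x : F.V} : x ∈ F.shape m ↔ ∀ k, (F.N k ^ m k) (x k) = 0 :=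
  Iff.rfl

/-- Stable subspaces of the form `⊕ ker (N_k ^ m_k)`. -/
def Good (E : Submodule K F.V) : Prop :=
  F.T.Stable E ∧ ∃ m, (∀ k, m k ≤ F.b k) ∧ E = F.shape m

theorem good_ker [CharZero K] {E : Submodule K F.V} (hE : F.T.Stable E) :
    F.Good (E ⊓ LinearMap.ker F.NN) := by
  classical
  have hk : F.T.Stable (LinearMap.ker F.NN) := by
    constructor
    · intro ω x hx
      rw [LinearMap.mem_ker] at hx ⊢
      rw [NN_op, hx, map_zero]
    · intro x hx
      rw [LinearMap.mem_ker] at hx ⊢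
      rw [NN_phi, hx, map_zero, smul_zero]
  let Y : Fin s → PG.{v} K Ω := fun k => (F.str k).kerPG
  let ν : ∀ k k', (Y k).V →ₗ[K] (Y k').V := fun k k' =>
    (F.α k k').restrict fun x hx => by
      rw [LinearMap.mem_ker] at hx ⊢
      rw [← F.comm, hx, map_zero]
  have hν : ∀ k k', IsHom 1 (Y k) (Y k') (ν k k') := by
    refine fun k k' => ⟨fun ω x => Subtype.ext ((F.hom k k').map_op ω x), fun x => Subtype.ext ?_⟩
    exact (F.hom k k').map_phi x
  let J : (∀ k, (Y k).V) →ₗ[K] F.V :=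
    LinearMap.pi fun k => (LinearMap.ker (F.N k)).subtype ∘ₗ LinearMap.proj k
  obtain ⟨A, hA⟩ := exists_coordinate (Y := Y) (ν := ν) (fun k => (F.str k).kerPG_simple) hν
    (fun k k' h0 => F.lt k k' fun h1 => h0 (LinearMap.ext fun x => Subtype.ext (by
      change F.α k k' x = 0
      rw [h1]; rfl)))
    (fun k k' hlt hT hmin h0 => by
      have hne := F.start k k' hlt hT hmin
      obtain ⟨n, hb, f, hf, hf0, hff⟩ := F.α_shift k k' hne
      have hn : n = 0 := by
        have h1 : Tw (c ^ (n : ℤ)) (F.str k).kerPG (F.str k').kerPG := ⟨f, by simpa using hf, hf0⟩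
        have h2 : Tw (c ^ (0 : ℤ)) (F.str k).kerPG (F.str k').kerPG := by simpa using hT
        exact_mod_cast Tw.zpow_unique F.c_zpow F.c_ne (F.str k).kerPG_simple
          (F.str k').kerPG_simple h1 h2
      subst hn
      refine hf0 (LinearMap.ext fun y => ?_)
      have h3 := hff 0 (y : (F.Z k).V)
      have h4 : (F.str k).proj (0 + 0) (y : (F.Z k).V) = y :=
        Subtype.ext ((F.str k).θ_eq _ y.2)
      have h5 : F.α k k' (y : (F.Z k).V) = 0 := congrArg Subtype.val (LinearMap.congr_fun h0 y)
      rw [h4, h5, map_zero] at h3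
      exact h3.symm)
    ((E ⊓ LinearMap.ker F.NN).comap J)
    (fun ω x hx => (hE.inf hk).op_mem ω _ hx)
    (fun x hx => by
      have := (hE.inf hk).phi_mem _ hx
      rw [Submodule.mem_comap]
      convert this using 1
      funext k
      rw [T_phi_apply]
      change (F.Z k).phi (((x k + ∑ k₁, ν k₁ k (x k₁) : LinearMap.ker (F.N k)) : (F.Z k).V)) = _
      rw [Submodule.coe_add, Submodule.coe_sum]
      rfl)
  refine ⟨hE.inf hk, fun k => if k ∈ A then 1 else 0, fun k => ?_, ?_⟩
  · have := (F.str k).pos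
    dsimp only
    split_ifs <;> omega
  · have h1 : ∀ x : F.V, (∀ k, F.N k (x k) = 0) → (x ∈ E ⊓ LinearMap.ker F.NN ↔
        ∀ k, k ∉ A → x k = 0) := by
      intro x hx
      have h2 := hA (fun k => ⟨x k, hx k⟩)
      rw [Submodule.mem_comap] at h2
      exact h2.trans (forall₂_congr fun k _ =>
        ⟨fun h => congrArg Subtype.val h, fun h => Subtype.ext h⟩)
    ext x
    constructor
    · intro hx k
      have hN : ∀ k, F.N k (x k) = 0 := fun k => congrFun hx.2 k
      dsimp only
      split_ifs with hkA
      · rw [pow_one]; exact hN k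
      · rw [pow_zero]; exact (h1 x hN).1 hx k hkA
    · intro hx
      have hN : ∀ k, F.N k (x k) = 0 := by
        intro k
        have := hx k
        dsimp only at this
        split_ifs at this with hkA
        · rwa [pow_one] at this
        · rw [pow_zero, Module.End.one_apply] at this
          rw [this, map_zero]
      refine (h1 x hN).2 fun k hkA => ?_
      have := hx k
      dsimp only at this
      rw [if_neg hkA, pow_zero] at this
      exact this

end Fam
end PG
end PhiN

namespace PhiN
namespace PG
namespace Fam

variable {K : Type*} [Field K] {Ω : Type*} {c : K} {s : ℕ} (F : Fam.{v} K Ω c s)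

variable {F} in
theorem _root_.PhiN.PG.Stable.map_NN {E : Submodule K F.V} (hE : F.T.Stable E) :
    F.T.Stable (E.map F.NN) := by
  constructor
  · rintro ω _ ⟨x, hx, rfl⟩
    exact ⟨_, hE.op_mem ω x hx, F.NN_op ω x⟩
  · rintro _ ⟨x, hx, rfl⟩
    refine ⟨c⁻¹ • F.T.phi x, E.smul_mem _ (hE.phi_mem x hx), ?_⟩
    rw [map_smul, NN_phi, smul_smul, inv_mul_cancel₀ F.c_ne, one_smul]

variable {F} in
theorem _root_.PhiN.PG.Stable.comap_NN {E : Submodule K F.V} (hE : F.T.Stable E) :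
    F.T.Stable (E.comap F.NN) := by
  constructor
  · intro ω x hx
    rw [Submodule.mem_comap, NN_op]
    exact hE.op_mem ω _ hx
  · intro x hx
    rw [Submodule.mem_comap, NN_phi]
    exact E.smul_mem _ (hE.phi_mem _ hx)

theorem range_NN_stable : F.T.Stable (LinearMap.range F.NN) := by
  rw [← Submodule.map_top]
  exact Stable.top.map_NN

/-- The projection of the sum on the tops of the strings. -/
def topProj : F.V →ₗ[K] (∀ k, LinearMap.ker (F.N k)) :=
  LinearMap.pi fun k => (F.str k).proj (F.b k - 1) ∘ₗ LinearMap.proj k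

theorem topProj_coe (x : F.V) (k : Fin s) :
    (F.topProj x k : (F.Z k).V) = (F.N k ^ (F.b k - 1)) (x k) := by
  refine (F.str k).θ_eq _ ?_
  rw [← Module.End.mul_apply, ← pow_succ']
  exact (F.str k).pow_zero_of_le (by omega) _

theorem ker_topProj : LinearMap.ker F.topProj = LinearMap.range F.NN := by
  apply le_antisymm
  · intro x hx
    have h1 : ∀ k, ∃ y, F.N k y = x k := by
      intro k
      have h2 : (F.N k ^ (F.b k - 1)) (x k) = 0 := by
        rw [← topProj_coe, LinearMap.mem_ker.1 hx]; rfl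
      have := (F.str k).pos
      obtain ⟨y, hy, -⟩ := (F.str k).exists_pow_eq (j := 1) h2 (by omega)
      exact ⟨y, by rwa [pow_one] at hy⟩
    choose y hy using h1
    exact ⟨y, funext hy⟩
  · rintro _ ⟨y, rfl⟩
    rw [LinearMap.mem_ker]
    funext k
    apply Subtype.ext
    have := (F.str k).pos
    rw [topProj_coe, NN_apply, pow_apply_apply, (F.str k).pow_zero_of_le (by omega)]
    rfl

theorem proj_surjective (k : Fin s) (y : LinearMap.ker (F.N k)) :
    ∃ x, (F.str k).proj (F.b k - 1) x = y := by
  have := (F.str k).pos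
  refine ⟨(F.str k).sec (F.b k - 1) y, Subtype.ext ?_⟩
  rw [IsString.proj_coe, (F.str k).θ_sec _ _ (by omega), if_pos rfl]

theorem exists_top_map (k k' : Fin s) : ∃ g : (F.str k).kerPG.V →ₗ[K] (F.str k').kerPG.V,
    IsHom 1 ((F.str k).kerPG.twist (pow_ne_zero (F.b k - 1) F.c_ne))
      ((F.str k').kerPG.twist (pow_ne_zero (F.b k' - 1) F.c_ne)) g ∧
    ∀ x, (F.str k').proj (F.b k' - 1) (F.α k k' x) = g ((F.str k).proj (F.b k - 1) x) := by
  by_cases h0 : F.α k k' = 0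
  · exact ⟨0, ⟨fun _ _ => by simp, fun _ => by simp⟩, fun x => by rw [h0]; simp⟩
  obtain ⟨n, hb, f, hf, -, hff⟩ := F.α_shift k k' h0
  have h1 := (F.str k).pos
  have h2 := (F.str k').pos
  rcases hb.eq_or_lt with he | hlt
  · refine ⟨f, (isHom_twist_iff _ _).2 ?_, fun x => ?_⟩
    · have h3 : F.b k - 1 = n + (F.b k' - 1) := by omega
      rw [one_mul, h3, pow_add, mul_div_cancel_right₀ _ (pow_ne_zero _ F.c_ne)]
      exact hf
    · rw [hff]
      congr 3
      omega
  · refine ⟨0, ⟨fun _ _ => by simp, fun _ => by simp⟩, fun x => ?_⟩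
    have h3 : (F.str k).proj (F.b k' - 1 + n) x = 0 := by
      apply Subtype.ext
      rw [IsString.proj_coe, (F.str k).pow_zero_of_le (by omega), map_zero]
      rfl
    rw [hff, h3, map_zero]
    rfl

theorem good_range [CharZero K] {E : Submodule K F.V} (hE : F.T.Stable E) :
    F.Good (E ⊔ LinearMap.range F.NN) := by
  classical
  let Y : Fin s → PG.{v} K Ω := fun k =>
    (F.str k).kerPG.twist (pow_ne_zero (F.b k - 1) F.c_ne)
  have hY : ∀ k, (Y k).Simple := fun k => (F.str k).kerPG_simple.twist _
  choose ν hν hνp using F.exists_top_map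
  have hlt : ∀ k k', ν k k' ≠ 0 → k < k' := by
    refine fun k k' h0 => F.lt k k' fun h1 => h0 (LinearMap.ext fun y => ?_)
    obtain ⟨x, rfl⟩ := F.proj_surjective k y
    rw [← hνp, h1]
    simp
  have hne : ∀ k k', k < k' → Tw 1 (Y k) (Y k') →
      (∀ k'', k < k'' → k'' < k' → ¬ Tw 1 (Y k) (Y k'')) → ν k k' ≠ 0 := by
    intro k k' hkk hT hmin h0
    have hconv : ∀ k k', Tw 1 (Y k) (Y k') ↔
        Tw (c ^ ((F.b k : ℤ) - F.b k')) (F.str k).kerPG (F.str k').kerPG := by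
      intro k k'
      have h1 := (F.str k).pos
      have h2 := (F.str k').pos
      rw [tw_twist_iff, one_mul, ← zpow_natCast, ← zpow_natCast, ← zpow_sub₀ F.c_ne]
      have : ((F.b k - 1 : ℕ) : ℤ) - ((F.b k' - 1 : ℕ) : ℤ) = (F.b k : ℤ) - F.b k' := by omega
      rw [this]
    have hend : ∀ k k', k < k' → (Tw 1 (Y k) (Y k') ↔
        ∃ l : ℕ, Tw (c ^ l) (F.str k).kerPG (F.str k').kerPG ∧ F.b k = l + F.b k') := by
      intro k k' hkk
      rw [hconv]
      constructor
      · intro h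
        by_cases hl : F.b k' ≤ F.b k
        · obtain ⟨l, hl⟩ := Nat.exists_eq_add_of_le' hl
          refine ⟨l, ?_, hl⟩
          have : (F.b k : ℤ) - F.b k' = l := by omega
          rwa [this, zpow_natCast] at h
        · have h1 := h.symm (zpow_ne_zero _ F.c_ne) (F.str k).kerPG_simple
            (F.str k').kerPG_simple
          rw [← zpow_neg] at h1
          have h2 := (F.str k).pos
          exact absurd (F.order k' k (-((F.b k : ℤ) - F.b k')) hkk.ne' (by omega) (by omega) h1)
            (not_lt.2 hkk.le)
      · rintro ⟨l, hT, hl⟩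
        have : (F.b k : ℤ) - F.b k' = l := by omega
        rwa [this, zpow_natCast]
    have hα := F.ending k k' hkk ((hend k k' hkk).1 hT) fun k'' h1 h2 h3 =>
      hmin k'' h1 h2 ((hend k k'' h1).2 h3)
    obtain ⟨l, hT', hl⟩ := (hend k k' hkk).1 hT
    obtain ⟨n, hb, f, hf, hf0, hff⟩ := F.α_shift k k' hα
    have hn : n = l := by
      have h1 : Tw (c ^ (n : ℤ)) (F.str k).kerPG (F.str k').kerPG := ⟨f, by simpa using hf, hf0⟩
      have h2 : Tw (c ^ (l : ℤ)) (F.str k).kerPG (F.str k').kerPG := by simpa using hT'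
      exact_mod_cast Tw.zpow_unique F.c_zpow F.c_ne (F.str k).kerPG_simple
        (F.str k').kerPG_simple h1 h2
    subst hn
    refine hf0 (LinearMap.ext fun y => ?_)
    obtain ⟨x, rfl⟩ := F.proj_surjective k y
    have h3 := hff (F.b k' - 1) x
    have h1 := (F.str k').pos
    have h4 : F.b k' - 1 + n = F.b k - 1 := by omega
    rw [hνp, h0, h4] at h3
    exact h3.symm
  have hphi : ∀ x : F.V, ∀ k, (Y k).phi (F.topProj x k + ∑ k₁, ν k₁ k (F.topProj x k₁)) =
      F.topProj (F.T.phi x) k := by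
    intro x k
    have h1 : F.topProj x k + ∑ k₁, ν k₁ k (F.topProj x k₁) =
        (F.str k).proj (F.b k - 1) (x k + ∑ k₁, F.α k₁ k (x k₁)) := by
      rw [map_add, map_sum]
      simp only [hνp]
      rfl
    have h2 := ((F.str k).isHom_proj F.c_ne (F.b k - 1)).map_phi
      (x k + ∑ k₁, F.α k₁ k (x k₁))
    rw [h1, twist_phi, ← h2, map_smul, smul_smul, mul_inv_cancel₀ (pow_ne_zero _ F.c_ne), one_smul]
    change _ = (F.str k).proj (F.b k - 1) (F.T.phi x k)
    rw [T_phi_apply]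
  obtain ⟨A, hA⟩ := exists_coordinate hY hν hlt hne (E.map F.topProj)
    (by
      rintro ω _ ⟨x, hx, rfl⟩
      exact ⟨_, hE.op_mem ω x hx, funext fun k =>
        ((F.str k).isHom_proj F.c_ne (F.b k - 1)).map_op ω (x k)⟩)
    (by
      rintro _ ⟨x, hx, rfl⟩
      exact ⟨_, hE.phi_mem x hx, funext fun k => (hphi x k).symm⟩)
  refine ⟨hE.sup F.range_NN_stable, fun k => if k ∈ A then F.b k else F.b k - 1, fun k => ?_, ?_⟩
  · dsimp only
    split_ifs <;> omega
  · have h1 : ∀ x, x ∈ E ⊔ LinearMap.range F.NN ↔ F.topProj x ∈ E.map F.topProj := by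
      intro x
      rw [← F.ker_topProj, ← Submodule.comap_map_eq, Submodule.mem_comap]
    ext x
    rw [h1, hA]
    constructor
    · intro hx k
      dsimp only
      split_ifs with hk
      · exact (F.str k).pow_zero_of_le le_rfl _
      · rw [← topProj_coe, hx k hk]; rfl
    · intro hx k hk
      have := hx k
      dsimp only at this
      rw [if_neg hk, ← topProj_coe] at this
      exact Subtype.ext this

variable {F} in
theorem Good.map_NN {M : Submodule K F.V} (hM : F.Good M) : F.Good (M.map F.NN) := by
  obtain ⟨hM, m, hm, rfl⟩ := hM
  refine ⟨hM.map_NN, fun k => m k - 1, fun k => (Nat.sub_le _ _).trans (hm k), ?_⟩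
  apply le_antisymm
  · rintro _ ⟨x, hx, rfl⟩ k
    rw [NN_apply, pow_apply_apply]
    rcases Nat.eq_zero_or_pos (m k) with h0 | h0
    · have := hx k
      rw [h0, pow_zero, Module.End.one_apply] at this
      rw [this, map_zero]
    · rw [Nat.sub_add_cancel h0]; exact hx k
  · intro y hy
    have h1 : ∀ k, ∃ x, (F.N k ^ m k) x = 0 ∧ F.N k x = y k := by
      intro k
      rcases Nat.eq_zero_or_pos (m k) with h0 | h0
      · refine ⟨0, map_zero _, ?_⟩
        have := hy k
        simp only [h0, Nat.zero_sub, pow_zero, Module.End.one_apply] at this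
        rw [this, map_zero]
      · have := hm k
        obtain ⟨x, hx, hx'⟩ := (F.str k).exists_pow_eq (j := 1) (hy k)
          (show m k - 1 + 1 ≤ F.b k by omega)
        rw [Nat.sub_add_cancel h0] at hx'
        exact ⟨x, hx', by rwa [pow_one] at hx⟩
    choose x hx hxy using h1
    exact ⟨x, hx, funext hxy⟩

variable {F} in
theorem Good.comap_NN {M E : Submodule K F.V} (hM : F.Good M) (hE : F.Good E) :
    F.Good (E.comap F.NN ⊓ M) := by
  obtain ⟨hM, m, hm, rfl⟩ := hM
  obtain ⟨hE, e, he, rfl⟩ := hE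
  refine ⟨hE.comap_NN.inf hM, fun k => min (e k + 1) (m k), fun k =>
    (min_le_right _ _).trans (hm k), ?_⟩
  ext x
  constructor
  · rintro ⟨h1, h2⟩ k
    have h3 := h1 k
    rw [NN_apply, pow_apply_apply] at h3
    rcases min_choice (e k + 1) (m k) with h | h
    · simp only [h]; exact h3
    · simp only [h]; exact h2 k
  · intro hx
    refine ⟨fun k => ?_, fun k => ?_⟩
    · rw [NN_apply, pow_apply_apply]
      obtain ⟨t, ht⟩ := Nat.exists_eq_add_of_le' (min_le_left (e k + 1) (m k))
      rw [ht, pow_add, Module.End.mul_apply, hx k, map_zero]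
    · obtain ⟨t, ht⟩ := Nat.exists_eq_add_of_le' (min_le_right (e k + 1) (m k))
      rw [ht, pow_add, Module.End.mul_apply, hx k, map_zero]

variable {F} in
theorem Good.sup {M E : Submodule K F.V} (hM : F.Good M) (hE : F.Good E) : F.Good (M ⊔ E) := by
  classical
  obtain ⟨hM, m, hm, rfl⟩ := hM
  obtain ⟨hE, e, he, rfl⟩ := hE
  refine ⟨hM.sup hE, fun k => max (m k) (e k), fun k => max_le (hm k) (he k), ?_⟩
  have hle : ∀ {a b : ℕ} {k : Fin s} {y : (F.Z k).V}, a ≤ b → (F.N k ^ a) y = 0 →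
      (F.N k ^ b) y = 0 := by
    intro a b k y hab hy
    obtain ⟨t, rfl⟩ := Nat.exists_eq_add_of_le' hab
    rw [pow_add, Module.End.mul_apply, hy, map_zero]
  apply le_antisymm
  · refine sup_le (fun x hx k => hle (le_max_left _ _) (hx k))
      (fun x hx k => hle (le_max_right _ _) (hx k))
  · intro x hx
    have h1 : (fun k => if e k ≤ m k then x k else 0) ∈ F.shape m := by
      intro k
      have := hx k
      dsimp only at this ⊢
      split_ifs with h
      · rwa [max_eq_left h] at this
      · exact map_zero _
    have h2 : (fun k => if e k ≤ m k then 0 else x k) ∈ F.shape e := by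
      intro k
      have := hx k
      dsimp only at this ⊢
      split_ifs with h
      · exact map_zero _
      · rwa [max_eq_right (by omega)] at this
    have h3 := Submodule.add_mem_sup h1 h2
    convert h3 using 1
    funext k
    rw [Pi.add_apply]
    split_ifs <;> simp

theorem supp_good {P : Fin s → Prop} (hP : ∀ k k', F.rel k k' → (P k ↔ P k')) :
    F.Good (F.supp P) := by
  classical
  refine ⟨F.supp_stable fun k k' h0 => (hP k k' (F.rel_of_ne k k' h0)).1,
    fun k => if P k then F.b k else 0, fun k => ?_, ?_⟩
  · dsimp only
    split_ifs <;> omega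
  · ext x
    constructor
    · intro hx k
      dsimp only
      split_ifs with h
      · exact (F.str k).pow_zero_of_le le_rfl _
      · exact hx k h
    · intro hx k hk
      have := hx k
      dsimp only at this
      rwa [if_neg hk] at this

theorem good_sup_map [CharZero K] {P : Fin s → Prop} (hP : ∀ k k', F.rel k k' → (P k ↔ P k'))
    {E : Submodule K F.V} (hE : F.T.Stable E) (hle : E ≤ F.supp P) :
    F.Good (E ⊔ (F.supp P).map F.NN) := by
  classical
  have h1 : E ⊔ (F.supp P).map F.NN = (E ⊔ LinearMap.range F.NN) ⊓ F.supp P := by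
    rw [sup_inf_assoc_of_le _ hle]
    congr 1
    apply le_antisymm
    · rintro _ ⟨x, hx, rfl⟩
      exact ⟨⟨x, rfl⟩, fun k hk => by rw [NN_apply, hx k hk, map_zero]⟩
    · rintro _ ⟨⟨x, rfl⟩, hx⟩
      refine ⟨fun k => if P k then x k else 0, fun k hk => if_neg hk, funext fun k => ?_⟩
      rw [NN_apply]
      split_ifs with hk
      · rfl
      · rw [hx k hk, map_zero]
  obtain ⟨hs, m, hm, h2⟩ := F.good_range hE
  rw [h1]
  refine ⟨hs.inf (F.supp_good hP).1, fun k => if P k then m k else 0, fun k => ?_, ?_⟩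
  · dsimp only
    split_ifs
    · exact hm k
    · exact Nat.zero_le _
  · rw [h2]
    ext x
    constructor
    · rintro ⟨h3, h4⟩ k
      dsimp only
      split_ifs with hk
      · exact h3 k
      · exact h4 k hk
    · intro hx
      have h5 : ∀ k, ¬ P k → x k = 0 := by
        intro k hk
        have := hx k
        dsimp only at this
        rwa [if_neg hk] at this
      refine ⟨fun k => ?_, h5⟩
      by_cases hk : P k
      · have := hx k
        dsimp only at this
        rwa [if_pos hk] at this
      · rw [h5 k hk, map_zero]

end Fam
end PG
end PhiN

namespace PhiN
namespace PG
namespace Fam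

open Module

variable {K : Type*} [Field K] {Ω : Type*} {c : K} {s : ℕ} (F : Fam.{v} K Ω c s)

theorem finrank_map_add {V V' : Type*} [AddCommGroup V] [Module K V] [AddCommGroup V'] [Module K V']
    [FiniteDimensional K V] (f : V →ₗ[K] V') (E : Submodule K V) :
    finrank K (E.map f) + finrank K ↥(E ⊓ LinearMap.ker f) = finrank K E := by
  have h := LinearMap.finrank_range_add_finrank_ker (f.domRestrict E)
  rw [LinearMap.range_domRestrict, LinearMap.ker_domRestrict] at h
  rw [← h]
  congr 1
  refine LinearEquiv.finrank_eq ?_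
  exact (Submodule.equivSubtypeMap _ _).symm.symm.trans
    (LinearEquiv.ofEq _ _ (by rw [Submodule.map_comap_subtype])) |>.symm

theorem map_inf_comap_NN (E M G : Submodule K F.V) (hE : E ≤ M) :
    (E ⊓ (G.comap F.NN ⊓ M)).map F.NN = E.map F.NN ⊓ G := by
  apply le_antisymm
  · rintro _ ⟨x, ⟨h1, h2, -⟩, rfl⟩
    exact ⟨⟨x, h1, rfl⟩, h2⟩
  · rintro _ ⟨⟨x, hx, rfl⟩, h2⟩
    exact ⟨x, ⟨hx, h2, hE hx⟩, rfl⟩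

theorem good_bot : F.Good ⊥ := by
  refine ⟨Stable.bot, fun _ => 0, fun _ => Nat.zero_le _, ?_⟩
  ext x
  simp only [Submodule.mem_bot, mem_shape, pow_zero, Module.End.one_apply]
  exact ⟨fun h k => by rw [h]; rfl, fun h => funext h⟩

theorem NN_pow_eq_zero : ∃ n, F.NN ^ n = 0 := by
  refine ⟨∑ k, F.b k, LinearMap.ext fun x => funext fun k => ?_⟩
  rw [NN_pow_apply, (F.str k).pow_zero_of_le (Finset.single_le_sum (f := F.b)
    (fun _ _ => Nat.zero_le _) (Finset.mem_univ k))]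
  rfl

/-- Inside a good subspace `M`, a stable subspace `E` meets some good subspace at least as much as
its proportion predicts. -/
theorem exists_good [CharZero K] {M : Submodule K F.V} (hM : F.Good M)
    (hQ : ∀ E, F.T.Stable E → E ≤ M → F.Good (E ⊔ M.map F.NN)) (hMN : M.map F.NN ≤ M)
    {E : Submodule K F.V} (hE : F.T.Stable E) (hEM : E ≤ M)
    (hEN : E.map F.NN ≤ E) {j : ℕ} (hj : j ≤ finrank K M) :
    ∃ G, F.Good G ∧ G ≤ M ∧ (j : ℤ) * finrank K E ≤
      (finrank K ↥(E ⊓ G) - max ((finrank K G : ℤ) - j) 0) * finrank K M := by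
  obtain ⟨t, ht⟩ : ∃ t, finrank K M ≤ t := ⟨_, le_rfl⟩
  induction t generalizing M E j with
  | zero =>
    have h0 : finrank K M = 0 := by omega
    refine ⟨⊥, F.good_bot, bot_le, ?_⟩
    have : j = 0 := by omega
    subst this
    simp [h0]
  | succ t ih =>
    by_cases h0 : finrank K M = 0
    · refine ⟨⊥, F.good_bot, bot_le, ?_⟩
      have : j = 0 := by omega
      subst this
      simp [h0]
    have hMn := finrank_map_add F.NN M
    have hEn := finrank_map_add F.NN E
    have hw : 0 < finrank K ↥(M ⊓ LinearMap.ker F.NN) := by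
      rw [Nat.pos_iff_ne_zero]
      intro hw
      have hbot : M ⊓ LinearMap.ker F.NN = ⊥ := Submodule.finrank_eq_zero.1 hw
      obtain ⟨n, hn⟩ := F.NN_pow_eq_zero
      have hall : ∀ m, ∀ x ∈ M, (F.NN ^ m) x = 0 → x = 0 := by
        intro m
        induction m with
        | zero => intro x _ hx; exact hx
        | succ m ihm =>
          intro x hx hmx
          rw [pow_succ, Module.End.mul_apply] at hmx
          have h1 := ihm _ (hMN ⟨x, hx, rfl⟩) hmx
          exact (Submodule.mem_bot K).1 (hbot ▸ ⟨hx, h1⟩)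
      apply h0
      rw [Submodule.finrank_eq_zero, eq_bot_iff]
      intro x hx
      exact hall n x hx (by rw [hn]; rfl)
    have hgw : finrank K ↥(E ⊓ LinearMap.ker F.NN) ≤ finrank K ↥(M ⊓ LinearMap.ker F.NN) :=
      Submodule.finrank_mono (inf_le_inf_right _ hEM)
    have hMst := hM.1
    have ih' : ∀ {E' : Submodule K F.V} (_ : F.T.Stable E') (_ : E' ≤ M.map F.NN)
        (_ : E'.map F.NN ≤ E') {i : ℕ}
        (_ : i ≤ finrank K ↥(M.map F.NN)), ∃ G, F.Good G ∧ G ≤ M.map F.NN ∧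
        (i : ℤ) * finrank K E' ≤ (finrank K ↥(E' ⊓ G) - max ((finrank K G : ℤ) - i) 0) *
          finrank K ↥(M.map F.NN) := by
      intro E' hE' hle hEN' i hi
      refine ih hM.map_NN (fun E₁ hE₁ hle₁ => ?_) (Submodule.map_mono hMN) hE' hle hEN' hi (by omega)
      have h1 := (hQ _ (hE₁.comap_NN.inf hMst) inf_le_right).map_NN
      rw [Submodule.map_sup] at h1
      convert h1 using 2
      have h2 := F.map_inf_comap_NN M M E₁ le_rfl
      rw [inf_left_comm, inf_idem] at h2
      rw [h2]
      exact (inf_eq_right.2 hle₁).symm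
    have hEM' := Submodule.finrank_mono hEM
    set n := finrank K M with hn
    set e := finrank K E with he
    set g := finrank K ↥(E ⊓ LinearMap.ker F.NN) with hg
    set w := finrank K ↥(M ⊓ LinearMap.ker F.NN) with hwd
    set n' := finrank K ↥(M.map F.NN) with hn'
    have hge : g ≤ e := by omega
    by_cases hA : e * w ≤ g * n
    · have hA' : (e : ℤ) * w ≤ g * n := by exact_mod_cast hA
      by_cases hjw : j ≤ w
      · refine ⟨E ⊓ LinearMap.ker F.NN, F.good_ker hE, inf_le_left.trans hEM, ?_⟩
        rw [← inf_assoc, inf_idem, ← hg]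
        by_cases hjg : j ≤ g
        · rw [max_eq_left (by omega), sub_sub_cancel, mul_comm (j : ℤ), mul_comm (j : ℤ)]
          exact mul_le_mul_of_nonneg_right (by exact_mod_cast hEM') (by positivity)
        · rw [max_eq_right (by omega), sub_zero]
          have : (j : ℤ) * e ≤ w * e := by
            apply mul_le_mul_of_nonneg_right <;> omega
          nlinarith
      · obtain ⟨G, hG, hGM, hb⟩ := ih' hE.map_NN (Submodule.map_mono hEM)
          (Submodule.map_mono hEN) (i := j - w) (by omega)
        have h1 := finrank_map_add F.NN (G.comap F.NN ⊓ M)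
        have h2 := finrank_map_add F.NN (E ⊓ (G.comap F.NN ⊓ M))
        have h3 : (G.comap F.NN ⊓ M).map F.NN = G := by
          have h4 := F.map_inf_comap_NN M M G le_rfl
          rw [inf_left_comm, inf_idem] at h4
          rw [h4]
          exact inf_eq_right.2 hGM
        have hk : LinearMap.ker F.NN ≤ G.comap F.NN := by
          intro x hx
          rw [Submodule.mem_comap, LinearMap.mem_ker.1 hx]
          exact zero_mem _
        have h5 : G.comap F.NN ⊓ M ⊓ LinearMap.ker F.NN = M ⊓ LinearMap.ker F.NN := by
          rw [inf_assoc]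
          exact inf_eq_right.2 (inf_le_right.trans hk)
        have h6 : E ⊓ (G.comap F.NN ⊓ M) ⊓ LinearMap.ker F.NN = E ⊓ LinearMap.ker F.NN := by
          rw [inf_assoc, h5, ← inf_assoc, inf_eq_left.2 hEM]
        rw [F.map_inf_comap_NN E M G hEM, h6, ← hg] at h2
        rw [h3, h5, ← hwd] at h1
        refine ⟨G.comap F.NN ⊓ M, hM.comap_NN hG, inf_le_right, ?_⟩
        rw [← h1, ← h2]
        have hc1 : ((j - w : ℕ) : ℤ) = (j : ℤ) - w := by omega
        have hc2 : (finrank K ↥(E.map F.NN) : ℤ) = e - g := by omega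
        have hc3 : (n' : ℤ) = n - w := by omega
        rw [hc1, hc2, hc3] at hb
        have hc4 : ((finrank K G + w : ℕ) : ℤ) - j = finrank K G - ((j : ℤ) - w) := by
          push_cast; ring
        rw [hc4]
        push_cast
        set T : ℤ := finrank K ↥(E.map F.NN ⊓ G) - max ((finrank K G : ℤ) - (j - w)) 0 with hT
        have hc5 : (finrank K ↥(E.map F.NN ⊓ G) : ℤ) + g - max ((finrank K G : ℤ) - (j - w)) 0 =
            T + g := by rw [hT]; ring
        rw [hc5]
        have hpos : 0 < (n : ℤ) - w := by omega
        have hnj : 0 ≤ (n : ℤ) - j := by omega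
        refine le_of_mul_le_mul_right ?_ hpos
        have hn0 : (0 : ℤ) ≤ n := by positivity
        linarith [mul_nonneg hnj (sub_nonneg.2 hA'), mul_le_mul_of_nonneg_left hb hn0]
    · have hB : (g : ℤ) * n < e * w := by exact_mod_cast not_le.1 hA
      have hNE : E.map F.NN ≤ E ⊓ M.map F.NN := le_inf hEN (Submodule.map_mono hEM)
      have hNEr := Submodule.finrank_mono hNE
      have hqe : finrank K ↥(E ⊓ M.map F.NN) ≤ e := Submodule.finrank_mono inf_le_left
      have hsup := Submodule.finrank_sup_add_finrank_inf_eq E (M.map F.NN)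
      have hsM := Submodule.finrank_mono (sup_le hEM hMN)
      set q := finrank K ↥(E ⊓ M.map F.NN) with hq
      rw [← he, ← hn'] at hsup
      have hh : ((e : ℤ) - q) * n < e * w := by
        refine lt_of_le_of_lt (mul_le_mul_of_nonneg_right (by omega) (by positivity)) hB
      have hc3 : (n' : ℤ) = n - w := by omega
      by_cases hjn : j ≤ n'
      · rcases Nat.eq_zero_or_pos j with rfl | hj0
        · exact ⟨⊥, F.good_bot, bot_le, by simp; positivity⟩
        obtain ⟨G, hG, hGM, hb⟩ := ih' (hE.inf hM.map_NN.1) inf_le_right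
          ((Submodule.map_inf_le _).trans
            (inf_le_inf hEN (Submodule.map_mono hMN))) hjn
        refine ⟨G, hG, hGM.trans hMN, ?_⟩
        rw [inf_assoc, inf_eq_right.2 hGM, hc3] at hb
        have hpos : 0 < (n : ℤ) - w := by omega
        refine le_of_mul_le_mul_right ?_ hpos
        have hn0 : (0 : ℤ) ≤ n := by positivity
        have hj0 : (0 : ℤ) ≤ j := by positivity
        linarith [mul_le_mul_of_nonneg_left hb hn0, mul_le_mul_of_nonneg_left hh.le hj0]
      · refine ⟨E ⊔ M.map F.NN, hQ E hE hEM, sup_le hEM hMN, ?_⟩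
        rw [inf_eq_left.2 (le_sup_left : E ≤ E ⊔ M.map F.NN), ← he]
        by_cases hm : finrank K ↥(E ⊔ M.map F.NN) ≤ j
        · rw [max_eq_right (by omega), sub_zero, mul_comm]
          exact mul_le_mul_of_nonneg_left (by exact_mod_cast hj) (by positivity)
        · rw [max_eq_left (by omega)]
          have hw0 : (0 : ℤ) < w := by exact_mod_cast hw
          have hc5 : (finrank K ↥(E ⊔ M.map F.NN) : ℤ) = e + n - w - q := by omega
          rw [hc5]
          refine le_of_mul_le_mul_right ?_ hw0
          have h1 : (0 : ℤ) ≤ w - (n - j) := by omega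
          have h2 : (0 : ℤ) ≤ w - (e - q) := by omega
          have hn0 : (0 : ℤ) ≤ n := by positivity
          have hnj : 0 ≤ (n : ℤ) - j := by omega
          linarith [mul_nonneg (mul_nonneg h1 hn0) h2, mul_nonneg hnj (sub_nonneg.2 hh.le)]

end Fam
end PG
end PhiN

namespace PhiN

open Module

section wt

variable {p : ℕ} [Fact p.Prime] {V V' : Type*} [AddCommGroup V] [Module ℚ_[p] V]
  [FiniteDimensional ℚ_[p] V] [AddCommGroup V'] [Module ℚ_[p] V'] [FiniteDimensional ℚ_[p] V']

open Classical in
/-- The valuation of the determinant of `φ` on the stable subspace `E`. -/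
def wt (φ : V →ₗ[ℚ_[p]] V) (E : Submodule ℚ_[p] V) : ℤ :=
  if h : ∀ x ∈ E, φ x ∈ E then (LinearMap.det (φ.restrict h)).valuation else 0

theorem wt_eq {φ : V →ₗ[ℚ_[p]] V} {E : Submodule ℚ_[p] V} (h : ∀ x ∈ E, φ x ∈ E) :
    wt φ E = (LinearMap.det (φ.restrict h)).valuation := dif_pos h

theorem det_eq_of_conj {K U U' : Type*} [Field K] [AddCommGroup U] [Module K U] [AddCommGroup U']
    [Module K U'] (e : U ≃ₗ[K] U') (g : U →ₗ[K] U) (g' : U' →ₗ[K] U')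
    (h : ∀ x, e (g x) = g' (e x)) : LinearMap.det g = LinearMap.det g' := by
  rw [← LinearMap.det_conj g e]
  congr 1
  refine LinearMap.ext fun x => ?_
  simp [h]

theorem det_ne_zero_of_injective {U : Type*} [AddCommGroup U] [Module ℚ_[p] U]
    [FiniteDimensional ℚ_[p] U] {g : U →ₗ[ℚ_[p]] U} (hg : Function.Injective g) :
    LinearMap.det g ≠ 0 := by
  have := LinearEquiv.isUnit_det' (LinearEquiv.ofInjectiveEndo g hg)
  exact this.ne_zero

theorem wt_eq_add {φ : V →ₗ[ℚ_[p]] V} (hφ : Function.Injective φ) {E : Submodule ℚ_[p] V}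
    (hE : ∀ x ∈ E, φ x ∈ E) (f : V →ₗ[ℚ_[p]] V') {φ' : V' →ₗ[ℚ_[p]] V'}
    (hφ' : Function.Injective φ') (hf : ∀ x ∈ E, f (φ x) = φ' (f x)) :
    wt φ E = wt φ (E ⊓ LinearMap.ker f) + wt φ' (E.map f) := by
  have h1 : ∀ x ∈ E ⊓ LinearMap.ker f, φ x ∈ E ⊓ LinearMap.ker f := by
    rintro x ⟨hx, hx'⟩
    refine ⟨hE x hx, ?_⟩
    have hx'' : f x = 0 := hx'
    change f (φ x) = 0
    rw [hf x hx, hx'', map_zero]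
  have h2 : ∀ x ∈ E.map f, φ' x ∈ E.map f := by
    rintro _ ⟨x, hx, rfl⟩
    exact ⟨φ x, hE x hx, hf x hx⟩
  rw [wt_eq hE, wt_eq h1, wt_eq h2]
  let g := φ.restrict hE
  let fE := f.domRestrict E
  let W := LinearMap.ker fE
  have hW : W ≤ W.comap g := by
    intro x hx
    have hx' : f (x : V) = 0 := hx
    change f (φ x) = 0
    rw [hf x x.2, hx', map_zero]
  have h3 := LinearMap.det_eq_det_mul_det W g hW
  have h4 : LinearMap.det (g.restrict hW) = LinearMap.det (φ.restrict h1) := by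
    let e : W ≃ₗ[ℚ_[p]] ↥(E ⊓ LinearMap.ker f) :=
      { toFun := fun x => ⟨x.1.1, x.1.2, x.2⟩
        invFun := fun x => ⟨⟨x.1, x.2.1⟩, x.2.2⟩
        map_add' := fun _ _ => rfl
        map_smul' := fun _ _ => rfl
        left_inv := fun _ => rfl
        right_inv := fun _ => rfl }
    exact det_eq_of_conj e _ _ fun x => rfl
  have h5 : LinearMap.det (W.mapQ W g hW) = LinearMap.det (φ'.restrict h2) := by
    have hr : LinearMap.range fE = E.map f := LinearMap.range_domRestrict E f
    let e : (E ⧸ W) ≃ₗ[ℚ_[p]] ↥(E.map f) := fE.quotKerEquivRange.trans (LinearEquiv.ofEq _ _ hr)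
    refine det_eq_of_conj e _ _ fun x => ?_
    obtain ⟨x, rfl⟩ := W.mkQ_surjective x
    apply Subtype.ext
    exact hf x x.2
  rw [h4, h5] at h3
  rw [h3]
  refine Padic.valuation_mul (det_ne_zero_of_injective fun x y h => Subtype.ext
    (hφ (congrArg Subtype.val h))) (det_ne_zero_of_injective fun x y h => Subtype.ext
    (hφ' (congrArg Subtype.val h)))

theorem mem_of_apply_mem {φ : V →ₗ[ℚ_[p]] V} (hφ : Function.Injective φ) {E : Submodule ℚ_[p] V}
    (hE : ∀ x ∈ E, φ x ∈ E) {x : V} (hx : φ x ∈ E) : x ∈ E := by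
  have h1 : E.map φ ≤ E := by
    rintro _ ⟨y, hy, rfl⟩
    exact hE y hy
  have h2 : E.map φ = E := Submodule.eq_of_le_of_finrank_eq h1
    (LinearEquiv.finrank_map_eq (LinearEquiv.ofInjectiveEndo φ hφ) E)
  rw [← h2] at hx
  obtain ⟨y, hy, h⟩ := hx
  rwa [← hφ h]

theorem wt_sup_add_inf {φ : V →ₗ[ℚ_[p]] V} (hφ : Function.Injective φ) {E E' : Submodule ℚ_[p] V}
    (hE : ∀ x ∈ E, φ x ∈ E) (hE' : ∀ x ∈ E', φ x ∈ E') :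
    wt φ (E ⊔ E') + wt φ (E ⊓ E') = wt φ E + wt φ E' := by
  have hs : ∀ x ∈ E ⊔ E', φ x ∈ E ⊔ E' := by
    intro x hx
    obtain ⟨y, hy, z, hz, rfl⟩ := Submodule.mem_sup.1 hx
    rw [map_add]
    exact Submodule.add_mem_sup (hE y hy) (hE' z hz)
  have hc : E' ≤ E'.comap φ := hE'
  have hinj : Function.Injective (E'.mapQ E' φ hc) := by
    refine (injective_iff_map_eq_zero _).2 fun x hx => ?_
    obtain ⟨x, rfl⟩ := E'.mkQ_surjective x
    have h1 : φ x ∈ E' := (Submodule.Quotient.mk_eq_zero E').1 hx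
    exact (Submodule.Quotient.mk_eq_zero E').2 (mem_of_apply_mem hφ hE' h1)
  have h1 := wt_eq_add hφ hs E'.mkQ hinj fun x _ => rfl
  have h2 := wt_eq_add hφ hE E'.mkQ hinj fun x _ => rfl
  rw [Submodule.ker_mkQ] at h1 h2
  rw [inf_eq_right.2 le_sup_right, Submodule.map_sup] at h1
  have h3 : E'.map E'.mkQ = ⊥ := Submodule.mkQ_map_self E'
  rw [h3, sup_bot_eq] at h1
  rw [h1, h2]
  ring

theorem wt_bot (φ : V →ₗ[ℚ_[p]] V) : wt φ ⊥ = 0 := by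
  have h : ∀ x ∈ (⊥ : Submodule ℚ_[p] V), φ x ∈ (⊥ : Submodule ℚ_[p] V) := by simp
  rw [wt_eq h, LinearMap.det_eq_one_of_subsingleton]
  simp

theorem wt_top (φ : V →ₗ[ℚ_[p]] V) : wt φ ⊤ = (LinearMap.det φ).valuation := by
  rw [wt_eq fun x (_ : x ∈ (⊤ : Submodule ℚ_[p] V)) => (Submodule.mem_top : φ x ∈ _)]
  congr 1
  exact det_eq_of_conj Submodule.topEquiv _ _ fun _ => rfl

theorem wt_smul {φ : V →ₗ[ℚ_[p]] V} (hφ : Function.Injective φ) {E : Submodule ℚ_[p] V}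
    (hE : ∀ x ∈ E, φ x ∈ E) {c : ℚ_[p]} (hc : c ≠ 0) :
    wt (c • φ) E = finrank ℚ_[p] E * c.valuation + wt φ E := by
  have h : ∀ x ∈ E, (c • φ) x ∈ E := fun x hx => E.smul_mem c (hE x hx)
  rw [wt_eq h, wt_eq hE]
  have : (c • φ).restrict h = c • φ.restrict hE := rfl
  rw [this, LinearMap.det_smul, Padic.valuation_mul (pow_ne_zero _ hc)
    (det_ne_zero_of_injective fun x y h => Subtype.ext (hφ (congrArg Subtype.val h))),
    Padic.valuation_pow]

end wt

end PhiN

namespace PhiN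
namespace PG
namespace Fam

open Module

variable {p : ℕ} [Fact p.Prime] {Ω : Type*} {s : ℕ} (F : Fam.{v} ℚ_[p] Ω (p : ℚ_[p]) s)

theorem rel_symm {i j : Fin s} (h : F.rel i j) : F.rel j i := .symm _ _ h

theorem rel_trans {i j k : Fin s} (h : F.rel i j) (h' : F.rel j k) : F.rel i k := .trans _ _ _ h h'

open Classical in
/-- The degree of the first element of the string `k`, relatively to the string `k₀` of the same
block. -/
def deg (k₀ k : Fin s) : ℤ := if h : F.rel k₀ k then (F.exists_tw k₀ k h).choose else 0

variable {k₀ : Fin s}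

theorem deg_spec {k : Fin s} (h : F.rel k₀ k) :
    Tw ((p : ℚ_[p]) ^ F.deg k₀ k) (F.str k₀).kerPG (F.str k).kerPG := by
  rw [deg, dif_pos h]
  exact (F.exists_tw k₀ k h).choose_spec

theorem deg_eq {i j : Fin s} (hi : F.rel k₀ i) (hj : F.rel k₀ j) {l : ℤ}
    (h : Tw ((p : ℚ_[p]) ^ l) (F.str i).kerPG (F.str j).kerPG) :
    F.deg k₀ j = F.deg k₀ i + l :=
  F.tw_unique (F.deg_spec hj) (F.tw_trans (F.deg_spec hi) h)

theorem proj_α {k k' : Fin s} (h0 : F.α k k' ≠ 0) (hk : F.rel k₀ k) (i : ℕ) :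
    ∃ n : ℕ, F.deg k₀ k' = F.deg k₀ k + n ∧ ∀ x, (F.str k).proj (i + n) x = 0 →
      (F.str k').proj i (F.α k k' x) = 0 := by
  obtain ⟨n, -, f, hf, hf0, h⟩ := F.α_shift k k' h0
  refine ⟨n, F.deg_eq hk (F.rel_trans hk (F.rel_of_ne k k' h0)) ⟨f, by rwa [zpow_natCast], hf0⟩,
    fun x hx => ?_⟩
  rw [h, hx, map_zero]

variable (k₀) in
/-- The vectors of the block of `k₀` whose coordinates vanish in degrees `> l`, and in degree `l`
for the strings before the `n`-th one. -/
def lev (l : ℤ) (n : ℕ) : Submodule ℚ_[p] F.V where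
  carrier := {x | (∀ k, ¬ F.rel k₀ k → x k = 0) ∧ ∀ k, F.rel k₀ k → ∀ i : ℕ,
    (l < F.deg k₀ k + i ∨ (l = F.deg k₀ k + i ∧ (k : ℕ) < n)) → (F.str k).proj i (x k) = 0}
  add_mem' := fun hx hy => ⟨fun k hk => by rw [Pi.add_apply, hx.1 k hk, hy.1 k hk, add_zero],
    fun k hk i hi => by rw [Pi.add_apply, map_add, hx.2 k hk i hi, hy.2 k hk i hi, add_zero]⟩
  zero_mem' := ⟨fun _ _ => rfl, fun _ _ _ _ => map_zero _⟩
  smul_mem' := fun a x hx => ⟨fun k hk => by rw [Pi.smul_apply, hx.1 k hk, smul_zero],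
    fun k hk i hi => by rw [Pi.smul_apply, map_smul, hx.2 k hk i hi, smul_zero]⟩

theorem proj_phi (k : Fin s) (i : ℕ) (y : (F.Z k).V) :
    (F.str k).proj i ((F.Z k).phi y) = ((p : ℚ_[p]) ^ i) • (F.str k).kerPG.phi ((F.str k).proj i y) := by
  have := ((F.str k).isHom_proj F.c_ne i).map_phi y
  rw [← this, map_smul, smul_smul, mul_inv_cancel₀ (pow_ne_zero _ F.c_ne), one_smul]

theorem proj_op (k : Fin s) (i : ℕ) (ω : Ω) (y : (F.Z k).V) :
    (F.str k).proj i ((F.Z k).op ω y) = (F.str k).kerPG.op ω ((F.str k).proj i y) :=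
  ((F.str k).isHom_proj F.c_ne i).map_op ω y

/-- On `lev l n` the coordinate of degree `l` of the `n`-th string is compatible with the
Frobenius. -/
theorem proj_T_phi {l : ℤ} {n : ℕ} {x : F.V} (hx : x ∈ F.lev k₀ l n) {k : Fin s} (hk : F.rel k₀ k)
    {i : ℕ} (hi : l < F.deg k₀ k + i ∨ (l = F.deg k₀ k + i ∧ (k : ℕ) ≤ n)) :
    (F.str k).proj i (F.T.phi x k) =
      ((p : ℚ_[p]) ^ i) • (F.str k).kerPG.phi ((F.str k).proj i (x k)) := by
  rw [T_phi_apply, proj_phi, map_add, map_sum, Finset.sum_eq_zero, add_zero]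
  intro k₁ _
  by_cases h0 : F.α k₁ k = 0
  · rw [h0, LinearMap.zero_apply, map_zero]
  have hk₁ : F.rel k₀ k₁ := F.rel_trans hk (F.rel_symm (F.rel_of_ne _ _ h0))
  obtain ⟨m, hm, h⟩ := F.proj_α h0 hk₁ i
  have hlt : (k₁ : ℕ) < k := F.lt _ _ h0
  refine h _ (hx.2 k₁ hk₁ _ ?_)
  push_cast
  rcases hi with hi | hi
  · left; omega
  · right; omega

theorem lev_stable (l : ℤ) (n : ℕ) : F.T.Stable (F.lev k₀ l n) := by
  constructor
  · intro ω x hx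
    refine ⟨fun k hk => ?_, fun k hk i hi => ?_⟩
    · rw [T_op_apply, hx.1 k hk, map_zero]
    · rw [T_op_apply, proj_op, hx.2 k hk i hi, map_zero]
  · intro x hx
    refine ⟨fun k hk => ?_, fun k hk i hi => ?_⟩
    · rw [T_phi_apply, hx.1 k hk, zero_add, Finset.sum_eq_zero, map_zero]
      intro k₁ _
      by_cases h0 : F.α k₁ k = 0
      · rw [h0]; rfl
      · rw [hx.1 k₁ fun h => hk (F.rel_trans h (F.rel_of_ne _ _ h0)), map_zero]
    · rw [F.proj_T_phi hx hk (hi.imp_right fun h => ⟨h.1, h.2.le⟩), hx.2 k hk i hi, map_zero,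
        smul_zero]

theorem proj_eq_zero {k : Fin s} {i : ℕ} (hi : F.b k ≤ i) (x : (F.Z k).V) :
    (F.str k).proj i x = 0 := by
  apply Subtype.ext
  rw [IsString.proj_coe, (F.str k).pow_zero_of_le hi, map_zero]
  rfl

theorem lev_good (l : ℤ) : F.Good (F.lev k₀ l 0) := by
  classical
  refine ⟨F.lev_stable l 0, fun k => if F.rel k₀ k then
    min (F.b k) (l + 1 - F.deg k₀ k).toNat else 0, fun k => ?_, ?_⟩
  · dsimp only
    split_ifs
    · exact min_le_left _ _
    · exact Nat.zero_le _
  · ext x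
    constructor
    · intro hx k
      dsimp only
      split_ifs with hk
      · rw [(F.str k).mem_ker_pow]
        intro i hi hib
        exact congrArg Subtype.val (hx.2 k hk i (by left; omega))
      · exact hx.1 k hk
    · intro hx
      refine ⟨fun k hk => ?_, fun k hk i hi => ?_⟩
      · have := hx k
        dsimp only at this
        rwa [if_neg hk] at this
      · have := hx k
        dsimp only at this
        rw [if_pos hk, (F.str k).mem_ker_pow] at this
        by_cases hib : i < F.b k
        · exact Subtype.ext (this i (by omega) hib)
        · exact F.proj_eq_zero (not_lt.1 hib) _

theorem lev_last (l : ℤ) : F.lev k₀ l s = F.lev k₀ (l - 1) 0 := by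
  ext x
  refine and_congr_right fun _ => forall₂_congr fun k _ => forall_congr' fun i => ?_
  have : ((l < F.deg k₀ k + i ∨ l = F.deg k₀ k + i ∧ (k : ℕ) < s) ↔
      (l - 1 < F.deg k₀ k + i ∨ l - 1 = F.deg k₀ k + i ∧ (k : ℕ) < 0)) := by
    have := k.2
    omega
  rw [this]

variable (k₀) in
/-- The slope in degree `0`. -/
def baseSlope : ℚ :=
  wt (F.str k₀).kerPG.phi.toLinearMap ⊤ / finrank ℚ_[p] (LinearMap.ker (F.N k₀))

theorem wt_ker {k : Fin s} (hk : F.rel k₀ k) (i : ℕ) :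
    (wt (((p : ℚ_[p]) ^ i) • (F.str k).kerPG.phi.toLinearMap) ⊤ : ℚ) =
      (F.baseSlope k₀ + (F.deg k₀ k + i)) * finrank ℚ_[p] (LinearMap.ker (F.N k)) := by
  obtain ⟨f, hf, h0⟩ := F.deg_spec hk
  have hc := zpow_ne_zero (F.deg k₀ k) F.c_ne
  let e : (F.str k₀).kerPG.V ≃ₗ[ℚ_[p]] (F.str k).kerPG.V := LinearEquiv.ofBijective f
    (hf.bijective hc (F.str k₀).kerPG_simple (F.str k).kerPG_simple h0)
  have h1 : LinearMap.det ((p : ℚ_[p]) ^ F.deg k₀ k • (F.str k₀).kerPG.phi.toLinearMap) =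
      LinearMap.det (F.str k).kerPG.phi.toLinearMap :=
    det_eq_of_conj e _ _ fun x => hf.map_phi x
  have hfr : finrank ℚ_[p] (LinearMap.ker (F.N k₀)) = finrank ℚ_[p] (LinearMap.ker (F.N k)) :=
    e.finrank_eq
  have h2 := congrArg Padic.valuation h1
  rw [← wt_top, ← wt_top, wt_smul (F.str k₀).kerPG.phi.injective (fun _ _ => Submodule.mem_top) hc,
    Padic.valuation_zpow, Padic.valuation_p, finrank_top] at h2
  rw [wt_smul (F.str k).kerPG.phi.injective (fun _ _ => Submodule.mem_top)
    (pow_ne_zero _ F.c_ne), Padic.valuation_pow, Padic.valuation_p, finrank_top, ← h2]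
  have hne : (finrank ℚ_[p] (LinearMap.ker (F.N k₀)) : ℚ) ≠ 0 := by
    have := (F.str k₀).kerPG_simple.nontrivial
    exact_mod_cast (finrank_pos (R := ℚ_[p]) (M := (F.str k₀).kerPG.V)).ne'
  have h3 : (wt (F.str k₀).kerPG.phi.toLinearMap ⊤ : ℚ) =
      F.baseSlope k₀ * finrank ℚ_[p] (LinearMap.ker (F.N k₀)) := by
    rw [baseSlope, div_mul_cancel₀ _ hne]
  push_cast
  rw [h3, ← hfr]
  ring

theorem wt_lev_step {E : Submodule ℚ_[p] F.V} (hE : F.T.Stable E) (l : ℤ) (n : ℕ) (hn : n ≤ s) :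
    (wt F.T.phi.toLinearMap (E ⊓ F.lev k₀ l 0) : ℚ) - wt F.T.phi.toLinearMap (E ⊓ F.lev k₀ l n) =
      (F.baseSlope k₀ + l) * ((finrank ℚ_[p] ↥(E ⊓ F.lev k₀ l 0) : ℚ) -
        finrank ℚ_[p] ↥(E ⊓ F.lev k₀ l n)) := by
  induction n with
  | zero => simp
  | succ n ih =>
    have ih := ih (by omega)
    let a : Fin s := ⟨n, hn⟩
    by_cases ha : F.rel k₀ a ∧ ∃ i : ℕ, l = F.deg k₀ a + i
    · obtain ⟨ha, i, hi⟩ := ha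
      let f : F.V →ₗ[ℚ_[p]] LinearMap.ker (F.N a) := (F.str a).proj i ∘ₗ LinearMap.proj a
      have hst : F.T.Stable (E ⊓ F.lev k₀ l n) := hE.inf (F.lev_stable l n)
      have hker : E ⊓ F.lev k₀ l n ⊓ LinearMap.ker f = E ⊓ F.lev k₀ l (n + 1) := by
        rw [inf_assoc]
        congr 1
        ext x
        constructor
        · rintro ⟨⟨h1, h2⟩, h3⟩
          refine ⟨h1, fun k hk j hj => ?_⟩
          by_cases hka : k = a ∧ l = F.deg k₀ k + j
          · obtain ⟨rfl, hj'⟩ := hka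
            have : j = i := by omega
            rw [this]; exact h3
          · refine h2 k hk j (hj.imp_right fun h => ⟨h.1, ?_⟩)
            have : (k : ℕ) ≠ n := fun h' => hka ⟨Fin.ext h', h.1⟩
            omega
        · rintro ⟨h1, h2⟩
          exact ⟨⟨h1, fun k hk j hj => h2 k hk j (hj.imp_right fun h => ⟨h.1, by omega⟩)⟩,
            h2 a ha i (Or.inr ⟨hi, Nat.lt_succ_self n⟩)⟩
      have hfphi : ∀ x ∈ E ⊓ F.lev k₀ l n, f (F.T.phi.toLinearMap x) =
          (((p : ℚ_[p]) ^ i) • (F.str a).kerPG.phi.toLinearMap) (f x) := fun x hx =>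
        F.proj_T_phi hx.2 ha (Or.inr ⟨hi, le_rfl⟩)
      have hw := wt_eq_add (φ := F.T.phi.toLinearMap) F.T.phi.injective hst.phi_mem f
        (φ' := ((p : ℚ_[p]) ^ i) • (F.str a).kerPG.phi.toLinearMap)
        (fun x y h => (F.str a).kerPG.phi.injective
          (smul_right_injective _ (pow_ne_zero i F.c_ne) h)) hfphi
      have hd := finrank_map_add f (E ⊓ F.lev k₀ l n)
      have him : (F.str a).kerPG.Stable ((E ⊓ F.lev k₀ l n).map f) := by
        constructor
        · rintro ω _ ⟨x, hx, rfl⟩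
          exact ⟨_, hst.op_mem ω x hx, F.proj_op a i ω _⟩
        · rintro _ ⟨x, hx, rfl⟩
          have h1 : f (F.T.phi x) ∈ (E ⊓ F.lev k₀ l n).map f := ⟨_, hst.phi_mem x hx, rfl⟩
          have h2 := hfphi x hx
          have h3 : ((p : ℚ_[p]) ^ i) • (F.str a).kerPG.phi (f x) ∈ (E ⊓ F.lev k₀ l n).map f := by
            rw [← show f (F.T.phi x) = ((p : ℚ_[p]) ^ i) • (F.str a).kerPG.phi (f x) from h2]
            exact h1
          exact (Submodule.smul_mem_iff _ (pow_ne_zero i F.c_ne)).1 h3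
      rw [hker] at hw hd
      rcases (F.str a).kerPG_simple.eq_bot_or _ him with h0 | h0
      · rw [h0, wt_bot, add_zero] at hw
        rw [h0, finrank_bot, zero_add] at hd
        rw [← hw, hd]
        exact ih
      · rw [h0] at hw hd
        have h4 := F.wt_ker ha i
        rw [finrank_top] at hd
        have h5 : (F.deg k₀ a : ℚ) + i = l := by
          rw [hi]; push_cast; ring
        rw [h5] at h4
        have h6 : (wt F.T.phi.toLinearMap (E ⊓ F.lev k₀ l n) : ℚ) =
            wt F.T.phi.toLinearMap (E ⊓ F.lev k₀ l (n + 1)) +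
              (F.baseSlope k₀ + l) * finrank ℚ_[p] (LinearMap.ker (F.N a)) := by
          rw [← h4]
          exact_mod_cast hw
        have h7 : (finrank ℚ_[p] ↥(E ⊓ F.lev k₀ l n) : ℚ) =
            finrank ℚ_[p] (LinearMap.ker (F.N a)) + finrank ℚ_[p] ↥(E ⊓ F.lev k₀ l (n + 1)) := by
          exact_mod_cast hd.symm
        rw [h6, h7] at ih
        linear_combination ih
    · have : F.lev k₀ l (n + 1) = F.lev k₀ l n := by
        ext x
        refine and_congr_right fun _ => ?_
        constructor
        · intro h k hk j hj
          exact h k hk j (hj.imp_right fun h => ⟨h.1, by omega⟩)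
        · intro h k hk j hj
          refine h k hk j (hj.imp_right fun h1 => ⟨h1.1, ?_⟩)
          have : (k : ℕ) ≠ n := by
            intro h'
            have : k = a := Fin.ext h'
            subst this
            exact ha ⟨hk, j, h1.1⟩
          omega
      rw [this]
      exact ih

end Fam
end PG
end PhiN

namespace PhiN
namespace PG
namespace Fam

open Module

variable {p : ℕ} [Fact p.Prime] {Ω : Type*} {s : ℕ} (F : Fam.{v} ℚ_[p] Ω (p : ℚ_[p]) s)

theorem exists_cover {k₀ k₁ k₂ : Fin s} (h₁ : F.rel k₀ k₁) (h₂ : F.rel k₀ k₂) {l : ℤ}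
    (hl₁ : F.deg k₀ k₁ ≤ l) (hl₂ : l < F.deg k₀ k₂ + F.b k₂) :
    ∃ k, F.rel k₀ k ∧ F.deg k₀ k ≤ l ∧ l < F.deg k₀ k + F.b k := by
  by_contra! hall
  have key : ∀ i j, F.rel i j → F.rel k₀ i → (l < F.deg k₀ i ↔ l < F.deg k₀ j) := by
    intro i j hij
    induction hij with
    | rel i j h =>
      intro hi
      have hj : F.rel k₀ j := F.rel_trans hi (.rel _ _ h)
      obtain ⟨f, hf, h0⟩ := h
      obtain ⟨a, b, ha, hb, hT⟩ := F.exists_overlap hf h0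
      have h1 := F.deg_eq hi hj hT
      have h2 := hall i hi
      have h3 := hall j hj
      constructor
      · intro h
        by_contra hle
        have := h3 (not_lt.1 hle)
        omega
      · intro h
        by_contra hle
        have := h2 (not_lt.1 hle)
        omega
    | refl i => exact fun _ => Iff.rfl
    | symm i j h ih => exact fun hj => (ih (F.rel_trans hj (F.rel_symm h))).symm
    | trans i j k h h' ih ih' => exact fun hi => (ih hi).trans (ih' (F.rel_trans hi h))
  have h3 := (key k₁ k₂ (F.rel_trans (F.rel_symm h₁) h₂) h₁)
  have h4 : ¬ l < F.deg k₀ k₂ := fun h => absurd (h3.2 h) (not_lt.2 hl₁)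
  exact absurd (hall k₂ h₂ (not_lt.1 h4)) (not_le.2 hl₂)

/-- The filtration of a block by the degree, and the determinant of the Frobenius on stable
subspaces of the block. -/
theorem exists_levels (k₀ : Fin s) : ∃ (n₀ : ℕ) (M : ℕ → Submodule ℚ_[p] F.V) (T : ℚ),
    (∀ n, F.Good (M n)) ∧ (∀ n, M n ≤ F.supp (F.rel k₀)) ∧ M n₀ = F.supp (F.rel k₀) ∧
    (∀ n < n₀, finrank ℚ_[p] (M n) < finrank ℚ_[p] (M (n + 1))) ∧
    ∀ E, F.T.Stable E → E ≤ F.supp (F.rel k₀) → (wt F.T.phi.toLinearMap E : ℚ) =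
      T * finrank ℚ_[p] E - ∑ n ∈ Finset.range n₀, (finrank ℚ_[p] ↥(E ⊓ M n) : ℚ) := by
  classical
  have hne : (Finset.univ.filter (F.rel k₀)).Nonempty := ⟨k₀, by simpa using .refl _⟩
  obtain ⟨k₁, hk₁, hlo⟩ := Finset.exists_min_image _ (F.deg k₀) hne
  obtain ⟨k₂, hk₂, hhi⟩ := Finset.exists_max_image _ (fun k => F.deg k₀ k + F.b k) hne
  simp only [Finset.mem_filter, Finset.mem_univ, true_and] at hk₁ hk₂ hlo hhi
  have hle : F.deg k₀ k₁ ≤ F.deg k₀ k₂ + F.b k₂ := (hlo k₂ hk₂).trans (by omega)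
  obtain ⟨n₀, hn₀⟩ := Int.eq_ofNat_of_zero_le (sub_nonneg.2 hle)
  let M : ℕ → Submodule ℚ_[p] F.V := fun n => F.lev k₀ (F.deg k₀ k₁ - 1 + n) 0
  have hM0 : M 0 = ⊥ := by
    rw [eq_bot_iff]
    intro x hx
    rw [Submodule.mem_bot]
    funext k
    by_cases hk : F.rel k₀ k
    · have := hlo k hk
      exact (F.str k).inj _ fun i hi => congrArg Subtype.val (hx.2 k hk i (by
        left; push_cast; omega))
    · exact hx.1 k hk
  have hMn : M n₀ = F.supp (F.rel k₀) := by
    apply le_antisymm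
    · exact fun x hx => hx.1
    · refine fun x hx => ⟨hx, fun k hk i hi => F.proj_eq_zero ?_ _⟩
      have := hhi k hk
      omega
  refine ⟨n₀, M, F.baseSlope k₀ + (F.deg k₀ k₁ - 1 + n₀), fun n => F.lev_good _,
    fun n x hx => hx.1, hMn, fun n hn => ?_, fun E hE hEB => ?_⟩
  · obtain ⟨k, hk, h1, h2⟩ := F.exists_cover (l := F.deg k₀ k₁ + n) hk₁ hk₂ (by omega) (by omega)
    obtain ⟨i, hi⟩ := Int.eq_ofNat_of_zero_le (sub_nonneg.2 h1)
    obtain ⟨y, hy, hy0⟩ := Submodule.exists_mem_ne_zero_of_ne_bot (F.str k).ker_ne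
    refine Submodule.finrank_lt_finrank_of_lt (lt_of_le_of_ne (fun x hx => ⟨hx.1,
      fun k hk j hj => hx.2 k hk j (by push_cast at hj ⊢; omega)⟩) fun he => hy0 ?_)
    have hib : i < F.b k := by omega
    have h3 : (Pi.single k ((F.str k).sec i ⟨y, hy⟩) : F.V) ∈ M (n + 1) := by
      refine ⟨fun k' hk' => ?_, fun k' hk' j hj => ?_⟩
      · have : k' ≠ k := fun h => hk' (h ▸ hk)
        rw [Pi.single_eq_of_ne this]
      · by_cases hkk : k' = k
        · subst hkk
          rw [Pi.single_eq_same]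
          apply Subtype.ext
          rw [IsString.proj_coe, (F.str k').θ_sec _ _ hib, if_neg]
          · rfl
          · push_cast at hj; omega
        · rw [Pi.single_eq_of_ne hkk, map_zero]
    rw [← he] at h3
    have h4 := congrArg Subtype.val (h3.2 k hk i (by left; omega))
    rw [Pi.single_eq_same, IsString.proj_coe, (F.str k).θ_sec _ _ hib, if_pos rfl] at h4
    exact h4
  · have key : ∀ n : ℕ, (wt F.T.phi.toLinearMap (E ⊓ M n) : ℚ) =
        (F.baseSlope k₀ + (F.deg k₀ k₁ - 1 + n)) * finrank ℚ_[p] ↥(E ⊓ M n) -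
          ∑ m ∈ Finset.range n, (finrank ℚ_[p] ↥(E ⊓ M m) : ℚ) := by
      intro n
      induction n with
      | zero => rw [hM0, inf_bot_eq, wt_bot, finrank_bot]; simp
      | succ n ih =>
        have h1 := F.wt_lev_step (k₀ := k₀) hE (F.deg k₀ k₁ - 1 + (n + 1 : ℕ)) s le_rfl
        rw [F.lev_last] at h1
        have h2 : F.deg k₀ k₁ - 1 + ((n + 1 : ℕ) : ℤ) - 1 = F.deg k₀ k₁ - 1 + n := by
          push_cast; ring
        rw [h2] at h1
        change (wt F.T.phi.toLinearMap (E ⊓ M (n + 1)) : ℚ) - wt F.T.phi.toLinearMap (E ⊓ M n) =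
          _ * ((finrank ℚ_[p] ↥(E ⊓ M (n + 1)) : ℚ) - finrank ℚ_[p] ↥(E ⊓ M n)) at h1
        rw [Finset.sum_range_succ]
        push_cast at h1 ⊢
        linear_combination h1 + ih
    have h1 := key n₀
    rw [hMn, inf_eq_left.2 hEB] at h1
    exact h1

theorem supp_inf_eq_bot {P Q : Fin s → Prop} (h : ∀ k, P k → ¬ Q k) :
    F.supp P ⊓ F.supp Q = ⊥ := by
  rw [eq_bot_iff]
  rintro x ⟨h1, h2⟩
  rw [Submodule.mem_bot]
  funext k
  by_cases hk : P k
  · exact h2 k (h k hk)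
  · exact h1 k hk

/-- `y i E` is the (suitably normalized) dimension of `Fil^i ∩ E` for a filtration with jumps
`j 0 < j 1 < ⋯` which is transverse to the good subspaces. -/
structure IsJump (u n : ℕ) (j : Fin n → ℤ) (y : ℤ → Submodule ℚ_[p] F.V → ℚ) : Prop where
  strictMono : StrictMono j
  sup : ∀ i E E', F.T.Stable E → F.T.Stable E' → y i E + y i E' ≤ y i (E ⊔ E') + y i (E ⊓ E')
  mono : ∀ i E E', F.T.Stable E → F.T.Stable E' → E ≤ E' → y i E ≤ y i E'
  codim : ∀ i E E', F.T.Stable E → F.T.Stable E' → E ≤ E' →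
    y i E' - y i E ≤ (finrank ℚ_[p] E' : ℚ) - finrank ℚ_[p] E
  good : ∀ i G, F.Good G →
    y i G = max ((finrank ℚ_[p] G : ℚ) - u * (Finset.univ.filter fun a => j a < i).card) 0
  dim : finrank ℚ_[p] F.V = u * n
  dvd : ∀ E, F.T.Stable E → u ∣ finrank ℚ_[p] E

variable {F} in
theorem IsJump.le {u n : ℕ} {j : Fin n → ℤ} {y : ℤ → Submodule ℚ_[p] F.V → ℚ}
    (hy : F.IsJump u n j y) (i : ℤ) {E G : Submodule ℚ_[p] F.V} (hE : F.T.Stable E)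
    (hG : F.Good G) : y i E ≤ finrank ℚ_[p] E - finrank ℚ_[p] ↥(E ⊓ G) +
      max ((finrank ℚ_[p] G : ℚ) - u * (Finset.univ.filter fun a => j a < i).card) 0 := by
  have h1 := hy.codim i _ _ (hE.inf hG.1) hE inf_le_left
  have h2 := hy.mono i _ _ (hE.inf hG.1) hG.1 inf_le_right
  rw [hy.good i G hG] at h2
  linarith

section

variable {F} {u n : ℕ} {j : Fin n → ℤ} {y : ℤ → Submodule ℚ_[p] F.V → ℚ}
  (hy : F.IsJump u n j y) {k₀ : Fin s} {A E : Submodule ℚ_[p] F.V} (hA : F.Good A)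
  (hAB : A ⊓ F.supp (F.rel k₀) = ⊥) (hE : F.T.Stable E) (hEB : E ≤ F.supp (F.rel k₀))
  (hEN : E.map F.NN ≤ E) {θ : ℚ}
  (hθ : (finrank ℚ_[p] E : ℚ) = θ * finrank ℚ_[p] (F.supp (F.rel k₀)))

theorem rel_closed (k₀ k k' : Fin s) (h : F.rel k k') : F.rel k₀ k ↔ F.rel k₀ k' :=
  ⟨fun h' => F.rel_trans h' h, fun h' => F.rel_trans h' (F.rel_symm h)⟩

include hAB in
theorem finrank_sup_of_le {G : Submodule ℚ_[p] F.V} (hG : G ≤ F.supp (F.rel k₀)) :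
    finrank ℚ_[p] ↥(G ⊔ A) = finrank ℚ_[p] G + finrank ℚ_[p] A := by
  have h := Submodule.finrank_sup_add_finrank_inf_eq G A
  have h1 : G ⊓ A = ⊥ := by
    rw [eq_bot_iff, ← hAB, inf_comm]
    exact inf_le_inf_left _ hG
  rw [h1, finrank_bot, add_zero] at h
  exact h

include hAB hEB in
theorem le_finrank_inf_sup {G : Submodule ℚ_[p] F.V} :
    finrank ℚ_[p] ↥(E ⊓ G) + finrank ℚ_[p] A ≤ finrank ℚ_[p] ↥((E ⊔ A) ⊓ (G ⊔ A)) := by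
  rw [← finrank_sup_of_le hAB (inf_le_left.trans hEB)]
  exact Submodule.finrank_mono (sup_le (inf_le_inf le_sup_left le_sup_left)
    (le_inf le_sup_right le_sup_right))

include hy hA hAB hE hEB hEN hθ in
theorem IsJump.block_le (i : ℤ) :
    y i (E ⊔ A) - (1 - θ) * y i A - θ * y i (F.supp (F.rel k₀) ⊔ A) ≤ 0 := by
  have hB : F.Good (F.supp (F.rel k₀)) := F.supp_good (rel_closed k₀)
  have hBA := finrank_sup_of_le hAB (le_refl (F.supp (F.rel k₀)))
  have hEA := finrank_sup_of_le hAB hEB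
  rw [hy.good i A hA, hy.good i _ (hB.sup hA), hBA]
  set q := (Finset.univ.filter fun a => j a < i).card
  by_cases h1 : u * q ≤ finrank ℚ_[p] A
  · have h2 := hy.le i (hE.sup hA.1) hA
    have h3 : (E ⊔ A) ⊓ A = A := inf_eq_right.2 le_sup_right
    rw [h3, hEA] at h2
    have h1' : (u * q : ℚ) ≤ finrank ℚ_[p] A := by exact_mod_cast h1
    rw [max_eq_left (by linarith)] at h2 ⊢
    push_cast at h2 ⊢
    have h4 : (0 : ℚ) ≤ finrank ℚ_[p] (F.supp (F.rel k₀)) := by positivity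
    rw [max_eq_left (by linarith)]
    nlinarith
  · by_cases h2 : finrank ℚ_[p] (F.supp (F.rel k₀)) + finrank ℚ_[p] A ≤ u * q
    · have h2' : (finrank ℚ_[p] (F.supp (F.rel k₀)) + finrank ℚ_[p] A : ℚ) ≤ u * q := by
        exact_mod_cast h2
      have h3 := hy.mono i _ _ (hE.sup hA.1) (hB.sup hA).1 (sup_le_sup_right hEB A)
      rw [hy.good i _ (hB.sup hA), hBA] at h3
      have h4 : (0 : ℚ) ≤ finrank ℚ_[p] (F.supp (F.rel k₀)) := by positivity
      push_cast at h3 ⊢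
      rw [max_eq_right (by linarith)] at h3 ⊢
      rw [max_eq_right (by linarith)]
      linarith
    · obtain ⟨G, hG, hGB, hb⟩ := F.exists_good (j := u * q - finrank ℚ_[p] A) hB
        (fun E hE hle => F.good_sup_map (rel_closed k₀) hE hle)
        (by
          rintro _ ⟨x, hx, rfl⟩ k hk
          rw [NN_apply, hx k hk, map_zero]) hE hEB hEN (by omega)
      have h3 := hy.le i (hE.sup hA.1) (hG.sup hA)
      rw [finrank_sup_of_le hAB hGB, hEA] at h3
      have h4 := le_finrank_inf_sup hAB hEB (G := G)
      have h1' : (finrank ℚ_[p] A : ℚ) < u * q := by exact_mod_cast not_le.1 h1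
      have h2' : (u * q : ℚ) < finrank ℚ_[p] (F.supp (F.rel k₀)) + finrank ℚ_[p] A := by
        exact_mod_cast not_le.1 h2
      have h4' : (finrank ℚ_[p] ↥(E ⊓ G) + finrank ℚ_[p] A : ℚ) ≤
        finrank ℚ_[p] ↥((E ⊔ A) ⊓ (G ⊔ A)) := by exact_mod_cast h4
      have hBpos : (0 : ℚ) < finrank ℚ_[p] (F.supp (F.rel k₀)) := by linarith
      have hc : ((u * q - finrank ℚ_[p] A : ℕ) : ℤ) = u * q - finrank ℚ_[p] A := by
        rw [Nat.cast_sub (by omega)]; push_cast; ring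
      rw [hc] at hb
      have hb' : ((u * q : ℚ) - finrank ℚ_[p] A) * finrank ℚ_[p] E ≤
          (finrank ℚ_[p] ↥(E ⊓ G) - max ((finrank ℚ_[p] G : ℚ) - (u * q - finrank ℚ_[p] A)) 0) *
            finrank ℚ_[p] (F.supp (F.rel k₀)) := by exact_mod_cast hb
      rw [hθ, ← mul_assoc] at hb'
      have h5 := le_of_mul_le_mul_right hb' hBpos
      have h6 : (finrank ℚ_[p] G : ℚ) - (u * q - finrank ℚ_[p] A) =
          finrank ℚ_[p] G + finrank ℚ_[p] A - u * q := by ring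
      rw [h6] at h5
      push_cast at h3 ⊢
      rw [max_eq_right (show (finrank ℚ_[p] A : ℚ) - u * q ≤ 0 by linarith),
        max_eq_left (show (0 : ℚ) ≤ finrank ℚ_[p] (F.supp (F.rel k₀)) + finrank ℚ_[p] A - u * q by
          linarith)]
      linarith

include hy hA hAB hE hEB hθ in
theorem IsJump.block_level_le {M : Submodule ℚ_[p] F.V} (hM : F.Good M)
    (hMB : M ≤ F.supp (F.rel k₀)) {a : Fin n}
    (ha : u * (a : ℕ) = finrank ℚ_[p] M + finrank ℚ_[p] A) :
    y (j a) (E ⊔ A) - (1 - θ) * y (j a) A - θ * y (j a) (F.supp (F.rel k₀) ⊔ A) ≤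
      θ * finrank ℚ_[p] M - finrank ℚ_[p] ↥(E ⊓ M) := by
  have hB : F.Good (F.supp (F.rel k₀)) := F.supp_good (rel_closed k₀)
  have hBA := finrank_sup_of_le hAB (le_refl (F.supp (F.rel k₀)))
  have hEA := finrank_sup_of_le hAB hEB
  have hMA := finrank_sup_of_le hAB hMB
  have hq : (Finset.univ.filter fun a' => j a' < j a).card = a := by
    have : (Finset.univ.filter fun a' => j a' < j a) = Finset.Iio a := by
      ext a'
      simp [hy.strictMono.lt_iff_lt]
    rw [this, Fin.card_Iio]
  have h1 := hy.le (j a) (hE.sup hA.1) (hM.sup hA)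
  have h2 := le_finrank_inf_sup hAB hEB (G := M)
  have h2' : (finrank ℚ_[p] ↥(E ⊓ M) + finrank ℚ_[p] A : ℚ) ≤
        finrank ℚ_[p] ↥((E ⊔ A) ⊓ (M ⊔ A)) := by exact_mod_cast h2
  have ha' : (u * (a : ℕ) : ℚ) = finrank ℚ_[p] M + finrank ℚ_[p] A := by exact_mod_cast ha
  have h3 : (finrank ℚ_[p] M : ℚ) ≤ finrank ℚ_[p] (F.supp (F.rel k₀)) := by
    exact_mod_cast Submodule.finrank_mono hMB
  rw [hq, hMA, hEA] at h1
  rw [hy.good _ A hA, hy.good _ _ (hB.sup hA), hBA, hq]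
  push_cast at h1 ⊢
  rw [ha'] at h1 ⊢
  have h4 : (0 : ℚ) ≤ finrank ℚ_[p] M := by positivity
  rw [max_eq_right (by linarith)] at h1
  rw [max_eq_right (by linarith), max_eq_left (by linarith)]
  linarith

include hy hA hAB hE hEB hEN hθ in
theorem IsJump.block_sum_le {lo hi : ℤ} (hj : ∀ a, j a ∈ Finset.Ioc lo hi) :
    ∑ i ∈ Finset.Ioc lo hi,
      (y i (E ⊔ A) - (1 - θ) * y i A - θ * y i (F.supp (F.rel k₀) ⊔ A)) ≤
      wt F.T.phi.toLinearMap E - θ * wt F.T.phi.toLinearMap (F.supp (F.rel k₀)) := by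
  classical
  obtain ⟨n₀, M, T, hMg, hMB, hMn, hMlt, hwt⟩ := F.exists_levels k₀
  have hB : F.Good (F.supp (F.rel k₀)) := F.supp_good (rel_closed k₀)
  have hBA := finrank_sup_of_le hAB (le_refl (F.supp (F.rel k₀)))
  have hlt : ∀ m m', m < m' → m' ≤ n₀ → finrank ℚ_[p] (M m) < finrank ℚ_[p] (M m') := by
    intro m m' h
    induction m', h using Nat.le_induction with
    | base => exact fun h => hMlt m (by omega)
    | succ m' _ ih => exact fun h => (ih (by omega)).trans (hMlt m' (by omega))
  have hidx : ∀ m : Fin n₀, ∃ a : Fin n,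
      u * (a : ℕ) = finrank ℚ_[p] (M m) + finrank ℚ_[p] A := by
    intro m
    obtain ⟨t, ht⟩ := hy.dvd _ (((hMg m).sup hA).1)
    rw [finrank_sup_of_le hAB (hMB m)] at ht
    have h1 := hlt m n₀ m.2 le_rfl
    have h2 : finrank ℚ_[p] ↥(F.supp (F.rel k₀) ⊔ A) ≤ finrank ℚ_[p] F.V :=
      Submodule.finrank_le _
    rw [hMn] at h1
    rw [hBA, hy.dim] at h2
    have h3 : u * t < u * n := by omega
    exact ⟨⟨t, lt_of_mul_lt_mul_left h3 (Nat.zero_le _)⟩, ht.symm⟩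
  choose a ha using hidx
  have hinj : Function.Injective fun m => j (a m) := by
    intro m m' h
    have h1 : a m = a m' := hy.strictMono.injective h
    have h2 := (ha m).symm.trans (h1 ▸ ha m')
    by_contra hne
    rcases lt_or_gt_of_ne (Fin.val_ne_of_ne hne) with h3 | h3
    · have := hlt m m' h3 m'.2.le; omega
    · have := hlt m' m h3 m.2.le; omega
  set t : ℤ → ℚ := fun i =>
    y i (E ⊔ A) - (1 - θ) * y i A - θ * y i (F.supp (F.rel k₀) ⊔ A) with ht
  have ht0 : ∀ i, t i ≤ 0 := hy.block_le hA hAB hE hEB hEN hθ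
  have hsub : Finset.univ.image (fun m => j (a m)) ⊆ Finset.Ioc lo hi := by
    intro i hi
    obtain ⟨m, -, rfl⟩ := Finset.mem_image.1 hi
    exact hj _
  have h1 : ∑ i ∈ Finset.Ioc lo hi, t i ≤ ∑ m : Fin n₀, t (j (a m)) := by
    rw [← Finset.sum_image (f := t) (hinj.injOn), ← Finset.sum_sdiff hsub]
    have : ∑ i ∈ Finset.Ioc lo hi \ Finset.univ.image (fun m => j (a m)), t i ≤ 0 :=
      Finset.sum_nonpos fun i _ => ht0 i
    linarith
  have h3 : ∑ m : Fin n₀, t (j (a m)) ≤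
      ∑ m : Fin n₀, (θ * finrank ℚ_[p] (M m) - finrank ℚ_[p] ↥(E ⊓ M m)) :=
    Finset.sum_le_sum fun m _ => hy.block_level_le hA hAB hE hEB hθ (hMg m) (hMB m) (ha m)
  refine h1.trans (h3.trans_eq ?_)
  have h4 : ∀ m : ℕ, F.supp (F.rel k₀) ⊓ M m = M m := fun m => inf_eq_right.2 (hMB m)
  have h5 : (wt F.T.phi.toLinearMap (F.supp (F.rel k₀)) : ℚ) =
      T * finrank ℚ_[p] (F.supp (F.rel k₀)) - ∑ m ∈ Finset.range n₀, (finrank ℚ_[p] (M m) : ℚ) := by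
    rw [hwt _ hB.1 le_rfl]
    congr 1
    exact Finset.sum_congr rfl fun m _ => congrArg (fun S : Submodule ℚ_[p] F.V =>
      (finrank ℚ_[p] S : ℚ)) (h4 m)
  rw [hwt E hE hEB, h5, hθ, Finset.sum_sub_distrib, ← Finset.mul_sum,
    Finset.sum_range, Finset.sum_range]
  ring

end

end Fam
end PG
end PhiN

namespace PhiN
namespace PG
namespace Fam

open Module

variable {p : ℕ} [Fact p.Prime] {Ω : Type*} {s : ℕ} {F : Fam.{v} ℚ_[p] Ω (p : ℚ_[p]) s}
  {ι : Type*} [Fintype ι]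

variable (F) in
/-- The (normalized) difference `t_H - t_N`. -/
def defect (y : ι → ℤ → Submodule ℚ_[p] F.V → ℚ) (lo hi : ℤ) (E : Submodule ℚ_[p] F.V) : ℚ :=
  ∑ σ, (lo * finrank ℚ_[p] E + ∑ i ∈ Finset.Ioc lo hi, y σ i E - wt F.T.phi.toLinearMap E)

variable {u n : ℕ} {j : ι → Fin n → ℤ} {y : ι → ℤ → Submodule ℚ_[p] F.V → ℚ}
  (hy : ∀ σ, F.IsJump u n (j σ) (y σ)) {lo hi : ℤ}

theorem wt_sup {E E' : Submodule ℚ_[p] F.V} (hE : F.T.Stable E) (hE' : F.T.Stable E') :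
    wt F.T.phi.toLinearMap (E ⊔ E') + wt F.T.phi.toLinearMap (E ⊓ E') =
      wt F.T.phi.toLinearMap E + wt F.T.phi.toLinearMap E' :=
  wt_sup_add_inf F.T.phi.injective hE.phi_mem hE'.phi_mem

include hy in
theorem defect_bot : F.defect y lo hi ⊥ = 0 := by
  refine Finset.sum_eq_zero fun σ _ => ?_
  rw [finrank_bot, Finset.sum_eq_zero, wt_bot]
  · simp
  · intro i _
    rw [(hy σ).good i ⊥ F.good_bot, finrank_bot]
    apply max_eq_right
    simp only [Nat.cast_zero, zero_sub, Left.neg_nonpos_iff]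
    positivity

include hy in
theorem defect_sup {E E' : Submodule ℚ_[p] F.V} (hE : F.T.Stable E) (hE' : F.T.Stable E') :
    F.defect y lo hi E + F.defect y lo hi E' ≤
      F.defect y lo hi (E ⊔ E') + F.defect y lo hi (E ⊓ E') := by
  simp only [defect, ← Finset.sum_add_distrib]
  refine Finset.sum_le_sum fun σ _ => ?_
  have h1 : (finrank ℚ_[p] ↥(E ⊔ E') : ℚ) + finrank ℚ_[p] ↥(E ⊓ E') =
      finrank ℚ_[p] E + finrank ℚ_[p] E' := by
    exact_mod_cast Submodule.finrank_sup_add_finrank_inf_eq E E'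
  have h2 : (wt F.T.phi.toLinearMap (E ⊔ E') : ℚ) + wt F.T.phi.toLinearMap (E ⊓ E') =
      wt F.T.phi.toLinearMap E + wt F.T.phi.toLinearMap E' := by exact_mod_cast wt_sup hE hE'
  have h3 : ∑ i ∈ Finset.Ioc lo hi, y σ i E + ∑ i ∈ Finset.Ioc lo hi, y σ i E' ≤
      ∑ i ∈ Finset.Ioc lo hi, y σ i (E ⊔ E') + ∑ i ∈ Finset.Ioc lo hi, y σ i (E ⊓ E') := by
    simp only [← Finset.sum_add_distrib]
    exact Finset.sum_le_sum fun i _ => (hy σ).sup i E E' hE hE'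
  linear_combination h3 - lo * h1 + h2

include hy in
theorem defect_block_le (hj : ∀ σ a, j σ a ∈ Finset.Ioc lo hi) {k₀ : Fin s}
    {A E : Submodule ℚ_[p] F.V} (hA : F.Good A)
    (hAB : A ⊓ F.supp (F.rel k₀) = ⊥) (hE : F.T.Stable E) (hEB : E ≤ F.supp (F.rel k₀))
    (hEN : E.map F.NN ≤ E) {θ : ℚ}
    (hθ : (finrank ℚ_[p] E : ℚ) = θ * finrank ℚ_[p] (F.supp (F.rel k₀))) :
    F.defect y lo hi (E ⊔ A) - F.defect y lo hi A ≤
      θ * (F.defect y lo hi (F.supp (F.rel k₀) ⊔ A) - F.defect y lo hi A) := by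
  simp only [defect, ← Finset.sum_sub_distrib, Finset.mul_sum]
  refine Finset.sum_le_sum fun σ _ => ?_
  have hB : F.Good (F.supp (F.rel k₀)) := F.supp_good (rel_closed k₀)
  have hw : ∀ G : Submodule ℚ_[p] F.V, F.T.Stable G → G ≤ F.supp (F.rel k₀) →
      (wt F.T.phi.toLinearMap (G ⊔ A) : ℚ) = wt F.T.phi.toLinearMap G +
        wt F.T.phi.toLinearMap A := by
    intro G hG hGB
    have h := wt_sup hG hA.1
    have h1 : G ⊓ A = ⊥ := by
      rw [eq_bot_iff, ← hAB, inf_comm]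
      exact inf_le_inf_left _ hGB
    rw [h1, wt_bot, add_zero] at h
    exact_mod_cast h
  have h1 := (hy σ).block_sum_le hA hAB hE hEB hEN hθ (hj σ)
  rw [Finset.sum_sub_distrib, Finset.sum_sub_distrib, ← Finset.mul_sum, ← Finset.mul_sum] at h1
  rw [hw E hE hEB, hw _ hB.1 le_rfl, finrank_sup_of_le hAB hEB,
    finrank_sup_of_le hAB (le_refl (F.supp (F.rel k₀)))]
  push_cast
  rw [hθ]
  linear_combination h1

theorem finrank_supp_pos (k₀ : Fin s) : 0 < finrank ℚ_[p] (F.supp (F.rel k₀)) := by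
  rw [Module.finrank_pos_iff_exists_ne_zero]
  obtain ⟨y, -, hy0⟩ := Submodule.exists_mem_ne_zero_of_ne_bot (F.str k₀).ker_ne
  refine ⟨⟨Pi.single k₀ y, fun k hk => Pi.single_eq_of_ne ?_ _⟩, fun h => hy0 ?_⟩
  · rintro rfl
    exact hk (.refl _)
  · have := congrFun (congrArg Subtype.val h) k₀
    simpa using this

include hy in
theorem defect_inf_supp_le (hj : ∀ σ a, j σ a ∈ Finset.Ioc lo hi)
    (hP : ∀ P : Fin s → Prop, (∀ k k', F.rel k k' → (P k ↔ P k')) →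
      F.defect y lo hi (F.supp P) ≤ 0)
    {E : Submodule ℚ_[p] F.V} (hE : F.T.Stable E) (hEN : E.map F.NN ≤ E) (m : ℕ) :
    ∀ P : Fin s → Prop, (∀ k k', F.rel k k' → (P k ↔ P k')) → {k | P k}.ncard ≤ m →
      ∀ t : ℚ, (∀ k, P k → t * finrank ℚ_[p] (F.supp (F.rel k)) ≤
        finrank ℚ_[p] ↥(E ⊓ F.supp (F.rel k))) →
      F.defect y lo hi (E ⊓ F.supp P) ≤ t * F.defect y lo hi (F.supp P) := by
  classical
  induction m with
  | zero =>
    intro P _ hm t _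
    have h0 : ∀ k, ¬ P k := fun k hk => by
      have := (Set.ncard_eq_zero (Set.toFinite _)).1 (Nat.le_zero.1 hm)
      exact (this ▸ (show k ∈ {k | P k} from hk) : k ∈ (∅ : Set (Fin s)))
    have h1 : F.supp P = ⊥ := by
      rw [eq_bot_iff]
      exact fun x hx => funext fun k => hx k (h0 k)
    rw [h1, inf_bot_eq, defect_bot hy, mul_zero]
  | succ m ih =>
    intro P hPc hm t ht
    by_cases hne : ∃ k, P k
    swap
    · exact ih P hPc (by
        have : {k | P k} = ∅ := Set.eq_empty_of_forall_notMem fun k hk => hne ⟨k, hk⟩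
        rw [this, Set.ncard_empty]; exact Nat.zero_le _) t ht
    obtain ⟨k, hk⟩ := hne
    obtain ⟨k₀, hk₀, hmin⟩ := Finset.exists_min_image (Finset.univ.filter P)
      (fun k => (finrank ℚ_[p] ↥(E ⊓ F.supp (F.rel k)) : ℚ) / finrank ℚ_[p] (F.supp (F.rel k)))
      ⟨k, by simpa using hk⟩
    simp only [Finset.mem_filter, Finset.mem_univ, true_and] at hk₀ hmin
    set θ : ℚ := (finrank ℚ_[p] ↥(E ⊓ F.supp (F.rel k₀)) : ℚ) /
      finrank ℚ_[p] (F.supp (F.rel k₀)) with hθ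
    have hpos : ∀ k, (0 : ℚ) < finrank ℚ_[p] (F.supp (F.rel k)) := fun k => by
      exact_mod_cast finrank_supp_pos k
    have htθ : t ≤ θ := (le_div_iff₀ (hpos k₀)).2 (ht k₀ hk₀)
    let P' : Fin s → Prop := fun k => P k ∧ ¬ F.rel k₀ k
    have hPc' : ∀ k k', F.rel k k' → (P' k ↔ P' k') := fun k k' h =>
      and_congr (hPc k k' h) (not_congr (rel_closed k₀ k k' h))
    have hA : F.Good (F.supp P') := F.supp_good hPc'
    have hB : F.Good (F.supp (F.rel k₀)) := F.supp_good (rel_closed k₀)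
    have hPs : F.T.Stable (F.supp P) := (F.supp_good hPc).1
    have hAB : F.supp P' ⊓ F.supp (F.rel k₀) = ⊥ := supp_inf_eq_bot F fun k h => h.2
    have hle : F.supp (F.rel k₀) ≤ F.supp P := fun x hx k hk => hx k fun h => hk
      ((hPc _ _ h).1 hk₀)
    have hle' : F.supp P' ≤ F.supp P := fun x hx k hk => hx k fun h => hk h.1
    have hdec : ∀ x ∈ F.supp P, (fun k => if F.rel k₀ k then x k else 0) ∈ F.supp (F.rel k₀) ∧
        x - (fun k => if F.rel k₀ k then x k else 0) ∈ F.supp P' := by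
      intro x hx
      refine ⟨fun k hk => if_neg hk, fun k hk => ?_⟩
      rw [Pi.sub_apply]
      by_cases h : F.rel k₀ k
      · rw [if_pos h, sub_self]
      · rw [if_neg h, sub_zero]
        exact hx k fun hk' => hk ⟨hk', h⟩
    have h1 : ∀ x ∈ E, (fun k => if F.rel k₀ k then x k else 0) ∈ E := fun x hx =>
      F.block_mem (rel_closed k₀) hE hx
    have e1 : E ⊓ F.supp P ⊔ F.supp P' = E ⊓ F.supp (F.rel k₀) ⊔ F.supp P' := by
      apply le_antisymm
      · refine sup_le ?_ le_sup_right
        rintro x ⟨hx, hxP⟩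
        obtain ⟨a, b⟩ := hdec x hxP
        exact Submodule.mem_sup.2 ⟨_, ⟨h1 x hx, a⟩, _, b, add_sub_cancel _ _⟩
      · exact sup_le_sup_right (inf_le_inf_left _ hle) _
    have e2 : E ⊓ F.supp P ⊓ F.supp P' = E ⊓ F.supp P' := by
      rw [inf_assoc, inf_eq_right.2 hle']
    have e3 : F.supp (F.rel k₀) ⊔ F.supp P' = F.supp P := by
      apply le_antisymm (sup_le hle hle')
      intro x hx
      obtain ⟨a, b⟩ := hdec x hx
      exact Submodule.mem_sup.2 ⟨_, a, _, b, add_sub_cancel _ _⟩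
    have hEB : (E ⊓ F.supp (F.rel k₀)).map F.NN ≤ E ⊓ F.supp (F.rel k₀) := by
      rintro _ ⟨x, ⟨hx, hxk⟩, rfl⟩
      refine ⟨hEN (Submodule.mem_map_of_mem hx), fun k hk => ?_⟩
      rw [NN_apply, hxk k hk, map_zero]
    have s1 := defect_sup hy (lo := lo) (hi := hi) (hE.inf hPs) hA.1
    have s2 := defect_block_le hy hj hA hAB (hE.inf hB.1) inf_le_right hEB
      (θ := θ) (div_mul_cancel₀ _ (hpos k₀).ne').symm
    have s3 := ih P' hPc' (by
      have h2 : {k | P' k} ⊂ {k | P k} := by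
        refine ⟨fun k hk => hk.1, fun h => ?_⟩
        exact (h (show k₀ ∈ {k | P k} from hk₀)).2 (.refl _)
      have := Set.ncard_lt_ncard h2
      omega) θ fun k hk => (le_div_iff₀ (hpos k)).1 (hmin k hk.1)
    have s4 := hP P hPc
    rw [e1, e2] at s1
    rw [e3] at s2
    nlinarith [mul_nonneg (sub_nonneg.2 htθ) (neg_nonneg.2 s4)]

include hy in
theorem defect_nonpos (hj : ∀ σ a, j σ a ∈ Finset.Ioc lo hi)
    (hP : ∀ P : Fin s → Prop, (∀ k k', F.rel k k' → (P k ↔ P k')) →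
      F.defect y lo hi (F.supp P) ≤ 0)
    {E : Submodule ℚ_[p] F.V} (hE : F.T.Stable E) (hEN : E.map F.NN ≤ E) :
    F.defect y lo hi E ≤ 0 := by
  have h := defect_inf_supp_le hy hj hP hE hEN s (fun _ => True) (fun _ _ _ => Iff.rfl)
    ((Set.ncard_le_card _).trans (by simp)) 0 (fun k _ => by rw [zero_mul]; positivity)
  have h1 : F.supp (fun _ => True) = ⊤ := eq_top_iff.2 fun x _ k hk => absurd trivial hk
  rw [h1, inf_top_eq, zero_mul] at h
  exact h

end Fam
end PG
end PhiN

namespace PhiN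

theorem sum_lt_convex {n : ℕ} {g : Fin n → ℚ} (hg : Monotone g) {a b c : ℕ} (hab : a ≤ b)
    (hbc : b ≤ c) (hc : c ≤ n) :
    (c - a : ℚ) * ∑ i : Fin n with i.val < b, g i ≤
      (c - b : ℚ) * ∑ i : Fin n with i.val < a, g i +
        (b - a : ℚ) * ∑ i : Fin n with i.val < c, g i := by
  rcases hbc.eq_or_lt with rfl | hlt
  · linarith
  have hb : b < n := hlt.trans_le hc
  have key : ∀ x y : ℕ, x ≤ y → y ≤ n →
      ∑ i : Fin n with i.val < y, g i - ∑ i : Fin n with i.val < x, g i =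
        ∑ i : Fin n with x ≤ i.val ∧ i.val < y, g i := by
    intro x y hxy _
    rw [sub_eq_iff_eq_add, ← Finset.sum_union]
    · congr 1
      ext i
      simp only [Finset.mem_filter, Finset.mem_univ, true_and, Finset.mem_union]
      omega
    · rw [Finset.disjoint_left]
      intro i hi hi'
      simp only [Finset.mem_filter, Finset.mem_univ, true_and] at hi hi'
      omega
  have hcard : ∀ x y : ℕ, x ≤ y → y ≤ n →
      ((Finset.univ.filter fun i : Fin n => x ≤ i.val ∧ i.val < y).card : ℚ) = y - x := by
    intro x y hxy hy
    have h : (Finset.univ.filter fun i : Fin n => x ≤ i.val ∧ i.val < y).card = y - x := by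
      rw [← Finset.card_map Fin.valEmbedding, ← Nat.card_Ico]
      congr 1
      ext i
      simp only [Finset.mem_map, Finset.mem_filter, Finset.mem_univ, true_and,
        Fin.valEmbedding_apply, Finset.mem_Ico]
      exact ⟨fun ⟨i', h, e⟩ => e ▸ h, fun h => ⟨⟨i, by omega⟩, h, rfl⟩⟩
    rw [h, Nat.cast_sub hxy]
  have h1 : ∑ i : Fin n with a ≤ i.val ∧ i.val < b, g i ≤ (b - a : ℚ) * g ⟨b, hb⟩ := by
    rw [← hcard a b hab (by omega), ← nsmul_eq_mul]
    refine Finset.sum_le_card_nsmul _ _ _ fun i hi => hg ?_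
    simp only [Finset.mem_filter, Finset.mem_univ, true_and] at hi
    exact Fin.mk_le_mk.2 hi.2.le
  have h2 : (c - b : ℚ) * g ⟨b, hb⟩ ≤ ∑ i : Fin n with b ≤ i.val ∧ i.val < c, g i := by
    rw [← hcard b c hlt.le hc, ← nsmul_eq_mul]
    refine Finset.card_nsmul_le_sum _ _ _ fun i hi => hg ?_
    simp only [Finset.mem_filter, Finset.mem_univ, true_and] at hi
    exact Fin.mk_le_mk.2 hi.1
  rw [← key a b hab (by omega)] at h1
  rw [← key b c hlt.le hc] at h2
  have h3 : (0 : ℚ) ≤ b - a := by rw [sub_nonneg]; exact_mod_cast hab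
  have h4 : (0 : ℚ) ≤ c - b := by rw [sub_nonneg]; exact_mod_cast hlt.le
  nlinarith [mul_le_mul_of_nonneg_left h1 h4, mul_le_mul_of_nonneg_left h2 h3]

theorem exists_lt_iff_of_down {s : ℕ} (Q : Fin s → Prop) (h : ∀ k k', k' ≤ k → Q k → Q k') :
    ∃ m ≤ s, ∀ k, Q k ↔ k.val < m := by
  classical
  by_cases hQ : ∃ m : ℕ, ∃ hm : m < s, ¬ Q ⟨m, hm⟩
  · obtain ⟨hm, hQm⟩ := Nat.find_spec hQ
    refine ⟨Nat.find hQ, hm.le, fun k => ⟨fun hk => ?_, fun hk => ?_⟩⟩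
    · by_contra hle
      exact hQm (h k _ (Fin.mk_le_of_le_val (not_lt.1 hle)) hk)
    · by_contra hk'
      exact Nat.find_min hQ hk ⟨k.2, hk'⟩
  · push Not at hQ
    exact ⟨s, le_rfl, fun k => ⟨fun _ => k.2, fun _ => hQ k k.2⟩⟩

open Classical in
/-- A combinatorial lemma on blocks of positive integers `r k`, with weights `w k`, the blocks
being ordered by slope: bounds for the initial segments imply bounds for all unions of blocks. -/
theorem sum_le_of_prefix {s n : ℕ} {R : Fin s → Fin s → Prop} (hR : Equivalence R)
    (hint : ∀ k₁ k₂ k₃, k₁ ≤ k₂ → k₂ ≤ k₃ → R k₁ k₃ → R k₁ k₂) {r : Fin s → ℕ}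
    (hr : ∀ k, 0 < r k) (hn : ∑ k, r k = n) {w : Fin s → ℚ}
    (hslope : ∀ k₁ k₂, ¬ R k₁ k₂ → (∑ k with R k₁ k, w k) / (∑ k with R k₁ k, (r k : ℚ)) <
      (∑ k with R k₂ k, w k) / (∑ k with R k₂ k, (r k : ℚ)) → k₁ < k₂)
    {g : Fin n → ℚ} (hg : Monotone g)
    (hpre : ∀ m ≤ s, ∑ a : Fin n with a.val < ∑ k : Fin s with k.val < m, r k, g a ≤
      ∑ k : Fin s with k.val < m, w k)
    (P : Fin s → Prop) (hP : ∀ k k', R k k' → (P k ↔ P k')) :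
    ∑ a : Fin n with a.val < ∑ k : Fin s with P k, r k, g a ≤ ∑ k : Fin s with P k, w k := by
  set μ : Fin s → ℚ := fun k₁ => (∑ k with R k₁ k, w k) / (∑ k with R k₁ k, (r k : ℚ)) with hμ
  have hμR : ∀ k k', R k k' → μ k = μ k' := by
    intro k k' h
    have : (Finset.univ.filter (R k)) = Finset.univ.filter (R k') := by
      ext x
      simp only [Finset.mem_filter, Finset.mem_univ, true_and]
      exact ⟨fun h' => hR.trans (hR.symm h) h', fun h' => hR.trans h h'⟩
    simp only [hμ, this]
  have hμm : Monotone μ := by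
    intro k k' h
    by_cases hkk : R k k'
    · exact (hμR k k' hkk).le
    · by_contra hlt
      exact absurd (hslope k' k (fun h' => hkk (hR.symm h')) (not_le.1 hlt)) (not_lt.2 h)
  -- the weight of a union of blocks
  have hw : ∀ (Q : Fin s → Prop), (∀ k k', R k k' → (Q k ↔ Q k')) →
      ∑ k with Q k, w k = ∑ k with Q k, μ k * r k := by
    intro Q hQ
    have hpos : ∀ k, (0 : ℚ) < ∑ i with R k i, (r i : ℚ) := fun k =>
      Finset.sum_pos (fun i _ => by exact_mod_cast hr i) ⟨k, by simpa using hR.refl k⟩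
    have h1 : ∀ k, ∑ i with R k i, μ i * r i = ∑ i with R k i, w i := by
      intro k
      have : ∀ i ∈ Finset.univ.filter (R k), μ i * r i = μ k * r i := fun i hi => by
        rw [hμR k i (by simpa using hi)]
      rw [Finset.sum_congr rfl this, ← Finset.mul_sum]
      exact div_mul_cancel₀ _ (hpos k).ne'
    let S : Setoid (Fin s) := ⟨R, hR⟩
    have h2 : ∀ f : Fin s → ℚ, ∑ k with Q k, f k =
        ∑ q : Quotient S, ∑ k with Q k ∧ Quotient.mk S k = q, f k := by
      intro f
      rw [← Finset.sum_fiberwise (s := Finset.univ.filter Q) (g := Quotient.mk S)]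
      simp only [Finset.filter_filter]
    rw [h2, h2]
    refine Finset.sum_congr rfl fun q _ => ?_
    obtain ⟨k, rfl⟩ := Quotient.exists_rep q
    by_cases hk : Q k
    · have h3 : (Finset.univ.filter fun i => Q i ∧ Quotient.mk S i = Quotient.mk S k) =
          Finset.univ.filter (R k) := by
        ext i
        simp only [Finset.mem_filter, Finset.mem_univ, true_and]
        constructor
        · exact fun h => hR.symm (Quotient.exact h.2)
        · exact fun h => ⟨(hQ k i h).1 hk, Quotient.sound (hR.symm h)⟩
      rw [h3, h1]
    · have h3 : (Finset.univ.filter fun i => Q i ∧ Quotient.mk S i = Quotient.mk S k) = ∅ := by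
        ext i
        simp only [Finset.mem_filter, Finset.mem_univ, true_and, Finset.notMem_empty, iff_false]
        exact fun h => hk ((hQ k i (hR.symm (Quotient.exact h.2))).2 h.1)
      rw [h3, Finset.sum_empty, Finset.sum_empty]
  have hdown : ∀ (Q : Fin s → Prop), (∀ k k', k' ≤ k → Q k → Q k') →
      ∑ a : Fin n with a.val < ∑ k : Fin s with Q k, r k, g a ≤ ∑ k : Fin s with Q k, w k := by
    intro Q hQ
    obtain ⟨m, hm, h⟩ := exists_lt_iff_of_down Q hQ
    simp only [h]
    exact hpre m hm
  set ν := ∑ k : Fin s with P k, r k with hν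
  -- the block in which `ν` lies
  by_cases h0 : ∃ k, P k
  swap
  · push Not at h0
    exact hdown P fun k _ _ h => absurd h (h0 k)
  have hsn : 0 < s := h0.elim fun k _ => k.pos
  have hex : ∃ m : ℕ, ∃ hm : m < s, ν ≤ ∑ k : Fin s with k.val < m + 1, r k := by
    refine ⟨s - 1, by omega, ?_⟩
    refine Finset.sum_le_sum_of_subset fun k _ => ?_
    simp only [Finset.mem_filter, Finset.mem_univ, true_and]
    omega
  obtain ⟨hm, hle⟩ := Nat.find_spec hex
  have hge : ∑ k : Fin s with k.val < Nat.find hex, r k ≤ ν := by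
    rcases Nat.eq_zero_or_pos (Nat.find hex) with h | h
    · rw [h]; simp
    · have h1 := Nat.find_min hex (m := Nat.find hex - 1) (by omega)
      push Not at h1
      have h2 := h1 (by omega)
      rw [Nat.sub_add_cancel h] at h2
      exact h2.le
  set k₀ : Fin s := ⟨Nat.find hex, hm⟩ with hk₀
  obtain ⟨Q₀, e₀⟩ : ∃ Q : Fin s → Prop, ∀ k, Q k ↔ k < k₀ ∧ ¬ R k₀ k := ⟨_, fun _ => Iff.rfl⟩
  obtain ⟨Q₁, e₁⟩ : ∃ Q : Fin s → Prop, ∀ k, Q k ↔ k < k₀ ∨ R k₀ k := ⟨_, fun _ => Iff.rfl⟩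
  have hQ₀ : ∀ k k', k' ≤ k → Q₀ k → Q₀ k' := by
    simp only [e₀]
    exact fun k k' h hk => ⟨h.trans_lt hk.1, fun h' =>
      hk.2 (hR.trans h' (hint k' k k₀ h hk.1.le (hR.symm h')))⟩
  have hQ₁ : ∀ k k', k' ≤ k → Q₁ k → Q₁ k' := by
    simp only [e₁]
    intro k k' h hk
    by_cases hlt : k' < k₀
    · exact Or.inl hlt
    · rcases hk with hk | hk
      · exact absurd (h.trans_lt hk) hlt
      · exact Or.inr (hint k₀ k' k (not_lt.1 hlt) h hk)
  have c₀ : ∀ k k', R k k' → (Q₀ k ↔ Q₀ k') := by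
    have : ∀ k k', R k k' → Q₀ k → Q₀ k' := fun k k' h hk => by
      rw [e₀] at hk ⊢
      have h1 : ¬ R k₀ k' := fun h' => hk.2 (hR.trans h' (hR.symm h))
      refine ⟨?_, h1⟩
      by_contra hlt
      exact hk.2 (hR.symm (hint k k₀ k' hk.1.le (not_lt.1 hlt) h))
    exact fun k k' h => ⟨this k k' h, this k' k (hR.symm h)⟩
  have c₁ : ∀ k k', R k k' → (Q₁ k ↔ Q₁ k') := by
    have e : ∀ k, Q₁ k ↔ Q₀ k ∨ R k₀ k := fun k => by
      by_cases h : R k₀ k <;> simp [e₀, e₁, h]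
    intro k k' h
    rw [e, e, c₀ k k' h]
    exact or_congr Iff.rfl ⟨fun h' => hR.trans h' h, fun h' => hR.trans h' (hR.symm h)⟩
  have g₀ := hdown Q₀ hQ₀
  have g₁ := hdown Q₁ hQ₁
  set n₀ := ∑ k : Fin s with Q₀ k, r k with hn₀
  set n₁ := ∑ k : Fin s with Q₁ k, r k with hn₁
  have l₀ : n₀ ≤ ν := le_trans (Finset.sum_le_sum_of_subset fun k hk => by
    simp only [Finset.mem_filter, Finset.mem_univ, true_and, e₀] at hk ⊢
    exact hk.1) hge
  have l₁ : ν ≤ n₁ := hle.trans (Finset.sum_le_sum_of_subset fun k hk => by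
    simp only [Finset.mem_filter, Finset.mem_univ, true_and, e₁] at hk ⊢
    rcases (Nat.lt_succ_iff.1 hk).lt_or_eq with h | h
    · exact Or.inl h
    · have : k = k₀ := Fin.ext h
      exact Or.inr (this ▸ hR.refl _))
  have l₂ : n₁ ≤ n := hn ▸ Finset.sum_le_sum_of_subset (Finset.filter_subset _ _)
  have hsplit : ∀ f : Fin s → ℚ, ∑ k with Q₁ k, f k = ∑ k with Q₀ k, f k + ∑ k with R k₀ k, f k := by
    intro f
    rw [← Finset.sum_union]
    · congr 1
      ext k
      simp only [Finset.mem_filter, Finset.mem_univ, true_and, Finset.mem_union, e₀, e₁]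
      tauto
    · rw [Finset.disjoint_left]
      intro k hk hk'
      simp only [Finset.mem_filter, Finset.mem_univ, true_and, e₀] at hk hk'
      exact hk.2 hk'
  have hr1 : (n₁ : ℚ) = n₀ + ∑ k with R k₀ k, (r k : ℚ) := by
    rw [hn₁, hn₀]; push_cast; exact hsplit _
  have hpos : (0 : ℚ) < ∑ i with R k₀ i, (r i : ℚ) :=
    Finset.sum_pos (fun i _ => by exact_mod_cast hr i) ⟨k₀, by simpa using hR.refl k₀⟩
  have hw1 : ∑ k with Q₁ k, w k = ∑ k with Q₀ k, w k + μ k₀ * ∑ k with R k₀ k, (r k : ℚ) := by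
    rw [hsplit]
    congr 1
    exact (div_mul_cancel₀ _ hpos.ne').symm
  have hwP : ∑ k with Q₀ k, w k + μ k₀ * (ν - n₀) ≤ ∑ k with P k, w k := by
    rw [hw Q₀ c₀, hw P hP, hν, hn₀]
    push_cast
    simp only [Finset.sum_filter, ← Finset.sum_sub_distrib, Finset.mul_sum,
      ← Finset.sum_add_distrib]
    refine Finset.sum_le_sum fun k _ => ?_
    have hrk : (0 : ℚ) ≤ r k := by positivity
    by_cases hk : Q₀ k
    · have h1 := mul_le_mul_of_nonneg_right (hμm ((e₀ k).1 hk).1.le) hrk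
      by_cases hk' : P k
      · rw [if_pos hk, if_pos hk', if_pos hk, if_pos hk']
        linarith
      · rw [if_pos hk, if_neg hk', if_pos hk, if_neg hk']
        linarith
    · have h1 : μ k₀ * r k ≤ μ k * r k := by
        apply mul_le_mul_of_nonneg_right _ hrk
        by_cases hRk : R k₀ k
        · exact (hμR _ _ hRk).le
        · exact hμm (not_lt.1 fun h => hk ((e₀ k).2 ⟨h, hRk⟩))
      by_cases hk' : P k
      · rw [if_neg hk, if_pos hk', if_neg hk, if_pos hk']
        linarith
      · rw [if_neg hk, if_neg hk', if_neg hk, if_neg hk']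
        linarith
  have hconv := sum_lt_convex hg l₀ l₁ l₂
  have d0 : (0 : ℚ) ≤ ν - n₀ := by rw [sub_nonneg]; exact_mod_cast l₀
  have d1 : (0 : ℚ) ≤ n₁ - ν := by rw [sub_nonneg]; exact_mod_cast l₁
  have h5 : ((n₁ : ℚ) - n₀) * ∑ a : Fin n with a.val < ν, g a ≤
      (n₁ - n₀) * ∑ k with P k, w k := by
    rw [hw1] at g₁
    have h6 := mul_le_mul_of_nonneg_left g₀ d1
    have h7 := mul_le_mul_of_nonneg_left g₁ d0
    have h8 : (n₁ : ℚ) - n₀ = ∑ k with R k₀ k, (r k : ℚ) := by rw [hr1]; ring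
    have h9 := mul_le_mul_of_nonneg_left hwP hpos.le
    rw [← h8] at h7 h9
    nlinarith
  exact le_of_mul_le_mul_left h5 (by rw [hr1]; linarith)

end PhiN

namespace PhiN

open Module

theorem trace_restrictScalars (R : Type*) {S A : Type*} [Field R] [Field S] [Algebra R S]
    [FiniteDimensional R S] [AddCommGroup A] [Module R A] [Module S A] [IsScalarTower R S A]
    [FiniteDimensional S A] (f : A →ₗ[S] A) :
    LinearMap.trace R A (f.restrictScalars R) = Algebra.trace R S (LinearMap.trace S A f) := by
  classical
  let bS := finBasis R S
  let bA := finBasis S A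
  rw [LinearMap.trace_eq_matrix_trace R (bS.smulTower' bA), LinearMap.trace_eq_matrix_trace S bA,
    Matrix.trace, Matrix.trace, map_sum]
  rw [Fintype.sum_prod_type]
  refine Finset.sum_congr rfl fun i _ => ?_
  rw [Algebra.trace_eq_matrix_trace bS, Matrix.trace]
  refine Finset.sum_congr rfl fun t _ => ?_
  simp only [Matrix.diag_apply, LinearMap.toMatrix_apply, Algebra.leftMulMatrix_eq_repr_mul]
  simp [Basis.smulTower'_repr, Basis.smulTower'_apply, mul_comm]

section Idempotents

variable (k F K : Type*) [Field k] [Field F] [Field K] [Algebra k F] [Algebra k K]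

/-- The evaluation `l ⊗ x ↦ (σ l * x)_σ`. -/
def evHom : F ⊗[k] K →ₐ[k] ((F →ₐ[k] K) → K) :=
  Algebra.TensorProduct.lift (AlgHom.pi fun σ => σ)
    (AlgHom.pi fun _ => AlgHom.id k K) fun _ _ => mul_comm _ _

variable {k F K} in
theorem evHom_tmul (l : F) (x : K) (σ : F →ₐ[k] K) : evHom k F K (l ⊗ₜ x) σ = σ l * x := rfl

variable [FiniteDimensional k F] [FiniteDimensional k K]

theorem evHom_surjective : Function.Surjective (evHom k F K) := by
  classical
  have hli := linearIndependent_algHom_toLinearMap k F K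
  have key : Submodule.span K (Set.range fun l : F => fun σ : F →ₐ[k] K => σ l) = ⊤ := by
    by_contra hne
    obtain ⟨f, hf0, hf⟩ := Submodule.exists_dual_map_eq_bot_of_lt_top (lt_top_iff_ne_top.2 hne)
      inferInstance
    apply hf0
    have h1 : ∀ l : F, f (fun σ => σ l) = 0 := fun l => by
      have : f (fun σ => σ l) ∈ (Submodule.span K (Set.range fun l : F =>
          fun σ : F →ₐ[k] K => σ l)).map f :=
        Submodule.mem_map_of_mem (Submodule.subset_span ⟨l, rfl⟩)
      rwa [hf] at this
    have h2 : ∀ x, f x = ∑ σ, x σ * f (Pi.single σ 1) := fun x => by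
      conv_lhs => rw [← Finset.univ_sum_single x]
      rw [map_sum]
      refine Finset.sum_congr rfl fun σ _ => ?_
      rw [← smul_eq_mul, ← map_smul, ← Pi.single_smul, smul_eq_mul, mul_one]
    have h3 := Fintype.linearIndependent_iff.1 hli (fun σ => f (Pi.single σ 1))
      (LinearMap.ext fun l => by
        rw [LinearMap.sum_apply, LinearMap.zero_apply, ← h1 l, h2]
        exact Finset.sum_congr rfl fun σ _ => mul_comm _ _)
    refine LinearMap.ext fun x => ?_
    rw [h2, LinearMap.zero_apply]
    exact Finset.sum_eq_zero fun σ _ => by rw [h3, mul_zero]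
  intro y
  have hy : y ∈ Submodule.span K (Set.range fun l : F => fun σ : F →ₐ[k] K => σ l) := by
    rw [key]; trivial
  induction hy using Submodule.span_induction with
  | mem y hy =>
    obtain ⟨l, rfl⟩ := hy
    exact ⟨l ⊗ₜ 1, funext fun σ => by rw [evHom_tmul, mul_one]⟩
  | zero => exact ⟨0, map_zero _⟩
  | add y z _ _ hy hz =>
    obtain ⟨a, rfl⟩ := hy
    obtain ⟨b, rfl⟩ := hz
    exact ⟨a + b, map_add _ _ _⟩
  | smul c y _ hy =>
    obtain ⟨a, rfl⟩ := hy
    refine ⟨(1 ⊗ₜ c) * a, ?_⟩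
    rw [map_mul]
    funext σ
    rw [Pi.mul_apply, evHom_tmul, map_one, one_mul]
    rfl

/-- `K` contains all the conjugates of `F`. -/
def Splits : Prop := Nat.card (F →ₐ[k] K) = finrank k F

variable {k F K}

theorem evHom_injective (h : Splits k F K) : Function.Injective (evHom k F K) := by
  have h1 : finrank k (F ⊗[k] K) = finrank k ((F →ₐ[k] K) → K) := by
    rw [finrank_tensorProduct, finrank_pi_fintype, Finset.sum_const, smul_eq_mul,
      Finset.card_univ, ← Nat.card_eq_fintype_card, h]
  exact (LinearMap.injective_iff_surjective_of_finrank_eq_finrank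
    (f := (evHom k F K).toLinearMap) h1).2 (evHom_surjective k F K)

open Classical in
/-- The idempotent of `F ⊗ K` which cuts out the part where `F` acts through `σ`. -/
def idem (σ : F →ₐ[k] K) : F ⊗[k] K := (evHom_surjective k F K (Pi.single σ 1)).choose

open Classical in
theorem evHom_idem (σ : F →ₐ[k] K) : evHom k F K (idem σ) = Pi.single σ 1 :=
  (evHom_surjective k F K (Pi.single σ 1)).choose_spec

theorem tmul_one_mul_idem (h : Splits k F K) (σ : F →ₐ[k] K) (l : F) :
    (l ⊗ₜ 1) * idem σ = (1 ⊗ₜ σ l) * idem σ := by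
  classical
  apply evHom_injective h
  rw [map_mul, map_mul, evHom_idem]
  funext τ
  rw [Pi.mul_apply, Pi.mul_apply, evHom_tmul, evHom_tmul]
  by_cases hτ : τ = σ
  · subst hτ; simp
  · rw [Pi.single_eq_of_ne hτ, mul_zero, mul_zero]

theorem sum_idem (h : Splits k F K) : ∑ σ : F →ₐ[k] K, idem σ = 1 := by
  classical
  apply evHom_injective h
  rw [map_sum, map_one]
  simp only [evHom_idem]
  exact Finset.univ_sum_single 1

theorem trace_eq_sum [Algebra.IsSeparable k F] (h : Splits k F K) (l : F) :
    algebraMap k K (Algebra.trace k F l) = ∑ σ : F →ₐ[k] K, σ l := by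
  apply (algebraMap K (AlgebraicClosure K)).injective
  rw [← IsScalarTower.algebraMap_apply, trace_eq_sum_embeddings (AlgebraicClosure K), map_sum]
  symm
  let i : (F →ₐ[k] K) → (F →ₐ[k] AlgebraicClosure K) := fun σ =>
    (IsScalarTower.toAlgHom k K (AlgebraicClosure K)).comp σ
  have hi : Function.Injective i := fun σ τ hστ => AlgHom.ext fun x =>
    (algebraMap K (AlgebraicClosure K)).injective (DFunLike.congr_fun hστ x)
  have hb : Function.Bijective i := by
    rw [Fintype.bijective_iff_injective_and_card]
    refine ⟨hi, ?_⟩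
    rw [show Fintype.card (F →ₐ[k] AlgebraicClosure K) = finrank k F from
      AlgHom.card k F (AlgebraicClosure K), ← Nat.card_eq_fintype_card]
    exact h
  exact Fintype.sum_bijective i hb _ _ fun σ => rfl

/-- `l ⊗ x ↦ Tr(l) Tr(x)`. -/
def trTr : F ⊗[k] K →ₗ[k] k :=
  TensorProduct.lift ((LinearMap.mul k k).compl₁₂ (Algebra.trace k F) (Algebra.trace k K))

theorem trTr_tmul (l : F) (x : K) :
    trTr (l ⊗ₜ[k] x) = Algebra.trace k F l * Algebra.trace k K x := rfl

theorem trTr_idem [Algebra.IsSeparable k F] (h : Splits k F K) (σ : F →ₐ[k] K) :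
    trTr (idem σ) = (finrank k K : k) := by
  classical
  have key : (trTr : F ⊗[k] K →ₗ[k] k) = Algebra.trace k K ∘ₗ
      (∑ τ : F →ₐ[k] K, LinearMap.proj τ) ∘ₗ (evHom k F K).toLinearMap := by
    refine TensorProduct.ext' fun l x => ?_
    rw [trTr_tmul, LinearMap.comp_apply, LinearMap.comp_apply, LinearMap.sum_apply]
    simp only [LinearMap.proj_apply, AlgHom.toLinearMap_apply, evHom_tmul]
    rw [← Finset.sum_mul, ← trace_eq_sum h, ← Algebra.smul_def, map_smul, smul_eq_mul]
  rw [key, LinearMap.comp_apply, LinearMap.comp_apply, AlgHom.toLinearMap_apply, evHom_idem,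
    LinearMap.sum_apply]
  simp only [LinearMap.proj_apply]
  rw [Finset.sum_pi_single', if_pos (Finset.mem_univ _), ← map_one (algebraMap k K),
    Algebra.trace_algebraMap, nsmul_one]

end Idempotents

section Bimodule

variable {k F K M : Type*} [Field k] [Field F] [Field K] [Algebra k F] [Algebra k K]
  [FiniteDimensional k F] [FiniteDimensional k K] [AddCommGroup M] [Module k M]
  (ρF : F →ₐ[k] End k M) (ρK : K →ₐ[k] End k M)

/-- The part of `M` on which `F` acts through `σ`. -/
def part (σ : F →ₐ[k] K) : Submodule k M where
  carrier := {x | ∀ l, ρF l x = ρK (σ l) x}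
  add_mem' := fun hx hy l => by rw [map_add, map_add, hx l, hy l]
  zero_mem' := fun l => by rw [map_zero, map_zero]
  smul_mem' := fun c x hx l => by rw [map_smul, map_smul, hx l]

variable (hc : ∀ l x, Commute (ρF l) (ρK x))

/-- The action of `F ⊗ K`. -/
def biAct : F ⊗[k] K →ₐ[k] End k M := Algebra.TensorProduct.lift ρF ρK hc

theorem biAct_tmul (l : F) (x : K) (m : M) :
    biAct ρF ρK hc (l ⊗ₜ x) m = ρF l (ρK x m) := rfl

theorem biAct_mem {U : Submodule k M} (hF : ∀ l, ∀ m ∈ U, ρF l m ∈ U)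
    (hK : ∀ x, ∀ m ∈ U, ρK x m ∈ U) (t : F ⊗[k] K) {m : M} (hm : m ∈ U) :
    biAct ρF ρK hc t m ∈ U := by
  induction t using TensorProduct.induction_on with
  | zero => rw [map_zero]; exact U.zero_mem
  | tmul l x => exact hF l _ (hK x _ hm)
  | add s t hs ht => rw [map_add]; exact U.add_mem hs ht

variable (h : Splits k F K)

include h in
theorem biAct_idem_mem (σ : F →ₐ[k] K) (m : M) :
    biAct ρF ρK hc (idem σ) m ∈ part ρF ρK σ := by
  intro l
  have h1 : ∀ t, biAct ρF ρK hc (t * idem σ) m =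
      biAct ρF ρK hc t (biAct ρF ρK hc (idem σ) m) := fun t => by rw [map_mul]; rfl
  have h2 := h1 (l ⊗ₜ 1)
  rw [tmul_one_mul_idem h, h1, biAct_tmul, biAct_tmul] at h2
  simpa using h2.symm

theorem biAct_of_mem {σ : F →ₐ[k] K} (t : F ⊗[k] K) {m : M} (hm : m ∈ part ρF ρK σ) :
    biAct ρF ρK hc t m = ρK (evHom k F K t σ) m := by
  induction t using TensorProduct.induction_on with
  | zero => simp
  | tmul l x =>
    rw [biAct_tmul, evHom_tmul, ← Module.End.mul_apply, (hc l x).eq, Module.End.mul_apply, hm l,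
      ← Module.End.mul_apply, ← map_mul, mul_comm]
  | add s t hs ht => rw [map_add, map_add, LinearMap.add_apply, hs, ht, Pi.add_apply, map_add]; rfl

theorem biAct_idem_of_mem {σ : F →ₐ[k] K} {m : M} (hm : m ∈ part ρF ρK σ) :
    biAct ρF ρK hc (idem σ) m = m := by
  classical
  rw [biAct_of_mem ρF ρK hc _ hm, evHom_idem, Pi.single_eq_same, map_one]
  rfl

theorem biAct_idem_of_mem_ne {σ τ : F →ₐ[k] K} (hστ : σ ≠ τ) {m : M} (hm : m ∈ part ρF ρK σ) :
    biAct ρF ρK hc (idem τ) m = 0 := by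
  classical
  rw [biAct_of_mem ρF ρK hc _ hm, evHom_idem, Pi.single_eq_of_ne hστ, map_zero]
  rfl

include h in
theorem sum_biAct_idem (m : M) : ∑ σ, biAct ρF ρK hc (idem σ) m = m := by
  rw [← LinearMap.sum_apply, ← map_sum, sum_idem h, map_one]
  rfl

include h in
theorem isProj_biAct_idem (σ : F →ₐ[k] K) :
    LinearMap.IsProj (part ρF ρK σ) (biAct ρF ρK hc (idem σ)) :=
  ⟨biAct_idem_mem ρF ρK hc h σ, fun _ hm => biAct_idem_of_mem ρF ρK hc hm⟩

include hc h in
theorem sum_finrank_part [CharZero k] [FiniteDimensional k M] :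
    ∑ σ, finrank k (part ρF ρK σ) = finrank k M := by
  have h1 : ∑ σ, LinearMap.trace k M (biAct ρF ρK hc (idem σ)) = (finrank k M : k) := by
    rw [← map_sum, ← map_sum, sum_idem h, map_one, LinearMap.trace_one]
  have h2 : ∀ σ, LinearMap.trace k M (biAct ρF ρK hc (idem σ)) =
      (finrank k (part ρF ρK σ) : k) := fun σ => (isProj_biAct_idem ρF ρK hc h σ).trace
  simp only [h2] at h1
  exact_mod_cast h1

include hc h in
theorem finrank_part [CharZero k] [FiniteDimensional k M] {C : k}
    (htr : ∀ l x, LinearMap.trace k M (ρF l * ρK x) =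
      C * (Algebra.trace k F l * Algebra.trace k K x)) (σ : F →ₐ[k] K) :
    (finrank k (part ρF ρK σ) : k) = C * finrank k K := by
  have : Algebra.IsSeparable k F := inferInstance
  rw [← (isProj_biAct_idem ρF ρK hc h σ).trace, ← trTr_idem h σ]
  have key : LinearMap.trace k M ∘ₗ (biAct ρF ρK hc).toLinearMap = C • trTr := by
    refine TensorProduct.ext' fun l x => ?_
    exact htr l x
  exact LinearMap.congr_fun key (idem σ)

include hc h in
theorem finrank_part_mul [CharZero k] [FiniteDimensional k M] {C : k}
    (htr : ∀ l x, LinearMap.trace k M (ρF l * ρK x) =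
      C * (Algebra.trace k F l * Algebra.trace k K x)) (σ : F →ₐ[k] K) :
    finrank k F * finrank k (part ρF ρK σ) = finrank k M := by
  have h1 := sum_finrank_part ρF ρK hc h
  have h2 : ∀ τ, finrank k (part ρF ρK τ) = finrank k (part ρF ρK σ) := fun τ => by
    have := (finrank_part ρF ρK hc h htr τ).trans (finrank_part ρF ρK hc h htr σ).symm
    exact_mod_cast this
  rw [Finset.sum_congr rfl fun τ _ => h2 τ, Finset.sum_const, smul_eq_mul, Finset.card_univ,
    ← Nat.card_eq_fintype_card, h] at h1
  exact h1

end Bimodule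

section Restrict

variable {k A M : Type*} [Field k] [Ring A] [Algebra k A] [AddCommGroup M] [Module k M]

/-- The restriction of an action to a stable subspace. -/
def restrictRep (ρ : A →ₐ[k] End k M) (U : Submodule k M) (h : ∀ a, ∀ x ∈ U, ρ a x ∈ U) :
    A →ₐ[k] End k U where
  toFun a := (ρ a).restrict (h a)
  map_one' := by ext x; simp
  map_mul' a b := by ext x; simp
  map_zero' := by ext x; simp
  map_add' a b := by ext x; simp
  commutes' a := by ext x; simp [Module.algebraMap_end_apply]

end Restrict

section RestrictPart

variable {k F K M : Type*} [Field k] [Field F] [Field K] [Algebra k F] [Algebra k K]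
  [AddCommGroup M] [Module k M] (ρF : F →ₐ[k] End k M) (ρK : K →ₐ[k] End k M)
  {U : Submodule k M} (hF : ∀ l, ∀ m ∈ U, ρF l m ∈ U) (hK : ∀ x, ∀ m ∈ U, ρK x m ∈ U)

theorem finrank_part_restrict (σ : F →ₐ[k] K) :
    finrank k (part (restrictRep ρF U hF) (restrictRep ρK U hK) σ) =
      finrank k ↥(U ⊓ part ρF ρK σ) := by
  have h : (part (restrictRep ρF U hF) (restrictRep ρK U hK) σ).map U.subtype =
      U ⊓ part ρF ρK σ := by
    ext x
    constructor
    · rintro ⟨y, hy, rfl⟩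
      exact ⟨y.2, fun l => congrArg Subtype.val (hy l)⟩
    · rintro ⟨hx, hx'⟩
      exact ⟨⟨x, hx⟩, fun l => Subtype.ext (hx' l), rfl⟩
  rw [← h]
  exact (Submodule.equivMapOfInjective U.subtype U.injective_subtype _).finrank_eq

end RestrictPart

end PhiN

namespace PhiN

open Module

section BiActComm

variable {k F K M M' : Type*} [Field k] [Field F] [Field K] [Algebra k F] [Algebra k K]
  [AddCommGroup M] [Module k M] [AddCommGroup M'] [Module k M']
  {ρF : F →ₐ[k] End k M} {ρK : K →ₐ[k] End k M} {ρF' : F →ₐ[k] End k M'} {ρK' : K →ₐ[k] End k M'}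

theorem biAct_comm (hc : ∀ l x, Commute (ρF l) (ρK x)) (hc' : ∀ l x, Commute (ρF' l) (ρK' x))
    (f : M →ₗ[k] M') (hF : ∀ l m, f (ρF l m) = ρF' l (f m)) (hK : ∀ x m, f (ρK x m) = ρK' x (f m))
    (t : F ⊗[k] K) (m : M) : f (biAct ρF ρK hc t m) = biAct ρF' ρK' hc' t (f m) := by
  induction t using TensorProduct.induction_on with
  | zero => simp
  | tmul l x =>
    change f (ρF l (ρK x m)) = ρF' l (ρK' x (f m))
    rw [hF, hK]
  | add s t hs ht => simp only [map_add, LinearMap.add_apply, hs, ht]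

end BiActComm

section Frob

variable (p : ℕ) [Fact p.Prime] (E : Type*) [Field E] [Algebra ℚ_[p] E] [FiniteDimensional ℚ_[p] E]

theorem orderOf_frob : orderOf (frob p E) = resDeg p E := by
  have h : Nat.card (maxUnram p E ≃ₐ[ℚ_[p]] maxUnram p E) = resDeg p E :=
    IsGalois.card_aut_eq_finrank _ _
  rw [← h]
  refine orderOf_eq_card_of_forall_mem_zpowers fun g => ?_
  obtain ⟨i, rfl⟩ := exists_frob_pow p E g
  exact ⟨i, zpow_natCast _ _⟩

theorem resDeg_pos : 0 < resDeg p E := finrank_pos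

theorem frob_zpow_eq_one_iff (n : ℤ) : frob p E ^ n = 1 ↔ (resDeg p E : ℤ) ∣ n := by
  rw [← orderOf_frob, orderOf_dvd_iff_zpow_eq_one]

variable {p E}

/-- Every embedding of `E₀` is obtained from a given one by a unique power of the Frobenius. -/
theorem existsUnique_comp_frob {K : Type*} [Field K] [Algebra ℚ_[p] K]
    (h : Splits ℚ_[p] (maxUnram p E) K) (σ τ : maxUnram p E →ₐ[ℚ_[p]] K) :
    ∃! i : Fin (resDeg p E), τ = σ.comp ((frob p E ^ (i : ℕ) :
      maxUnram p E ≃ₐ[ℚ_[p]] maxUnram p E) : maxUnram p E →ₐ[ℚ_[p]] maxUnram p E) := by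
  let f : Fin (resDeg p E) → (maxUnram p E →ₐ[ℚ_[p]] K) := fun i =>
    σ.comp ((frob p E ^ (i : ℕ) : maxUnram p E ≃ₐ[ℚ_[p]] maxUnram p E) :
      maxUnram p E →ₐ[ℚ_[p]] maxUnram p E)
  have hi : Function.Injective f := by
    intro i j hij
    have h1 : frob p E ^ (i : ℕ) = frob p E ^ (j : ℕ) := AlgEquiv.ext fun l =>
      σ.toRingHom.injective (DFunLike.congr_fun hij l)
    have h2 := pow_injOn_Iio_orderOf (x := frob p E)
    rw [orderOf_frob] at h2
    exact Fin.ext (h2 i.2 j.2 h1)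
  have hb : Function.Bijective f := by
    rw [Fintype.bijective_iff_injective_and_card]
    refine ⟨hi, ?_⟩
    rw [Fintype.card_fin, ← Nat.card_eq_fintype_card]
    exact h.symm
  obtain ⟨i, h1, h2⟩ := hb.existsUnique τ
  exact ⟨i, h1.symm, fun j hj => h2 j hj.symm⟩

end Frob

namespace ModObj

attribute [local instance] TensorProduct.Algebra.module

variable {p : ℕ} [Fact p.Prime] {L L' K : Type*} [Field L] [Field L'] [Field K]
  [Algebra ℚ_[p] L] [Algebra ℚ_[p] L'] [Algebra ℚ_[p] K] [Algebra L L']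
  [IsScalarTower ℚ_[p] L L'] [FiniteDimensional ℚ_[p] L'] (X Y : ModObj.{v} p L L' K)

theorem finite_Q [FiniteDimensional ℚ_[p] K] : FiniteDimensional ℚ_[p] X.D :=
  have := X.finite_K
  Module.Finite.trans K X.D

/-- The action of `L'₀`. -/
def rhoL : maxUnram p L' →ₐ[ℚ_[p]] End ℚ_[p] X.D := Algebra.lsmul ℚ_[p] ℚ_[p] X.D

/-- The action of `K`. -/
def rhoK : K →ₐ[ℚ_[p]] End ℚ_[p] X.D := Algebra.lsmul ℚ_[p] ℚ_[p] X.D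

theorem commute_rho (l : maxUnram p L') (k : K) : Commute (X.rhoL l) (X.rhoK k) :=
  LinearMap.ext fun x => smul_comm l k x

/-- The projection onto the component at `σ`. -/
def proj [FiniteDimensional ℚ_[p] K] (σ : maxUnram p L' →ₐ[ℚ_[p]] K) : X.D →ₗ[ℚ_[p]] X.D :=
  biAct X.rhoL X.rhoK X.commute_rho (idem σ)

/-- The linear operators of a `(φ, N, Gal)`-module. -/
abbrev Ops (p : ℕ) [Fact p.Prime] (L L' K : Type*) [Field L] [Field L'] [Field K]
    [Algebra ℚ_[p] L'] [Algebra L L'] : Type _ := maxUnram p L' ⊕ K ⊕ (L' ≃ₐ[L] L')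

/-- The underlying `ℚ_p`-space with its operators. -/
abbrev toPG [FiniteDimensional ℚ_[p] K] : PG.{v} ℚ_[p] (Ops p L L' K) :=
  have := X.finite_Q
  { V := X.D
    op := fun ω => match ω with
      | .inl l => X.rhoL l
      | .inr (.inl k) => X.rhoK k
      | .inr (.inr g) => (X.gal g).restrictScalars ℚ_[p]
    phi := X.phi.restrictScalars ℚ_[p] }

section

variable [FiniteDimensional ℚ_[p] K]

theorem stable_iff {E : Submodule ℚ_[p] X.D} : X.toPG.Stable E ↔
    (∀ l : maxUnram p L', ∀ x ∈ E, l • x ∈ E) ∧ (∀ k : K, ∀ x ∈ E, k • x ∈ E) ∧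
      (∀ g, ∀ x ∈ E, X.gal g x ∈ E) ∧ ∀ x ∈ E, X.phi x ∈ E := by
  constructor
  · intro h
    exact ⟨fun l => h.op_mem (.inl l), fun k => h.op_mem (.inr (.inl k)),
      fun g => h.op_mem (.inr (.inr g)), h.phi_mem⟩
  · rintro ⟨h1, h2, h3, h4⟩
    exact ⟨fun ω => match ω with
      | .inl l => h1 l
      | .inr (.inl k) => h2 k
      | .inr (.inr g) => h3 g, h4⟩

theorem phi_zpow_mem {E : Submodule ℚ_[p] X.D} (hE : ∀ x ∈ E, X.phi x ∈ E) (n : ℤ) :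
    ∀ x ∈ E, (X.phi ^ n) x ∈ E := by
  have := X.finite_Q
  have hs : ∀ x, X.phi x ∈ E → x ∈ E := fun x hx =>
    mem_of_apply_mem (φ := (X.phi.restrictScalars ℚ_[p]).toLinearMap) X.phi.injective hE hx
  have h2 : ∀ y, X.phi (X.phi⁻¹ y) = y := fun y => X.phi.apply_symm_apply y
  induction n using Int.induction_on with
  | zero => exact fun x hx => by simpa using hx
  | succ n ih =>
    intro x hx
    rw [zpow_add_one, LinearEquiv.mul_apply]
    exact ih _ (hE x hx)
  | pred n ih =>
    intro x hx
    rw [zpow_sub_one, LinearEquiv.mul_apply]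
    exact ih _ (hs _ (by rwa [h2]))

theorem phi_zpow_mem_WDspace (n : ℤ) {τ τ' : maxUnram p L' →ₐ[ℚ_[p]] K}
    (h : ∀ l, τ' l = τ ((frob p L' ^ (-n)) l)) {x : X.D} (hx : x ∈ X.WDspace τ) :
    (X.phi ^ n) x ∈ X.WDspace τ' := by
  intro l
  have h1 := X.phi_zpow_smul n ((frob p L' ^ (-n)) l) x
  rw [hx, map_smul, ← AlgEquiv.mul_apply, ← zpow_add, add_neg_cancel, zpow_zero,
    AlgEquiv.one_apply] at h1
  rw [← h1, h]

variable (hS : Splits ℚ_[p] (maxUnram p L') K) (σ : maxUnram p L' →ₐ[ℚ_[p]] K)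

include hS in
theorem proj_mem (x : X.D) : X.proj σ x ∈ X.WDspace σ :=
  biAct_idem_mem X.rhoL X.rhoK X.commute_rho hS σ x

variable {σ} in
theorem proj_of_mem {x : X.D} (hx : x ∈ X.WDspace σ) : X.proj σ x = x :=
  biAct_idem_of_mem X.rhoL X.rhoK X.commute_rho hx

variable {X Y} in
theorem map_proj (f : X.D →ₗ[K] Y.D) (hf : ∀ (l : maxUnram p L') x, f (l • x) = l • f x) (x : X.D) :
    f (X.proj σ x) = Y.proj σ (f x) :=
  biAct_comm X.commute_rho Y.commute_rho (f.restrictScalars ℚ_[p]) hf (fun k x => map_smul f k x)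
    _ x

theorem proj_smul (l : maxUnram p L') (x : X.D) : X.proj σ (l • x) = l • X.proj σ x :=
  (biAct_comm X.commute_rho X.commute_rho (X.rhoL l)
    (fun l' x => smul_comm l l' x) (fun k x => smul_comm l k x) _ x).symm

theorem proj_smulK (k : K) (x : X.D) : X.proj σ (k • x) = k • X.proj σ x :=
  (biAct_comm X.commute_rho X.commute_rho (X.rhoK k)
    (fun l' x => smul_comm k l' x) (fun k' x => smul_comm k k' x) _ x).symm

theorem proj_stable {E : Submodule ℚ_[p] X.D} (h1 : ∀ l : maxUnram p L', ∀ x ∈ E, l • x ∈ E)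
    (h2 : ∀ k : K, ∀ x ∈ E, k • x ∈ E) {x : X.D} (hx : x ∈ E) : X.proj σ x ∈ E :=
  biAct_mem X.rhoL X.rhoK X.commute_rho h1 h2 _ hx

theorem proj_phi_zpow_eq_zero {n : ℤ} (hn : ¬ (resDeg p L' : ℤ) ∣ n) {x : X.D}
    (hx : x ∈ X.WDspace σ) : X.proj σ ((X.phi ^ n) x) = 0 := by
  let τ : maxUnram p L' →ₐ[ℚ_[p]] K := σ.comp ((frob p L' ^ (-n) :
      maxUnram p L' ≃ₐ[ℚ_[p]] maxUnram p L') : maxUnram p L' →ₐ[ℚ_[p]] maxUnram p L')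
  have h1 : (X.phi ^ n) x ∈ X.WDspace τ := X.phi_zpow_mem_WDspace n (fun l => rfl) hx
  refine biAct_idem_of_mem_ne X.rhoL X.rhoK X.commute_rho (σ := τ) (fun h => hn ?_) h1
  rw [← dvd_neg, ← frob_zpow_eq_one_iff]
  exact AlgEquiv.ext fun l => σ.toRingHom.injective (DFunLike.congr_fun h l)

include hS in
/-- `D` is the direct sum of the `φ^{-i} D_σ`. -/
theorem sum_proj (x : X.D) :
    ∑ i : Fin (resDeg p L'), (X.phi ^ (-(i : ℕ) : ℤ)) (X.proj σ ((X.phi ^ ((i : ℕ) : ℤ)) x)) = x := by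
  have key : ∀ τ : maxUnram p L' →ₐ[ℚ_[p]] K, ∀ y ∈ X.WDspace τ,
      ∑ i : Fin (resDeg p L'), (X.phi ^ (-(i : ℕ) : ℤ))
        (X.proj σ ((X.phi ^ ((i : ℕ) : ℤ)) y)) = y := by
    intro τ y hy
    obtain ⟨i, hi, huniq⟩ := existsUnique_comp_frob hS σ τ
    have hi' : ∀ l, τ l = σ ((frob p L' ^ (i : ℕ)) l) := fun l => DFunLike.congr_fun hi l
    rw [Finset.sum_eq_single i]
    · have h1 : (X.phi ^ ((i : ℕ) : ℤ)) y ∈ X.WDspace σ := X.phi_zpow_mem_WDspace _ (fun l => by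
        rw [hi', ← AlgEquiv.mul_apply, ← zpow_natCast, ← zpow_add, add_neg_cancel, zpow_zero,
          AlgEquiv.one_apply]) hy
      rw [X.proj_of_mem h1, ← LinearEquiv.mul_apply, ← zpow_add, neg_add_cancel, zpow_zero]
      rfl
    · intro j _ hj
      let τ' : maxUnram p L' →ₐ[ℚ_[p]] K := τ.comp ((frob p L' ^ (-((j : ℕ) : ℤ)) :
        maxUnram p L' ≃ₐ[ℚ_[p]] maxUnram p L') : maxUnram p L' →ₐ[ℚ_[p]] maxUnram p L')
      have h1 : (X.phi ^ ((j : ℕ) : ℤ)) y ∈ X.WDspace τ' :=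
        X.phi_zpow_mem_WDspace _ (fun l => rfl) hy
      have h2 : X.proj σ ((X.phi ^ ((j : ℕ) : ℤ)) y) = 0 := by
        refine biAct_idem_of_mem_ne X.rhoL X.rhoK X.commute_rho (σ := τ') (fun h => hj ?_) h1
        refine huniq j (AlgHom.ext fun l => ?_)
        have := DFunLike.congr_fun h ((frob p L' ^ (j : ℕ)) l)
        change _ = σ ((frob p L' ^ (j : ℕ)) l)
        rw [← this]
        change τ l = τ ((frob p L' ^ (-((j : ℕ) : ℤ))) ((frob p L' ^ (j : ℕ)) l))
        rw [← AlgEquiv.mul_apply, ← zpow_natCast, ← zpow_add, neg_add_cancel, zpow_zero,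
          AlgEquiv.one_apply]
      rw [h2, map_zero]
    · exact fun h => absurd (Finset.mem_univ _) h
  have h1 : x = ∑ τ, X.proj τ x := (sum_biAct_idem X.rhoL X.rhoK X.commute_rho hS x).symm
  conv_lhs => rw [h1]
  simp only [map_sum]
  rw [Finset.sum_comm]
  conv_rhs => rw [h1]
  exact Finset.sum_congr rfl fun τ _ => key τ _ (X.proj_mem hS τ x)

end

section Weil

variable [IsGalois L L'] [FiniteDimensional ℚ_[p] K] (hS : Splits ℚ_[p] (maxUnram p L') K)
  (σ : maxUnram p L' →ₐ[ℚ_[p]] K)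

/-- A `K`-subspace of the component at `σ` which is stable under the Weil group. -/
structure WeilStable (A : Submodule K X.D) : Prop where
  le : A ≤ X.WDspace σ
  mem : ∀ w, ∀ x ∈ A, X.weilAct w x ∈ A

theorem weilAct_gal_phi (w : WeilGp p L L') (n : ℤ) (x : X.D) :
    X.gal (weilToGal w) ((X.phi ^ n) x) = X.weilAct w ((X.phi ^ (weilDeg w + n)) x) := by
  change _ = X.gal (weilToGal w) ((X.phi ^ (-weilDeg w)) ((X.phi ^ (weilDeg w + n)) x))
  rw [← LinearEquiv.mul_apply (X.phi ^ (-weilDeg w)), ← zpow_add, neg_add_cancel_left]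

variable {X σ} in
theorem WeilStable.phi_zpow_mem {A : Submodule K X.D} (hA : X.WeilStable σ A) {n : ℤ}
    (hn : (resDeg p L' : ℤ) ∣ n) {x : X.D} (hx : x ∈ A) : (X.phi ^ n) x ∈ A := by
  obtain ⟨w, hw, hd⟩ := exists_weil (p := p) (1 : L' ≃ₐ[L] L') (-n) (by
    have h1 : galUnram p (1 : L' ≃ₐ[L] L') = 1 := AlgEquiv.ext fun l =>
      Subtype.ext (galUnram_coe p 1 l)
    rw [h1, (frob_zpow_eq_one_iff p L' (-n)).2 (hn.neg_right)])
  have h := X.weilAct_gal_phi w n x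
  rw [hw, hd, neg_add_cancel, map_one] at h
  exact h ▸ hA.mem w _ (by simpa using hx)

/-- The stable subspace of `D` generated by a stable subspace of `D_σ`. -/
def WeilStable.extend (A : Submodule K X.D) : Submodule ℚ_[p] X.D where
  carrier := {x | ∀ n : ℤ, X.proj σ ((X.phi ^ n) x) ∈ A}
  add_mem' := fun hx hy n => by
    rw [map_add, map_add]; exact A.add_mem (hx n) (hy n)
  zero_mem' := fun n => by rw [map_zero, map_zero]; exact A.zero_mem
  smul_mem' := fun c x hx n => by
    rw [← algebraMap_smul K c x, map_smul, proj_smulK]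
    exact A.smul_mem _ (hx n)

variable {X σ}

include hS in
theorem WeilStable.extend_stable {A : Submodule K X.D} (hA : X.WeilStable σ A) :
    X.toPG.Stable (WeilStable.extend X σ A) := by
  rw [stable_iff]
  refine ⟨fun l x hx n => ?_, fun k x hx n => ?_, fun g x hx n => ?_, fun x hx n => ?_⟩
  · rw [X.phi_zpow_smul, proj_smul, X.proj_mem hS]
    exact A.smul_mem _ (hx n)
  · rw [map_smul, proj_smulK]
    exact A.smul_mem _ (hx n)
  · obtain ⟨a, ha⟩ := exists_frob_pow p L' (galUnram p g)
    obtain ⟨w, rfl, hd⟩ := exists_weil (p := p) g a (by rw [ha, zpow_natCast])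
    rw [← X.gal_phi_zpow, weilAct_gal_phi, ← map_proj σ (X.weilAct w) (X.weilAct_smul w)]
    exact hA.mem w _ (hx _)
  · have := hx (n + 1)
    rwa [zpow_add_one, LinearEquiv.mul_apply] at this

include hS in
theorem WeilStable.le_extend {A : Submodule K X.D} (hA : X.WeilStable σ A) {x : X.D}
    (hx : x ∈ A) : x ∈ WeilStable.extend X σ A := by
  intro n
  by_cases hn : (resDeg p L' : ℤ) ∣ n
  · have h1 := hA.phi_zpow_mem hn hx
    rwa [X.proj_of_mem (hA.le h1)]
  · rw [X.proj_phi_zpow_eq_zero σ hn (hA.le hx)]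
    exact A.zero_mem

/-- The intersection of a stable subspace with `D_σ`. -/
def restr (X : ModObj.{v} p L L' K) (σ : maxUnram p L' →ₐ[ℚ_[p]] K) (E : Submodule ℚ_[p] X.D)
    (hE : X.toPG.Stable E) : Submodule K X.D where
  carrier := {x | x ∈ E ∧ x ∈ X.WDspace σ}
  add_mem' := fun hx hy => ⟨E.add_mem hx.1 hy.1, (X.WDspace σ).add_mem hx.2 hy.2⟩
  zero_mem' := ⟨E.zero_mem, (X.WDspace σ).zero_mem⟩
  smul_mem' := fun k x hx => ⟨(X.stable_iff.1 hE).2.1 k x hx.1, (X.WDspace σ).smul_mem k hx.2⟩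

theorem restr_weilStable {E : Submodule ℚ_[p] X.D} (hE : X.toPG.Stable E) :
    X.WeilStable σ (restr X σ E hE) := by
  refine ⟨fun x hx => hx.2, fun w x hx => ⟨?_, X.weilAct_mem σ w x hx.2⟩⟩
  exact (X.stable_iff.1 hE).2.2.1 _ _ (X.phi_zpow_mem (X.stable_iff.1 hE).2.2.2 _ x hx.1)

include hS in
theorem proj_mem_restr {E : Submodule ℚ_[p] X.D} (hE : X.toPG.Stable E) {x : X.D} (hx : x ∈ E)
    (n : ℤ) : X.proj σ ((X.phi ^ n) x) ∈ restr X σ E hE := by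
  obtain ⟨h1, h2, -, h4⟩ := X.stable_iff.1 hE
  exact ⟨X.proj_stable σ h1 h2 (X.phi_zpow_mem h4 n x hx), X.proj_mem hS σ _⟩

include hS in
theorem mem_of_proj_mem {E : Submodule ℚ_[p] X.D} (hE : X.toPG.Stable E) {x : X.D}
    (h : ∀ n : ℤ, X.proj σ ((X.phi ^ n) x) ∈ E) : x ∈ E := by
  rw [← X.sum_proj hS σ x]
  exact E.sum_mem fun i _ => X.phi_zpow_mem (X.stable_iff.1 hE).2.2.2 _ _ (h _)

include hS in
theorem toPG_semisimple (h : ∀ A, X.WeilStable σ A → ∃ B, X.WeilStable σ B ∧ A ⊓ B = ⊥ ∧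
    X.WDspace σ ≤ A ⊔ B) : X.toPG.Semisimple := by
  intro E hE
  obtain ⟨B, hB, hinf, hsup⟩ := h _ (restr_weilStable hE)
  have hBs := hB.extend_stable hS
  refine ⟨_, hBs, ?_, ?_⟩
  · rw [disjoint_iff, eq_bot_iff]
    rintro x ⟨hx, hx'⟩
    have h1 : ∀ n : ℤ, X.proj σ ((X.phi ^ n) x) = 0 := fun n =>
      (Submodule.mem_bot K).1 (hinf ▸ ⟨proj_mem_restr hS hE hx n, hx' n⟩)
    exact mem_of_proj_mem hS PG.Stable.bot fun n => (h1 n).symm ▸ Submodule.zero_mem _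
  · rw [codisjoint_iff, eq_top_iff]
    rintro x -
    refine mem_of_proj_mem (σ := σ) hS (hE.sup hBs) fun n => ?_
    obtain ⟨a, ha, b, hb, hab⟩ := Submodule.mem_sup.1 (hsup (X.proj_mem hS σ ((X.phi ^ n) x)))
    rw [← hab]
    exact Submodule.add_mem_sup ha.1 (hB.le_extend hS hb)

include hS in
theorem toPG_indecomposable (h : ∀ A B, X.WeilStable σ A → X.WeilStable σ B →
      (∀ x ∈ A, X.N x ∈ A) → (∀ x ∈ B, X.N x ∈ B) → A ⊓ B = ⊥ → X.WDspace σ ≤ A ⊔ B →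
      A = ⊥ ∨ B = ⊥) {A B : Submodule ℚ_[p] X.D} (hA : X.toPG.Stable A) (hB : X.toPG.Stable B)
    (hAN : ∀ x ∈ A, X.N x ∈ A) (hBN : ∀ x ∈ B, X.N x ∈ B) (hAB : IsCompl A B) :
    A = ⊥ ∨ B = ⊥ := by
  have key : ∀ E (hE : X.toPG.Stable E), restr X σ E hE = ⊥ → E = ⊥ := by
    intro E hE h0
    rw [eq_bot_iff]
    intro x hx
    refine mem_of_proj_mem (σ := σ) hS PG.Stable.bot fun n => ?_
    have h1 : X.proj σ ((X.phi ^ n) x) = 0 :=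
      (Submodule.mem_bot K).1 (h0 ▸ proj_mem_restr (σ := σ) hS hE hx n)
    exact h1.symm ▸ Submodule.zero_mem _
  refine (h _ _ (restr_weilStable hA) (restr_weilStable hB)
    (fun x hx => ⟨hAN x hx.1, X.N_mem_WDspace σ x hx.2⟩)
    (fun x hx => ⟨hBN x hx.1, X.N_mem_WDspace σ x hx.2⟩) ?_ ?_).imp (key A hA) (key B hB)
  · rw [eq_bot_iff]
    rintro x ⟨hx, hx'⟩
    exact (Submodule.mem_bot K).2 ((Submodule.mem_bot ℚ_[p]).1 (hAB.inf_eq_bot ▸ ⟨hx.1, hx'.1⟩))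
  · intro x hx
    have h1 : x ∈ A ⊔ B := by rw [hAB.sup_eq_top]; trivial
    obtain ⟨a, ha, b, hb, hab⟩ := Submodule.mem_sup.1 h1
    have h2 := congrArg (X.proj σ) hab
    rw [map_add, X.proj_of_mem hx] at h2
    rw [← h2]
    have h3 := proj_mem_restr (σ := σ) hS hA ha 0
    have h4 := proj_mem_restr (σ := σ) hS hB hb 0
    rw [zpow_zero] at h3 h4
    exact Submodule.add_mem_sup h3 h4

end Weil

end ModObj

end PhiN

namespace PhiN

open Module

namespace ModObj

attribute [local instance] TensorProduct.Algebra.module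

variable {p : ℕ} [Fact p.Prime] {L L' K : Type*} [Field L] [Field L'] [Field K]
  [Algebra ℚ_[p] L] [Algebra ℚ_[p] L'] [Algebra ℚ_[p] K] [Algebra L L']
  [IsScalarTower ℚ_[p] L L'] [FiniteDimensional ℚ_[p] L'] [FiniteDimensional ℚ_[p] K]
  [IsGalois L L'] {σ : maxUnram p L' →ₐ[ℚ_[p]] K}

theorem exists_weilStable_compl {V : WDRep.{v} p L L' K} (hV : V.IsSemisimple)
    {X : ModObj.{v} p L L' K}
    (i : X.WDspace σ →ₗ[K] V.V) (hi : Function.Injective i)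
    (hr : ∀ w (x : X.WDspace σ), V.r w (i x) = i ⟨X.weilAct w x, X.weilAct_mem σ w x x.2⟩) (A : Submodule K X.D) (hA : X.WeilStable σ A) :
    ∃ B, X.WeilStable σ B ∧ A ⊓ B = ⊥ ∧ X.WDspace σ ≤ A ⊔ B := by
  let A' : Subrepresentation V.r :=
    { toSubmodule := (A.comap (X.WDspace σ).subtype).map i
      apply_mem_toSubmodule := by
        rintro w _ ⟨x, hx, rfl⟩
        rw [hr]
        exact ⟨⟨X.weilAct w x, X.weilAct_mem σ w x x.2⟩, hA.mem w x hx, rfl⟩ }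
  have : ComplementedLattice (Subrepresentation V.r) := hV
  obtain ⟨B', hB'⟩ := exists_isCompl A'
  have hinf : ∀ x, x ∈ A' → x ∈ B' → x = 0 := by
    intro x h1 h2
    have h3 : x ∈ A' ⊓ B' := ⟨h1, h2⟩
    rw [hB'.inf_eq_bot] at h3
    exact h3
  have hsup : ∀ x : V.V, ∃ a ∈ A', ∃ b ∈ B', a + b = x := by
    intro x
    have h3 : x ∈ A' ⊔ B' := by rw [hB'.sup_eq_top]; trivial
    exact Submodule.mem_sup.1 h3
  refine ⟨(B'.toSubmodule.comap i).map (X.WDspace σ).subtype, ⟨?_, ?_⟩, ?_, ?_⟩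
  · rintro _ ⟨x, -, rfl⟩
    exact x.2
  · rintro w _ ⟨x, hx, rfl⟩
    refine ⟨⟨X.weilAct w x, X.weilAct_mem σ w x x.2⟩, ?_, rfl⟩
    change i ⟨X.weilAct w x, X.weilAct_mem σ w x x.2⟩ ∈ B'.toSubmodule
    rw [← hr]
    exact B'.apply_mem_toSubmodule w hx
  · rw [eq_bot_iff]
    rintro _ ⟨hx, ⟨x, hx', rfl⟩⟩
    have h1 := hinf (i x) ⟨x, hx, rfl⟩ hx'
    rw [Submodule.mem_bot, hi (h1.trans (map_zero i).symm), map_zero]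
  · intro x hx
    obtain ⟨_, ⟨a, ha, rfl⟩, b, hb, hab⟩ := hsup (i ⟨x, hx⟩)
    have h1 : b = i (⟨x, hx⟩ - a) := by rw [map_sub, ← hab, add_sub_cancel_left]
    refine Submodule.mem_sup.2 ⟨a, ha, _, ⟨⟨x, hx⟩ - a, ?_, rfl⟩, ?_⟩
    · change i (⟨x, hx⟩ - a) ∈ B'.toSubmodule
      rwa [← h1]
    · change (a : X.D) + (x - a) = x
      abel

theorem eq_bot_of_isAbsIndecomposable {W : WDRep.{v} p L L' K} (hW : W.IsAbsIndecomposable)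
    {X : ModObj.{v} p L L' K} (hX : (X.WD σ).Iso W) (A B : Submodule K X.D)
    (hA : X.WeilStable σ A) (hB : X.WeilStable σ B)
    (hAN : ∀ x ∈ A, X.N x ∈ A) (hBN : ∀ x ∈ B, X.N x ∈ B) (hinf : A ⊓ B = ⊥)
    (hsup : X.WDspace σ ≤ A ⊔ B) : A = ⊥ ∨ B = ⊥ := by
  obtain ⟨e, hr, hN⟩ := hX
  let Kb := AlgebraicClosure K
  let e' : X.WDspace σ ≃ₗ[K] W.V := e
  have hr' : ∀ w (x : X.WDspace σ), W.r w (e' x) = e' ⟨X.weilAct w x, X.weilAct_mem σ w x x.2⟩ :=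
    fun w x => (hr w x).symm
  have hN' : ∀ x : X.WDspace σ, W.N (e' x) = e' ⟨X.N x, X.N_mem_WDspace σ x x.2⟩ :=
    fun x => (hN x).symm
  let im : Submodule K X.D → Submodule K W.V := fun A =>
    (A.comap (X.WDspace σ).subtype).map e'.toLinearMap
  have himr : ∀ A, X.WeilStable σ A → ∀ w, ∀ x ∈ im A, W.r w x ∈ im A := by
    rintro A hA w _ ⟨x, hx, rfl⟩
    exact ⟨⟨X.weilAct w x, X.weilAct_mem σ w x x.2⟩, hA.mem w x hx, (hr' w x).symm⟩
  have himN : ∀ A : Submodule K X.D, (∀ x ∈ A, X.N x ∈ A) → ∀ x ∈ im A, W.N x ∈ im A := by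
    rintro A hA _ ⟨x, hx, rfl⟩
    exact ⟨⟨X.N x, X.N_mem_WDspace σ x x.2⟩, hA x hx, (hN' x).symm⟩
  have hc : IsCompl (im A) (im B) := by
    refine IsCompl.of_eq ?_ ?_
    · rw [eq_bot_iff]
      rintro _ ⟨⟨x, hx, rfl⟩, ⟨y, hy, hxy⟩⟩
      have h1 : y = x := e'.injective hxy
      subst h1
      have h2 : (y : X.D) ∈ A ⊓ B := ⟨hx, hy⟩
      rw [hinf] at h2
      have h3 : y = 0 := Subtype.ext h2
      rw [h3, map_zero]
      exact Submodule.zero_mem _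
    · rw [eq_top_iff]
      rintro y -
      obtain ⟨x, rfl⟩ := e'.surjective y
      obtain ⟨a, ha, b, hb, hab⟩ := Submodule.mem_sup.1 (hsup x.2)
      have h1 : x = ⟨a, hA.le ha⟩ + ⟨b, hB.le hb⟩ := Subtype.ext hab.symm
      rw [h1, map_add]
      exact Submodule.add_mem_sup ⟨⟨a, hA.le ha⟩, ha, rfl⟩ ⟨⟨b, hB.le hb⟩, hb, rfl⟩
  have hstab : ∀ (f : W.V →ₗ[K] W.V) (S : Submodule K W.V), (∀ x ∈ S, f x ∈ S) →
      ∀ x ∈ S.baseChange Kb, f.baseChange Kb x ∈ S.baseChange Kb := by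
    intro f S hS x hx
    rw [Submodule.baseChange_eq_span] at hx
    induction hx using Submodule.span_induction with
    | mem x hx =>
      obtain ⟨y, hy, rfl⟩ := hx
      change f.baseChange Kb (1 ⊗ₜ y) ∈ _
      rw [LinearMap.baseChange_tmul]
      exact Submodule.tmul_mem_baseChange_of_mem _ (hS y hy)
    | zero => rw [map_zero]; exact Submodule.zero_mem _
    | add x y _ _ hx hy => rw [map_add]; exact Submodule.add_mem _ hx hy
    | smul a x _ hx => rw [map_smul]; exact Submodule.smul_mem _ _ hx
  obtain ⟨π, hπA, hπB, hπ⟩ : ∃ π : W.V →ₗ[K] W.V, (∀ x ∈ im A, π x = x) ∧ (∀ x ∈ im B, π x = 0) ∧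
      ∀ x, π x ∈ im A :=
    ⟨(im A).projection (im B) hc, fun x hx => Submodule.projection_apply_of_mem_left hc hx,
      fun x hx => (Submodule.projection_apply_eq_zero_iff hc).2 hx,
      fun x => Submodule.projection_apply_mem hc x⟩
  have hcK : IsCompl ((im A).baseChange Kb) ((im B).baseChange Kb) := by
    have key1 : ∀ x ∈ (im A).baseChange Kb, π.baseChange Kb x = x := by
      intro x hx
      rw [Submodule.baseChange_eq_span] at hx
      induction hx using Submodule.span_induction with
      | mem x hx =>
        obtain ⟨y, hy, rfl⟩ := hx
        change π.baseChange Kb (1 ⊗ₜ y) = 1 ⊗ₜ y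
        rw [LinearMap.baseChange_tmul, hπA y hy]
      | zero => rw [map_zero]
      | add x y _ _ hx hy => rw [map_add, hx, hy]
      | smul a x _ hx => rw [map_smul, hx]
    have key2 : ∀ x ∈ (im B).baseChange Kb, π.baseChange Kb x = 0 := by
      intro x hx
      rw [Submodule.baseChange_eq_span] at hx
      induction hx using Submodule.span_induction with
      | mem x hx =>
        obtain ⟨y, hy, rfl⟩ := hx
        change π.baseChange Kb (1 ⊗ₜ y) = 0
        rw [LinearMap.baseChange_tmul, hπB y hy, TensorProduct.tmul_zero]
      | zero => rw [map_zero]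
      | add x y _ _ hx hy => rw [map_add, hx, hy, add_zero]
      | smul a x _ hx => rw [map_smul, hx, smul_zero]
    refine IsCompl.of_eq ?_ ?_
    · rw [eq_bot_iff]
      rintro x ⟨h1, h2⟩
      rw [Submodule.mem_bot, ← key1 x h1, key2 x h2]
    · rw [eq_top_iff, ← Submodule.baseChange_top, Submodule.baseChange_eq_span, Submodule.span_le]
      rintro _ ⟨y, -, rfl⟩
      have h1 : y ∈ im A ⊔ im B := by rw [hc.sup_eq_top]; trivial
      obtain ⟨a, ha, b, hb, rfl⟩ := Submodule.mem_sup.1 h1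
      rw [map_add]
      exact Submodule.add_mem_sup (Submodule.tmul_mem_baseChange_of_mem 1 ha)
        (Submodule.tmul_mem_baseChange_of_mem 1 hb)
  have hfin : ∀ A : Submodule K X.D, X.WeilStable σ A → (im A).baseChange Kb = ⊥ → A = ⊥ := by
    intro A hA h0
    rw [eq_bot_iff]
    intro x hx
    have h1 : (1 : Kb) ⊗ₜ[K] e' ⟨x, hA.le hx⟩ ∈ (im A).baseChange Kb :=
      Submodule.tmul_mem_baseChange_of_mem 1 ⟨⟨x, hA.le hx⟩, hx, rfl⟩
    rw [h0, Submodule.mem_bot] at h1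
    have h2 : e' ⟨x, hA.le hx⟩ = 0 :=
      Module.FaithfullyFlat.tensorProduct_mk_injective (A := K) (B := Kb) W.V
        (h1.trans (TensorProduct.tmul_zero _ _).symm)
    have h3 := (LinearEquiv.map_eq_zero_iff e').1 h2
    exact congrArg Subtype.val h3
  exact (hW.2 _ _ (fun w => hstab _ _ (himr A hA w)) (hstab _ _ (himN A hAN))
    (fun w => hstab _ _ (himr B hB w)) (hstab _ _ (himN B hBN)) hcK).imp (hfin A hA) (hfin B hB)

/-- `N`, as a `ℚ_p`-linear map. -/
abbrev NQ (X : ModObj.{v} p L L' K) : X.toPG.V →ₗ[ℚ_[p]] X.toPG.V := X.N.restrictScalars ℚ_[p]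

omit [IsGalois L L'] in
theorem NQ_op (X : ModObj.{v} p L L' K) (ω : Ops p L L' K) (x : X.toPG.V) :
    X.NQ (X.toPG.op ω x) = X.toPG.op ω (X.NQ x) :=
  match ω with
  | .inl l => X.N_smul l x
  | .inr (.inl k) => map_smul X.N k x
  | .inr (.inr g) => (X.gal_N g x).symm

omit [IsGalois L L'] in
theorem natCast_smul (X : ModObj.{v} p L L' K) (n : ℕ) (x : X.D) :
    (n : ℚ_[p]) • x = (n : K) • x := by
  rw [← algebraMap_smul K (n : ℚ_[p]) x, map_natCast]

omit [IsGalois L L'] in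
theorem zpow_smul' (X : ModObj.{v} p L L' K) (l : ℤ) (x : X.D) :
    (p : ℚ_[p]) ^ l • x = (p : K) ^ l • x := by
  rw [← algebraMap_smul K ((p : ℚ_[p]) ^ l) x, map_zpow₀, map_natCast]

omit [IsGalois L L'] in
theorem NQ_phi (X : ModObj.{v} p L L' K) (x : X.toPG.V) :
    X.NQ (X.toPG.phi x) = (p : ℚ_[p]) • X.toPG.phi (X.NQ x) :=
  (X.N_phi x).trans (X.natCast_smul p _).symm

theorem exists_isString (hS : Splits ℚ_[p] (maxUnram p L') K) {W : WDRep.{v} p L L' K}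
    (hW : W.IsAbsIndecomposable) {X : ModObj.{v} p L L' K} (hX : (X.WD σ).Iso W)
    (hss : X.toPG.Semisimple) :
    ∃ θ, PG.IsString (p : ℚ_[p]) X.toPG X.NQ θ X.nilLength := by
  have := X.finite_Q
  have := X.finite_K
  have hp0 : (p : ℚ_[p]) ≠ 0 := Nat.cast_ne_zero.2 (Fact.out : p.Prime).ne_zero
  have hnt : Nontrivial X.D := by
    obtain ⟨e, -⟩ := hX
    have := hW.1
    have : Nontrivial (X.WDspace σ) := e.toEquiv.nontrivial
    exact (X.WDspace σ).injective_subtype.nontrivial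
  have hind : ∀ A B : Submodule ℚ_[p] X.toPG.V, X.toPG.Stable A → X.toPG.Stable B →
      (∀ x ∈ A, X.NQ x ∈ A) → (∀ x ∈ B, X.NQ x ∈ B) → IsCompl A B → A = ⊥ ∨ B = ⊥ :=
    fun A B h1 h2 h3 h4 h5 => toPG_indecomposable hS
      (eq_bot_of_isAbsIndecomposable hW hX) h1 h2 h3 h4 h5
  have hhom : ∀ n, PG.IsHom ((p : ℚ_[p]) ^ n)⁻¹ X.toPG X.toPG (X.NQ ^ n) :=
    PG.isHom_pow_N X.NQ_op X.NQ_phi hp0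
  have hnil : IsNilpotent X.NQ := by
    obtain ⟨m, hm⟩ := Filter.eventually_atTop.1 (LinearMap.eventually_isCompl_ker_pow_range_pow X.NQ)
    have hn := hm (m + 1) (by omega)
    set n := m + 1 with hnm
    have hcomm : ∀ x, (X.NQ ^ n) (X.NQ x) = X.NQ ((X.NQ ^ n) x) := fun x => by
      rw [← Module.End.mul_apply, ← Module.End.mul_apply, ← pow_succ, ← pow_succ']
    rcases hind _ _ ((hhom n).ker_stable (inv_ne_zero (pow_ne_zero _ hp0))) (hhom n).range_stable
      (fun x hx => by
        rw [LinearMap.mem_ker] at hx ⊢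
        rw [hcomm, hx, map_zero])
      (by
        rintro _ ⟨x, rfl⟩
        exact ⟨X.NQ x, hcomm x⟩) hn with h | h
    · exfalso
      have hinj : Function.Injective X.NQ := by
        refine (injective_iff_map_eq_zero _).2 fun x hx => ?_
        have h1 : x ∈ LinearMap.ker (X.NQ ^ n) := by
          rw [LinearMap.mem_ker, hnm, pow_succ, Module.End.mul_apply, hx, map_zero]
        rw [h] at h1
        exact h1
      have h1 : LinearMap.det X.NQ ≠ 0 := det_ne_zero_of_injective hinj
      have h2 : LinearMap.det X.toPG.phi.toLinearMap ≠ 0 :=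
        det_ne_zero_of_injective X.toPG.phi.injective
      have h3 : X.NQ * X.toPG.phi.toLinearMap =
          (p : ℚ_[p]) • (X.toPG.phi.toLinearMap * X.NQ) := LinearMap.ext X.NQ_phi
      have h4 := congrArg LinearMap.det h3
      rw [LinearMap.det_smul, map_mul, map_mul, mul_comm (LinearMap.det X.NQ)] at h4
      have h5 := (mul_eq_right₀ (mul_ne_zero h2 h1)).1 h4.symm
      have h6 := congrArg Padic.valuation h5
      rw [Padic.valuation_pow, Padic.valuation_p, Padic.valuation_one, mul_one] at h6
      have h7 : 0 < finrank ℚ_[p] X.D := finrank_pos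
      have h8 : finrank ℚ_[p] X.D = 0 := by exact_mod_cast h6
      omega
    · exact ⟨n, LinearMap.range_eq_bot.1 h⟩
  have hpow : ∀ m x, (X.NQ ^ m) x = (X.N ^ m) x := by
    intro m x
    induction m with
    | zero => rfl
    | succ m ih => rw [pow_succ', pow_succ', Module.End.mul_apply, ih]; rfl
  have hnil' : IsNilpotent X.N := by
    obtain ⟨n, hn⟩ := hnil
    refine ⟨n, LinearMap.ext fun x => ?_⟩
    rw [← hpow, hn]
    rfl
  have hpos : 0 < X.nilLength := pos_nilpotencyClass_iff.2 hnil'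
  obtain ⟨b, hb⟩ := Nat.exists_eq_add_of_le' hpos
  rw [hb]
  refine PG.exists_isString hss hp0 X.NQ_op X.NQ_phi ?_ ?_ hind
  · refine LinearMap.ext fun x => ?_
    rw [hpow, ← hb, nilLength, pow_nilpotencyClass hnil']
    rfl
  · intro h0
    apply pow_pred_nilpotencyClass hnil'
    change X.N ^ (X.nilLength - 1) = 0
    rw [hb, Nat.add_sub_cancel]
    exact LinearMap.ext fun x => by rw [← hpow, h0]; rfl

end ModObj

end PhiN

namespace PhiN

open Module

namespace ModObj

attribute [local instance] TensorProduct.Algebra.module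

variable {p : ℕ} [Fact p.Prime] {L L' K : Type*} [Field L] [Field L'] [Field K]
  [Algebra ℚ_[p] L] [Algebra ℚ_[p] L'] [Algebra ℚ_[p] K] [Algebra L L']
  [IsScalarTower ℚ_[p] L L'] [FiniteDimensional ℚ_[p] L'] [FiniteDimensional ℚ_[p] K]

theorem PhiGalHom.isHom {X Y : ModObj.{v} p L L' K} (f : PhiGalHom X Y) :
    PG.IsHom 1 X.toPG Y.toPG (f.f.restrictScalars ℚ_[p]) :=
  ⟨fun ω x => match ω with
    | .inl l => f.map_smul l x
    | .inr (.inl k) => _root_.map_smul f.f k x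
    | .inr (.inr g) => f.map_gal g x,
    fun x => by rw [one_smul]; exact f.map_phi x⟩

/-- A morphism from its underlying `ℚ_p`-linear map. -/
def homOf {X Y : ModObj.{v} p L L' K} (f : X.toPG.V →ₗ[ℚ_[p]] Y.toPG.V)
    (hf : PG.IsHom 1 X.toPG Y.toPG f) : PhiGalHom X Y where
  f := { toFun := f
         map_add' := map_add f
         map_smul' := fun k x => hf.map_op (.inr (.inl k)) x }
  map_smul := fun l x => hf.map_op (.inl l) x
  map_phi := fun x => by
    have h := hf.map_phi x
    rw [one_smul] at h
    exact h
  map_gal := fun g x => hf.map_op (.inr (.inr g)) x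

theorem sameType_iff {X Y : ModObj.{v} p L L' K} :
    SameType X Y ↔ ∃ f, PG.IsHom 1 X.toPG Y.toPG f ∧ f ≠ 0 := by
  constructor
  · rintro ⟨f, hf⟩
    exact ⟨_, f.isHom, fun h => hf (LinearMap.ext fun x => LinearMap.congr_fun h x)⟩
  · rintro ⟨f, hf, h0⟩
    exact ⟨homOf f hf, fun h => h0 (LinearMap.ext fun x => LinearMap.congr_fun h x)⟩

theorem kerTwistIso_iff {X Y : ModObj.{v} p L L' K} {θX θY} {bX bY : ℕ}
    (hX : PG.IsString (p : ℚ_[p]) X.toPG X.NQ θX bX)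
    (hY : PG.IsString (p : ℚ_[p]) Y.toPG Y.NQ θY bY) (l : ℤ) :
    KerTwistIso X Y l ↔ PG.Tw ((p : ℚ_[p]) ^ l) hX.kerPG hY.kerPG := by
  have hp0 : (p : ℚ_[p]) ≠ 0 := Nat.cast_ne_zero.2 (Fact.out : p.Prime).ne_zero
  constructor
  · rintro ⟨e, h1, h2, h3⟩
    let f : hX.kerPG.V →ₗ[ℚ_[p]] hY.kerPG.V :=
      { toFun := fun x => ⟨e ⟨x.1, x.2⟩, (e ⟨x.1, x.2⟩).2⟩
        map_add' := fun x y => Subtype.ext (congrArg Subtype.val (map_add e ⟨x.1, x.2⟩ ⟨y.1, y.2⟩))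
        map_smul' := fun c x => by
          apply Subtype.ext
          have h := congrArg Subtype.val (map_smul e (algebraMap ℚ_[p] K c) ⟨x.1, x.2⟩)
          have h4 : algebraMap ℚ_[p] K c • (⟨x.1, x.2⟩ : LinearMap.ker X.N) =
              ⟨(c • x : hX.kerPG.V).1, (c • x : hX.kerPG.V).2⟩ :=
            Subtype.ext (algebraMap_smul K c (x.1 : X.D))
          rw [h4] at h
          exact h.trans (algebraMap_smul K c _) }
    refine ⟨f, ⟨fun ω x => Subtype.ext ?_, fun x => Subtype.ext ?_⟩, fun h0 => ?_⟩
    · match ω with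
      | .inl l => exact h1 l ⟨x.1, x.2⟩ ⟨_, (hX.kerPG.op (.inl l) x).2⟩ rfl
      | .inr (.inl k) => exact congrArg Subtype.val (map_smul e k ⟨x.1, x.2⟩)
      | .inr (.inr g) => exact h3 g ⟨x.1, x.2⟩ ⟨_, (hX.kerPG.op (.inr (.inr g)) x).2⟩ rfl
    · exact h2 ⟨x.1, x.2⟩ ⟨_, ((p : ℚ_[p]) ^ l • hX.kerPG.phi x).2⟩ (X.zpow_smul' l _)
    · obtain ⟨y, hy, hy0⟩ := Submodule.exists_mem_ne_zero_of_ne_bot hX.ker_ne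
      have h4 : e ⟨y, hy⟩ = 0 := Subtype.ext (congrArg Subtype.val
        (LinearMap.congr_fun h0 (⟨y, hy⟩ : LinearMap.ker X.NQ)))
      exact hy0 (congrArg Subtype.val ((LinearEquiv.map_eq_zero_iff e).1 h4))
  · rintro ⟨f, hf, h0⟩
    have hb := hf.bijective (zpow_ne_zero _ hp0) hX.kerPG_simple hY.kerPG_simple h0
    let e : hX.kerPG.V ≃ₗ[ℚ_[p]] hY.kerPG.V := LinearEquiv.ofBijective f hb
    refine ⟨{ toFun := fun x => ⟨(e ⟨x.1, x.2⟩).1, (e ⟨x.1, x.2⟩).2⟩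
              map_add' := fun x y => Subtype.ext (congrArg Subtype.val
                (map_add e ⟨x.1, x.2⟩ ⟨y.1, y.2⟩))
              map_smul' := fun k x => Subtype.ext (congrArg Subtype.val
                (hf.map_op (.inr (.inl k)) ⟨x.1, x.2⟩))
              invFun := fun y => ⟨(e.symm ⟨y.1, y.2⟩).1, (e.symm ⟨y.1, y.2⟩).2⟩
              left_inv := fun x => Subtype.ext (congrArg Subtype.val
                (e.symm_apply_apply ⟨x.1, x.2⟩))
              right_inv := fun y => Subtype.ext (congrArg Subtype.val
                (e.apply_symm_apply ⟨y.1, y.2⟩)) }, ?_, ?_, ?_⟩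
    · intro c x y hxy
      have h := congrArg Subtype.val (hf.map_op (.inl c) ⟨x.1, x.2⟩)
      have h4 : (⟨y.1, y.2⟩ : hX.kerPG.V) = hX.kerPG.op (.inl c) ⟨x.1, x.2⟩ := Subtype.ext hxy
      exact (congrArg (fun z => (f z).1) h4).trans h
    · intro x y hxy
      have h := congrArg Subtype.val (hf.map_phi ⟨x.1, x.2⟩)
      have h4 : (⟨y.1, y.2⟩ : hX.kerPG.V) = (p : ℚ_[p]) ^ l • hX.kerPG.phi ⟨x.1, x.2⟩ :=
        Subtype.ext (hxy.trans (X.zpow_smul' l _).symm)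
      exact (congrArg (fun z => (f z).1) h4).trans h
    · intro g x y hxy
      have h := congrArg Subtype.val (hf.map_op (.inr (.inr g)) ⟨x.1, x.2⟩)
      have h4 : (⟨y.1, y.2⟩ : hX.kerPG.V) = hX.kerPG.op (.inr (.inr g)) ⟨x.1, x.2⟩ :=
        Subtype.ext hxy
      exact (congrArg (fun z => (f z).1) h4).trans h

theorem p_zpow_eq_one {n : ℤ} (h : (p : ℚ_[p]) ^ n = 1) : n = 0 := by
  have h1 := congrArg Padic.valuation h
  rwa [Padic.valuation_zpow, Padic.valuation_p, Padic.valuation_one, mul_one] at h1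

theorem sameType_of_tw {X Y : ModObj.{v} p L L' K} {θX θY} {bX bY : ℕ}
    (hX : PG.IsString (p : ℚ_[p]) X.toPG X.NQ θX bX)
    (hY : PG.IsString (p : ℚ_[p]) Y.toPG Y.NQ θY bY) {l : ℕ} (hl : l < bX)
    (h : PG.Tw ((p : ℚ_[p]) ^ l) hX.kerPG hY.kerPG) : SameType X Y := by
  have hp0 : (p : ℚ_[p]) ≠ 0 := Nat.cast_ne_zero.2 (Fact.out : p.Prime).ne_zero
  obtain ⟨f, hf, h0⟩ := h
  refine sameType_iff.2 ⟨hY.sec 0 ∘ₗ f ∘ₗ hX.proj l, ?_, fun h => h0 (LinearMap.ext fun y => ?_)⟩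
  · have h1 := ((hX.isHom_proj hp0 l).comp hf).comp (hY.isHom_sec 0)
    rwa [inv_mul_cancel₀ (pow_ne_zero _ hp0), pow_zero, one_mul] at h1
  · have h1 := LinearMap.congr_fun h (hX.sec l y)
    have h2 : hX.proj l (hX.sec l y) = y := Subtype.ext (by
      rw [PG.IsString.proj_coe, hX.θ_sec l l hl, if_pos rfl])
    rw [LinearMap.comp_apply, LinearMap.comp_apply, h2] at h1
    exact Subtype.ext ((hY.sec_zero _).symm.trans h1)

section Family

variable {s : ℕ} {D : Fin s → ModObj.{v} p L L' K} {θ : ∀ k, (D k).toPG.V →ₗ[ℚ_[p]] (D k).toPG.V}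
  (hstr : ∀ k, PG.IsString (p : ℚ_[p]) (D k).toPG (D k).NQ (θ k) (D k).nilLength)
  (hss : ∀ k, (D k).toPG.Semisimple) (hord : IsOrdered D) (α : ∀ k₁ k₂, Hom (D k₁) (D k₂))
  (hα : ∀ k₁ k₂, Linked D k₁ k₂ → (α k₁ k₂).f ≠ 0)

open Classical in
/-- The family of strings attached to the objects `D k` and the morphisms `α`. -/
def toFam : PG.Fam.{v} ℚ_[p] (Ops p L L' K) (p : ℚ_[p]) s where
  Z k := (D k).toPG
  N k := (D k).NQ
  θ := θ
  b k := (D k).nilLength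
  str := hstr
  ss := hss
  α k k' := if Linked D k k' then (α k k').f.restrictScalars ℚ_[p] else 0
  hom k k' := by
    split_ifs
    · exact (α k k').isHom
    · exact ⟨fun ω x => by simp, fun x => by simp⟩
  comm k k' x := by
    split_ifs
    · exact (α k k').map_N x
    · exact (map_zero (D k').NQ).symm
  lt k k' h := by
    by_contra hlt
    exact h (if_neg fun hl => hlt hl.1)
  order k k' l hne h0 hl hT := by
    obtain ⟨m, rfl⟩ := Int.eq_ofNat_of_zero_le h0.le
    have h1 : SameBlock D k k' := .rel _ _ (sameType_of_tw (l := m) (hstr k) (hstr k') (by omega)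
      (by rw [← zpow_natCast]; exact hT))
    exact hord.twist k k' h1 hne _ h0 ((kerTwistIso_iff (hstr k) (hstr k') _).2 hT)
  start k k' hlt hT hmin := by
    have key : ∀ k', SameStart D k k' ↔ PG.Tw 1 (hstr k).kerPG (hstr k').kerPG := by
      intro k'
      have h1 := kerTwistIso_iff (hstr k) (hstr k') 0
      rw [zpow_zero] at h1
      refine ⟨fun h => h1.1 h.2, fun h => ⟨.rel _ _ ?_, h1.2 h⟩⟩
      exact sameType_of_tw (l := 0) (hstr k) (hstr k') (hstr k).pos (by rwa [pow_zero])
    have hl : Linked D k k' := ⟨hlt, Or.inl ⟨(key k').2 hT, fun k'' h1 h2 h3 =>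
      hmin k'' h1 h2 ((key k'').1 h3)⟩⟩
    rw [if_pos hl]
    exact fun h => hα k k' hl (LinearMap.ext fun x => LinearMap.congr_fun h x)
  ending k k' hlt hT hmin := by
    have key : ∀ k', SameEnd D k k' ↔ ∃ l : ℕ, PG.Tw ((p : ℚ_[p]) ^ l) (hstr k).kerPG
        (hstr k').kerPG ∧ (D k).nilLength = l + (D k').nilLength := by
      intro k'
      constructor
      · rintro ⟨-, l, h1, h2⟩
        have h3 := (kerTwistIso_iff (hstr k) (hstr k') _).1 h1
        rw [zpow_natCast] at h3
        exact ⟨l, h3, h2⟩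
      · rintro ⟨l, h1, h2⟩
        have := (hstr k').pos
        refine ⟨.rel _ _ (sameType_of_tw (l := l) (hstr k) (hstr k') (by omega) h1), l,
          (kerTwistIso_iff (hstr k) (hstr k') _).2 ?_, h2⟩
        rwa [zpow_natCast]
    have hl : Linked D k k' := ⟨hlt, Or.inr ⟨(key k').2 hT, fun k'' h1 h2 h3 =>
      hmin k'' h1 h2 ((key k'').1 h3)⟩⟩
    rw [if_pos hl]
    exact fun h => hα k k' hl (LinearMap.ext fun x => LinearMap.congr_fun h x)
  c_ne := Nat.cast_ne_zero.2 (Fact.out : p.Prime).ne_zero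
  c_zpow n h := p_zpow_eq_one h

theorem toFam_rel (k k' : Fin s) : (toFam hstr hss hord α hα).rel k k' ↔ SameBlock D k k' := by
  have h : (fun i j => ∃ f, PG.IsHom 1 (D i).toPG (D j).toPG f ∧ f ≠ 0) =
      fun i j => SameType (D i) (D j) := by
    funext i j
    exact propext sameType_iff.symm
  change Relation.EqvGen (fun i j => ∃ f, PG.IsHom 1 (D i).toPG (D j).toPG f ∧ f ≠ 0) k k' ↔ _
  rw [h]
  rfl

theorem toFam_phi (x : ∀ k, (D k).D) :
    (toFam hstr hss hord α hα).T.phi x = (modified D α).phi x := by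
  classical
  funext k
  refine (PG.Fam.T_phi_apply _ _ _).trans ?_
  change (D k).phi _ = (D k).phi (x k + linkMap D α x k)
  rw [linkMap_apply]
  congr 2
  refine Finset.sum_congr rfl fun k₁ _ => ?_
  change (if Linked D k₁ k then (α k₁ k).f.restrictScalars ℚ_[p] else 0) (x k₁) = _
  split_ifs <;> rfl

theorem toFam_stable_iff (E : Submodule ℚ_[p] (∀ k, (D k).D)) :
    (toFam hstr hss hord α hα).T.Stable E ↔ (modified D α).toPG.Stable E := by
  have h1 : ∀ ω x, (toFam hstr hss hord α hα).T.op ω x = (modified D α).toPG.op ω x := by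
    intro ω x
    funext k
    match ω with
    | .inl l => rfl
    | .inr (.inl k) => rfl
    | .inr (.inr g) => rfl
  constructor
  · intro h
    exact ⟨fun ω x hx => h1 ω x ▸ h.op_mem ω x hx,
      fun x hx => toFam_phi hstr hss hord α hα x ▸ h.phi_mem x hx⟩
  · intro h
    exact ⟨fun ω x hx => (h1 ω x).symm ▸ h.op_mem ω x hx,
      fun x hx => (toFam_phi hstr hss hord α hα x).symm ▸ h.phi_mem x hx⟩

end Family

end ModObj

end PhiN

namespace PhiN

open Module

theorem trace_semilinear {F V : Type*} [Field F] [AddCommGroup V] [Module F V]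
    [FiniteDimensional F V] (s : F ≃+* F) (φ : V ≃+ V) (hφ : ∀ a x, φ (a • x) = s a • φ x)
    (f : V →ₗ[F] V) (hf : ∀ x, f (φ x) = φ (f x)) :
    s (LinearMap.trace F V f) = LinearMap.trace F V f := by
  classical
  let b := finBasis F V
  have hli : LinearIndependent F fun i => φ (b i) := by
    rw [Fintype.linearIndependent_iff]
    intro g hg i
    have h1 : φ (∑ i, s.symm (g i) • b i) = 0 := by
      rw [map_sum, ← hg]
      exact Finset.sum_congr rfl fun i _ => by rw [hφ, s.apply_symm_apply]
    have h2 := Fintype.linearIndependent_iff.1 b.linearIndependent _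
      ((AddEquiv.map_eq_zero_iff φ).1 h1) i
    exact (RingEquiv.map_eq_zero_iff s.symm).1 h2
  let b' := basisOfLinearIndependentOfCardEqFinrank' _ hli (by simp)
  have hb' : ∀ i, b' i = φ (b i) := fun i => by simp [b']
  have h3 : ∀ i j, b'.repr (f (b' j)) i = s (b.repr (f (b j)) i) := by
    intro i j
    have h4 : f (b' j) = ∑ i, s (b.repr (f (b j)) i) • b' i := by
      conv_lhs => rw [hb', hf, ← b.sum_repr (f (b j)), map_sum]
      exact Finset.sum_congr rfl fun i _ => by rw [hφ, hb']
    rw [h4, b'.repr_sum_self]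
  conv_lhs => rw [LinearMap.trace_eq_matrix_trace F b f, Matrix.trace, map_sum]
  conv_rhs => rw [LinearMap.trace_eq_matrix_trace F b' f, Matrix.trace]
  refine Finset.sum_congr rfl fun i _ => ?_
  rw [Matrix.diag_apply, Matrix.diag_apply, LinearMap.toMatrix_apply, LinearMap.toMatrix_apply, h3]

theorem trace_eq_of_conj {k U U' : Type*} [Field k] [AddCommGroup U] [Module k U] [AddCommGroup U']
    [Module k U'] (e : U ≃ₗ[k] U') (g : U →ₗ[k] U) (g' : U' →ₗ[k] U')
    (h : ∀ x, e (g x) = g' (e x)) : LinearMap.trace k U g = LinearMap.trace k U' g' := by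
  rw [← LinearMap.trace_conj' g e]
  congr 1
  refine LinearMap.ext fun x => ?_
  simp [h]

section InfPart

variable {k F K M : Type*} [Field k] [Field F] [Field K] [Algebra k F] [Algebra k K]
  [AddCommGroup M] [Module k M] [FiniteDimensional k F] [FiniteDimensional k K]
  [FiniteDimensional k M] [CharZero k]
  (ρF : F →ₐ[k] End k M) (ρK : K →ₐ[k] End k M) (hc : ∀ l x, Commute (ρF l) (ρK x))
  (h : Splits k F K) {U : Submodule k M} (hF : ∀ l, ∀ m ∈ U, ρF l m ∈ U)
  (hK : ∀ x, ∀ m ∈ U, ρK x m ∈ U)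

include hc in
theorem commute_restrictRep (l : F) (x : K) :
    Commute (restrictRep ρF U hF l) (restrictRep ρK U hK x) :=
  LinearMap.ext fun m => Subtype.ext (LinearMap.congr_fun (hc l x) (m : M))

include hc h hF hK in
theorem sum_finrank_inf_part : ∑ σ, finrank k ↥(U ⊓ part ρF ρK σ) = finrank k U := by
  rw [← sum_finrank_part _ _ (commute_restrictRep ρF ρK hc hF hK) h]
  exact Finset.sum_congr rfl fun σ _ => (finrank_part_restrict ρF ρK hF hK σ).symm

include hc h in
theorem finrank_inf_part_mul {C : k}
    (htr : ∀ l x, LinearMap.trace k U ((ρF l * ρK x).restrict fun m hm =>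
      hF l _ (hK x m hm)) = C * (Algebra.trace k F l * Algebra.trace k K x)) (σ : F →ₐ[k] K) :
    finrank k F * finrank k ↥(U ⊓ part ρF ρK σ) = finrank k U := by
  rw [← finrank_part_restrict ρF ρK hF hK σ]
  exact finrank_part_mul _ _ (commute_restrictRep ρF ρK hc hF hK) h htr σ

end InfPart

namespace ModObj

attribute [local instance] TensorProduct.Algebra.module

variable {p : ℕ} [Fact p.Prime] {L L' K : Type*} [Field L] [Field L'] [Field K]
  [Algebra ℚ_[p] L] [Algebra ℚ_[p] L'] [Algebra ℚ_[p] K] [Algebra L L']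
  [IsScalarTower ℚ_[p] L L'] [FiniteDimensional ℚ_[p] L'] [FiniteDimensional ℚ_[p] K]
  (X : ModObj.{v} p L L' K)

theorem finite_L : FiniteDimensional (maxUnram p L') X.D :=
  have := X.finite_Q
  Module.Finite.of_restrictScalars_finite ℚ_[p] _ _

variable {X} {E : Submodule (maxUnram p L') X.D} (hK : ∀ k : K, ∀ x ∈ E, k • x ∈ E)
  (hφ : ∀ x ∈ E, X.phi x ∈ E)

/-- The action of `k : K` on a stable subspace. -/
def resK (k : K) : E →ₗ[maxUnram p L'] E :=
  (DistribSMul.toLinearMap (maxUnram p L') X.D k).restrict (hK k)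

include hφ in
theorem exists_trace_resK : ∃ C : ℚ_[p], ∀ k, LinearMap.trace _ _ (resK hK k) =
    algebraMap ℚ_[p] (maxUnram p L') (C * Algebra.trace ℚ_[p] K k) := by
  have := X.finite_Q
  have := X.finite_K
  have := X.finite_L
  let EK : Submodule K X.D :=
    { carrier := E
      add_mem' := E.add_mem
      zero_mem' := E.zero_mem
      smul_mem' := hK }
  have hph : Function.Bijective fun x : E => (⟨X.phi (x : X.D), hφ x x.2⟩ : E) := by
    refine ⟨fun x y h => Subtype.ext (X.phi.injective (congrArg Subtype.val h)), fun y => ?_⟩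
    have h1 := X.phi_zpow_mem (E := E.restrictScalars ℚ_[p]) hφ (-1) y y.2
    exact ⟨⟨_, h1⟩, Subtype.ext (X.phi.apply_symm_apply _)⟩
  let φE : E ≃+ E := AddEquiv.ofBijective
    (⟨⟨fun x : E => (⟨X.phi (x : X.D), hφ x x.2⟩ : E), Subtype.ext (map_zero X.phi)⟩,
      fun x y => Subtype.ext (map_add X.phi (x : X.D) (y : X.D))⟩ : E →+ E) hph
  have hf : (finrank ℚ_[p] (maxUnram p L') : ℚ_[p]) ≠ 0 :=
    Nat.cast_ne_zero.2 finrank_pos.ne'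
  refine ⟨finrank K EK / finrank ℚ_[p] (maxUnram p L'), fun k => ?_⟩
  obtain ⟨t, ht⟩ := (IsGalois.mem_range_algebraMap_iff_fixed (F := ℚ_[p])
    (LinearMap.trace _ _ (resK hK k))).2 fun g => by
      obtain ⟨i, rfl⟩ := exists_frob_pow p L' g
      have h1 := trace_semilinear (frob p L' : maxUnram p L' ≃+* maxUnram p L') φE
        (fun a x => Subtype.ext (X.phi_smul a x)) (resK hK k)
        (fun x => Subtype.ext (map_smul X.phi k (x : X.D)).symm)
      induction i with
      | zero => rfl
      | succ i ih => rw [pow_succ, AlgEquiv.mul_apply]; exact (congrArg _ h1).trans ih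
  rw [← ht]
  congr 1
  have h1 := trace_restrictScalars ℚ_[p] (resK hK k)
  rw [← ht, Algebra.trace_algebraMap] at h1
  have h2 := trace_restrictScalars ℚ_[p] (k • LinearMap.id : EK →ₗ[K] EK)
  have h4 : LinearMap.trace K EK (k • LinearMap.id) = (finrank K EK : K) * k := by
    rw [map_smul, LinearMap.trace_id, smul_eq_mul, mul_comm]
  rw [h4, ← nsmul_eq_mul, map_nsmul] at h2
  have h3 := trace_eq_of_conj (k := ℚ_[p]) (U := EK) (U' := E)
    { toFun := fun x => ⟨x.1, x.2⟩
      map_add' := fun _ _ => rfl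
      map_smul' := fun _ _ => rfl
      invFun := fun x => ⟨x.1, x.2⟩
      left_inv := fun _ => rfl
      right_inv := fun _ => rfl } ((k • LinearMap.id : EK →ₗ[K] EK).restrictScalars ℚ_[p])
      ((resK hK k).restrictScalars ℚ_[p]) fun x => rfl
  rw [h1, h2, nsmul_eq_mul, nsmul_eq_mul] at h3
  field_simp
  linear_combination -h3

variable (X)

/-- The action of `L` on `D_{L'}`. -/
def rhoDL : L →ₐ[ℚ_[p]] End ℚ_[p] X.DL :=
  (Algebra.lsmul ℚ_[p] ℚ_[p] X.DL : L' →ₐ[ℚ_[p]] _).comp (IsScalarTower.toAlgHom ℚ_[p] L L')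

theorem actK_tmul (k : K) (l : L') (x : X.D) : X.actK k (l ⊗ₜ x) = l ⊗ₜ (k • x) := rfl

/-- The action of `K` on `D_{L'}`. -/
def rhoDK : K →ₐ[ℚ_[p]] End ℚ_[p] X.DL where
  toFun k := (X.actK k).restrictScalars ℚ_[p]
  map_one' := LinearMap.ext fun x => by
    induction x using TensorProduct.induction_on with
    | zero => simp
    | tmul l x => exact (X.actK_tmul 1 l x).trans (by rw [one_smul]; rfl)
    | add x y hx hy => rw [map_add, hx, hy]; rfl
  map_mul' a b := LinearMap.ext fun x => by
    induction x using TensorProduct.induction_on with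
    | zero => simp
    | tmul l x => exact (X.actK_tmul (a * b) l x).trans (by rw [mul_smul]; rfl)
    | add x y hx hy => rw [map_add, hx, hy, map_add]
  map_zero' := LinearMap.ext fun x => by
    induction x using TensorProduct.induction_on with
    | zero => simp
    | tmul l x => exact (X.actK_tmul 0 l x).trans (by rw [zero_smul, TensorProduct.tmul_zero]; rfl)
    | add x y hx hy => rw [map_add, hx, hy]; rfl
  map_add' a b := LinearMap.ext fun x => by
    induction x using TensorProduct.induction_on with
    | zero => simp
    | tmul l x => exact (X.actK_tmul (a + b) l x).trans (by
        rw [add_smul, TensorProduct.tmul_add]; rfl)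
    | add x y hx hy => rw [map_add, hx, hy, map_add]
  commutes' c := LinearMap.ext fun x => by
    induction x using TensorProduct.induction_on with
    | zero => simp
    | tmul l x => exact (X.actK_tmul _ l x).trans (by
        rw [algebraMap_smul, Module.algebraMap_end_apply, TensorProduct.smul_tmul',
          ← algebraMap_smul (maxUnram p L') c x, ← TensorProduct.smul_tmul, algebraMap_smul])
    | add x y hx hy => rw [map_add, hx, hy, map_add]

theorem commute_rhoD (l : L) (k : K) : Commute (X.rhoDL l) (X.rhoDK k) :=
  LinearMap.ext fun x => (map_smul (X.actK k) (algebraMap L L' l) x).symm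

theorem finite_DL : FiniteDimensional ℚ_[p] X.DL :=
  have := X.finite_L
  Module.Finite.trans L' X.DL

theorem finrank_Q (W : Submodule L' X.DL) :
    finrank ℚ_[p] (W.restrictScalars ℚ_[p]) = finrank ℚ_[p] L' * finrank L' W := by
  have : Module.Free L' W := Module.Free.of_divisionRing L' W
  exact (finrank_mul_finrank ℚ_[p] L' W).symm

variable [FiniteDimensional ℚ_[p] L] (hLK : Splits ℚ_[p] L K)

include hLK in
theorem sum_finrank_sigma {W : Submodule L' X.DL} (hW : ∀ k, ∀ x ∈ W, X.actK k x ∈ W) :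
    ∑ σ, finrank L' ↥(W ⊓ X.sigmaPart σ) = finrank L' W := by
  have := X.finite_DL
  have h := sum_finrank_inf_part X.rhoDL X.rhoDK X.commute_rhoD hLK
    (U := W.restrictScalars ℚ_[p]) (fun l x hx => W.smul_mem (algebraMap L L' l) hx) hW
  have h1 : ∀ σ, finrank ℚ_[p] ↥(W.restrictScalars ℚ_[p] ⊓ part X.rhoDL X.rhoDK σ) =
      finrank ℚ_[p] L' * finrank L' ↥(W ⊓ X.sigmaPart σ) := fun σ => X.finrank_Q (W ⊓ X.sigmaPart σ)
  rw [Finset.sum_congr rfl fun σ _ => h1 σ, ← Finset.mul_sum, X.finrank_Q] at h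
  exact Nat.eq_of_mul_eq_mul_left finrank_pos h

variable {X}

theorem actK_mem_baseChange (hK : ∀ k : K, ∀ x ∈ E, k • x ∈ E) (k : K) :
    ∀ x ∈ E.baseChange L', X.actK k x ∈ E.baseChange L' := by
  intro x hx
  rw [Submodule.baseChange_eq_span] at hx
  induction hx using Submodule.span_induction with
  | mem x hx =>
    obtain ⟨y, hy, rfl⟩ := hx
    exact Submodule.tmul_mem_baseChange_of_mem (1 : L') (hK k y hy)
  | zero => rw [map_zero]; exact Submodule.zero_mem _
  | add x y _ _ hx hy => rw [map_add]; exact Submodule.add_mem _ hx hy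
  | smul a x _ hx => rw [map_smul]; exact Submodule.smul_mem _ _ hx

variable (E) in
/-- `E_{L'} = L' ⊗ E`. -/
def baseChangeEquiv : L' ⊗[maxUnram p L'] E ≃ₗ[L'] E.baseChange L' :=
  LinearEquiv.ofBijective (E.toBaseChange L') ⟨fun x y h =>
    Module.Flat.lTensor_preserves_injective_linearMap (M := L') E.subtype E.injective_subtype
      (congrArg Subtype.val h), E.toBaseChange_surjective L'⟩

theorem finrank_baseChange (E : Submodule (maxUnram p L') X.D) :
    finrank L' (E.baseChange L') = finrank (maxUnram p L') E := by
  rw [← (baseChangeEquiv E).finrank_eq, Module.finrank_baseChange]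

include hLK hK hφ in
theorem finrank_sigma (σ : L →ₐ[ℚ_[p]] K) :
    finrank ℚ_[p] L * finrank L' ↥(E.baseChange L' ⊓ X.sigmaPart σ) =
      finrank (maxUnram p L') E := by
  have := X.finite_DL
  have := X.finite_L
  have := Module.Finite.of_restrictScalars_finite ℚ_[p] L L'
  obtain ⟨C, hC⟩ := exists_trace_resK hK hφ
  let f : L' ⊗[maxUnram p L'] E →ₗ[ℚ_[p]] X.DL := (E.subtype.baseChange L').restrictScalars ℚ_[p]
  have hf : Function.Injective f :=
    Module.Flat.lTensor_preserves_injective_linearMap (M := L') E.subtype E.injective_subtype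
  obtain ⟨U, hU⟩ : ∃ U, U = LinearMap.range f := ⟨_, rfl⟩
  have hUE : U = (E.baseChange L').restrictScalars ℚ_[p] := by
    rw [hU]
    ext x
    exact ⟨fun ⟨y, hy⟩ => hy ▸ (E.toBaseChange L' y).2, fun hx => by
      obtain ⟨y, hy⟩ := E.toBaseChange_surjective L' ⟨x, hx⟩
      exact ⟨y, congrArg Subtype.val hy⟩⟩
  have hl : ∀ l, ∀ x ∈ U, X.rhoDL l x ∈ U := by
    rw [hUE]
    exact fun l x hx => (E.baseChange L').smul_mem (algebraMap L L' l) hx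
  have hk : ∀ k, ∀ x ∈ U, X.rhoDK k x ∈ U := by
    rw [hUE]
    exact actK_mem_baseChange hK
  let e : L' ⊗[maxUnram p L'] E ≃ₗ[ℚ_[p]] U :=
    (LinearEquiv.ofInjective f hf).trans (LinearEquiv.ofEq _ _ hU.symm)
  have h := finrank_inf_part_mul X.rhoDL X.rhoDK X.commute_rhoD hLK hl hk
    (C := C * finrank L L') (fun l k => by
      refine (trace_eq_of_conj (U := L' ⊗[maxUnram p L'] E) (U' := U) e ((algebraMap L L' l •
        (resK hK k).baseChange L').restrictScalars ℚ_[p]) _ fun x => Subtype.ext ?_).symm.trans ?_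
      · induction x using TensorProduct.induction_on with
        | zero => rw [map_zero, map_zero, map_zero]
        | tmul a x => rfl
        | add x y hx hy =>
          rw [map_add, map_add, map_add, map_add]
          exact congrArg₂ (· + ·) hx hy
      · rw [trace_restrictScalars, map_smul, LinearMap.trace_baseChange, hC,
          ← IsScalarTower.algebraMap_apply ℚ_[p] (maxUnram p L') L', smul_eq_mul, mul_comm,
          ← Algebra.smul_def, map_smul, ← Algebra.trace_trace (R := ℚ_[p]) (S := L) (T := L'),
          Algebra.trace_algebraMap, map_nsmul, smul_eq_mul, nsmul_eq_mul]
        ring) σ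
  have h1 : finrank ℚ_[p] ↥((E.baseChange L').restrictScalars ℚ_[p] ⊓
      part X.rhoDL X.rhoDK σ) = finrank ℚ_[p] L' * finrank L' ↥(E.baseChange L' ⊓ X.sigmaPart σ) :=
    X.finrank_Q (E.baseChange L' ⊓ X.sigmaPart σ)
  rw [hUE, h1, X.finrank_Q, finrank_baseChange] at h
  refine Nat.eq_of_mul_eq_mul_left (finrank_pos (R := ℚ_[p]) (M := L')) ?_
  rw [← h]
  ring

end ModObj

end PhiN

namespace PhiN

open Module

section Descent

variable {F F' M : Type*} [Field F] [Field F'] [Algebra F F'] [FiniteDimensional F F']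
  [IsGalois F F'] [AddCommGroup M] [Module F M] [Module F' M] [IsScalarTower F F' M]
  {a : (F' ≃ₐ[F] F') → M →+ M} (ha : ∀ g (l : F') m, a g (l • m) = g l • a g m)
  (h1 : ∀ m, a 1 m = m) (hm : ∀ g h m, a (g * h) m = a g (a h m))

include ha in
/-- The invariants of a semilinear action. -/
def invariants : Submodule F M where
  carrier := {m | ∀ g, a g m = m}
  add_mem' hx hy g := by rw [map_add, hx g, hy g]
  zero_mem' g := map_zero _
  smul_mem' c x hx g := by rw [← algebraMap_smul F' c x, ha, g.commutes, hx g]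

include hm in
theorem sum_mem_invariants (m : M) : ∑ g, a g m ∈ invariants ha := by
  intro h
  rw [map_sum]
  exact Fintype.sum_equiv (Equiv.mulLeft h) _ _ fun g => (hm h g m).symm

include h1 hm in
theorem mem_span_invariants {W : Submodule F' M} (hW : ∀ g, ∀ m ∈ W, a g m ∈ W) {w : M}
    (hw : w ∈ W) : w ∈ Submodule.span F' (W ∩ invariants ha : Set M) := by
  by_contra hn
  obtain ⟨f, hf, hle⟩ := Submodule.exists_le_ker_of_notMem hn
  have h2 := Fintype.linearIndependent_iff.1 ((linearIndependent_monoidHom F' F').comp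
    (fun g : F' ≃ₐ[F] F' => ((g : F' →ₐ[F] F') : F' →* F')) fun g h e => AlgEquiv.ext fun x =>
      DFunLike.congr_fun e x) (fun g => f (a g w)) (funext fun l => by
    have h3 := hle (Submodule.subset_span ⟨W.sum_mem fun g _ => hW g _ (W.smul_mem l hw),
      sum_mem_invariants ha hm (l • w)⟩)
    rw [LinearMap.mem_ker, map_sum] at h3
    rw [Finset.sum_apply]
    refine Eq.trans ?_ h3
    refine Finset.sum_congr rfl fun g _ => ?_
    rw [ha, map_smul, smul_eq_mul, mul_comm]
    rfl) 1
  exact hf (by rwa [h1] at h2)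

include hm in
theorem linearIndependent_of_invariants {ι : Type*} {v : ι → M} (hv : LinearIndependent F v)
    (hi : ∀ i, v i ∈ invariants ha) : LinearIndependent F' v := by
  rw [linearIndependent_iff'] at hv ⊢
  intro s c hc i his
  refine traceForm_nondegenerate F F' |>.1 _ fun l => ?_
  refine hv s (fun i => Algebra.traceForm F F' (c i) l) ?_ i his
  calc ∑ j ∈ s, Algebra.traceForm F F' (c j) l • v j
      = ∑ j ∈ s, ∑ g : F' ≃ₐ[F] F', a g (l • c j • v j) := Finset.sum_congr rfl fun j _ => by
        rw [← algebraMap_smul F', Algebra.traceForm_apply, trace_eq_sum_automorphisms,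
          Finset.sum_smul]
        refine Finset.sum_congr rfl fun g _ => ?_
        rw [smul_smul, ha, hi j g, mul_comm]
    _ = ∑ g : F' ≃ₐ[F] F', a g (l • ∑ j ∈ s, c j • v j) := by
        rw [Finset.sum_comm]
        exact Finset.sum_congr rfl fun g _ => by rw [Finset.smul_sum, map_sum]
    _ = 0 := by simp [hc]

include h1 hm in
theorem finrank_invariants [FiniteDimensional F' M] {W : Submodule F' M}
    (hW : ∀ g, ∀ m ∈ W, a g m ∈ W) :
    finrank F ↥(W.restrictScalars F ⊓ invariants ha) = finrank F' W := by
  have : FiniteDimensional F M := Module.Finite.trans F' M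
  let b := finBasis F ↥(W.restrictScalars F ⊓ invariants ha)
  have hl := linearIndependent_of_invariants ha hm (v := fun i => (b i : M))
    (b.linearIndependent.map' (Submodule.subtype _) (Submodule.ker_subtype _))
    fun i => (b i).2.2
  have h2 : Submodule.span F' (Set.range fun i => (b i : M)) = W := by
    apply le_antisymm
    · rw [Submodule.span_le]
      rintro _ ⟨i, rfl⟩
      exact (b i).2.1
    · intro w hw
      refine Submodule.span_le.2 (fun m hmW => ?_) (mem_span_invariants ha h1 hm hW hw)
      have h3 := congrArg Subtype.val (b.sum_repr ⟨m, hmW⟩)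
      rw [AddSubmonoidClass.coe_finsetSum] at h3
      rw [SetLike.mem_coe, ← show _ = m from h3]
      refine Submodule.sum_mem _ fun i _ => ?_
      rw [Submodule.coe_smul, ← algebraMap_smul F']
      exact Submodule.smul_mem _ _ (Submodule.subset_span ⟨i, rfl⟩)
  conv_rhs => rw [← h2, finrank_span_eq_card hl, Fintype.card_fin]

end Descent

namespace ModObj

attribute [local instance] TensorProduct.Algebra.module

variable {p : ℕ} [Fact p.Prime] {L L' K : Type*} [Field L] [Field L'] [Field K]
  [Algebra ℚ_[p] L] [Algebra ℚ_[p] L'] [Algebra ℚ_[p] K] [Algebra L L']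
  [IsScalarTower ℚ_[p] L L'] [FiniteDimensional ℚ_[p] L'] [FiniteDimensional ℚ_[p] K]
  (X : ModObj.{v} p L L' K)

theorem actGal_tmul (g : L' ≃ₐ[L] L') (l : L') (x : X.D) :
    X.actGal g (l ⊗ₜ x) = g l ⊗ₜ X.gal g x := rfl

theorem actGal_smul (g : L' ≃ₐ[L] L') (l : L') (x : X.DL) :
    X.actGal g (l • x) = g l • X.actGal g x := by
  induction x using TensorProduct.induction_on with
  | zero => simp
  | tmul a x => rw [TensorProduct.smul_tmul', actGal_tmul, actGal_tmul, TensorProduct.smul_tmul',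
      smul_eq_mul, map_mul, smul_eq_mul]
  | add x y hx hy => rw [smul_add, map_add, hx, hy, map_add, smul_add]

theorem actGal_one (x : X.DL) : X.actGal 1 x = x := by
  induction x using TensorProduct.induction_on with
  | zero => simp
  | tmul a x => rw [actGal_tmul, map_one]; rfl
  | add x y hx hy => rw [map_add, hx, hy]

theorem actGal_mul (g h : L' ≃ₐ[L] L') (x : X.DL) :
    X.actGal (g * h) x = X.actGal g (X.actGal h x) := by
  induction x using TensorProduct.induction_on with
  | zero => simp
  | tmul a x => rw [actGal_tmul, map_mul]; rfl
  | add x y hx hy => rw [map_add, hx, hy, map_add, map_add]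

theorem actGal_actK (g : L' ≃ₐ[L] L') (k : K) (x : X.DL) :
    X.actGal g (X.actK k x) = X.actK k (X.actGal g x) := by
  induction x using TensorProduct.induction_on with
  | zero => simp
  | tmul a x =>
    exact congrArg (g a ⊗ₜ[maxUnram p L'] ·) (map_smul (X.gal g) k x)
  | add x y hx hy => simp only [map_add, hx, hy]

/-- The action of `K` on `D_{L'}`, as a module structure. -/
@[reducible] def moduleKDL : Module K X.DL := Module.compHom X.DL X.rhoDK.toRingHom

attribute [local instance] moduleKDL

theorem smul_DL (k : K) (x : X.DL) : k • x = X.actK k x := rfl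

/-- The space of invariants of `W ≤ D_{L'}` under `Gal(L'/L)`, as a `K`-subspace. -/
def inv (W : Submodule L' X.DL) (hW : ∀ k, ∀ x ∈ W, X.actK k x ∈ W) : Submodule K X.DL where
  carrier := {x | x ∈ W ∧ ∀ g, X.actGal g x = x}
  add_mem' hx hy := ⟨W.add_mem hx.1 hy.1, fun g => by rw [map_add, hx.2 g, hy.2 g]⟩
  zero_mem' := ⟨W.zero_mem, fun g => map_zero _⟩
  smul_mem' k x hx := ⟨hW k x hx.1, fun g => by rw [smul_DL, actGal_actK, hx.2 g]⟩

variable [IsGalois L L'] [Algebra L K] [IsScalarTower ℚ_[p] L K] [FiniteDimensional ℚ_[p] L]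

theorem finrank_inv {W : Submodule L' X.DL} (hW : ∀ k, ∀ x ∈ W, X.actK k x ∈ W)
    (hg : ∀ g, ∀ x ∈ W, X.actGal g x ∈ W) :
    finrank L' W = finrank L K * finrank K (X.inv W hW) := by
  have := X.finite_DL
  have := Module.Finite.of_restrictScalars_finite ℚ_[p] L' X.DL
  have := Module.Finite.of_restrictScalars_finite ℚ_[p] L L'
  let a : (L' ≃ₐ[L] L') → X.DL →+ X.DL := fun g => (X.actGal g).toAddMonoidHom
  have h := finrank_invariants (a := a) X.actGal_smul X.actGal_one X.actGal_mul hg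
  have : IsScalarTower ℚ_[p] K X.DL := ⟨fun c k x => by
    rw [smul_DL, Algebra.smul_def, smul_DL]
    exact (LinearMap.congr_fun (map_mul X.rhoDK (algebraMap ℚ_[p] K c) k) x).trans
      (LinearMap.congr_fun (X.rhoDK.commutes c) (X.actK k x))⟩
  have h2 : finrank ℚ_[p] L * finrank L' W = finrank ℚ_[p] K * finrank K (X.inv W hW) := by
    rw [← h]
    generalize hY : W.restrictScalars L ⊓ invariants (a := a) X.actGal_smul = Y
    have : Module.Free L Y := Module.Free.of_divisionRing L Y
    have : Module.Free K (X.inv W hW) := @Module.Free.of_divisionRing K _ _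
      (Submodule.addCommGroup (X.inv W hW)) (Submodule.module (X.inv W hW))
    rw [finrank_mul_finrank, finrank_mul_finrank]
    subst hY
    exact LinearEquiv.finrank_eq
      { toFun := fun x => ⟨x.1, x.2⟩
        map_add' := fun _ _ => rfl
        map_smul' := fun _ _ => rfl
        invFun := fun x => ⟨x.1, x.2⟩
        left_inv := fun _ => rfl
        right_inv := fun _ => rfl }
  rw [← finrank_mul_finrank ℚ_[p] L K, mul_assoc] at h2
  exact Nat.eq_of_mul_eq_mul_left finrank_pos h2

end ModObj

end PhiN

namespace PhiN

open Module

section Count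

variable {n : ℕ} {j : Fin n → ℤ} (hj : StrictMono j) {r : ℕ} (hr : r ≤ n)

include hj hr in
theorem card_lt_and_le (i : ℤ) : (Finset.univ.filter fun a : Fin n => a.val < r ∧ i ≤ j a).card =
    r - (Finset.univ.filter fun a => j a < i).card := by
  have h1 : (Finset.univ.filter fun a : Fin n => a.val < r).card = r := by
    rw [Fin.card_filter_val_lt, min_eq_right hr]
  have h2 := Finset.card_filter_add_card_filter_not
    (s := Finset.univ.filter fun a : Fin n => a.val < r) (fun a => i ≤ j a)
  rw [Finset.filter_filter, Finset.filter_filter, h1] at h2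
  by_cases h : ∃ a : Fin n, r ≤ a.val ∧ j a < i
  · obtain ⟨a, ha, hai⟩ := h
    have h3 : (Finset.univ.filter fun a : Fin n => a.val < r ∧ i ≤ j a).card = 0 := by
      rw [Finset.card_eq_zero, Finset.filter_eq_empty_iff]
      rintro b - ⟨hb, hbi⟩
      have := hj (show b < a from Fin.lt_def.2 (by omega))
      omega
    have h4 : (Finset.univ.filter fun a : Fin n => a.val < r ∧ ¬ i ≤ j a).card ≤
        (Finset.univ.filter fun a => j a < i).card :=
      Finset.card_le_card fun b hb => by simp at hb ⊢; exact hb.2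
    omega
  · push Not at h
    have h4 : (Finset.univ.filter fun a : Fin n => a.val < r ∧ ¬ i ≤ j a) =
        (Finset.univ.filter fun a => j a < i) := Finset.filter_congr fun b _ => by
      rw [not_le]
      exact ⟨fun hb => hb.2, fun hb => ⟨not_le.1 fun hle => absurd (h b hle) (not_le.2 hb), hb⟩⟩
    rw [h4] at h2
    omega

include hj hr in
theorem sum_card_le {lo hi : ℤ} (hJ : ∀ a, j a ∈ Finset.Ioc lo hi) :
    lo * r + ∑ i ∈ Finset.Ioc lo hi, ((r - (Finset.univ.filter fun a => j a < i).card : ℕ) : ℤ) =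
      ∑ a : Fin n with a.val < r, j a := by
  have h1 : ∀ i, ((r - (Finset.univ.filter fun a => j a < i).card : ℕ) : ℤ) =
      ∑ a : Fin n with a.val < r, if i ≤ j a then 1 else 0 := fun i => by
    rw [← card_lt_and_le hj hr, Finset.sum_ite, Finset.filter_filter]
    simp
  have h2 : ∀ a, ∑ i ∈ Finset.Ioc lo hi, (if i ≤ j a then (1 : ℤ) else 0) = j a - lo := fun a => by
    have h3 := Finset.mem_Ioc.1 (hJ a)
    have h4 : (Finset.Ioc lo hi).filter (fun i => i ≤ j a) = Finset.Ioc lo (j a) := by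
      ext i
      simp only [Finset.mem_filter, Finset.mem_Ioc]
      omega
    rw [Finset.sum_ite, h4]
    simp [h3.1.le]
  simp only [h1]
  rw [Finset.sum_comm]
  simp only [h2]
  rw [Finset.sum_sub_distrib, Finset.sum_const, Fin.card_filter_val_lt, min_eq_right hr]
  simp [mul_comm]

include hj hr in
theorem eq_of_drop {g : ℤ → ℕ} {κ : ℕ} (hg : Antitone g) (hd : ∀ i, κ ∣ g i)
    {lo hi : ℤ} (hlo : ∀ i ≤ lo, g i = κ * r) (hhi : ∀ i, hi < i → g i = 0)
    (hJ : ∀ i, g i ≠ g (i + 1) ↔ ∃ a : Fin n, a.val < r ∧ j a = i) (i : ℤ) :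
    g i = κ * (r - (Finset.univ.filter fun a => j a < i).card) := by
  rw [← card_lt_and_le hj hr]
  set c : ℤ → ℕ := fun i => (Finset.univ.filter fun a : Fin n => a.val < r ∧ i ≤ j a).card with hc
  have hJm : ∀ a : Fin n, a.val < r → lo ≤ j a ∧ j a ≤ hi := by
    intro a ha
    have h1 := (hJ (j a)).2 ⟨a, ha, rfl⟩
    constructor
    · by_contra hlt
      exact h1 (by rw [hlo _ (by omega), hlo _ (by omega)])
    · by_contra hlt
      exact h1 (by rw [hhi _ (by omega), hhi _ (by omega)])
  have hf : Antitone fun i => (g i : ℤ) - κ * c i := by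
    refine antitone_int_of_succ_le fun i => ?_
    by_cases h : ∃ a : Fin n, a.val < r ∧ j a = i
    · obtain ⟨a, ha, rfl⟩ := h
      have h1 : c (j a) ≤ c (j a + 1) + 1 := by
        rw [← Finset.card_singleton a]
        refine (Finset.card_le_card fun b hb => ?_).trans (Finset.card_union_le _ _)
        simp only [Finset.mem_filter, Finset.mem_univ, true_and, Finset.mem_union,
          Finset.mem_singleton] at hb ⊢
        by_cases hba : b = a
        · exact Or.inr hba
        · have := hj.injective.ne hba
          exact Or.inl ⟨hb.1, by omega⟩
      have h2 : κ ≤ g (j a) - g (j a + 1) := Nat.le_of_dvd (Nat.sub_pos_of_lt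
        (lt_of_le_of_ne (hg (by omega)) ((hJ _).2 ⟨a, ha, rfl⟩).symm)) (Nat.dvd_sub (hd _) (hd _))
      have h3 : g (j a + 1) ≤ g (j a) := hg (by omega)
      have h4 : (κ : ℤ) * c (j a) ≤ κ * (c (j a + 1) + 1) :=
        mul_le_mul_of_nonneg_left (by exact_mod_cast h1) (Int.natCast_nonneg κ)
      have h5 : (κ : ℤ) ≤ g (j a) - g (j a + 1) := by omega
      linarith
    · have h1 : g i = g (i + 1) := not_not.1 fun h' => h ((hJ i).1 h')
      have h2 : c i = c (i + 1) := congrArg Finset.card (Finset.filter_congr fun b _ =>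
        and_congr_right fun hb => by
          have : j b ≠ i := fun h' => h ⟨b, hb, h'⟩
          omega)
      rw [h1, h2]
  have h1 : (g (min lo i) : ℤ) - κ * c (min lo i) = 0 := by
    have h2 : c (min lo i) = r := by
      have h3 : (Finset.univ.filter fun a : Fin n => a.val < r).card = r := by
        rw [Fin.card_filter_val_lt, min_eq_right hr]
      conv_rhs => rw [← h3]
      exact congrArg Finset.card (Finset.filter_congr fun b _ =>
        and_iff_left_of_imp fun hb => (min_le_left _ _).trans (hJm b hb).1)
    rw [hlo _ (min_le_left _ _), h2]
    push_cast
    ring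
  have h2 : (g (max (hi + 1) i) : ℤ) - κ * c (max (hi + 1) i) = 0 := by
    have h3 : c (max (hi + 1) i) = 0 := by
      rw [hc, Finset.card_eq_zero, Finset.filter_eq_empty_iff]
      rintro b - ⟨hb, hbi⟩
      have := (hJm b hb).2
      have := (le_max_left (hi + 1) i).trans hbi
      omega
    rw [hhi _ (lt_of_lt_of_le (by omega) (le_max_left (hi + 1) i)), h3]
    simp
  have h3 := hf (min_le_right lo i)
  have h4 := hf (le_max_right (hi + 1) i)
  simp only [h1, h2] at h3 h4
  have h5 : (g i : ℤ) = κ * c i := by linarith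
  exact_mod_cast h5

end Count

namespace ModObj

attribute [local instance] TensorProduct.Algebra.module

variable {p : ℕ} [Fact p.Prime] {L L' K : Type*} [Field L] [Field L'] [Field K]
  [Algebra ℚ_[p] L] [Algebra ℚ_[p] L'] [Algebra ℚ_[p] K] [Algebra L L']
  [IsScalarTower ℚ_[p] L L'] [FiniteDimensional ℚ_[p] L'] [FiniteDimensional ℚ_[p] K]
  [FiniteDimensional ℚ_[p] L] {X : ModObj.{v} p L L' K} (F : Filtration X)

theorem Filtration.exists_bounds : ∃ lo hi : ℤ, lo ≤ hi ∧ (∀ i ≤ lo, F.Fil i = ⊤) ∧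
    ∀ i, hi < i → F.Fil i = ⊥ := by
  have := X.finite_DL
  have := Module.Finite.of_restrictScalars_finite ℚ_[p] L' X.DL
  obtain ⟨lo, hlo⟩ : ∃ lo, ⊤ ≤ F.Fil lo := by
    choose i hi using F.exhaustive
    let b := finBasis L' X.DL
    obtain ⟨m, hm⟩ := (Set.finite_range fun a => i (b a)).bddBelow
    refine ⟨m, ?_⟩
    rw [← b.span_eq, Submodule.span_le]
    rintro _ ⟨a, rfl⟩
    exact F.anti (hm ⟨a, rfl⟩) (hi _)
  obtain ⟨hi, hhi⟩ : ∃ hi, F.Fil hi ≤ ⊥ := by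
    obtain ⟨i, hi⟩ := WellFounded.has_min (measure fun i => finrank L' (F.Fil i)).wf Set.univ
      ⟨0, trivial⟩
    refine ⟨i, fun x hx => F.separated x fun k => ?_⟩
    rcases le_total k i with h | h
    · exact F.anti h hx
    · rwa [Submodule.eq_of_le_of_finrank_le (F.anti h) (not_lt.1 (hi.2 k trivial))]
  exact ⟨min lo hi, hi, min_le_right _ _,
    fun i h => top_le_iff.1 (hlo.trans (F.anti (h.trans (min_le_left _ _)))),
    fun i h => le_bot_iff.1 ((F.anti h.le).trans hhi)⟩

variable {F} {lo hi : ℤ} (hle : lo ≤ hi) (hlo : ∀ i ≤ lo, F.Fil i = ⊤)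
  (hhi : ∀ i, hi < i → F.Fil i = ⊥)

include hle hlo hhi in
theorem Filtration.tH_eq (W : Submodule L' X.DL) : F.tH W = lo * finrank L' W +
    ∑ i ∈ Finset.Ioc lo hi, (finrank L' ↥(F.Fil i ⊓ W) : ℤ) := by
  have h1 : ∀ k, lo ≤ k → ∑ i ∈ Finset.Icc lo k, i * ((finrank L' ↥(F.Fil i ⊓ W) : ℤ) -
      finrank L' ↥(F.Fil (i + 1) ⊓ W)) = lo * finrank L' ↥(F.Fil lo ⊓ W) +
        ∑ i ∈ Finset.Ioc lo k, (finrank L' ↥(F.Fil i ⊓ W) : ℤ) -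
        k * finrank L' ↥(F.Fil (k + 1) ⊓ W) := by
    intro k hk
    induction k, hk using Int.leInduction with
    | base => simp; ring
    | succ k hk ih =>
      have h2 : Finset.Icc lo (k + 1) = insert (k + 1) (Finset.Icc lo k) := by
        ext; simp only [Finset.mem_insert, Finset.mem_Icc]; omega
      have h3 : Finset.Ioc lo (k + 1) = insert (k + 1) (Finset.Ioc lo k) := by
        ext; simp only [Finset.mem_insert, Finset.mem_Ioc]; omega
      rw [h2, h3, Finset.sum_insert (by simp), Finset.sum_insert (by simp), ih]
      ring
  rw [Filtration.tH, finsum_eq_sum_of_support_subset (s := Finset.Icc lo hi), h1 hi hle,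
    hlo lo le_rfl, hhi (hi + 1) (by omega), top_inf_eq, bot_inf_eq, finrank_bot]
  · simp
  · intro i hi'
    rw [Finset.coe_Icc, Set.mem_Icc]
    by_contra hn
    refine hi' ?_
    change i * ((finrank L' ↥(F.Fil i ⊓ W) : ℤ) - finrank L' ↥(F.Fil (i + 1) ⊓ W)) = 0
    rcases le_or_gt lo i with h | h
    · rw [hhi i (by omega), hhi (i + 1) (by omega), sub_self, mul_zero]
    · rw [hlo i (by omega), hlo (i + 1) (by omega), sub_self, mul_zero]

theorem baseChange_sup (E E' : Submodule (maxUnram p L') X.D) :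
    (E ⊔ E').baseChange L' = E.baseChange L' ⊔ E'.baseChange L' := by
  apply le_antisymm
  · rw [Submodule.baseChange_eq_span, Submodule.span_le]
    rintro _ ⟨x, hx, rfl⟩
    obtain ⟨y, hy, z, hz, rfl⟩ := Submodule.mem_sup.1 hx
    rw [map_add]
    exact Submodule.add_mem_sup (Submodule.tmul_mem_baseChange_of_mem 1 hy)
      (Submodule.tmul_mem_baseChange_of_mem 1 hz)
  · exact sup_le (Submodule.baseChange_mono L' le_sup_left) (Submodule.baseChange_mono L' le_sup_right)

theorem baseChange_inf (E E' : Submodule (maxUnram p L') X.D) :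
    (E ⊓ E').baseChange L' = E.baseChange L' ⊓ E'.baseChange L' := by
  have := X.finite_DL
  have := Module.Finite.of_restrictScalars_finite ℚ_[p] L' X.DL
  have := X.finite_L
  refine Submodule.eq_of_le_of_finrank_eq (le_inf (Submodule.baseChange_mono L' inf_le_left)
    (Submodule.baseChange_mono L' inf_le_right)) ?_
  have h1 := Submodule.finrank_sup_add_finrank_inf_eq (E.baseChange L') (E'.baseChange L')
  have h2 := Submodule.finrank_sup_add_finrank_inf_eq E E'
  rw [← baseChange_sup, finrank_baseChange, finrank_baseChange, finrank_baseChange] at h1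
  rw [finrank_baseChange]
  omega

variable (X) in
theorem tNSub_eq (E : Submodule (maxUnram p L') X.D) (hE : ∀ x ∈ E, X.phi x ∈ E) :
    resDeg p L' * X.tNSub E hE =
      wt (X.phi.restrictScalars ℚ_[p]).toLinearMap (E.restrictScalars ℚ_[p]) := by
  have := X.finite_L
  have := X.finite_Q
  have hf : (resDeg p L' : ℚ) ≠ 0 := Nat.cast_ne_zero.2 (resDeg_pos p L').ne'
  let f : E →ₗ[ℚ_[p]] E := (X.phi.restrictScalars ℚ_[p]).toLinearMap.restrict
    (p := E.restrictScalars ℚ_[p]) (q := E.restrictScalars ℚ_[p]) hE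
  have h1 : (X.phiPow.restrict (X.phiPow_mem E hE)).restrictScalars ℚ_[p] = f ^ resDeg p L' := by
    have h2 : ∀ (n : ℕ) (x : E), (((f ^ n) x : E) : X.D) = (X.phi ^ n) (x : X.D) := by
      intro n
      induction n with
      | zero => exact fun x => rfl
      | succ n ih =>
        intro x
        rw [pow_succ', pow_succ', LinearEquiv.mul_apply, ← ih]
        rfl
    exact LinearMap.ext fun x => Subtype.ext (h2 _ x).symm
  have h2 : LinearMap.det f ^ resDeg p L' =
      Algebra.norm ℚ_[p] (LinearMap.det (X.phiPow.restrict (X.phiPow_mem E hE))) := by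
    rw [← map_pow, ← h1, LinearMap.det_restrictScalars]
  have h3 : wt (X.phi.restrictScalars ℚ_[p]).toLinearMap (E.restrictScalars ℚ_[p]) =
      (LinearMap.det f).valuation := wt_eq hE
  rw [tNSub, valP, ← h2, h3, Padic.valuation_pow, ← resDeg]
  push_cast
  field_simp

variable (X) in
theorem tN_eq : resDeg p L' * X.tN = wt (X.phi.restrictScalars ℚ_[p]).toLinearMap ⊤ := by
  rw [← Submodule.restrictScalars_top ℚ_[p] (maxUnram p L') X.D,
    ← X.tNSub_eq ⊤ fun _ _ => Submodule.mem_top]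
  unfold tN tNSub
  congr 3
  exact (det_eq_of_conj Submodule.topEquiv _ _ fun _ => rfl).symm

variable (X) in
theorem isScalarTower_tensor :
    IsScalarTower ℚ_[p] (maxUnram p L' ⊗[ℚ_[p]] K) X.D := by
  refine IsScalarTower.of_algebraMap_smul (R := ℚ_[p]) (A := maxUnram p L' ⊗[ℚ_[p]] K)
    (M := X.D) fun c x => ?_
  rw [Algebra.TensorProduct.algebraMap_apply]
  refine (TensorProduct.Algebra.smul_def _ _ _).trans ?_
  rw [one_smul, algebraMap_smul]

variable {E : Submodule (maxUnram p L') X.D} (hK : ∀ k : K, ∀ x ∈ E, k • x ∈ E)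
  (hφ : ∀ x ∈ E, X.phi x ∈ E) (hL'K : Splits ℚ_[p] (maxUnram p L') K)

variable (E) in
theorem finrank_Q_D : finrank ℚ_[p] (E.restrictScalars ℚ_[p]) =
    resDeg p L' * finrank (maxUnram p L') E := by
  have : Module.Free (maxUnram p L') E := Module.Free.of_divisionRing (maxUnram p L') E
  exact (finrank_mul_finrank ℚ_[p] (maxUnram p L') E).symm

/-- The component at `σ` of a subspace stable under `L'₀` and `K`. -/
def infWD (hK : ∀ k : K, ∀ x ∈ E, k • x ∈ E) (σ : maxUnram p L' →ₐ[ℚ_[p]] K) :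
    Submodule K X.D where
  carrier := {x | x ∈ E ∧ x ∈ X.WDspace σ}
  add_mem' hx hy := ⟨E.add_mem hx.1 hy.1, (X.WDspace σ).add_mem hx.2 hy.2⟩
  zero_mem' := ⟨E.zero_mem, (X.WDspace σ).zero_mem⟩
  smul_mem' k x hx := ⟨hK k x hx.1, (X.WDspace σ).smul_mem k hx.2⟩

include hφ hL'K in
theorem finrank_eq_infWD (σ : maxUnram p L' →ₐ[ℚ_[p]] K) :
    finrank (maxUnram p L') E = finrank ℚ_[p] K * finrank K (infWD hK σ) := by
  have := X.finite_Q
  have := X.finite_L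
  obtain ⟨C, hC⟩ := exists_trace_resK hK hφ
  have h := finrank_inf_part_mul X.rhoL X.rhoK X.commute_rho hL'K
    (U := E.restrictScalars ℚ_[p]) (fun l x hx => E.smul_mem l hx) hK (C := C) (fun l k => by
      refine (trace_eq_of_conj (U := E) (U' := E.restrictScalars ℚ_[p]) (LinearEquiv.refl ℚ_[p] E)
        ((l • resK hK k).restrictScalars ℚ_[p]) _ fun x => rfl).symm.trans ?_
      rw [trace_restrictScalars, map_smul, hC, smul_eq_mul, mul_comm, ← Algebra.smul_def, map_smul,
        smul_eq_mul]
      ring) σ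
  rw [finrank_Q_D] at h
  refine (Nat.eq_of_mul_eq_mul_left (resDeg_pos p L') h).symm.trans ?_
  exact (finrank_mul_finrank ℚ_[p] K (infWD hK σ)).symm

include hK hφ hL'K in
theorem finrank_eq_subRank :
    finrank (maxUnram p L') E = finrank ℚ_[p] K * X.subRank E := by
  have h : 0 < Nat.card (maxUnram p L' →ₐ[ℚ_[p]] K) := by
    rw [hL'K]; exact finrank_pos
  obtain ⟨σ⟩ := (Nat.card_pos_iff.1 h).1
  have h1 := finrank_eq_infWD hK hφ hL'K σ
  rw [subRank, Nat.mul_div_cancel' ⟨_, h1⟩]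

variable (X) in
theorem finrank_Q_eq_rank : finrank ℚ_[p] X.D = resDeg p L' * finrank ℚ_[p] K * X.rank := by
  have := X.free
  have := X.isScalarTower_tensor
  have h : finrank ℚ_[p] (maxUnram p L' ⊗[ℚ_[p]] K) = resDeg p L' * finrank ℚ_[p] K :=
    finrank_tensorProduct
  have : Nontrivial (maxUnram p L' ⊗[ℚ_[p]] K) := nontrivial_of_finrank_pos (R := ℚ_[p])
    (h ▸ Nat.mul_pos (resDeg_pos p L') finrank_pos)
  have : StrongRankCondition (maxUnram p L' ⊗[ℚ_[p]] K) := 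
    commRing_strongRankCondition (maxUnram p L' ⊗[ℚ_[p]] K)
  rw [rank, ← finrank_mul_finrank ℚ_[p] (maxUnram p L' ⊗[ℚ_[p]] K) X.D, h]

variable (X) in
include hL'K in
theorem rank_eq (σ : maxUnram p L' →ₐ[ℚ_[p]] K) : X.rank = finrank K (X.WDspace σ) := by
  have h1 := finrank_eq_infWD (X := X) (E := ⊤) (fun _ _ _ => trivial) (fun _ _ => trivial) hL'K σ
  have h2 := finrank_Q_D (⊤ : Submodule (maxUnram p L') X.D)
  have h3 : infWD (X := X) (E := ⊤) (fun _ _ _ => trivial) σ = X.WDspace σ :=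
    Submodule.ext fun x => and_iff_right trivial
  rw [h1, h3, Submodule.restrictScalars_top, finrank_top, finrank_Q_eq_rank, mul_assoc] at h2
  exact Nat.eq_of_mul_eq_mul_left finrank_pos (Nat.eq_of_mul_eq_mul_left (resDeg_pos p L') h2)

variable (hLK : Splits ℚ_[p] L K) [IsGalois L L'] [Algebra L K]
  [IsScalarTower ℚ_[p] L K]

include hK hφ hL'K hLK in
theorem finrank_sigma_eq (σ : L →ₐ[ℚ_[p]] K) :
    finrank L' ↥(E.baseChange L' ⊓ X.sigmaPart σ) = finrank L K * X.subRank E := by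
  have h := finrank_sigma hK hφ hLK σ
  rw [finrank_eq_subRank hK hφ hL'K, ← finrank_mul_finrank ℚ_[p] L K, mul_assoc] at h
  exact Nat.eq_of_mul_eq_mul_left finrank_pos h

theorem actK_mem_sigmaPart (σ : L →ₐ[ℚ_[p]] K) (k : K) :
    ∀ x ∈ X.sigmaPart σ, X.actK k x ∈ X.sigmaPart σ := by
  intro x hx l
  rw [← map_smul, hx l]
  exact LinearMap.congr_fun ((Commute.all k (σ l)).map X.rhoDK) x

theorem actGal_mem_sigmaPart (σ : L →ₐ[ℚ_[p]] K) (g : L' ≃ₐ[L] L') :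
    ∀ x ∈ X.sigmaPart σ, X.actGal g x ∈ X.sigmaPart σ := by
  intro x hx l
  rw [← actGal_actK, ← hx l, actGal_smul, g.commutes]

theorem actGal_mem_baseChange (hg : ∀ g, ∀ x ∈ E, X.gal g x ∈ E) (g : L' ≃ₐ[L] L') :
    ∀ x ∈ E.baseChange L', X.actGal g x ∈ E.baseChange L' := by
  intro x hx
  rw [Submodule.baseChange_eq_span] at hx
  induction hx using Submodule.span_induction with
  | mem x hx =>
    obtain ⟨y, hy, rfl⟩ := hx
    exact Submodule.tmul_mem_baseChange_of_mem (g 1) (hg g y hy)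
  | zero => rw [map_zero]; exact Submodule.zero_mem _
  | add x y _ _ hx hy => rw [map_add]; exact Submodule.add_mem _ hx hy
  | smul a x _ hx => rw [actGal_smul]; exact Submodule.smul_mem _ _ hx

include hK hφ hL'K hLK in
theorem finrank_Fil_inf (hg : ∀ g, ∀ x ∈ E, X.gal g x ∈ E) (F : Filtration X)
    {σ : L →ₐ[ℚ_[p]] K} {n : ℕ} {j : Fin n → ℤ} (hj : StrictMono j) (hr : X.subRank E ≤ n)
    (hJ : F.jumps (E.baseChange L' ⊓ X.sigmaPart σ) = j '' {a | (a : ℕ) < X.subRank E}) (i : ℤ) :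
    finrank L' ↥(F.Fil i ⊓ (E.baseChange L' ⊓ X.sigmaPart σ)) =
      finrank L K * (X.subRank E - (Finset.univ.filter fun a => j a < i).card) := by
  have := X.finite_DL
  have := Module.Finite.of_restrictScalars_finite ℚ_[p] L' X.DL
  obtain ⟨lo, hi, -, hlo, hhi⟩ := F.exists_bounds
  set W := E.baseChange L' ⊓ X.sigmaPart σ
  have hW : finrank L' W = finrank L K * X.subRank E := finrank_sigma_eq hK hφ hL'K hLK σ
  have hanti : ∀ i i', i ≤ i' → F.Fil i' ⊓ W ≤ F.Fil i ⊓ W := fun i i' h =>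
    inf_le_inf_right _ (F.anti h)
  refine eq_of_drop hj hr (g := fun i => finrank L' ↥(F.Fil i ⊓ W))
    (fun i i' h => Submodule.finrank_mono (hanti i i' h)) (fun i => ⟨_, X.finrank_inv
      (W := F.Fil i ⊓ W) (fun k x hx => ⟨F.actK_mem i k x hx.1, actK_mem_baseChange hK k x hx.2.1,
        actK_mem_sigmaPart σ k x hx.2.2⟩) fun g x hx => ⟨F.actGal_mem i g x hx.1,
        actGal_mem_baseChange hg g x hx.2.1, actGal_mem_sigmaPart σ g x hx.2.2⟩⟩)
    (fun i h => by rw [hlo i h, top_inf_eq, hW])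
    (fun i h => by rw [hhi i h, bot_inf_eq, finrank_bot]) (fun i => ?_) i
  have h1 : i ∈ F.jumps W ↔ ∃ a : Fin n, a.val < X.subRank E ∧ j a = i := by rw [hJ]; rfl
  rw [← h1]
  exact not_congr ⟨fun h => (Submodule.eq_of_le_of_finrank_eq (hanti i (i + 1) (by omega))
    h.symm).symm, fun h => congrArg (fun U : Submodule L' X.DL => finrank L' U) h⟩

end ModObj

end PhiN

namespace PhiN

open Module

section Inf

variable {F V : Type*} [Field F] [AddCommGroup V] [Module F V] [FiniteDimensional F V]

theorem finrank_inf_add_le (A W W' : Submodule F V) :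
    finrank F ↥(A ⊓ W) + finrank F ↥(A ⊓ W') ≤
      finrank F ↥(A ⊓ (W ⊔ W')) + finrank F ↥(A ⊓ (W ⊓ W')) := by
  rw [← Submodule.finrank_sup_add_finrank_inf_eq, ← inf_inf_distrib_left]
  have h : A ⊓ W ⊔ A ⊓ W' ≤ A ⊓ (W ⊔ W') :=
    sup_le (inf_le_inf_left _ le_sup_left) (inf_le_inf_left _ le_sup_right)
  exact Nat.add_le_add_right (Submodule.finrank_mono h) _

theorem finrank_inf_add_le_of_le (A : Submodule F V) {W W' : Submodule F V} (h : W ≤ W') :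
    finrank F ↥(A ⊓ W') + finrank F W ≤ finrank F W' + finrank F ↥(A ⊓ W) := by
  rw [← Submodule.finrank_sup_add_finrank_inf_eq, inf_assoc, inf_eq_right.2 h]
  have h' : A ⊓ W' ⊔ W ≤ W' := sup_le inf_le_right h
  exact Nat.add_le_add_right (Submodule.finrank_mono h') _

end Inf

namespace ModObj

attribute [local instance] TensorProduct.Algebra.module

variable {p : ℕ} [Fact p.Prime] {L L' K : Type*} [Field L] [Field L'] [Field K]
  [Algebra ℚ_[p] L] [Algebra ℚ_[p] L'] [Algebra ℚ_[p] K] [Algebra L L']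
  [IsScalarTower ℚ_[p] L L'] [FiniteDimensional ℚ_[p] L'] [FiniteDimensional ℚ_[p] K]
  [FiniteDimensional ℚ_[p] L] {X : ModObj.{v} p L L' K} (F : Filtration X)

theorem finite_DL' (X : ModObj.{v} p L L' K) : FiniteDimensional L' X.DL :=
  have := X.finite_DL
  Module.Finite.of_restrictScalars_finite ℚ_[p] L' X.DL

namespace Filtration

/-- The difference `t_H - t_N`. -/
def gap (lo hi : ℤ) (E : Submodule (maxUnram p L') X.D) : ℚ :=
  lo * finrank L' (E.baseChange L') +
    ∑ i ∈ Finset.Ioc lo hi, (finrank L' ↥(F.Fil i ⊓ E.baseChange L') : ℚ) -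
    wt (X.phi.restrictScalars ℚ_[p]).toLinearMap (E.restrictScalars ℚ_[p]) / resDeg p L'

variable {F} {lo hi : ℤ}

theorem gap_eq (hle : lo ≤ hi) (hlo : ∀ i ≤ lo, F.Fil i = ⊤) (hhi : ∀ i, hi < i → F.Fil i = ⊥)
    {E : Submodule (maxUnram p L') X.D} (hE : ∀ x ∈ E, X.phi x ∈ E) :
    (F.tH (E.baseChange L') : ℚ) - X.tNSub E hE = F.gap lo hi E := by
  have hf : (resDeg p L' : ℚ) ≠ 0 := Nat.cast_ne_zero.2 (resDeg_pos p L').ne'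
  rw [gap, ← X.tNSub_eq E hE, mul_div_cancel_left₀ _ hf, F.tH_eq hle hlo hhi]
  push_cast
  rfl

theorem gap_sup {E E' : Submodule (maxUnram p L') X.D} (hE : ∀ x ∈ E, X.phi x ∈ E)
    (hE' : ∀ x ∈ E', X.phi x ∈ E') :
    F.gap lo hi E + F.gap lo hi E' ≤ F.gap lo hi (E ⊔ E') + F.gap lo hi (E ⊓ E') := by
  have := X.finite_Q
  have := X.finite_DL'
  have h1 := wt_sup_add_inf (φ := (X.phi.restrictScalars ℚ_[p]).toLinearMap) X.phi.injective
    (E := E.restrictScalars ℚ_[p]) (E' := E'.restrictScalars ℚ_[p]) hE hE'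
  rw [← Submodule.restrictScalars_sup, ← Submodule.restrictScalars_inf] at h1
  have h2 := Submodule.finrank_sup_add_finrank_inf_eq (E.baseChange L') (E'.baseChange L')
  have h3 := Finset.sum_le_sum fun i (_ : i ∈ Finset.Ioc lo hi) =>
    finrank_inf_add_le (F.Fil i) (E.baseChange L') (E'.baseChange L')
  rw [← baseChange_sup, ← baseChange_inf] at h2 h3
  simp only [Finset.sum_add_distrib] at h3
  simp only [gap]
  have h1' : (wt (X.phi.restrictScalars ℚ_[p]).toLinearMap ((E ⊔ E').restrictScalars ℚ_[p]) : ℚ) +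
      wt (X.phi.restrictScalars ℚ_[p]).toLinearMap ((E ⊓ E').restrictScalars ℚ_[p]) =
      wt (X.phi.restrictScalars ℚ_[p]).toLinearMap (E.restrictScalars ℚ_[p]) +
      wt (X.phi.restrictScalars ℚ_[p]).toLinearMap (E'.restrictScalars ℚ_[p]) := by exact_mod_cast h1
  have h2' : (finrank L' ((E ⊔ E').baseChange L') : ℚ) +
      finrank L' ((E ⊓ E').baseChange L') =
      finrank L' (E.baseChange L') + finrank L' (E'.baseChange L') := by exact_mod_cast h2
  have h3' : ∑ i ∈ Finset.Ioc lo hi, (finrank L' ↥(F.Fil i ⊓ E.baseChange L') : ℚ) +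
      ∑ i ∈ Finset.Ioc lo hi, (finrank L' ↥(F.Fil i ⊓ E'.baseChange L') : ℚ) ≤
      ∑ i ∈ Finset.Ioc lo hi, (finrank L' ↥(F.Fil i ⊓ (E ⊔ E').baseChange L') : ℚ) +
      ∑ i ∈ Finset.Ioc lo hi, (finrank L' ↥(F.Fil i ⊓ (E ⊓ E').baseChange L') : ℚ) :=
    by exact_mod_cast h3
  linear_combination h3' - (lo : ℚ) * h2' + h1' / resDeg p L'

theorem gap_le_map {E E' : Submodule (maxUnram p L') X.D} (hE : ∀ x ∈ E, X.phi x ∈ E)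
    {γ : X.D →ₗ[ℚ_[p]] X.D} (hγ : Function.Injective γ) (hφ : ∀ x, γ (X.phi x) = X.phi (γ x))
    (hEE' : E'.restrictScalars ℚ_[p] = (E.restrictScalars ℚ_[p]).map γ)
    {γ' : X.DL →ₗ[ℚ_[p]] X.DL} (hγ' : Function.Injective γ') (hF : ∀ i, ∀ x ∈ F.Fil i,
      γ' x ∈ F.Fil i) (hb : ∀ x ∈ E.baseChange L', γ' x ∈ E'.baseChange L') :
    finrank (maxUnram p L') E' = finrank (maxUnram p L') E ∧ F.gap lo hi E ≤ F.gap lo hi E' := by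
  have := X.finite_Q
  have := X.finite_DL
  have h1 : finrank (maxUnram p L') E' = finrank (maxUnram p L') E := by
    have h := (Submodule.equivMapOfInjective γ hγ (E.restrictScalars ℚ_[p])).finrank_eq
    rw [← hEE', finrank_Q_D, finrank_Q_D] at h
    exact (Nat.eq_of_mul_eq_mul_left (resDeg_pos p L') h).symm
  refine ⟨h1, ?_⟩
  have h2 : wt (X.phi.restrictScalars ℚ_[p]).toLinearMap (E.restrictScalars ℚ_[p]) =
      wt (X.phi.restrictScalars ℚ_[p]).toLinearMap (E'.restrictScalars ℚ_[p]) := by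
    rw [wt_eq_add (φ := (X.phi.restrictScalars ℚ_[p]).toLinearMap) X.phi.injective hE γ
      (φ' := (X.phi.restrictScalars ℚ_[p]).toLinearMap) X.phi.injective fun x _ => hφ x,
      LinearMap.ker_eq_bot.2 hγ, inf_bot_eq, wt_bot, zero_add, hEE']
  have h3 : ∀ i, finrank L' ↥(F.Fil i ⊓ E.baseChange L') ≤
      finrank L' ↥(F.Fil i ⊓ E'.baseChange L') := by
    intro i
    refine Nat.le_of_mul_le_mul_left ?_ (finrank_pos (R := ℚ_[p]) (M := L'))
    rw [← finrank_Q, ← finrank_Q]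
    refine LinearMap.finrank_le_finrank_of_injective (f := γ'.restrict
      (p := (F.Fil i ⊓ E.baseChange L').restrictScalars ℚ_[p])
      (q := (F.Fil i ⊓ E'.baseChange L').restrictScalars ℚ_[p])
      fun x hx => ⟨hF i x hx.1, hb x hx.2⟩) fun x y h => Subtype.ext
        (hγ' (congrArg Subtype.val h))
  have h4 : ∑ i ∈ Finset.Ioc lo hi, (finrank L' ↥(F.Fil i ⊓ E.baseChange L') : ℚ) ≤
      ∑ i ∈ Finset.Ioc lo hi, (finrank L' ↥(F.Fil i ⊓ E'.baseChange L') : ℚ) :=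
    Finset.sum_le_sum fun i _ => by exact_mod_cast h3 i
  rw [gap, gap, h2, finrank_baseChange, finrank_baseChange, h1]
  linarith

theorem exists_smul {E : Submodule (maxUnram p L') X.D} (hE : ∀ x ∈ E, X.phi x ∈ E)
    (hN : ∀ x ∈ E, X.N x ∈ E) {k : K} (hk : k ≠ 0) : ∃ E' : Submodule (maxUnram p L') X.D,
      (∀ x ∈ E', X.phi x ∈ E') ∧ (∀ x ∈ E', X.N x ∈ E') ∧ (∀ x ∈ E, k • x ∈ E') ∧
      finrank (maxUnram p L') E' = finrank (maxUnram p L') E ∧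
      F.gap lo hi E ≤ F.gap lo hi E' := by
  let E' := E.map (DistribSMul.toLinearMap (maxUnram p L') X.D k)
  have hinj : Function.Injective (X.rhoK k) := fun x y h => by
    have h1 : k • x = k • y := h
    simpa [smul_smul, inv_mul_cancel₀ hk] using congrArg (k⁻¹ • ·) h1
  have hinj' : Function.Injective (X.rhoDK k) := fun x y h => by
    have h1 : ∀ x, X.rhoDK k⁻¹ (X.rhoDK k x) = x := fun x => by
      rw [← Module.End.mul_apply, ← map_mul, inv_mul_cancel₀ hk, map_one, Module.End.one_apply]
    rw [← h1 x, h, h1]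
  refine ⟨E', ?_, ?_, fun x hx => ⟨x, hx, rfl⟩, gap_le_map hE hinj
    (fun x => (map_smul X.phi k x).symm) (Submodule.ext fun x => Iff.rfl) hinj'
    (fun i x hx => F.actK_mem i k x hx) fun x hx => ?_⟩
  · rintro _ ⟨x, hx, rfl⟩
    exact ⟨X.phi x, hE x hx, (map_smul X.phi k x).symm⟩
  · rintro _ ⟨x, hx, rfl⟩
    exact ⟨X.N x, hN x hx, (map_smul X.N k x).symm⟩
  · rw [Submodule.baseChange_eq_span] at hx
    induction hx using Submodule.span_induction with
    | mem x hx =>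
      obtain ⟨y, hy, rfl⟩ := hx
      exact Submodule.tmul_mem_baseChange_of_mem (1 : L') (p := E') ⟨y, hy, rfl⟩
    | zero => rw [map_zero]; exact Submodule.zero_mem _
    | add x y _ _ hx hy => rw [map_add]; exact Submodule.add_mem _ hx hy
    | smul a x _ hx =>
      exact (map_smul (X.actK k) a x).symm ▸ Submodule.smul_mem _ _ hx

theorem exists_gal {E : Submodule (maxUnram p L') X.D} (hE : ∀ x ∈ E, X.phi x ∈ E)
    (hN : ∀ x ∈ E, X.N x ∈ E) (g : L' ≃ₐ[L] L') : ∃ E' : Submodule (maxUnram p L') X.D,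
      (∀ x ∈ E', X.phi x ∈ E') ∧ (∀ x ∈ E', X.N x ∈ E') ∧ (∀ x ∈ E, X.gal g x ∈ E') ∧
      finrank (maxUnram p L') E' = finrank (maxUnram p L') E ∧
      F.gap lo hi E ≤ F.gap lo hi E' := by
  have hg : ∀ x, X.gal g⁻¹ (X.gal g x) = x := fun x => by
    rw [← Module.End.mul_apply, ← map_mul, inv_mul_cancel, map_one, Module.End.one_apply]
  have hg' : ∀ x, X.gal g (X.gal g⁻¹ x) = x := fun x => by
    rw [← Module.End.mul_apply, ← map_mul, mul_inv_cancel, map_one, Module.End.one_apply]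
  let E' : Submodule (maxUnram p L') X.D :=
    { carrier := {x | X.gal g⁻¹ x ∈ E}
      add_mem' := fun {x y} hx hy => by
        rw [Set.mem_ofPred_eq, map_add]; exact E.add_mem hx hy
      zero_mem' := by rw [Set.mem_ofPred_eq, map_zero]; exact E.zero_mem
      smul_mem' := fun l x hx => by
        rw [Set.mem_ofPred_eq, X.gal_smul]; exact E.smul_mem _ hx }
  have hmem : ∀ x ∈ E, X.gal g x ∈ E' := fun x hx => by
    change X.gal g⁻¹ (X.gal g x) ∈ E
    rwa [hg]
  let γ' : X.DL →ₗ[ℚ_[p]] X.DL :=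
    { toFun := X.actGal g
      map_add' := map_add _
      map_smul' := fun c x => by
        rw [← algebraMap_smul L' c x, actGal_smul, RingHom.id_apply,
          IsScalarTower.algebraMap_apply ℚ_[p] L L', g.commutes,
          ← IsScalarTower.algebraMap_apply, algebraMap_smul] }
  refine ⟨E', fun x hx => ?_, fun x hx => ?_, hmem, gap_le_map hE
    (γ := (X.gal g).restrictScalars ℚ_[p]) (fun x y h => ?_) (X.gal_phi g)
    (Submodule.ext fun x => ⟨fun hx => ⟨_, hx, hg' x⟩, ?_⟩) (γ' := γ') (fun x y h => ?_)
    (fun i x hx => F.actGal_mem i g x hx) fun x hx => ?_⟩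
  · change X.gal g⁻¹ (X.phi x) ∈ E
    rw [X.gal_phi]
    exact hE _ hx
  · change X.gal g⁻¹ (X.N x) ∈ E
    rw [X.gal_N]
    exact hN _ hx
  · rw [← hg x, ← hg y]
    exact congrArg _ h
  · rintro ⟨y, hy, rfl⟩
    exact hmem y hy
  · have h1 : X.actGal g⁻¹ (X.actGal g x) = X.actGal g⁻¹ (X.actGal g y) := congrArg _ h
    rwa [← actGal_mul, ← actGal_mul, inv_mul_cancel, actGal_one, actGal_one] at h1
  · rw [Submodule.baseChange_eq_span] at hx
    induction hx using Submodule.span_induction with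
    | mem x hx =>
      obtain ⟨y, hy, rfl⟩ := hx
      exact Submodule.tmul_mem_baseChange_of_mem (g 1) (hmem y hy)
    | zero => rw [map_zero]; exact Submodule.zero_mem _
    | add x y _ _ hx hy => rw [map_add]; exact Submodule.add_mem _ hx hy
    | smul a x _ hx =>
      exact (X.actGal_smul g a x).symm ▸ Submodule.smul_mem _ (g a) hx

/-- It suffices to consider subobjects. -/
theorem gap_nonpos_of_subobject (h : ∀ E, X.IsSubobject E → F.gap lo hi E ≤ 0)
    {E : Submodule (maxUnram p L') X.D} (hE : ∀ x ∈ E, X.phi x ∈ E) (hN : ∀ x ∈ E, X.N x ∈ E) :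
    F.gap lo hi E ≤ 0 := by
  have := X.finite_L
  by_contra! hpos
  let S : Set (Submodule (maxUnram p L') X.D) :=
    {E | (∀ x ∈ E, X.phi x ∈ E) ∧ (∀ x ∈ E, X.N x ∈ E) ∧ 0 < F.gap lo hi E}
  obtain ⟨E₀, hE₀, hmin⟩ := WellFounded.has_min (measure fun E : Submodule (maxUnram p L') X.D =>
    finrank (maxUnram p L') E).wf S ⟨E, hE, hN, hpos⟩
  let M : Set (Submodule (maxUnram p L') X.D) :=
    {E | E ∈ S ∧ finrank (maxUnram p L') E = finrank (maxUnram p L') E₀}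
  obtain ⟨G, ⟨hGS, hGM⟩, hmax⟩ := WellFounded.has_min (wellFounded_gt (α :=
    Submodule (maxUnram p L') X.D)) {G | G ∈ S ∧ G ≤ sSup M} ⟨E₀, hE₀, le_sSup ⟨hE₀, rfl⟩⟩
  have hle : ∀ E ∈ M, E ≤ G := by
    rintro E ⟨hES, hEd⟩
    by_contra hn
    have h1 : F.gap lo hi (E ⊓ G) ≤ 0 := by
      by_contra! h2
      refine hmin (E ⊓ G) ⟨fun x hx => ⟨hES.1 x hx.1, hGS.1 x hx.2⟩,
        fun x hx => ⟨hES.2.1 x hx.1, hGS.2.1 x hx.2⟩, h2⟩ ?_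
      have h3 := Submodule.finrank_lt_finrank_of_lt (inf_lt_left.2 hn)
      rw [hEd] at h3
      exact h3
    have h2 := gap_sup (F := F) (lo := lo) (hi := hi) hES.1 hGS.1
    refine hmax (E ⊔ G) ⟨⟨fun x hx => ?_, fun x hx => ?_, ?_⟩,
      sup_le (le_sSup ⟨hES, hEd⟩) hGM⟩ (right_lt_sup.2 hn)
    · obtain ⟨y, hy, z, hz, rfl⟩ := Submodule.mem_sup.1 hx
      rw [map_add]
      exact Submodule.add_mem_sup (hES.1 y hy) (hGS.1 z hz)
    · obtain ⟨y, hy, z, hz, rfl⟩ := Submodule.mem_sup.1 hx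
      rw [map_add]
      exact Submodule.add_mem_sup (hES.2.1 y hy) (hGS.2.1 z hz)
    · have := hES.2.2
      have := hGS.2.2
      linarith
  have hG : G = sSup M := le_antisymm hGM (sSup_le hle)
  have key : ∀ (f : X.D →+ X.D), (∀ E ∈ M, ∃ E' ∈ M, ∀ x ∈ E, f x ∈ E') → ∀ x ∈ G, f x ∈ G := by
    intro f hf x hx
    rw [hG, sSup_eq_iSup'] at hx
    induction hx using Submodule.iSup_induction' with
    | mem E x hx =>
      obtain ⟨E', hE', h'⟩ := hf E E.2
      exact hle E' hE' (h' x hx)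
    | zero => rw [map_zero]; exact G.zero_mem
    | add x y _ _ hx hy => rw [map_add]; exact G.add_mem hx hy
  refine absurd (h G ⟨fun k => ?_, hGS.1, hGS.2.1, fun g => key (X.gal g : X.D →ₗ[K] X.D) ?_⟩)
    (not_le.2 hGS.2.2)
  · rcases eq_or_ne k 0 with rfl | hk
    · intro x _
      rw [zero_smul]
      exact G.zero_mem
    · refine key (DistribSMul.toAddMonoidHom X.D k) fun E hE => ?_
      obtain ⟨E', h1, h2, h3, h4, h5⟩ := exists_smul (F := F) (lo := lo) (hi := hi) hE.1.1 hE.1.2.1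
        hk
      exact ⟨E', ⟨⟨h1, h2, hE.1.2.2.trans_le h5⟩, h4.trans hE.2⟩, h3⟩
  · intro E hE
    obtain ⟨E', h1, h2, h3, h4, h5⟩ := exists_gal (F := F) (lo := lo) (hi := hi) hE.1.1 hE.1.2.1 g
    exact ⟨E', ⟨⟨h1, h2, hE.1.2.2.trans_le h5⟩, h4.trans hE.2⟩, h3⟩

end Filtration

end ModObj

end PhiN

namespace PhiN

open Module

theorem PG.Fam.supp_tail {p : ℕ} [Fact p.Prime] {Ω : Type*} {s : ℕ}
    (F : PG.Fam.{v} ℚ_[p] Ω (p : ℚ_[p]) s) (P : Fin s → Prop) [DecidablePred P] {t : ℕ}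
    (ht : t ≤ s) :
    finrank ℚ_[p] (F.supp fun k => P k ∧ s - t ≤ k.val) =
      ∑ k with P k ∧ s - t ≤ k.val, finrank ℚ_[p] (F.Z k).V ∧
    ((∀ k k', F.rel k k' → (P k ↔ P k')) →
      wt F.T.phi.toLinearMap (F.supp fun k => P k ∧ s - t ≤ k.val) =
      ∑ k with P k ∧ s - t ≤ k.val, wt (F.Z k).phi.toLinearMap ⊤) := by
  induction t with
  | zero =>
    have h1 : F.supp (fun k => P k ∧ s - 0 ≤ k.val) = ⊥ := by
      rw [eq_bot_iff]
      exact fun x hx => funext fun k => hx k fun h => by have := k.2; omega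
    have h2 : (Finset.univ.filter fun k : Fin s => P k ∧ s - 0 ≤ k.val) = ∅ :=
      Finset.filter_eq_empty_iff.2 fun k _ h => by have := k.2; omega
    rw [h1, h2, wt_bot, finrank_bot]
    exact ⟨rfl, fun _ => rfl⟩
  | succ t ih =>
    let k₀ : Fin s := ⟨s - (t + 1), by omega⟩
    let f : F.V →ₗ[ℚ_[p]] (F.Z k₀).V := LinearMap.proj k₀
    have h1 : F.supp (fun k => P k ∧ s - (t + 1) ≤ k.val) ⊓ LinearMap.ker f =
        F.supp fun k => P k ∧ s - t ≤ k.val := by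
      ext x
      constructor
      · rintro ⟨hx, hx'⟩ k hk
        by_cases h : k = k₀
        · subst h; exact hx'
        · refine hx k fun h' => hk ⟨h'.1, ?_⟩
          have : k.val ≠ s - (t + 1) := fun h'' => h (Fin.ext h'')
          omega
      · refine fun hx => ⟨fun k hk => hx k fun h' => hk ⟨h'.1, by omega⟩, hx k₀ fun h' => ?_⟩
        have : s - t ≤ s - (t + 1) := h'.2
        omega
    have h2 : (F.supp fun k => P k ∧ s - (t + 1) ≤ k.val).map f = if P k₀ then ⊤ else ⊥ := by
      split_ifs with hP
      · rw [eq_top_iff]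
        intro y _
        refine ⟨Pi.single k₀ y, fun k hk => Pi.single_eq_of_ne ?_ _, Pi.single_eq_same _ _⟩
        rintro rfl
        exact hk ⟨hP, le_rfl⟩
      · rw [eq_bot_iff]
        rintro _ ⟨x, hx, rfl⟩
        exact hx k₀ fun h => hP h.1
    have h3 : (Finset.univ.filter fun k : Fin s => P k ∧ s - (t + 1) ≤ k.val) =
        if P k₀ then insert k₀ (Finset.univ.filter fun k : Fin s => P k ∧ s - t ≤ k.val) else
          Finset.univ.filter fun k : Fin s => P k ∧ s - t ≤ k.val := by
      ext k
      have hk : s - (t + 1) ≤ k.val ↔ k = k₀ ∨ s - t ≤ k.val := by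
        rw [Fin.ext_iff]
        change _ ↔ k.val = s - (t + 1) ∨ _
        omega
      by_cases hP : P k₀
      · rw [if_pos hP]
        simp only [Finset.mem_insert, Finset.mem_filter, Finset.mem_univ, true_and, hk]
        refine ⟨fun h => h.2.imp_right fun h' => ⟨h.1, h'⟩, ?_⟩
        rintro (rfl | h)
        · exact ⟨hP, Or.inl rfl⟩
        · exact ⟨h.1, Or.inr h.2⟩
      · rw [if_neg hP]
        simp only [Finset.mem_filter, Finset.mem_univ, true_and, hk]
        refine and_congr_right fun h => or_iff_right ?_
        rintro rfl
        exact hP h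
    have h4 : k₀ ∉ Finset.univ.filter fun k : Fin s => P k ∧ s - t ≤ k.val := by
      rw [Finset.mem_filter]
      exact fun h => absurd h.2.2 (show ¬ s - t ≤ s - (t + 1) by omega)
    obtain ⟨ih1, ih2⟩ := ih (by omega)
    constructor
    · have h5 := finrank_map_add f (F.supp fun k => P k ∧ s - (t + 1) ≤ k.val)
      rw [h1, h2, ih1] at h5
      rw [h3]
      by_cases hP : P k₀
      · rw [if_pos hP, finrank_top] at h5
        rw [if_pos hP, Finset.sum_insert h4, h5]
      · rw [if_neg hP, finrank_bot, zero_add] at h5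
        rw [if_neg hP, h5]
    · intro hP
      have hst : F.T.Stable (F.supp fun k => P k ∧ s - (t + 1) ≤ k.val) :=
        F.supp_stable fun k k' h h' => ⟨(hP k k' (F.rel_of_ne k k' h)).1 h'.1,
          h'.2.trans (Fin.le_def.1 (F.lt k k' h).le)⟩
      rw [wt_eq_add F.T.phi.injective hst.phi_mem f (φ' := (F.Z k₀).phi.toLinearMap)
        (F.Z k₀).phi.injective, h1, h2, ih2 hP, h3]
      · by_cases hP : P k₀
        · rw [if_pos hP, if_pos hP, Finset.sum_insert h4, add_comm]
        · rw [if_neg hP, if_neg hP, wt_bot, add_zero]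
      · intro x hx
        refine (F.T_phi_apply x k₀).trans (congrArg (F.Z k₀).phi ?_)
        rw [Finset.sum_eq_zero, add_zero]
        · rfl
        intro k _
        by_contra hne
        have hlt := F.lt k k₀ fun h => hne (by rw [h]; rfl)
        refine hne ?_
        rw [hx k fun h => absurd h.2 (not_le.2 (Fin.lt_def.1 hlt)), map_zero]

namespace ModObj

attribute [local instance] TensorProduct.Algebra.module

variable {p : ℕ} [Fact p.Prime] {L L' K : Type*} [Field L] [Field L'] [Field K]
  [Algebra ℚ_[p] L] [Algebra ℚ_[p] L'] [Algebra ℚ_[p] K] [Algebra L L']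
  [IsScalarTower ℚ_[p] L L'] [FiniteDimensional ℚ_[p] L'] [FiniteDimensional ℚ_[p] K]
  [FiniteDimensional ℚ_[p] L]

section Span

variable {X : ModObj.{v} p L L' K}

/-- The `L'₀`-subspace generated by a `ℚ_p`-subspace. -/
def spn (E : Submodule ℚ_[p] X.D) : Submodule (maxUnram p L') X.D :=
  Submodule.span (maxUnram p L') (E : Set X.D)

theorem mem_spn {E : Submodule ℚ_[p] X.D} (hE : X.toPG.Stable E) {x : X.D} :
    x ∈ spn E ↔ x ∈ E := by
  refine ⟨fun hx => ?_, fun hx => Submodule.subset_span hx⟩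
  exact Submodule.span_le (p := { E with smul_mem' := (X.stable_iff.1 hE).1 }).2 (fun _ h => h) hx

theorem spn_restrict {E : Submodule ℚ_[p] X.D} (hE : X.toPG.Stable E) :
    (spn E).restrictScalars ℚ_[p] = E := Submodule.ext fun _ => mem_spn hE

theorem spn_sup {E E' : Submodule ℚ_[p] X.D} (hE : X.toPG.Stable E) (hE' : X.toPG.Stable E') :
    spn (E ⊔ E') = spn E ⊔ spn E' := by
  apply Submodule.restrictScalars_injective ℚ_[p]
  rw [spn_restrict (hE.sup hE'), Submodule.restrictScalars_sup, spn_restrict hE, spn_restrict hE']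

theorem spn_inf {E E' : Submodule ℚ_[p] X.D} (hE : X.toPG.Stable E) (hE' : X.toPG.Stable E') :
    spn (E ⊓ E') = spn E ⊓ spn E' := by
  apply Submodule.restrictScalars_injective ℚ_[p]
  rw [spn_restrict (hE.inf hE'), Submodule.restrictScalars_inf, spn_restrict hE, spn_restrict hE']

theorem spn_smul {E : Submodule ℚ_[p] X.D} (hE : X.toPG.Stable E) (k : K) :
    ∀ x ∈ spn E, k • x ∈ spn E := fun x hx =>
  (mem_spn hE).2 ((X.stable_iff.1 hE).2.1 k x ((mem_spn hE).1 hx))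

theorem spn_phi {E : Submodule ℚ_[p] X.D} (hE : X.toPG.Stable E) :
    ∀ x ∈ spn E, X.phi x ∈ spn E := fun x hx =>
  (mem_spn hE).2 ((X.stable_iff.1 hE).2.2.2 x ((mem_spn hE).1 hx))

theorem spn_gal {E : Submodule ℚ_[p] X.D} (hE : X.toPG.Stable E) (g : L' ≃ₐ[L] L') :
    ∀ x ∈ spn E, X.gal g x ∈ spn E := fun x hx =>
  (mem_spn hE).2 ((X.stable_iff.1 hE).2.2.1 g x ((mem_spn hE).1 hx))

/-- The normalized dimensions of the intersections with the filtration. -/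
def Filtration.dimFil (F : Filtration X) (σ : L →ₐ[ℚ_[p]] K) (i : ℤ) (E : Submodule ℚ_[p] X.D) :
    ℚ :=
  resDeg p L' * finrank ℚ_[p] L *
    finrank L' ↥(F.Fil i ⊓ ((spn E).baseChange L' ⊓ X.sigmaPart σ))

variable [IsGalois L L'] [Algebra L K] [IsScalarTower ℚ_[p] L K] (hLK : Splits ℚ_[p] L K)
  (hL'K : Splits ℚ_[p] (maxUnram p L') K)

include hLK in
theorem finrank_spn {E : Submodule ℚ_[p] X.D} (hE : X.toPG.Stable E) (σ : L →ₐ[ℚ_[p]] K) :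
    (finrank ℚ_[p] E : ℚ) = resDeg p L' * finrank ℚ_[p] L *
      finrank L' ↥((spn E).baseChange L' ⊓ X.sigmaPart σ) := by
  have h1 := finrank_Q_D (spn E)
  rw [spn_restrict hE, ← finrank_sigma (spn_smul hE) (spn_phi hE) hLK σ] at h1
  rw [h1]
  push_cast
  ring

include hLK in
/-- The difference `t_H - t_N`, in terms of the normalized dimensions. -/
theorem gap_spn (F : Filtration X) {lo hi : ℤ} {E : Submodule ℚ_[p] X.D} (hE : X.toPG.Stable E) :
    resDeg p L' * finrank ℚ_[p] L * F.gap lo hi (spn E) = ∑ σ : L →ₐ[ℚ_[p]] K,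
      (lo * finrank ℚ_[p] E + ∑ i ∈ Finset.Ioc lo hi, F.dimFil σ i E -
        wt X.toPG.phi.toLinearMap E) := by
  have hf : (resDeg p L' : ℚ) ≠ 0 := Nat.cast_ne_zero.2 (resDeg_pos p L').ne'
  have hc : (Fintype.card (L →ₐ[ℚ_[p]] K) : ℚ) = finrank ℚ_[p] L := by
    rw [← Nat.card_eq_fintype_card]; exact_mod_cast hLK
  have h1 : ∀ i, ∑ σ : L →ₐ[ℚ_[p]] K, F.dimFil σ i E = resDeg p L' * finrank ℚ_[p] L *
      finrank L' ↥(F.Fil i ⊓ (spn E).baseChange L') := by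
    intro i
    have h := X.sum_finrank_sigma hLK (W := F.Fil i ⊓ (spn E).baseChange L') fun k x hx =>
      ⟨F.actK_mem i k x hx.1, actK_mem_baseChange (spn_smul hE) k x hx.2⟩
    simp only [Filtration.dimFil]
    rw [← Finset.mul_sum, ← h, Nat.cast_sum]
    exact congrArg _ (Finset.sum_congr rfl fun σ _ => by rw [inf_assoc])
  have h2 : (finrank ℚ_[p] E : ℚ) = resDeg p L' * finrank L' ((spn E).baseChange L') := by
    have h := finrank_Q_D (spn E)
    rw [spn_restrict hE] at h
    rw [h, finrank_baseChange]
    push_cast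
    rfl
  rw [Finset.sum_sub_distrib, Finset.sum_add_distrib, Finset.sum_comm, Finset.sum_const,
    Finset.sum_const, Finset.card_univ, nsmul_eq_mul, nsmul_eq_mul, hc, Finset.sum_congr rfl
    fun i _ => h1 i, ← Finset.mul_sum, h2, Filtration.gap, spn_restrict hE]
  change _ = _ - (finrank ℚ_[p] L : ℚ) * wt (X.phi.restrictScalars ℚ_[p]).toLinearMap E
  field_simp

include hL'K in
theorem finrank_eq_mul_subRank {E : Submodule ℚ_[p] X.D} (hE : X.toPG.Stable E) :
    finrank ℚ_[p] E = resDeg p L' * finrank ℚ_[p] K * X.subRank (spn E) := by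
  have h := finrank_Q_D (spn E)
  rwa [spn_restrict hE, finrank_eq_subRank (spn_smul hE) (spn_phi hE) hL'K, ← mul_assoc] at h

namespace Filtration

variable (F : Filtration X) (σ : L →ₐ[ℚ_[p]] K) (i : ℤ) {E E' : Submodule ℚ_[p] X.D}

theorem dimFil_sup (hE : X.toPG.Stable E) (hE' : X.toPG.Stable E') :
    F.dimFil σ i E + F.dimFil σ i E' ≤ F.dimFil σ i (E ⊔ E') + F.dimFil σ i (E ⊓ E') := by
  have := X.finite_DL'
  have h := finrank_inf_add_le (F.Fil i ⊓ X.sigmaPart σ) ((spn E).baseChange L')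
    ((spn E').baseChange L')
  rw [← baseChange_sup, ← baseChange_inf, ← spn_sup hE hE', ← spn_inf hE hE'] at h
  have h1 : ∀ W : Submodule L' X.DL, finrank L' ↥(F.Fil i ⊓ X.sigmaPart σ ⊓ W) =
      finrank L' ↥(F.Fil i ⊓ (W ⊓ X.sigmaPart σ)) := fun W => by
    rw [inf_assoc, inf_comm W]
  rw [h1, h1, h1, h1] at h
  simp only [dimFil, ← mul_add]
  exact mul_le_mul_of_nonneg_left (by exact_mod_cast h) (by positivity)

theorem dimFil_mono (hle : E ≤ E') : F.dimFil σ i E ≤ F.dimFil σ i E' :=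
  have := X.finite_DL'
  mul_le_mul_of_nonneg_left (Nat.cast_le.2 (Submodule.finrank_mono (inf_le_inf_left _
    (inf_le_inf_right _ (Submodule.baseChange_mono L' (Submodule.span_mono hle))))))
    (by positivity)

include hLK in
theorem dimFil_codim (hE : X.toPG.Stable E) (hE' : X.toPG.Stable E') (hle : E ≤ E') :
    F.dimFil σ i E' - F.dimFil σ i E ≤ (finrank ℚ_[p] E' : ℚ) - finrank ℚ_[p] E := by
  have := X.finite_DL'
  have h : finrank L' ↥(F.Fil i ⊓ ((spn E').baseChange L' ⊓ X.sigmaPart σ)) +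
      finrank L' ↥((spn E).baseChange L' ⊓ X.sigmaPart σ) ≤
      finrank L' ↥((spn E').baseChange L' ⊓ X.sigmaPart σ) +
      finrank L' ↥(F.Fil i ⊓ ((spn E).baseChange L' ⊓ X.sigmaPart σ)) :=
    finrank_inf_add_le_of_le (F.Fil i) (inf_le_inf_right (X.sigmaPart σ)
      (Submodule.baseChange_mono L' (Submodule.span_mono hle)))
  have hc : (0 : ℚ) ≤ resDeg p L' * finrank ℚ_[p] L := by positivity
  have h3 := mul_le_mul_of_nonneg_left (a := (resDeg p L' * finrank ℚ_[p] L : ℚ))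
    (Nat.cast_le.2 h) hc
  push_cast at h3
  rw [mul_add, mul_add] at h3
  rw [finrank_spn hLK hE σ, finrank_spn hLK hE' σ, dimFil, dimFil]
  linarith

include hLK hL'K in
theorem dimFil_good {n : ℕ} (hn : finrank ℚ_[p] X.D = resDeg p L' * finrank ℚ_[p] K * n)
    (hE : X.toPG.Stable E) {j : Fin n → ℤ} (hj : StrictMono j)
    (hJ : F.jumps ((spn E).baseChange L' ⊓ X.sigmaPart σ) =
      j '' {a | (a : ℕ) < X.subRank (spn E)}) :
    F.dimFil σ i E = max ((finrank ℚ_[p] E : ℚ) - (resDeg p L' * finrank ℚ_[p] K : ℕ) *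
      (Finset.univ.filter fun a => j a < i).card) 0 := by
  have hr := finrank_eq_mul_subRank hL'K hE
  have hrn : X.subRank (spn E) ≤ n := by
    refine Nat.le_of_mul_le_mul_left ?_ (Nat.mul_pos (resDeg_pos p L')
      (finrank_pos (R := ℚ_[p]) (M := K)))
    rw [← hr, ← hn]
    have := X.finite_Q
    exact Submodule.finrank_le E
  have h := finrank_Fil_inf (spn_smul hE) (spn_phi hE) hL'K hLK (spn_gal hE) F hj hrn hJ i
  have h2 : (finrank ℚ_[p] K : ℚ) = finrank ℚ_[p] L * finrank L K := by
    exact_mod_cast (finrank_mul_finrank ℚ_[p] L K).symm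
  rw [dimFil, h, hr]
  push_cast [h2]
  rcases le_total (X.subRank (spn E)) (Finset.univ.filter fun a => j a < i).card with h3 | h3
  · have h4 : (X.subRank (spn E) : ℚ) ≤ (Finset.univ.filter fun a => j a < i).card := by
      exact_mod_cast h3
    rw [Nat.sub_eq_zero_of_le h3, max_eq_right]
    · simp
    · rw [← mul_sub]
      exact mul_nonpos_of_nonneg_of_nonpos (by positivity) (by linarith)
  · have h4 : ((Finset.univ.filter fun a => j a < i).card : ℚ) ≤ X.subRank (spn E) := by
      exact_mod_cast h3
    rw [max_eq_left, Nat.cast_sub h3]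
    · ring
    · rw [← mul_sub]
      exact mul_nonneg (by positivity) (by linarith)

end Filtration

end Span

section Family

variable [IsGalois L L'] [Algebra L K] [IsScalarTower ℚ_[p] L K] {s : ℕ}
  {D : Fin s → ModObj.{v} p L L' K} {θ : ∀ k, (D k).toPG.V →ₗ[ℚ_[p]] (D k).toPG.V}
  (hstr : ∀ k, PG.IsString (p : ℚ_[p]) (D k).toPG (D k).NQ (θ k) (D k).nilLength)
  (hss : ∀ k, (D k).toPG.Semisimple) (hord : IsOrdered D) (α : ∀ k₁ k₂, Hom (D k₁) (D k₂))
  (hα : ∀ k₁ k₂, Linked D k₁ k₂ → (α k₁ k₂).f ≠ 0)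
  (hLK : Splits ℚ_[p] L K) (hL'K : Splits ℚ_[p] (maxUnram p L') K)
  {n : ℕ} (hn : ∑ k, (D k).rank = n) {j : (L →ₐ[ℚ_[p]] K) → Fin n → ℤ}
  (hj : ∀ σ, StrictMono (j σ)) {F : Filtration (modified D α)}
  (hF : ∀ Δ, IsGoodFlag D α Δ → F.IsTransverse j Δ)

include hord in
theorem isGood_spn {G : Submodule ℚ_[p] (modified D α).D}
    (hG : (toFam hstr hss hord α hα).Good G) : IsGood D α (spn G) := by
  have hst := (toFam_stable_iff hstr hss hord α hα G).1 hG.1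
  obtain ⟨h1, m, hm, rfl⟩ := hG
  have hpow : ∀ (k : Fin s) (n : ℕ) (x : (D k).D), ((D k).NQ ^ n) x = ((D k).N ^ n) x := by
    intro k n
    induction n with
    | zero => exact fun x => rfl
    | succ n ih => exact fun x => ih ((D k).N x)
  refine ⟨⟨spn_smul hst, spn_phi hst, fun x hx => (mem_spn hst).2 fun k => ?_, spn_gal hst⟩,
    m, hm, fun x => (mem_spn hst).trans (forall_congr' fun k => ?_)⟩
  · have h2 := ((mem_spn hst).1 hx) k
    change ((D k).NQ ^ m k) ((D k).NQ (x k)) = 0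
    rw [PG.pow_apply_apply, pow_succ', Module.End.mul_apply]
    exact (congrArg (D k).NQ h2).trans (map_zero _)
  · change ((D k).NQ ^ m k) (x k) = 0 ↔ _
    rw [hpow]

include hL'K hn hj hF hLK in
theorem isJump_dimFil (σ : L →ₐ[ℚ_[p]] K) : (toFam hstr hss hord α hα).IsJump
    (resDeg p L' * finrank ℚ_[p] K) n (j σ) (F.dimFil σ) := by
  have hst := fun E => toFam_stable_iff hstr hss hord α hα E
  have hdim : finrank ℚ_[p] (modified D α).D = resDeg p L' * finrank ℚ_[p] K * n := by
    have h : finrank ℚ_[p] (∀ k, (D k).D) = ∑ k, finrank ℚ_[p] (D k).D :=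
      have := fun k => (D k).finite_Q
      finrank_pi_fintype ℚ_[p]
    refine h.trans ?_
    rw [← hn, Finset.mul_sum]
    exact Finset.sum_congr rfl fun k _ => (D k).finrank_Q_eq_rank
  refine ⟨hj σ, fun i E E' hE hE' => F.dimFil_sup σ i ((hst E).1 hE) ((hst E').1 hE'),
    fun i E E' _ _ hle => F.dimFil_mono σ i hle, fun i E E' hE hE' hle =>
      F.dimFil_codim hLK σ i ((hst E).1 hE) ((hst E').1 hE') hle, fun i G hG => ?_, hdim,
    fun E hE => ⟨_, finrank_eq_mul_subRank hL'K ((hst E).1 hE)⟩⟩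
  have hG' := (hst G).1 hG.1
  refine F.dimFil_good hLK hL'K σ i hdim hG' (hj σ) (hF {spn G} ⟨Set.subsingleton_singleton.isChain,
    fun E hE => hE ▸ isGood_spn hstr hss hord α hα hG⟩ _ rfl σ)

end Family

end ModObj

end PhiN

namespace PhiN

open Module

namespace ModObj

attribute [local instance] TensorProduct.Algebra.module

variable {p : ℕ} [Fact p.Prime] {L L' K : Type*} [Field L] [Field L'] [Field K]
  [Algebra ℚ_[p] L] [Algebra ℚ_[p] L'] [Algebra ℚ_[p] K] [Algebra L L']
  [IsScalarTower ℚ_[p] L L'] [FiniteDimensional ℚ_[p] L'] [FiniteDimensional ℚ_[p] K]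
  [FiniteDimensional ℚ_[p] L] [IsGalois L L'] [Algebra L K] [IsScalarTower ℚ_[p] L K] {s : ℕ}
  {D : Fin s → ModObj.{v} p L L' K} {θ : ∀ k, (D k).toPG.V →ₗ[ℚ_[p]] (D k).toPG.V}
  (hstr : ∀ k, PG.IsString (p : ℚ_[p]) (D k).toPG (D k).NQ (θ k) (D k).nilLength)
  (hss : ∀ k, (D k).toPG.Semisimple) (hord : IsOrdered D) (α : ∀ k₁ k₂, Hom (D k₁) (D k₂))
  (hα : ∀ k₁ k₂, Linked D k₁ k₂ → (α k₁ k₂).f ≠ 0)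
  (hLK : Splits ℚ_[p] L K) (hL'K : Splits ℚ_[p] (maxUnram p L') K)
  {n : ℕ} (hn : ∑ k, (D k).rank = n) {j : (L →ₐ[ℚ_[p]] K) → Fin n → ℤ}
  (hj : ∀ σ, StrictMono (j σ)) {F : Filtration (modified D α)}
  (hF : ∀ Δ, IsGoodFlag D α Δ → F.IsTransverse j Δ)

include hLK in
theorem gap_eq_defect {lo hi : ℤ} {E : Submodule ℚ_[p] (modified D α).D}
    (hE : (modified D α).toPG.Stable E) :
    resDeg p L' * finrank ℚ_[p] L * F.gap lo hi (spn E) =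
      (toFam hstr hss hord α hα).defect F.dimFil lo hi E := by
  have h : (toFam hstr hss hord α hα).T.phi.toLinearMap = (modified D α).toPG.phi.toLinearMap :=
    LinearMap.ext fun x => toFam_phi hstr hss hord α hα x
  rw [gap_spn hLK F hE, ← h]
  rfl

open Classical in
include hL'K hn hj hF hLK in
theorem gap_supp {lo hi : ℤ} (hJ : ∀ σ a, j σ a ∈ Finset.Ioc lo hi) {P : Fin s → Prop}
    (hP : ∀ k k', (toFam hstr hss hord α hα).rel k k' → (P k ↔ P k')) :
    F.gap lo hi (spn ((toFam hstr hss hord α hα).supp P)) = finrank L K *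
      ∑ a : Fin n with a.val < ∑ k with P k, (D k).rank, ∑ σ, (j σ a : ℚ) -
      ∑ k with P k, (D k).tN := by
  have hst := (toFam_stable_iff hstr hss hord α hα _).1
    ((toFam hstr hss hord α hα).supp_good hP).1
  have hf : (resDeg p L' : ℚ) ≠ 0 := Nat.cast_ne_zero.2 (resDeg_pos p L').ne'
  have hl : (finrank ℚ_[p] L : ℚ) ≠ 0 := Nat.cast_ne_zero.2 finrank_pos.ne'
  have hc : (Fintype.card (L →ₐ[ℚ_[p]] K) : ℚ) = finrank ℚ_[p] L := by
    rw [← Nat.card_eq_fintype_card]; exact_mod_cast hLK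
  have h2 : (finrank ℚ_[p] K : ℚ) = finrank ℚ_[p] L * finrank L K := by
    exact_mod_cast (finrank_mul_finrank ℚ_[p] L K).symm
  obtain ⟨r, hr⟩ : ∃ r, r = ∑ k with P k, (D k).rank := ⟨_, rfl⟩
  have hrn : r ≤ n := by
    rw [hr, ← hn]
    exact Finset.sum_le_sum_of_subset (Finset.filter_subset _ _)
  obtain ⟨ht1, ht2⟩ := (toFam hstr hss hord α hα).supp_tail P le_rfl
  have hPs : (fun k : Fin s => P k ∧ s - s ≤ k.val) = P := funext fun k => propext (by simp)
  have hfs : (Finset.univ.filter fun k : Fin s => P k ∧ s - s ≤ k.val) =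
      Finset.univ.filter fun k => P k := Finset.filter_congr fun k _ => by simp
  rw [hfs] at ht1 ht2
  rw [hPs] at ht1 ht2
  have hdim : finrank ℚ_[p] ((toFam hstr hss hord α hα).supp P) =
      resDeg p L' * finrank ℚ_[p] K * r := by
    rw [ht1, hr, Finset.mul_sum]
    exact Finset.sum_congr rfl fun k _ => (D k).finrank_Q_eq_rank
  have hwt : (wt (toFam hstr hss hord α hα).T.phi.toLinearMap
      ((toFam hstr hss hord α hα).supp P) : ℚ) = resDeg p L' * ∑ k with P k, (D k).tN := by
    rw [ht2 hP, Finset.mul_sum]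
    push_cast
    exact Finset.sum_congr rfl fun k _ => (D k).tN_eq.symm
  have key := gap_eq_defect hstr hss hord α hα hLK (F := F) (lo := lo) (hi := hi) hst
  have hsum : ∀ σ, (lo : ℚ) * finrank ℚ_[p] ((toFam hstr hss hord α hα).supp P) +
      ∑ i ∈ Finset.Ioc lo hi, F.dimFil σ i ((toFam hstr hss hord α hα).supp P) =
      resDeg p L' * finrank ℚ_[p] K * ∑ a : Fin n with a.val < r, (j σ a : ℚ) := by
    intro σ
    have h3 : ∀ i, F.dimFil σ i ((toFam hstr hss hord α hα).supp P) =
        resDeg p L' * finrank ℚ_[p] K *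
          ((r - (Finset.univ.filter fun a => j σ a < i).card : ℕ) : ℤ) := by
      intro i
      refine ((isJump_dimFil hstr hss hord α hα hLK hL'K hn hj hF σ).good i _
        ((toFam hstr hss hord α hα).supp_good hP)).trans ?_
      rw [hdim]
      push_cast
      rw [← mul_sub]
      rcases le_total r (Finset.univ.filter fun a => j σ a < i).card with h3 | h3
      · have h4 : (r : ℚ) ≤ (Finset.univ.filter fun a => j σ a < i).card := by exact_mod_cast h3
        rw [Nat.sub_eq_zero_of_le h3, max_eq_right (mul_nonpos_of_nonneg_of_nonpos
          (by positivity) (by linarith))]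
        simp
      · have h4 : ((Finset.univ.filter fun a => j σ a < i).card : ℚ) ≤ r := by exact_mod_cast h3
        rw [Nat.cast_sub h3, max_eq_left (mul_nonneg (by positivity) (by linarith))]
    have h5 := sum_card_le (hj σ) hrn (hJ σ)
    have h6 : (lo : ℚ) * r + ∑ i ∈ Finset.Ioc lo hi,
        (((r - (Finset.univ.filter fun a => j σ a < i).card : ℕ) : ℤ) : ℚ) =
        ∑ a : Fin n with a.val < r, (j σ a : ℚ) := by exact_mod_cast h5
    rw [Finset.sum_congr rfl fun i _ => h3 i, ← Finset.mul_sum, hdim, ← h6]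
    push_cast
    ring
  unfold PG.Fam.defect at key
  rw [Finset.sum_congr rfl fun σ _ => congrArg₂ (· - ·) (hsum σ) hwt,
    Finset.sum_sub_distrib, ← Finset.mul_sum, Finset.sum_comm, Finset.sum_const, Finset.card_univ,
    nsmul_eq_mul, hc, h2] at key
  rw [← hr]
  refine mul_left_cancel₀ (mul_ne_zero hf hl) (key.trans ?_)
  ring

open Classical in
include hstr hss hord hα hL'K hn hj hF hLK in
/-- A filtration which is transverse to all good flags, with jumps satisfying the inequalities, is
admissible. -/
theorem isAdmissible_of_isTransverse (hJ : F.HasJumps j)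
    (hle : ∀ m : ℕ, m < s → (finrank L K : ℚ) * ∑ a : Fin n with
      a.val < ∑ k : Fin s with k.val < m, (D k).rank, ∑ σ, (j σ a : ℚ) ≤
        ∑ k : Fin s with k.val < m, (D k).tN)
    (heq : (finrank L K : ℚ) * ∑ a : Fin n, ∑ σ, (j σ a : ℚ) = ∑ k, (D k).tN) :
    F.IsAdmissible := by
  obtain ⟨lo', hi, hlh', hlo', hhi⟩ := F.exists_bounds
  obtain ⟨lo, hlo'', hlh⟩ : ∃ lo, lo + 1 = lo' ∧ lo ≤ hi := ⟨lo' - 1, by omega, by omega⟩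
  have hlo : ∀ i ≤ lo, F.Fil i = ⊤ := fun i hi => hlo' i (by omega)
  have hJI : ∀ σ a, j σ a ∈ Finset.Ioc lo hi := by
    intro σ a
    have h1 : j σ a ∈ F.jumps ((modified D α).sigmaPart σ) := by rw [hJ σ]; exact ⟨a, rfl⟩
    rw [Finset.mem_Ioc]
    constructor
    · by_contra hn
      exact h1 (by rw [hlo' _ (by omega), hlo' _ (by omega)])
    · by_contra hn
      exact h1 (by rw [hhi _ (by omega), hhi _ (by omega)])
  have hc : (0 : ℚ) < resDeg p L' * finrank ℚ_[p] L :=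
    mul_pos (Nat.cast_pos.2 (resDeg_pos p L')) (Nat.cast_pos.2 finrank_pos)
  have hr : ∀ k, 0 < (D k).rank := by
    intro k
    obtain ⟨y, -, hy0⟩ := Submodule.exists_mem_ne_zero_of_ne_bot (hstr k).ker_ne
    have := (D k).finite_Q
    have h1 : 0 < finrank ℚ_[p] (D k).D := finrank_pos_iff_exists_ne_zero.2 ⟨y, hy0⟩
    rw [finrank_Q_eq_rank] at h1
    exact Nat.pos_of_mul_pos_left h1
  have hgap : ∀ E, (modified D α).IsSubobject E → F.gap lo hi E ≤ 0 := by
    intro E hE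
    have hst : (modified D α).toPG.Stable (E.restrictScalars ℚ_[p]) :=
      (modified D α).stable_iff.2 ⟨fun l x => E.smul_mem l, hE.smul_mem, hE.gal_mem, hE.phi_mem⟩
    have hspn : spn (E.restrictScalars ℚ_[p]) = E := Submodule.ext fun x => mem_spn hst
    refine nonpos_of_mul_nonpos_right ?_ hc
    rw [← hspn, gap_eq_defect hstr hss hord α hα hLK hst]
    refine PG.Fam.defect_nonpos (isJump_dimFil hstr hss hord α hα hLK hL'K hn hj hF) hJI
      (fun P hP => ?_) ((toFam_stable_iff hstr hss hord α hα _).2 hst) ?_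
    · have hst' := (toFam_stable_iff hstr hss hord α hα _).1
        ((toFam hstr hss hord α hα).supp_good hP).1
      rw [← gap_eq_defect hstr hss hord α hα hLK hst',
        gap_supp hstr hss hord α hα hLK hL'K hn hj hF hJI hP]
      refine mul_nonpos_of_nonneg_of_nonpos hc.le (sub_nonpos.2 ?_)
      rw [Finset.mul_sum]
      refine sum_le_of_prefix (R := SameBlock D) (Relation.EqvGen.is_equivalence _) hord.interval hr
        hn hord.slope (g := fun a => finrank L K * ∑ σ, (j σ a : ℚ)) (fun a b hab => ?_)
        (fun m hm => ?_) P fun k k' h => hP k k' ((toFam_rel hstr hss hord α hα k k').2 h)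
      · exact mul_le_mul_of_nonneg_left (Finset.sum_le_sum fun σ _ =>
          Int.cast_le.2 ((hj σ).monotone hab)) (by positivity)
      · rw [← Finset.mul_sum]
        rcases hm.lt_or_eq with hm | rfl
        · exact hle m hm
        · have h1 : ∀ k : Fin m, k ∈ Finset.univ.filter (fun k : Fin m => k.val < m) ↔
              k ∈ Finset.univ := fun k => by simp
          rw [Finset.ext h1, hn, Finset.filter_true_of_mem fun a _ => a.2]
          exact heq.le
    · rintro _ ⟨x, hx, rfl⟩
      exact hE.N_mem x hx
  refine ⟨?_, fun E hφ hN => ?_⟩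
  · have h1 := gap_supp hstr hss hord α hα hLK hL'K hn hj hF hJI (P := fun _ => True)
      fun _ _ _ => Iff.rfl
    have h2 : spn ((toFam hstr hss hord α hα).supp fun _ => True) =
        (⊤ : Submodule (maxUnram p L') (modified D α).D) :=
      eq_top_iff.2 fun x _ => Submodule.subset_span fun k hk => absurd trivial hk
    rw [h2, ← Filtration.gap_eq hlh hlo hhi fun _ _ => Submodule.mem_top, Submodule.baseChange_top,
      Finset.filter_true, hn, Finset.filter_true_of_mem fun a _ => a.2,
      heq, sub_self, sub_eq_zero] at h1
    rw [h1]
    refine mul_left_cancel₀ (Nat.cast_ne_zero.2 (resDeg_pos p L').ne' : (resDeg p L' : ℚ) ≠ 0) ?_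
    rw [tNSub_eq, tN_eq]
    rfl
  · have h1 := Filtration.gap_nonpos_of_subobject hgap hφ hN
    rwa [← Filtration.gap_eq hlh hlo hhi hφ, sub_nonpos] at h1

end ModObj

end PhiN

namespace PhiN

open Module

section Flag

variable {K V ι : Type*} [Field K] [Infinite K] [AddCommGroup V] [Module K V]
  [FiniteDimensional K V] [Finite ι] (U : ι → Submodule K V)

theorem exists_hyperplane (W : Submodule K V) :
    ∃ W' ≤ W, ∀ i, finrank K ↥(W' ⊓ U i) = finrank K ↥(W ⊓ U i) - 1 := by
  have hv : ∀ i : {i // W ⊓ U i ≠ ⊥}, ∃ v ∈ W ⊓ U i, v ≠ 0 := fun i =>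
    Submodule.exists_mem_ne_zero_of_ne_bot i.2
  choose v hv hv0 using hv
  obtain ⟨f, hf⟩ := Module.exists_dual_forall_apply_ne_zero (K := K) v hv0
  refine ⟨W ⊓ LinearMap.ker f, inf_le_left, fun i => ?_⟩
  have h1 : W ⊓ LinearMap.ker f ⊓ U i =
      (LinearMap.ker (f.domRestrict (W ⊓ U i))).map (W ⊓ U i).subtype := by
    rw [LinearMap.ker_domRestrict, Submodule.map_comap_subtype, inf_right_comm]
  rw [h1, Submodule.finrank_map_subtype_eq]
  by_cases hi : W ⊓ U i = ⊥
  · have h2 : finrank K ↥(W ⊓ U i) = 0 := by rw [hi, finrank_bot]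
    have h3 := Submodule.finrank_le (LinearMap.ker (f.domRestrict (W ⊓ U i)))
    omega
  · have h2 := Module.Dual.finrank_ker_add_one_of_ne_zero (f := f.domRestrict (W ⊓ U i))
      fun h => hf ⟨i, hi⟩ (LinearMap.congr_fun h ⟨v ⟨i, hi⟩, hv ⟨i, hi⟩⟩)
    omega

/-- A flag in general position with respect to finitely many subspaces. -/
theorem exists_flag (V₀ : Submodule K V) (hU : ∀ i, U i ≤ V₀) :
    ∃ W : ℕ → Submodule K V, Antitone W ∧ W 0 = V₀ ∧
      ∀ q i, finrank K ↥(W q ⊓ U i) = finrank K (U i) - q := by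
  choose f hf hf' using exists_hyperplane U
  refine ⟨fun q => f^[q] V₀, antitone_nat_of_succ_le fun q => ?_, rfl, fun q => ?_⟩
  · rw [Function.iterate_succ_apply']
    exact hf _
  · induction q with
    | zero =>
      exact fun i => by
        rw [Nat.sub_zero]
        exact congrArg (fun W : Submodule K V => finrank K W) (inf_eq_right.2 (hU i))
    | succ q ih =>
      exact fun i => by
        have h := Function.iterate_succ_apply' f q V₀
        exact (congrArg (fun W : Submodule K V => finrank K ↥(W ⊓ U i)) h).trans
          (by rw [hf', ih, Nat.sub_sub])

end Flag

namespace ModObj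

attribute [local instance] TensorProduct.Algebra.module

variable {p : ℕ} [Fact p.Prime] {L L' K : Type*} [Field L] [Field L'] [Field K]
  [Algebra ℚ_[p] L] [Algebra ℚ_[p] L'] [Algebra ℚ_[p] K] [Algebra L L']
  [IsScalarTower ℚ_[p] L L'] [FiniteDimensional ℚ_[p] L'] [FiniteDimensional ℚ_[p] K]
  [FiniteDimensional ℚ_[p] L] [IsGalois L L'] [Algebra L K] [IsScalarTower ℚ_[p] L K]
  {X : ModObj.{v} p L L' K} (hLK : Splits ℚ_[p] L K)
  (hL'K : Splits ℚ_[p] (maxUnram p L') K)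

attribute [local instance] moduleKDL

theorem mem_of_mem_span_inv {σ : L →ₐ[ℚ_[p]] K} {W : Submodule K X.DL}
    (hW : W ≤ X.inv (X.sigmaPart σ) (actK_mem_sigmaPart σ)) {x : X.DL}
    (hx : x ∈ Submodule.span L' (W : Set X.DL)) (hg : ∀ g, X.actGal g x = x) : x ∈ W := by
  have := Module.Finite.of_restrictScalars_finite ℚ_[p] L L'
  have key : ∀ c : L', ∑ g, X.actGal g (c • x) ∈ W := by
    clear hg
    induction hx using Submodule.span_induction with
    | mem x hx =>
      intro c
      have h1 : ∑ g, X.actGal g (c • x) = X.actK (σ (Algebra.trace L L' c)) x := by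
        rw [← (hW hx).1, trace_eq_sum_automorphisms, Finset.sum_smul]
        exact Finset.sum_congr rfl fun g _ => by rw [actGal_smul, (hW hx).2 g]
      rw [h1]
      exact W.smul_mem _ hx
    | zero => intro c; simp
    | add x y _ _ hx hy =>
      intro c
      simp only [smul_add, map_add, Finset.sum_add_distrib]
      exact W.add_mem (hx c) (hy c)
    | smul a x _ hx => intro c; rw [smul_smul]; exact hx _
  obtain ⟨c, hc⟩ := Algebra.trace_surjective L L' 1
  have h1 := key c
  have h2 : ∑ g, X.actGal g (c • x) = x := by
    have h3 : ∑ g, X.actGal g (c • x) = algebraMap L L' (Algebra.trace L L' c) • x := by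
      rw [trace_eq_sum_automorphisms, Finset.sum_smul]
      exact Finset.sum_congr rfl fun g _ => by rw [actGal_smul, hg g]
    rw [h3, hc, map_one, one_smul]
  rwa [h2] at h1

/-- The filtration of `D_{L'}` with given `D_{L',σ}`-components. -/
def filtrationOf (A : (L →ₐ[ℚ_[p]] K) → ℤ → Submodule L' X.DL) (hA : ∀ σ, Antitone (A σ))
    (hK : ∀ σ i k, ∀ x ∈ A σ i, X.actK k x ∈ A σ i)
    (hG : ∀ σ i g, ∀ x ∈ A σ i, X.actGal g x ∈ A σ i)
    {lo hi : ℤ} (hlo : ∀ σ, A σ lo = X.sigmaPart σ) (hhi : ∀ σ, A σ hi = ⊥) : Filtration X where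
  Fil i := ⨆ σ, A σ i
  anti i i' h := iSup_mono fun σ => hA σ h
  exhaustive x := ⟨lo, by
    rw [← sum_biAct_idem X.rhoDL X.rhoDK X.commute_rhoD hLK x]
    refine Submodule.sum_mem _ fun σ _ => Submodule.mem_iSup_of_mem σ ?_
    rw [hlo]
    exact biAct_idem_mem X.rhoDL X.rhoDK X.commute_rhoD hLK σ x⟩
  separated x hx := by
    have h := hx hi
    simp only [hhi, iSup_bot] at h
    exact h
  actK_mem i k x hx := by
    induction hx using Submodule.iSup_induction' with
    | mem σ x hx => exact Submodule.mem_iSup_of_mem σ (hK σ i k x hx)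
    | zero => rw [map_zero]; exact Submodule.zero_mem _
    | add x y _ _ hx hy => rw [map_add]; exact Submodule.add_mem _ hx hy
  actGal_mem i g x hx := by
    induction hx using Submodule.iSup_induction' with
    | mem σ x hx => exact Submodule.mem_iSup_of_mem σ (hG σ i g x hx)
    | zero => rw [map_zero]; exact Submodule.zero_mem _
    | add x y _ _ hx hy => rw [map_add]; exact Submodule.add_mem _ hx hy

theorem iSup_inf_sigmaPart {A : (L →ₐ[ℚ_[p]] K) → Submodule L' X.DL}
    (hA : ∀ σ, A σ ≤ X.sigmaPart σ) (σ : L →ₐ[ℚ_[p]] K) :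
    (⨆ τ, A τ) ⊓ X.sigmaPart σ = A σ := by
  refine le_antisymm ?_ (le_inf (le_iSup A σ) (hA σ))
  rintro x ⟨hx, hxσ⟩
  have key : biAct X.rhoDL X.rhoDK X.commute_rhoD (idem σ) x ∈ A σ := by
    clear hxσ
    induction hx using Submodule.iSup_induction' with
    | mem τ x hx =>
      by_cases h : τ = σ
      · subst h
        rwa [biAct_idem_of_mem X.rhoDL X.rhoDK X.commute_rhoD (hA _ hx)]
      · rw [biAct_idem_of_mem_ne X.rhoDL X.rhoDK X.commute_rhoD h (hA _ hx)]
        exact Submodule.zero_mem _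
    | zero => rw [map_zero]; exact Submodule.zero_mem _
    | add x y _ _ hx hy => rw [map_add]; exact Submodule.add_mem _ hx hy
  rwa [biAct_idem_of_mem X.rhoDL X.rhoDK X.commute_rhoD hxσ] at key

/-- The invariants of `E_{L',σ}` for a subobject `E`. -/
def invSub {E : Submodule (maxUnram p L') X.D} (hE : X.IsSubobject E) (σ : L →ₐ[ℚ_[p]] K) :
    Submodule K X.DL :=
  X.inv (E.baseChange L' ⊓ X.sigmaPart σ) fun k x hx =>
    ⟨actK_mem_baseChange hE.smul_mem k x hx.1, actK_mem_sigmaPart σ k x hx.2⟩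

include hLK hL'K in
theorem finrank_invSub {E : Submodule (maxUnram p L') X.D} (hE : X.IsSubobject E)
    (σ : L →ₐ[ℚ_[p]] K) : finrank K (invSub hE σ) = X.subRank E := by
  have := Module.Finite.of_restrictScalars_finite ℚ_[p] L K
  have h := X.finrank_inv (W := E.baseChange L' ⊓ X.sigmaPart σ) (fun k x hx =>
    ⟨actK_mem_baseChange hE.smul_mem k x hx.1, actK_mem_sigmaPart σ k x hx.2⟩)
    fun g x hx => ⟨actGal_mem_baseChange hE.gal_mem g x hx.1, actGal_mem_sigmaPart σ g x hx.2⟩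
  rw [finrank_sigma_eq hE.smul_mem hE.phi_mem hL'K hLK] at h
  exact (Nat.eq_of_mul_eq_mul_left finrank_pos h).symm

theorem isSubobject_top : X.IsSubobject ⊤ := by
  constructor <;> intros <;> trivial

include hL'K in
theorem subRank_top : X.subRank ⊤ = X.rank := by
  have h := finrank_eq_subRank (X := X) (E := ⊤) (fun _ _ _ => trivial) (fun _ _ => trivial) hL'K
  have h2 := finrank_Q_D (⊤ : Submodule (maxUnram p L') X.D)
  rw [h, Submodule.restrictScalars_top, finrank_top, finrank_Q_eq_rank, mul_assoc] at h2
  exact (Nat.eq_of_mul_eq_mul_left finrank_pos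
    (Nat.eq_of_mul_eq_mul_left (resDeg_pos p L') h2)).symm

include hL'K in
theorem subRank_le {E : Submodule (maxUnram p L') X.D} (hE : X.IsSubobject E) :
    X.subRank E ≤ X.rank := by
  have := X.finite_L
  rw [← subRank_top hL'K]
  exact Nat.div_le_div_right (Submodule.finrank_mono le_top)

include hLK hL'K in
/-- A filtration with prescribed jumps which is transverse to finitely many subobjects. -/
theorem exists_filtration {ι : Type*} [Finite ι] {E : ι → Submodule (maxUnram p L') X.D}
    (hE : ∀ i, X.IsSubobject (E i)) {i₀ : ι} (h₀ : E i₀ = ⊤) {n : ℕ} (hn : X.rank = n)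
    {j : (L →ₐ[ℚ_[p]] K) → Fin n → ℤ} (hj : ∀ σ, StrictMono (j σ)) :
    ∃ F : Filtration X, F.HasJumps j ∧ ∀ c σ, F.jumps ((E c).baseChange L' ⊓ X.sigmaPart σ) =
      j σ '' {a : Fin n | (a : ℕ) < X.subRank (E c)} := by
  have := X.finite_DL
  have := Module.Finite.of_restrictScalars_finite ℚ_[p] L' X.DL
  have := Module.Finite.of_restrictScalars_finite ℚ_[p] L K
  have := Module.Finite.of_restrictScalars_finite ℚ_[p] L L'
  have : IsScalarTower ℚ_[p] K X.DL := ⟨fun c k x => by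
    rw [smul_DL, Algebra.smul_def, smul_DL]
    exact (LinearMap.congr_fun (map_mul X.rhoDK (algebraMap ℚ_[p] K c) k) x).trans
      (LinearMap.congr_fun (X.rhoDK.commutes c) (X.actK k x))⟩
  have hfin : Module.Finite K X.DL := Module.Finite.of_restrictScalars_finite ℚ_[p] K X.DL
  have := charZero_of_algebra_padic p K
  have hr₀ : X.subRank (E i₀) = n := by rw [h₀, subRank_top hL'K, hn]
  have hflag := fun σ => exists_flag (fun c => invSub (hE c) σ)
    (X.inv (X.sigmaPart σ) (actK_mem_sigmaPart σ)) fun c x hx => ⟨hx.1.2, hx.2⟩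
  choose W hWa hW0 hWd using hflag
  have hWle : ∀ σ q, W σ q ≤ X.inv (X.sigmaPart σ) (actK_mem_sigmaPart σ) := fun σ q =>
    hW0 σ ▸ hWa σ (Nat.zero_le q)
  let q : (L →ₐ[ℚ_[p]] K) → ℤ → ℕ := fun σ i => (Finset.univ.filter fun a => j σ a < i).card
  let A : (L →ₐ[ℚ_[p]] K) → ℤ → Submodule L' X.DL := fun σ i =>
    Submodule.span L' (W σ (q σ i) : Set X.DL)
  have hAσ : ∀ σ i, A σ i ≤ X.sigmaPart σ := fun σ i =>
    Submodule.span_le.2 fun x hx => (hWle σ _ hx).1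
  have hAK : ∀ σ i k, ∀ x ∈ A σ i, X.actK k x ∈ A σ i := by
    intro σ i k x hx
    induction hx using Submodule.span_induction with
    | mem x hx => exact Submodule.subset_span ((W σ _).smul_mem k hx)
    | zero => rw [map_zero]; exact Submodule.zero_mem _
    | add x y _ _ hx hy => rw [map_add]; exact Submodule.add_mem _ hx hy
    | smul a x _ hx => rw [map_smul]; exact Submodule.smul_mem _ _ hx
  have hAG : ∀ σ i g, ∀ x ∈ A σ i, X.actGal g x ∈ A σ i := by
    intro σ i g x hx
    induction hx using Submodule.span_induction with
    | mem x hx => rw [(hWle σ _ hx).2 g]; exact Submodule.subset_span hx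
    | zero => rw [map_zero]; exact Submodule.zero_mem _
    | add x y _ _ hx hy => rw [map_add]; exact Submodule.add_mem _ hx hy
    | smul a x _ hx => rw [actGal_smul]; exact Submodule.smul_mem _ _ hx
  obtain ⟨lo, hlo⟩ := (Set.finite_range fun x : (L →ₐ[ℚ_[p]] K) × Fin n => j x.1 x.2).bddBelow
  obtain ⟨hi, hhi⟩ := (Set.finite_range fun x : (L →ₐ[ℚ_[p]] K) × Fin n => j x.1 x.2).bddAbove
  have hq0 : ∀ σ, q σ lo = 0 := fun σ => by
    refine Finset.card_eq_zero.2 (Finset.filter_eq_empty_iff.2 fun a _ => ?_)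
    exact not_lt.2 (hlo ⟨(σ, a), rfl⟩)
  have hqn : ∀ σ, q σ (hi + 1) = n := fun σ => by
    refine (congrArg Finset.card (Finset.filter_true_of_mem fun a _ => ?_)).trans (by simp)
    exact Int.lt_add_one_of_le (hhi ⟨(σ, a), rfl⟩)
  let F : Filtration X := filtrationOf hLK A
    (fun σ i i' h => Submodule.span_mono (hWa σ (Finset.card_le_card
      (Finset.monotone_filter_right _ fun a _ ha => lt_of_lt_of_le ha h)))) hAK hAG
    (lo := lo) (hi := hi + 1)
    (fun σ => le_antisymm (hAσ σ lo) fun x hx => by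
      have h1 := mem_span_invariants (a := fun g => (X.actGal g).toAddMonoidHom) X.actGal_smul
        X.actGal_one X.actGal_mul (actGal_mem_sigmaPart σ) hx
      refine Submodule.span_mono ?_ h1
      rw [hq0, hW0]
      exact fun y hy => hy)
    (fun σ => Submodule.span_eq_bot.2 fun x hx => by
      have h1 := hWd σ n i₀
      rw [finrank_invSub hLK hL'K, hr₀, Nat.sub_self,
        Submodule.finrank_eq_zero] at h1
      rw [SetLike.mem_coe, hqn] at hx
      have h2 : x ∈ W σ n ⊓ invSub (hE i₀) σ := ⟨hx, ⟨by
        rw [h₀, Submodule.baseChange_top]; trivial, (hWle σ _ hx).1⟩, (hWle σ _ hx).2⟩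
      rwa [h1] at h2)
  have hdim : ∀ c σ i, finrank L' ↥(F.Fil i ⊓ ((E c).baseChange L' ⊓ X.sigmaPart σ)) =
      finrank L K * (Finset.univ.filter fun a : Fin n =>
        a.val < X.subRank (E c) ∧ i ≤ j σ a).card := by
    intro c σ i
    have h1 : F.Fil i ⊓ ((E c).baseChange L' ⊓ X.sigmaPart σ) =
        A σ i ⊓ ((E c).baseChange L' ⊓ X.sigmaPart σ) := by
      rw [inf_comm ((E c).baseChange L'), ← inf_assoc, ← inf_assoc,
        ← iSup_inf_sigmaPart (A := fun σ => A σ i) (fun σ => hAσ σ i) σ, inf_assoc _ _ (X.sigmaPart σ),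
        inf_idem]
      rfl
    rw [h1, X.finrank_inv (W := A σ i ⊓ ((E c).baseChange L' ⊓ X.sigmaPart σ)) (fun k x hx => ⟨hAK σ i k x hx.1, actK_mem_baseChange (hE c).smul_mem k x
      hx.2.1, actK_mem_sigmaPart σ k x hx.2.2⟩) fun g x hx => ⟨hAG σ i g x hx.1,
      actGal_mem_baseChange (hE c).gal_mem g x hx.2.1, actGal_mem_sigmaPart σ g x hx.2.2⟩,
      card_lt_and_le (hj σ) (hn ▸ subRank_le hL'K (hE c)), ← finrank_invSub hLK hL'K (hE c) σ]
    refine congrArg _ (Eq.trans (congrArg (fun W : Submodule K X.DL => finrank K W) ?_)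
      (hWd σ (q σ i) c))
    ext x
    exact ⟨fun hx => ⟨mem_of_mem_span_inv (hWle σ _) hx.1.1 hx.2, hx.1.2, hx.2⟩,
      fun hx => ⟨⟨Submodule.subset_span hx.1, hx.2.1⟩, hx.2.2⟩⟩
  have hjump : ∀ c σ, F.jumps ((E c).baseChange L' ⊓ X.sigmaPart σ) =
      j σ '' {a : Fin n | (a : ℕ) < X.subRank (E c)} := by
    intro c σ
    ext i
    have hle : F.Fil (i + 1) ⊓ ((E c).baseChange L' ⊓ X.sigmaPart σ) ≤
        F.Fil i ⊓ ((E c).baseChange L' ⊓ X.sigmaPart σ) :=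
      inf_le_inf_right _ (F.anti (by omega))
    have hsub : (Finset.univ.filter fun a : Fin n => a.val < X.subRank (E c) ∧ i + 1 ≤ j σ a) ⊆
        Finset.univ.filter fun a : Fin n => a.val < X.subRank (E c) ∧ i ≤ j σ a :=
      Finset.monotone_filter_right _ fun a _ ha => ⟨ha.1, by omega⟩
    constructor
    · intro hi
      by_contra hne
      refine hi (Submodule.eq_of_le_of_finrank_eq hle ?_).symm
      rw [hdim, hdim]
      congr 2
      refine Finset.filter_congr fun a _ => and_congr_right fun ha => ?_
      have : j σ a ≠ i := fun h => hne ⟨a, ha, h⟩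
      omega
    · rintro ⟨a, ha, rfl⟩ heq
      have h1 := hdim c σ (j σ a)
      rw [heq, hdim] at h1
      have h2 := Finset.eq_of_subset_of_card_le hsub
        (Nat.eq_of_mul_eq_mul_left finrank_pos h1).ge
      have h3 : a ∈ Finset.univ.filter fun b : Fin n =>
        b.val < X.subRank (E c) ∧ j σ a ≤ j σ b := by simpa using ha
      rw [← h2, Finset.mem_filter] at h3
      omega
  refine ⟨F, fun σ => ?_, hjump⟩
  have h1 := hjump i₀ σ
  rw [hr₀, h₀, Submodule.baseChange_top, top_inf_eq] at h1
  rw [h1, ← Set.image_univ]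
  exact congrArg _ (Set.eq_univ_of_forall fun a => a.2)

end ModObj

end PhiN

namespace PhiN

open Module

theorem zpow_comm_apply {K A B : Type*} [Field K] [AddCommGroup A] [Module K A] [AddCommGroup B]
    [Module K B] (c : A →ₗ[K] B) (f : A ≃ₗ[K] A) (g : B ≃ₗ[K] B) (h : ∀ x, c (f x) = g (c x))
    (n : ℤ) (x : A) : c ((f ^ n) x) = (g ^ n) (c x) := by
  have hf : ∀ y, f (f⁻¹ y) = y := fun y => f.apply_symm_apply y
  have hg : ∀ y, g⁻¹ (g y) = y := fun y => g.symm_apply_apply y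
  induction n using Int.induction_on generalizing x with
  | zero => simp
  | succ n ih => rw [zpow_add_one, zpow_add_one, LinearEquiv.mul_apply, ih, h]; rfl
  | pred n ih =>
    rw [zpow_sub_one, zpow_sub_one, LinearEquiv.mul_apply, ih, LinearEquiv.mul_apply]
    congr 1
    rw [← hg (c _), ← h, hf]

namespace ModObj

attribute [local instance] TensorProduct.Algebra.module

variable {p : ℕ} [Fact p.Prime] {L L' K : Type*} [Field L] [Field L'] [Field K]
  [Algebra ℚ_[p] L] [Algebra ℚ_[p] L'] [Algebra ℚ_[p] K] [Algebra L L']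
  [IsScalarTower ℚ_[p] L L'] [FiniteDimensional ℚ_[p] L'] [FiniteDimensional ℚ_[p] K]

theorem exists_hom {X Y : ModObj.{v} p L L' K} {θX θY} {bX bY : ℕ}
    (hX : PG.IsString (p : ℚ_[p]) X.toPG X.NQ θX bX)
    (hY : PG.IsString (p : ℚ_[p]) Y.toPG Y.NQ θY bY) {l : ℕ} (hl : l < bX) (hb : bX ≤ l + bY)
    (h : PG.Tw ((p : ℚ_[p]) ^ l) hX.kerPG hY.kerPG) : ∃ α : Hom X Y, α.f ≠ 0 := by
  have hp0 : (p : ℚ_[p]) ≠ 0 := Nat.cast_ne_zero.2 (Fact.out : p.Prime).ne_zero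
  obtain ⟨f, hf, h0⟩ := h
  let g : X.toPG.V →ₗ[ℚ_[p]] Y.toPG.V := hY.coord.symm.toLinearMap ∘ₗ
    LinearMap.pi fun i : Fin bY => f ∘ₗ hX.proj (i + l)
  have hg : ∀ i x, hY.proj i (g x) = f (hX.proj (i + l) x) := by
    intro i x
    by_cases hi : i < bY
    · have h1 := congrFun (hY.coord.apply_symm_apply
        fun i : Fin bY => f (hX.proj (i + l) x)) ⟨i, hi⟩
      exact h1
    · have h1 : hX.proj (i + l) x = 0 := Subtype.ext (by
        rw [PG.IsString.proj_coe, hX.pow_zero_of_le (by omega), map_zero]; rfl)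
      rw [h1]
      refine Eq.trans (Subtype.ext ?_) (map_zero f).symm
      rw [PG.IsString.proj_coe, hY.pow_zero_of_le (by omega), map_zero]
      rfl
  have hext : ∀ x y, (∀ i, hY.proj i x = hY.proj i y) → x = y := fun x y h =>
    hY.ext_θ fun i _ => congrArg Subtype.val (h i)
  have hphi : ∀ m x, hX.proj m (X.toPG.phi x) =
      (p : ℚ_[p]) ^ m • hX.kerPG.phi (hX.proj m x) := fun m x => by
    rw [← (hX.isHom_proj hp0 m).map_phi, map_smul, smul_smul,
      mul_inv_cancel₀ (pow_ne_zero _ hp0), one_smul]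
  have hphi' : ∀ m x, hY.proj m (Y.toPG.phi x) =
      (p : ℚ_[p]) ^ m • hY.kerPG.phi (hY.proj m x) := fun m x => by
    rw [← (hY.isHom_proj hp0 m).map_phi, map_smul, smul_smul,
      mul_inv_cancel₀ (pow_ne_zero _ hp0), one_smul]
  have hhom : PG.IsHom 1 X.toPG Y.toPG g := by
    refine ⟨fun ω x => hext _ _ fun i => ?_, fun x => hext _ _ fun i => ?_⟩
    · rw [(hY.isHom_proj hp0 i).map_op, hg, hg, (hX.isHom_proj hp0 _).map_op, hf.map_op]
    · rw [one_smul, hphi', hg, hg, hphi, pow_add, mul_smul, map_smul, hf.map_phi]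
  refine ⟨{ toPhiGalHom := homOf g hhom
            map_N := fun x => hext _ _ fun i => ?_ }, fun h => h0 (LinearMap.ext fun y => ?_)⟩
  · refine (hg i (X.NQ x)).trans (Eq.trans ?_ (hg (i + 1) x).symm |>.trans ?_)
    · congr 1
      apply Subtype.ext
      rw [PG.IsString.proj_coe, PG.IsString.proj_coe, PG.pow_apply_apply, add_right_comm]
    · apply Subtype.ext
      rw [PG.IsString.proj_coe, PG.IsString.proj_coe]
      exact congrArg θY (PG.pow_apply_apply Y.NQ i (g x)).symm
  · have h1 : g (hX.sec l y) = 0 := LinearMap.congr_fun h (hX.sec l y)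
    have h2 := hg 0 (hX.sec l y)
    have h3 : hX.proj (0 + l) (hX.sec l y) = y := Subtype.ext (by
      rw [PG.IsString.proj_coe, hX.θ_sec _ _ hl, if_pos (zero_add l).symm])
    rw [h1, map_zero, h3] at h2
    exact h2.symm

variable {s : ℕ} {D : Fin s → ModObj.{v} p L L' K}

theorem exists_links {θ : ∀ k, (D k).toPG.V →ₗ[ℚ_[p]] (D k).toPG.V}
    (hstr : ∀ k, PG.IsString (p : ℚ_[p]) (D k).toPG (D k).NQ (θ k) (D k).nilLength)
    (hord : IsOrdered D) :
    ∃ α : ∀ k₁ k₂, Hom (D k₁) (D k₂), ∀ k₁ k₂, Linked D k₁ k₂ → (α k₁ k₂).f ≠ 0 := by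
  have key : ∀ k₁ k₂, ∃ α : Hom (D k₁) (D k₂), Linked D k₁ k₂ → α.f ≠ 0 := by
    intro k₁ k₂
    by_cases h : Linked D k₁ k₂
    · obtain ⟨α, hα⟩ : ∃ α : Hom (D k₁) (D k₂), α.f ≠ 0 := by
        obtain ⟨hlt, ⟨⟨-, hT⟩, -⟩ | ⟨⟨-, l, hT, hl⟩, -⟩⟩ := h
        · have hT' := (kerTwistIso_iff (hstr k₁) (hstr k₂) 0).1 hT
          rw [zpow_zero] at hT'
          refine exists_hom (hstr k₁) (hstr k₂) (hstr k₁).pos ?_ (by rwa [pow_zero])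
          by_contra hb
          refine hlt.not_gt (hord.length k₂ k₁ ((kerTwistIso_iff (hstr k₂) (hstr k₁) 0).2 ?_)
            (by omega))
          simpa using hT'.symm one_ne_zero (hstr k₁).kerPG_simple (hstr k₂).kerPG_simple
        · have hT' := (kerTwistIso_iff (hstr k₁) (hstr k₂) l).1 hT
          rw [zpow_natCast] at hT'
          have := (hstr k₂).pos
          exact exists_hom (hstr k₁) (hstr k₂) (by omega) hl.le hT'
      exact ⟨α, fun _ => hα⟩
    · exact ⟨{ f := 0
               map_smul := fun l x => (smul_zero l).symm
               map_phi := fun x => (map_zero (D k₂).phi).symm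
               map_gal := fun g x => (map_zero ((D k₂).gal g)).symm
               map_N := fun x => (map_zero (D k₂).N).symm }, fun h' => absurd h' h⟩
  choose α hα using key
  exact ⟨α, hα⟩

variable (α : ∀ k₁ k₂, Hom (D k₁) (D k₂))

theorem linkMap_comm (T : ∀ k, (D k).D →+ (D k).D)
    (hT : ∀ k₁ k₂ x, (α k₁ k₂).f (T k₁ x) = T k₂ ((α k₁ k₂).f x)) (x : ∀ k, (D k).D) (k : Fin s) :
    linkMap D α (fun k => T k (x k)) k = T k (linkMap D α x k) := by
  classical
  rw [linkMap_apply, linkMap_apply, map_sum]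
  refine Finset.sum_congr rfl fun k₁ _ => ?_
  split_ifs
  · exact hT _ _ _
  · exact (map_zero _).symm

variable [IsGalois L L'] {σ₀ : maxUnram p L' →ₐ[ℚ_[p]] K} {V : WDRep.{v} p L L' K}
  {W : Fin s → WDRep.{v} p L L' K} (hVW : V.IsDirectSum W) (hD : ∀ k, ((D k).WD σ₀).Iso (W k))

/-- The component at `σ₀` of the modified object is the direct sum of the components. -/
def wdSum : (modified D α).WDspace σ₀ ≃ₗ[K] ∀ k, (D k).WDspace σ₀ where
  toFun x k := ⟨x.1 k, fun l => congrFun (x.2 l) k⟩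
  map_add' _ _ := rfl
  map_smul' _ _ := rfl
  invFun y := ⟨fun k => (y k).1, fun l => funext fun k => (y k).2 l⟩
  left_inv _ := rfl
  right_inv _ := rfl

include hVW hD in
theorem isFrobSemisimplification (hV : V.IsSemisimple) :
    ((modified D α).WD σ₀).IsFrobSemisimplification V := by
  have := (modified D α).finite_K
  obtain ⟨eV, heV, heVN⟩ := hVW
  choose e he heN using hD
  let e' : ∀ k, (D k).WDspace σ₀ ≃ₗ[K] (W k).V := e
  let E : (modified D α).WDspace σ₀ ≃ₗ[K] V.V :=
    ((wdSum α).trans (LinearEquiv.piCongrRight e')).trans eV.symm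
  have hE : ∀ x k, eV (E x) k = e' k ⟨x.1 k, fun l => congrFun (x.2 l) k⟩ := fun x k =>
    congrFun (eV.apply_symm_apply _) k
  let U : (∀ k, (D k).D) ≃ₗ[K] (∀ k, (D k).D) := LinearEquiv.ofBijective (1 + linkMap D α)
    ((Module.End.isUnit_iff _).1 (isNilpotent_linkMap D α).isUnit_one_add)
  let P : (∀ k, (D k).D) ≃ₗ[K] (∀ k, (D k).D) := LinearEquiv.piCongrRight fun k => (D k).phi
  have hUP : (modified D α).phi = P * U := rfl
  have hUT : ∀ (T : ∀ k, (D k).D →+ (D k).D)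
      (hT : ∀ k₁ k₂ x, (α k₁ k₂).f (T k₁ x) = T k₂ ((α k₁ k₂).f x)) (x : ∀ k, (D k).D),
      U (fun k => T k (x k)) = fun k => T k (U x k) := fun T hT x => funext fun k =>
    (congrArg (T k (x k) + ·) (linkMap_comm α T hT x k)).trans (map_add (T k) _ _).symm
  have hUphi : ∀ x, U (P x) = P (U x) :=
    hUT (fun k => (D k).phi.toLinearMap.toAddMonoidHom) fun k₁ k₂ x => (α k₁ k₂).map_phi x
  have hUN : ∀ x, U ((modified D α).N x) = (modified D α).N (U x) :=
    hUT (fun k => (D k).N.toAddMonoidHom) fun k₁ k₂ x => (α k₁ k₂).map_N x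
  have hUgal : ∀ g x, U ((modified D α).gal g x) = (modified D α).gal g (U x) := fun g =>
    hUT (fun k => ((D k).gal g).toAddMonoidHom) fun k₁ k₂ x => (α k₁ k₂).map_gal g x
  have hUl : ∀ (l : maxUnram p L') (x : ∀ k, (D k).D), U (l • x) = l • U x := fun l =>
    hUT (fun k => DistribSMul.toAddMonoidHom (D k).D l) fun k₁ k₂ x => (α k₁ k₂).map_smul l x
  have hUmem : ∀ x ∈ (modified D α).WDspace σ₀, U x ∈ (modified D α).WDspace σ₀ := fun x hx l =>
    ((hUl l x).symm.trans (congrArg U (hx l))).trans (map_smul U _ _)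
  have hUinj : Function.Injective (U.toLinearMap.restrict hUmem) := by
    intro x y h
    have h1 := congrArg Subtype.val h
    exact Subtype.ext (U.injective h1)
  let u : (modified D α).WDspace σ₀ ≃ₗ[K] (modified D α).WDspace σ₀ :=
    LinearEquiv.ofInjectiveEndo (U.toLinearMap.restrict hUmem) hUinj
  have hu : ∀ (n : ℤ) x, ((u ^ n) x).1 = (U ^ n) x.1 := fun n x =>
    zpow_comm_apply ((modified D α).WDspace σ₀).subtype u U (fun _ => rfl) n x
  have hUphi' : ∀ x, U ((modified D α).phi x) = (modified D α).phi (U x) := fun x => hUphi (U x)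
  obtain ⟨m, hm⟩ := isNilpotent_linkMap D α
  refine ⟨hV, E, u, ⟨m, ?_⟩, fun w x => Subtype.ext ?_, fun x => Subtype.ext (hUN x.1),
    fun w x => eV.injective (funext fun k => ?_), fun x => eV.injective (funext fun k => ?_)⟩
  · have h1 : ∀ (n : ℕ) (x : (modified D α).WDspace σ₀),
        (((u.toLinearMap - 1 : Module.End K ((modified D α).WDspace σ₀)) ^ n) x).1 =
          (linkMap D α ^ n) x.1 := by
      intro n
      induction n with
      | zero => exact fun x => rfl
      | succ n ih =>
        intro x
        rw [pow_succ, Module.End.mul_apply]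
        exact (ih _).trans ((congrArg (linkMap D α ^ n) (add_sub_cancel_left x.1
          (linkMap D α x.1))).trans (LinearMap.congr_fun (pow_succ (linkMap D α) n) x.1).symm)
    exact LinearMap.ext fun x => Subtype.ext ((h1 m x).trans (LinearMap.congr_fun hm x.1))
  · refine (hUgal _ _).trans (congrArg _ ?_)
    exact zpow_comm_apply U.toLinearMap (modified D α).phi (modified D α).phi hUphi' _ _
  · have hc : Commute P U := LinearEquiv.ext fun x => (hUphi x).symm
    rw [heV]
    refine (hE _ k).trans (Eq.trans ?_ (congrArg ((W k).r w) (hE x k).symm))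
    refine Eq.trans (congrArg (e' k) (Subtype.ext ?_)) (he k w ⟨x.1 k, fun l => congrFun (x.2 l) k⟩)
    refine congrArg ((D k).gal (weilToGal w)) ?_
    refine (congrFun (congrArg ((modified D α).phi ^ (-weilDeg w)) (hu (weilDeg w) x)) k).trans ?_
    have h1 : (P * U) ^ (-weilDeg w) * U ^ weilDeg w = P ^ (-weilDeg w) := by
      rw [hc.mul_zpow, mul_assoc, ← zpow_add, neg_add_cancel, zpow_zero, mul_one]
    refine (congrFun (LinearEquiv.congr_fun h1 x.1) k).trans ?_
    exact zpow_comm_apply (LinearMap.proj k) P (D k).phi (fun _ => rfl) _ _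
  · rw [heVN]
    refine (hE _ k).trans (Eq.trans ?_ (congrArg (W k).N (hE x k).symm))
    exact heN k ⟨x.1 k, fun l => congrFun (x.2 l) k⟩

include hVW hD in
theorem toPG_semisimple_of_isDirectSum (hS : Splits ℚ_[p] (maxUnram p L') K)
    (hV : V.IsSemisimple) (k : Fin s) : (D k).toPG.Semisimple := by
  obtain ⟨eV, heV, -⟩ := hVW
  obtain ⟨e, he, -⟩ := hD k
  let e' : (D k).WDspace σ₀ ≃ₗ[K] (W k).V := e
  refine toPG_semisimple hS (exists_weilStable_compl hV
    (eV.symm.toLinearMap ∘ₗ LinearMap.single K _ k ∘ₗ e'.toLinearMap) ?_ fun w x => ?_)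
  · exact eV.symm.injective.comp ((Pi.single_injective k).comp e'.injective)
  · apply eV.injective
    funext i
    rw [heV]
    refine (congrArg ((W i).r w) (congrFun (eV.apply_symm_apply _) i)).trans
      (Eq.trans ?_ (congrFun (eV.apply_symm_apply _) i).symm)
    change (W i).r w ((Pi.single k (e' x) : ∀ i, (W i).V) i) =
      (Pi.single k (e' ⟨(D k).weilAct w x, _⟩) : ∀ i, (W i).V) i
    by_cases h : i = k
    · subst h
      rw [Pi.single_eq_same, Pi.single_eq_same]
      exact (he w x).symm
    · rw [Pi.single_eq_of_ne h, Pi.single_eq_of_ne h, map_zero]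

theorem finite_isGood : Finite {E // IsGood D α E} := by
  choose m hm hE using fun E : {E // IsGood D α E} => E.2.2
  refine Finite.of_injective (β := ∀ k : Fin s, Fin ((D k).nilLength + 1))
    (fun E k => ⟨m E k, Nat.lt_succ_of_le (hm E k)⟩) fun E E' h => Subtype.ext ?_
  have h1 : m E = m E' := funext fun k => congrArg Fin.val (congrFun h k)
  refine Submodule.ext fun x => (hE E x).trans (Iff.trans ?_ (hE E' x).symm)
  rw [h1]

/-- A filtration of the modified object with prescribed jumps, transverse to all good flags. -/
theorem exists_good_filtration [FiniteDimensional ℚ_[p] L] [Algebra L K] [IsScalarTower ℚ_[p] L K]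
    (hLK : Splits ℚ_[p] L K) (hL'K : Splits ℚ_[p] (maxUnram p L') K) {n : ℕ}
    (hn : (modified D α).rank = n) {j : (L →ₐ[ℚ_[p]] K) → Fin n → ℤ} (hj : ∀ σ, StrictMono (j σ)) :
    ∃ F : Filtration (modified D α), F.HasJumps j ∧
      ∀ Δ, IsGoodFlag D α Δ → F.IsTransverse j Δ := by
  have := finite_isGood α
  obtain ⟨F, hJ, hF⟩ := exists_filtration hLK hL'K (X := modified D α)
    (E := fun o : Option {E // IsGood D α E} => o.elim ⊤ Subtype.val)
    (fun o => match o with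
      | none => isSubobject_top
      | some E => E.2.1) (i₀ := none) rfl hn hj
  exact ⟨F, hJ, fun Δ hΔ E hE σ => hF (some ⟨E, hΔ.2 E hE⟩) σ⟩

end ModObj

end PhiN

end

theorem mainTheorem3
    -- the fields
    (p : ℕ) [Fact p.Prime]
    (L L' K : Type*) [Field L] [Field L'] [Field K]
    [Algebra ℚ_[p] L] [Algebra ℚ_[p] L'] [Algebra ℚ_[p] K]
    [FiniteDimensional ℚ_[p] L] [FiniteDimensional ℚ_[p] L'] [FiniteDimensional ℚ_[p] K]
    [Algebra L L'] [IsScalarTower ℚ_[p] L L'] [IsGalois L L']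
    [Algebra L K] [IsScalarTower ℚ_[p] L K]
    (hLK : Nat.card (L →ₐ[ℚ_[p]] K) = Module.finrank ℚ_[p] L)
    (hL'K : Nat.card (PhiN.maxUnram p L' →ₐ[ℚ_[p]] K) =
      Module.finrank ℚ_[p] (PhiN.maxUnram p L'))
    (σ₀ : PhiN.maxUnram p L' →ₐ[ℚ_[p]] K)
    -- the Weil–Deligne representation and its decomposition
    {d s : ℕ} (V : PhiN.WDRep.{v} p L L' K) (hV : V.IsSemisimple)
    (hd : Module.finrank K V.V = d + 1)
    (W : Fin s → PhiN.WDRep.{v} p L L' K) (hW : ∀ k, (W k).IsAbsIndecomposable)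
    (hVW : V.IsDirectSum W)
    -- the corresponding objects of `MOD_{L'/L}`
    (D : Fin s → PhiN.ModObj.{v} p L L' K) (hD : ∀ k, ((D k).WD σ₀).Iso (W k))
    (hord : PhiN.ModObj.IsOrdered D)
    -- the prescribed jumps, and the inequalities (iii)
    (j : (L →ₐ[ℚ_[p]] K) → Fin (d + 1) → ℤ) (hj : ∀ σ, StrictMono (j σ))
    (hle : ∀ m : ℕ, m < s →
      (Module.finrank L K : ℚ) *
        ∑ a : Fin (d + 1) with
          a.val < ∑ k : Fin s with k.val < m, Module.finrank K (W k).V, ∑ σ, (j σ a : ℚ) ≤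
        ∑ k : Fin s with k.val < m, (D k).tN)
    (heq : (Module.finrank L K : ℚ) * ∑ a : Fin (d + 1), ∑ σ, (j σ a : ℚ) = ∑ k, (D k).tN) :
    -- every filtration with the prescribed jumps which is transverse to all good flags of the
    -- object with modified Frobenius is admissible
    (∀ α : ∀ k₁ k₂, PhiN.ModObj.Hom (D k₁) (D k₂),
      (∀ k₁ k₂, PhiN.ModObj.Linked D k₁ k₂ → (α k₁ k₂).f ≠ 0) →
      ∀ F : PhiN.ModObj.Filtration (PhiN.ModObj.modified D α), F.HasJumps j →
        (∀ Δ, PhiN.ModObj.IsGoodFlag D α Δ → F.IsTransverse j Δ) → F.IsAdmissible) ∧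
    -- the implication (iii) ⇒ (ii)
    (∃ X : PhiN.ModObj.{v} p L L' K, (X.WD σ₀).IsFrobSemisimplification V ∧
      ∃ F : PhiN.ModObj.Filtration X, F.HasJumps j ∧ F.IsAdmissible) := by 
  have hrank : ∀ k, (D k).rank = Module.finrank K (W k).V := fun k => by
    obtain ⟨e, -⟩ := hD k
    rw [(D k).rank_eq hL'K σ₀]
    exact e.finrank_eq
  have hn : ∑ k, (D k).rank = d + 1 := by
    obtain ⟨e, -⟩ := hVW
    rw [Finset.sum_congr rfl fun k _ => hrank k, ← hd, e.finrank_eq, Module.finrank_pi_fintype]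
  have hss := PhiN.ModObj.toPG_semisimple_of_isDirectSum hVW hD hL'K hV
  choose θ hstr using fun k => PhiN.ModObj.exists_isString hL'K (hW k) (hD k) (hss k)
  have key : ∀ α : ∀ k₁ k₂, PhiN.ModObj.Hom (D k₁) (D k₂),
      (∀ k₁ k₂, PhiN.ModObj.Linked D k₁ k₂ → (α k₁ k₂).f ≠ 0) →
      ∀ F : PhiN.ModObj.Filtration (PhiN.ModObj.modified D α), F.HasJumps j →
        (∀ Δ, PhiN.ModObj.IsGoodFlag D α Δ → F.IsTransverse j Δ) → F.IsAdmissible := by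
    intro α hα F hJ hF
    refine PhiN.ModObj.isAdmissible_of_isTransverse hstr hss hord α hα hLK hL'K hn hj hF hJ ?_ heq
    intro m hm
    simp only [hrank]
    convert hle m hm
  refine ⟨key, ?_⟩
  obtain ⟨α, hα⟩ := PhiN.ModObj.exists_links hstr hord
  have hfs := PhiN.ModObj.isFrobSemisimplification α hVW hD hV
  have hX : (PhiN.ModObj.modified D α).rank = d + 1 := by
    obtain ⟨-, e, -⟩ := hfs
    rw [PhiN.ModObj.rank_eq _ hL'K σ₀, ← hd]
    exact e.finrank_eq
  obtain ⟨F, hJ, hF⟩ := PhiN.ModObj.exists_good_filtration α hLK hL'K hX hj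
  exact ⟨_, hfs, F, hJ, key α hα F hJ hF⟩
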